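/- **Conventions.** A graph is a finite connected graph (loops and multiple edges allowed) with a basepoint vertex $p$; it is *reduced* if it has no separating edge, $p$ is at least 2-valent and all other vertices are at least 3-valent. A *reduced cycle* is an embedded circle, and a *cactus graph* is a graph in which every edge lies in a unique reduced cycle. Let $F_n$ be the free group on $x_1,\dots,x_n$, identified with $\pi_1$ of the rose $R_n$. An automorphism of $F_n$ is *symmetric* if it sends every $x_i$ to a conjugate of some $x_j^{\pm1}$. A *marking* of $(\Gamma,p)$ is a based homotopy equivalence $\rho:R_n\to\Gamma$ up to based homotopy, equivalently an isomorphism $F_n\cong\pi_1(\Gamma,p)$; it is *symmetric* if for every maximal tree $T$ the composite $R_n\to\Gamma\to\Gamma/T\cong R_n$ induces a symmetric automorphism. A *marked cactus graph* is a reduced cactus graph with a symmetric marking. Marked graphs are considered up to basepoint-preserving isomorphisms compatible with the markings. The spine $K_n$ of Auter space is the simplicial complex whose vertices are the marked reduced graphs of rank $n$ and whose simplices are the chains of (marking-compatible, basepoint-preserving) collapses of forests; *cactus space* $\Sigma K_n$ is the full subcomplex spanned by the marked cactus graphs. If $\Gamma'$ arises from $\Gamma$ by collapsing a non-empty forest,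 then $\Gamma'$ is a *blow-down* of $\Gamma$ and $\Gamma$ is a *blow-up* of $\Gamma'$. For vertices $v,v'$ of a cactus graph $\Gamma$ let $d(v,v')$ be the number of reduced cycles sharing an edge with a shortest path from $v$ to $v'$, and let $\Lambda_i=\{v: d(p,v)=i\}$. The *base* of a reduced cycle is its unique vertex nearest to $p$. Let $n_i=-|\Lambda_i|$, and let $c_i$ be the number of reduced cycles whose base is not in $\Lambda_i$. The *coweight* $c(\Gamma)$ is the number of reduced cycles not containing $p$ (so $c=c_0$). The *height* is $h(\Gamma)=(c_0,n_1,c_1,n_2,c_2,\dots)$, ordered lexicographically. The *descending link* of a vertex $\Gamma$ of $\Sigma K_n$ consists of the simplices not containing $\Gamma$ that are faces of simplices of $\Sigma K_n$ which contain $\Gamma$ and all of whose vertices have height at most $h(\Gamma)$. The *down-link* (*up-link*) of $\Gamma$ is the full subcomplex of $\Sigma K_n$ spanned by the blow-downs (blow-ups) of $\Gamma$ in $\Sigma K_n$ whose height is less than $h(\Gamma)$. $\Gamma$ is *thin* if every reduced cycle has length at most 2. We put $S^{-1}=\emptyset$. **Proposition.** Let $\Gamma$ be a marked cactus graph of rank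 $n$ with coweight $c$ and with $V$ vertices. Then the descending link of $\Gamma$ is either contractible or homotopy equivalent to $S^{c-1}$. More precisely: * If $\Gamma$ is not thin, the descending link is contractible. * If $\Gamma$ is thin, the descending link is the simplicial join of the down-link and the up-link; moreover $1\le V\le c+1$, the down-link is homotopy equivalent to $S^{V-2}$, the up-link is homotopy equivalent to $S^{c-V}$, and the descending link is homotopy equivalent to $S^{c-1}$. -/

import Mathlib

open scoped ContinuousMap

/-! ### Geometric realization, joins and spheres -/

namespace PreAbstractSimplicialComplex

variable {α : Type*}

/-- The geometric realization of a simplicial complex, in barycentric coordinates: formal convex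
combinations of vertices whose support is a face. -/
def Realization (K : PreAbstractSimplicialComplex α) : Type _ :=
  {x : α →₀ ℝ // (∀ a, 0 ≤ x a) ∧ x.support ∈ K.faces ∧ ∑ a ∈ x.support, x a = 1}

/-- The closed simplex of the realization that is spanned by `s`. -/
def closedSimplex (K : PreAbstractSimplicialComplex α) (s : Finset α) : Type _ :=
  {x : K.Realization // x.1.support ⊆ s}

/-- A closed simplex carries the Euclidean topology of its barycentric coordinates. -/
instance (K : PreAbstractSimplicialComplex α) (s : Finset α) :
    TopologicalSpace (K.closedSimplex s) :=
  TopologicalSpace.induced (fun x (a : s) => x.1.1 a) inferInstance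

/-- The weak topology: a set is open if and only if its trace on every closed simplex is open. -/
instance (K : PreAbstractSimplicialComplex α) : TopologicalSpace K.Realization :=
  ⨆ s : K.faces, TopologicalSpace.coinduced
    (fun x : K.closedSimplex s.1 => (x.1 : K.Realization)) inferInstance

/-- `J` is the (internal) simplicial join of `K` and `L`: these have no vertex in common, and the
faces of `J` are the non-empty unions of a face of `K` or `∅` with a face of `L` or `∅`. -/
def IsJoin (J K L : PreAbstractSimplicialComplex α) : Prop :=
  (∀ s ∈ K.faces, ∀ t ∈ L.faces, Disjoint s t) ∧
  ∀ σ : Finset α, σ ∈ J.faces ↔ σ.Nonempty ∧ ∃ s t : Finset α,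
    (s = ∅ ∨ s ∈ K.faces) ∧ (t = ∅ ∨ t ∈ L.faces) ∧ (σ : Set α) = ↑s ∪ ↑t

end PreAbstractSimplicialComplex

/-- The unit sphere of `ℝᵏ`, that is, the sphere of dimension `k - 1`. For `k = 0` it is the
sphere of dimension `-1`, the empty space. -/
abbrev UnitSphere (k : ℕ) : Type := Metric.sphere (0 : EuclideanSpace ℝ (Fin k)) 1

/-! ### Graphs, paths, cycles and the height function -/

/-- A finite graph with a base vertex; loops and multiple edges are allowed. The orientation of the
edges is an auxiliary choice, which isomorphisms need not respect. -/
structure BasedGraph where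
  V : Type
  E : Type
  [finite_V : Finite V]
  [finite_E : Finite E]
  src : E → V
  tgt : E → V
  base : V

namespace BasedGraph

attribute [instance] finite_V finite_E

/-- The initial vertex of an oriented edge: `(e, true)` is `e` with its orientation and
`(e, false)` is `e` reversed. -/
def start (G : BasedGraph) : G.E × Bool → G.V
  | (e, true) => G.src e
  | (e, false) => G.tgt e

/-- `w` is an edge path from `u` to `v`. -/
def IsWalk (G : BasedGraph) : G.V → List (G.E × Bool) → G.V → Prop
  | u, [], v => u = v
  | u, x :: w, v => G.start x = u ∧ G.IsWalk (G.start (x.1, !x.2)) w v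

theorem IsWalk.append {G : BasedGraph} {u v z : G.V} {w w' : List (G.E × Bool)}
    (h : G.IsWalk u w v) (h' : G.IsWalk v w' z) : G.IsWalk u (w ++ w') z := by
  induction w generalizing u with
  | nil => cases h; exact h'
  | cons x w ih => exact ⟨h.1, ih h.2⟩

theorem IsWalk.invRev {G : BasedGraph} {u v : G.V} {w : List (G.E × Bool)}
    (h : G.IsWalk u w v) : G.IsWalk v (FreeGroup.invRev w) u := by
  induction w generalizing u with
  | nil => cases h; exact rfl
  | cons x w ih =>
    obtain ⟨hx, hw⟩ := h
    have : FreeGroup.invRev (x :: w) = FreeGroup.invRev w ++ [(x.1, !x.2)] := by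
      simp [FreeGroup.invRev]
    rw [this]
    refine (ih hw).append ⟨rfl, ?_⟩
    simpa [IsWalk] using hx

/-- The fundamental group `π₁(G, base)`: closed edge paths at the base vertex, up to insertion and
deletion of backtracks `e e⁻¹`. As an edge path is a word in the oriented edges, this is the
subgroup of the free group on the edges whose elements are represented by such paths. -/
def fundamentalGroup (G : BasedGraph) : Subgroup (FreeGroup G.E) where
  carrier := {g | ∃ w, G.IsWalk G.base w G.base ∧ FreeGroup.mk w = g}
  one_mem' := ⟨[], rfl, rfl⟩
  mul_mem' := by
    rintro _ _ ⟨w, hw, rfl⟩ ⟨w', hw', rfl⟩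
    exact ⟨w ++ w', hw.append hw', by simp⟩
  inv_mem' := by
    rintro _ ⟨w, hw, rfl⟩
    exact ⟨_, hw.invRev, by simp⟩

/-- The equivalence relation on vertices of being joined by a path with all edges in `F`. -/
def joinedIn (G : BasedGraph) (F : Set G.E) : Setoid G.V :=
  Relation.EqvGen.setoid fun u v => ∃ e ∈ F, G.src e = u ∧ G.tgt e = v

/-- The number of half-edges at `v`. -/
noncomputable def valence (G : BasedGraph) (v : G.V) : ℕ :=
  {e | G.src e = v}.ncard + {e | G.tgt e = v}.ncard

/-- Connected, without separating edges, the base vertex at least 2-valent and all other vertices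
at least 3-valent. -/
structure IsReduced (G : BasedGraph) : Prop where
  connected : ∀ u v, G.joinedIn Set.univ u v
  not_separating : ∀ e u v, G.joinedIn {e}ᶜ u v
  valence_base : 2 ≤ G.valence G.base
  valence_ne_base : ∀ v, v ≠ G.base → 3 ≤ G.valence v

/-- `C` is the edge set of a reduced cycle, that is, of an embedded circle: for some `m ≥ 0` there
are distinct vertices `v₀, …, vₘ` and distinct edges `e₀, …, eₘ` where `eᵢ` joins `vᵢ` and `vᵢ₊₁`,
with indices modulo `m + 1`. -/
def IsCycle (G : BasedGraph) (C : Set G.E) : Prop :=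
  ∃ (m : ℕ) (v : Fin (m + 1) → G.V) (e : Fin (m + 1) → G.E),
    Function.Injective v ∧ Function.Injective e ∧ Set.range e = C ∧
    ∀ i, (G.src (e i) = v i ∧ G.tgt (e i) = v (i + 1)) ∨
      (G.src (e i) = v (i + 1) ∧ G.tgt (e i) = v i)

/-- The vertices of a subgraph given by its edges. -/
def verts (G : BasedGraph) (C : Set G.E) : Set G.V :=
  {v | ∃ e ∈ C, G.src e = v ∨ G.tgt e = v}

/-- Every edge is contained in a unique reduced cycle. -/
def IsCactus (G : BasedGraph) : Prop := ∀ e, ∃! C, G.IsCycle C ∧ e ∈ C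

/-- Every reduced cycle has length at most two. -/
def IsThin (G : BasedGraph) : Prop := ∀ C, G.IsCycle C → C.ncard ≤ 2

/-- The number of reduced cycles that do not contain the base vertex. -/
noncomputable def coweight (G : BasedGraph) : ℕ :=
  {C | G.IsCycle C ∧ G.base ∉ G.verts C}.ncard

/-- `w` is an edge path from `u` to `v` of minimal length. -/
def IsGeodesic (G : BasedGraph) (u : G.V) (w : List (G.E × Bool)) (v : G.V) : Prop :=
  G.IsWalk u w v ∧ ∀ w', G.IsWalk u w' v → w.length ≤ w'.length

/-- The distance of two vertices: the number of reduced cycles that share an edge with a path of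
minimal length between them. In a connected cactus graph all such paths give the same number, so
the infimum is taken over a one-element set. -/
noncomputable def dist (G : BasedGraph) (u v : G.V) : ℕ :=
  sInf {k | ∃ w, G.IsGeodesic u w v ∧ k = {C | G.IsCycle C ∧ ∃ x ∈ w, x.1 ∈ C}.ncard}

/-- The set `Λᵢ` of vertices at distance `i` from the base vertex. -/
def level (G : BasedGraph) (i : ℕ) : Set G.V := {v | G.dist G.base v = i}

/-- `v` is the base of the cycle `C`: its unique vertex nearest to the base vertex. -/
def IsBaseOf (G : BasedGraph) (v : G.V) (C : Set G.E) : Prop :=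
  v ∈ G.verts C ∧ ∀ u ∈ G.verts C, u ≠ v → G.dist G.base v < G.dist G.base u

/-- The number `cᵢ` of reduced cycles whose base is not in `Λᵢ`. -/
noncomputable def localCoweight (G : BasedGraph) (i : ℕ) : ℕ :=
  {C | G.IsCycle C ∧ ¬ ∃ v ∈ G.level i, G.IsBaseOf v C}.ncard

/-- The height `(c₀, -|Λ₁|, c₁, -|Λ₂|, c₂, …)`, in the lexicographic order. -/
noncomputable def height (G : BasedGraph) : Lex (ℕ → ℤ) :=
  toLex fun k => if k % 2 = 0 then (G.localCoweight (k / 2) : ℤ)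
    else -((G.level ((k + 1) / 2)).ncard : ℤ)

/-! ### Isomorphisms -/

/-- An isomorphism of based graphs; `flip e` says whether it reverses the chosen orientation
of `e`. -/
structure Iso (G H : BasedGraph) where
  onV : G.V ≃ H.V
  onE : G.E ≃ H.E
  flip : G.E → Bool
  start_map : ∀ e b, H.start (onE e, xor (flip e) b) = onV (G.start (e, b))
  base_map : onV G.base = H.base

namespace Iso

variable {G H K : BasedGraph}

/-- The effect of an isomorphism on edge paths up to backtracking. -/
def hom (φ : Iso G H) : FreeGroup G.E →* FreeGroup H.E :=
  FreeGroup.lift fun e =>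
    if φ.flip e then (FreeGroup.of (φ.onE e))⁻¹ else FreeGroup.of (φ.onE e)

def refl (G : BasedGraph) : Iso G G where
  onV := Equiv.refl _
  onE := Equiv.refl _
  flip _ := false
  start_map _ _ := by simp
  base_map := rfl

def symm (φ : Iso G H) : Iso H G where
  onV := φ.onV.symm
  onE := φ.onE.symm
  flip e := φ.flip (φ.onE.symm e)
  start_map e b := by
    have := φ.start_map (φ.onE.symm e) (xor (φ.flip (φ.onE.symm e)) b)
    rw [← Bool.xor_assoc, Bool.xor_self, Bool.false_xor, Equiv.apply_symm_apply] at this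
    rw [this, Equiv.symm_apply_apply]
  base_map := by rw [← φ.base_map, Equiv.symm_apply_apply]

def trans (φ : Iso G H) (ψ : Iso H K) : Iso G K where
  onV := φ.onV.trans ψ.onV
  onE := φ.onE.trans ψ.onE
  flip e := xor (ψ.flip (φ.onE e)) (φ.flip e)
  start_map e b := by
    simp [ψ.start_map, φ.start_map]
  base_map := by simp [φ.base_map, ψ.base_map]

theorem hom_refl (g : FreeGroup G.E) : (refl G).hom g = g := by
  have : (refl G).hom = MonoidHom.id _ := by
    ext e; simp [hom, refl]
  rw [this]; rfl

theorem hom_trans (φ : Iso G H) (ψ : Iso H K) (g : FreeGroup G.E) :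
    (φ.trans ψ).hom g = ψ.hom (φ.hom g) := by
  have : (φ.trans ψ).hom = ψ.hom.comp φ.hom := by
    ext e
    cases h₁ : φ.flip e <;> cases h₂ : ψ.flip (φ.onE e) <;> simp [hom, trans, h₁, h₂]
  rw [this]; rfl

theorem hom_symm (φ : Iso G H) (g : FreeGroup G.E) : φ.symm.hom (φ.hom g) = g := by
  have : φ.symm.hom.comp φ.hom = MonoidHom.id _ := by
    ext e
    cases h₁ : φ.flip e <;> simp [hom, symm, h₁]
  exact DFunLike.congr_fun this g

theorem isWalk (φ : Iso G H) {u v : G.V} {w : List (G.E × Bool)} (h : G.IsWalk u w v) :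
    H.IsWalk (φ.onV u) (w.map fun x => (φ.onE x.1, xor (φ.flip x.1) x.2)) (φ.onV v) := by
  induction w generalizing u with
  | nil => exact congrArg φ.onV h
  | cons x w ih =>
    refine ⟨?_, ?_⟩
    · rw [← h.1]; exact φ.start_map x.1 x.2
    · have := ih h.2
      rw [← φ.start_map] at this
      simpa using this

theorem src_tgt (φ : Iso G H) (e : G.E) :
    (H.src (φ.onE e) = φ.onV (G.src e) ∧ H.tgt (φ.onE e) = φ.onV (G.tgt e)) ∨
    (H.src (φ.onE e) = φ.onV (G.tgt e) ∧ H.tgt (φ.onE e) = φ.onV (G.src e)) := by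
  have h₁ := φ.start_map e true
  have h₂ := φ.start_map e false
  cases h : φ.flip e <;> simp_all [start]

theorem isCycle_image (φ : Iso G H) {C : Set G.E} (h : G.IsCycle C) :
    H.IsCycle (φ.onE '' C) := by
  obtain ⟨m, v, e, hv, he, rfl, hve⟩ := h
  refine ⟨m, φ.onV ∘ v, φ.onE ∘ e, φ.onV.injective.comp hv, φ.onE.injective.comp he,
    Set.range_comp _ _, fun i => ?_⟩
  rcases hve i with ⟨h₁, h₂⟩ | ⟨h₁, h₂⟩ <;>
    rcases φ.src_tgt (e i) with ⟨h₃, h₄⟩ | ⟨h₃, h₄⟩ <;> simp [h₁, h₂, h₃, h₄]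

theorem image_symm_image (φ : Iso G H) (C : Set H.E) : φ.onE '' (φ.symm.onE '' C) = C :=
  φ.onE.image_symm_image C

theorem isCycle_image_iff (φ : Iso G H) {C : Set G.E} :
    H.IsCycle (φ.onE '' C) ↔ G.IsCycle C := by
  refine ⟨fun h => ?_, φ.isCycle_image⟩
  have := φ.symm.isCycle_image h
  rwa [show φ.symm.onE '' (φ.onE '' C) = C from φ.onE.symm_image_image C] at this

theorem mem_verts_image (φ : Iso G H) {C : Set G.E} {v : G.V} :
    φ.onV v ∈ H.verts (φ.onE '' C) ↔ v ∈ G.verts C := by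
  simp only [verts, Set.mem_ofPred_eq, Set.exists_mem_image]
  refine exists_congr fun e => and_congr_right fun _ => ?_
  rcases φ.src_tgt e with ⟨h₁, h₂⟩ | ⟨h₁, h₂⟩ <;> simp [h₁, h₂, or_comm]

/-- Corresponding sets of edge sets have the same cardinality. -/
theorem ncard_eq (φ : Iso G H) {P : Set G.E → Prop} {Q : Set H.E → Prop}
    (h : ∀ C, Q (φ.onE '' C) ↔ P C) : {C | Q C}.ncard = {C | P C}.ncard := by
  have : {C | Q C} = (fun C : Set G.E => φ.onE '' C) '' {C | P C} := by
    ext D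
    constructor
    · intro hD
      refine ⟨φ.symm.onE '' D, ?_, φ.image_symm_image D⟩
      rw [Set.mem_ofPred_eq, ← h, φ.image_symm_image]; exact hD
    · rintro ⟨C, hC, rfl⟩
      exact (h C).2 hC
  rw [this]
  exact Set.ncard_image_of_injective _ φ.onE.injective.image_injective

theorem isGeodesic (φ : Iso G H) {u v : G.V} {w : List (G.E × Bool)} (h : G.IsGeodesic u w v) :
    H.IsGeodesic (φ.onV u) (w.map fun x => (φ.onE x.1, xor (φ.flip x.1) x.2)) (φ.onV v) := by
  refine ⟨φ.isWalk h.1, fun w' hw' => ?_⟩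
  have := φ.symm.isWalk hw'
  simp only [symm, Equiv.symm_apply_apply] at this
  simpa using h.2 _ this

theorem dist_set_subset (φ : Iso G H) (u v : G.V) :
    {k | ∃ w, G.IsGeodesic u w v ∧ k = {C | G.IsCycle C ∧ ∃ x ∈ w, x.1 ∈ C}.ncard} ⊆
    {k | ∃ w, H.IsGeodesic (φ.onV u) w (φ.onV v) ∧
      k = {C | H.IsCycle C ∧ ∃ x ∈ w, x.1 ∈ C}.ncard} := by
  rintro k ⟨w, hw, rfl⟩
  refine ⟨_, φ.isGeodesic hw, (φ.ncard_eq fun C => ?_).symm⟩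
  rw [φ.isCycle_image_iff]
  refine and_congr_right fun _ => ?_
  simp only [List.mem_map, Prod.exists]
  constructor
  · rintro ⟨_, _, ⟨a, b, h, hab⟩, hm⟩
    obtain ⟨rfl, -⟩ := Prod.mk.inj hab
    exact ⟨a, b, h, (φ.onE.injective.mem_set_image).1 hm⟩
  · rintro ⟨a, b, h, hm⟩
    exact ⟨_, _, ⟨a, b, h, rfl⟩, Set.mem_image_of_mem _ hm⟩

theorem dist_map (φ : Iso G H) (u v : G.V) : H.dist (φ.onV u) (φ.onV v) = G.dist u v := by
  refine congrArg sInf (Set.Subset.antisymm ?_ (φ.dist_set_subset u v))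
  have := φ.symm.dist_set_subset (φ.onV u) (φ.onV v)
  simpa only [symm, Equiv.symm_apply_apply] using this

theorem mem_level (φ : Iso G H) {i : ℕ} {v : G.V} : φ.onV v ∈ H.level i ↔ v ∈ G.level i := by
  simp only [level, Set.mem_ofPred_eq]
  rw [← φ.base_map, φ.dist_map]

theorem ncard_level (φ : Iso G H) (i : ℕ) : (H.level i).ncard = (G.level i).ncard := by
  have : H.level i = φ.onV '' G.level i := by
    ext v
    obtain ⟨v, rfl⟩ := φ.onV.surjective v
    rw [φ.mem_level, φ.onV.injective.mem_set_image]
  rw [this, Set.ncard_image_of_injective _ φ.onV.injective]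

theorem isBaseOf (φ : Iso G H) {v : G.V} {C : Set G.E} :
    H.IsBaseOf (φ.onV v) (φ.onE '' C) ↔ G.IsBaseOf v C := by
  rw [IsBaseOf, IsBaseOf, φ.mem_verts_image, φ.onV.surjective.forall]
  simp only [φ.mem_verts_image, ← φ.base_map, φ.dist_map, ne_eq, φ.onV.injective.eq_iff]

theorem localCoweight_eq (φ : Iso G H) (i : ℕ) : H.localCoweight i = G.localCoweight i := by
  refine φ.ncard_eq fun C => ?_
  rw [φ.isCycle_image_iff, φ.onV.surjective.exists]
  simp only [φ.mem_level, φ.isBaseOf]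

/-- The height is an isomorphism invariant. -/
theorem height_eq (φ : Iso G H) : H.height = G.height := by
  unfold height
  simp only [φ.localCoweight_eq, φ.ncard_level]

end Iso

/-! ### Forest collapses -/

/-- A forest is a subgraph (given by its edges) that contains no cycle. -/
def IsForest (G : BasedGraph) (F : Set G.E) : Prop := ∀ C, G.IsCycle C → ¬ C ⊆ F

/-- A maximal tree of a connected graph: a forest that joins all vertices. -/
def IsMaximalTree (G : BasedGraph) (T : Set G.E) : Prop :=
  G.IsForest T ∧ ∀ u v, G.joinedIn T u v

/-- The graph `G/F` where every component of the subgraph with edge set `F` is collapsed to a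
vertex. -/
def collapse (G : BasedGraph) (F : Set G.E) : BasedGraph where
  V := Quotient (G.joinedIn F)
  E := {e // e ∉ F}
  src e := Quotient.mk _ (G.src e)
  tgt e := Quotient.mk _ (G.tgt e)
  base := Quotient.mk _ G.base

open Classical in
/-- The effect of the collapse `G → G/F` on edge paths: the edges of `F` are dropped. -/
noncomputable def collapseHom (G : BasedGraph) (F : Set G.E) :
    FreeGroup G.E →* FreeGroup (G.collapse F).E :=
  FreeGroup.lift fun e => if h : e ∈ F then 1 else FreeGroup.of (⟨e, h⟩ : {e // e ∉ F})

end BasedGraph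

/-! ### Marked graphs, the spine of Auter space and cactus space -/

/-- A marked reduced basepointed graph of rank `n`. The based homotopy equivalences from the rose
with `n` petals to a graph are given, up to based homotopy, by the isomorphisms from `Fₙ`, the
fundamental group of the rose, to the fundamental group of the graph. -/
structure MarkedGraph (n : ℕ) where
  graph : BasedGraph
  reduced : graph.IsReduced
  marking : FreeGroup (Fin n) ≃* graph.fundamentalGroup

/-- An automorphism of `Fₙ` is symmetric if it maps every generator to a conjugate of a generator
or of the inverse of a generator. -/
def IsSymmetricAut {n : ℕ} (φ : MulAut (FreeGroup (Fin n))) : Prop :=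
  ∀ i, ∃ j, IsConj (φ (FreeGroup.of i)) (FreeGroup.of j) ∨
    IsConj (φ (FreeGroup.of i)) (FreeGroup.of j)⁻¹

namespace MarkedGraph

variable {n : ℕ}

/-- Markings are equivalent if they differ by an isomorphism of based graphs. -/
instance setoid (n : ℕ) : Setoid (MarkedGraph n) where
  r X Y := ∃ φ : BasedGraph.Iso X.graph Y.graph,
    ∀ g, φ.hom (X.marking g : FreeGroup X.graph.E) = Y.marking g
  iseqv :=
    { refl := fun X => ⟨.refl _, fun _ => BasedGraph.Iso.hom_refl _⟩
      symm := by
        rintro X Y ⟨φ, hφ⟩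
        exact ⟨φ.symm, fun g => by rw [← hφ, φ.hom_symm]⟩
      trans := by
        rintro X Y Z ⟨φ, hφ⟩ ⟨ψ, hψ⟩
        exact ⟨φ.trans ψ, fun g => by rw [φ.hom_trans, hφ, hψ]⟩ }

/-- A symmetric marking: for every maximal tree `T`, the marking followed by the collapse of `T`
to a rose, whose petals are identified with those of the standard rose, is a symmetric
automorphism of `Fₙ`. (Symmetry does not depend on the way the petals are identified.) -/
def IsSymmetric (X : MarkedGraph n) : Prop :=
  ∀ T, X.graph.IsMaximalTree T →
    ∃ (τ : {e // e ∉ T} ≃ Fin n) (φ : MulAut (FreeGroup (Fin n))), IsSymmetricAut φ ∧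
      ∀ g, FreeGroup.freeGroupCongr τ (X.graph.collapseHom T (X.marking g)) = φ g

/-- A marked cactus graph is a cactus graph with a symmetric marking. -/
def IsMarkedCactus (X : MarkedGraph n) : Prop := X.graph.IsCactus ∧ X.IsSymmetric

/-- `Y` arises from `X` by collapsing a forest, compatibly with the markings. -/
def CollapsesTo (X Y : MarkedGraph n) : Prop :=
  ∃ F, X.graph.IsForest F ∧ ∃ φ : BasedGraph.Iso (X.graph.collapse F) Y.graph,
    ∀ g, φ.hom (X.graph.collapseHom F (X.marking g)) = Y.marking g

end MarkedGraph

/-- The vertices of the spine of Auter space: equivalence classes of marked graphs. -/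
def AuterVertex (n : ℕ) : Type 1 := Quotient (MarkedGraph.setoid n)

namespace AuterVertex

variable {n : ℕ}

/-- The class of a marked graph. -/
def mk (X : MarkedGraph n) : AuterVertex n := Quotient.mk _ X

/-- The height of the underlying graph. -/
noncomputable def height (a : AuterVertex n) : Lex (ℕ → ℤ) :=
  Quotient.lift (fun X : MarkedGraph n => X.graph.height)
    (fun X Y (h : (MarkedGraph.setoid n).r X Y) => h.elim fun φ _ => φ.height_eq.symm) a

/-- `a` is represented by a marked cactus graph. -/
def IsMarkedCactus (a : AuterVertex n) : Prop := ∃ X, mk X = a ∧ X.IsMarkedCactus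

/-- `b` is obtained from `a` by a forest collapse. Equality is included: `∅` is a forest. -/
def CollapsesTo (a b : AuterVertex n) : Prop :=
  ∃ X Y, mk X = a ∧ mk Y = b ∧ X.CollapsesTo Y

/-- `b` is a (proper) blow-down of `a`, and `a` is a (proper) blow-up of `b`. -/
def IsBlowDown (b a : AuterVertex n) : Prop := a.CollapsesTo b ∧ b ≠ a

end AuterVertex

/-- The spine `Kₙ` of Auter space. Forest collapses compose, so the vertex sets of the chains of
forest collapses are the finite sets of vertices that are pairwise related by a collapse. -/
def auterSpine (n : ℕ) : PreAbstractSimplicialComplex (AuterVertex n) where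
  faces := {s | s.Nonempty ∧ IsChain AuterVertex.CollapsesTo (s : Set (AuterVertex n))}
  isRelLowerSet_faces := fun _ hs =>
    ⟨hs.1, fun _ hts ht => ⟨ht, hs.2.mono (Finset.coe_subset.2 hts)⟩⟩

/-- The full subcomplex spanned by the vertices with a property. -/
def PreAbstractSimplicialComplex.fullOn {α : Type*} (K : PreAbstractSimplicialComplex α)
    (P : α → Prop) : PreAbstractSimplicialComplex α where
  faces := {s | s ∈ K.faces ∧ ∀ a ∈ s, P a}
  isRelLowerSet_faces := fun _ hs =>
    ⟨(K.isRelLowerSet_faces hs.1).1, fun _ hts ht =>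
      ⟨(K.isRelLowerSet_faces hs.1).2 hts ht, fun a ha => hs.2 a (hts ha)⟩⟩

/-- Cactus space `ΣKₙ`: the full subcomplex of `Kₙ` on the marked cactus graphs. -/
def cactusSpace (n : ℕ) : PreAbstractSimplicialComplex (AuterVertex n) :=
  (auterSpine n).fullOn AuterVertex.IsMarkedCactus

namespace AuterVertex

variable {n : ℕ}

/-- The subcomplex of cactus space on the vertices of height at most that of `a`. -/
def sublevel (a : AuterVertex n) : PreAbstractSimplicialComplex (AuterVertex n) :=
  (cactusSpace n).fullOn fun b => b.height ≤ a.height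

/-- The descending star: the simplices of the sublevel complex that contain `a`. -/
def descendingStar (a : AuterVertex n) : Set (Finset (AuterVertex n)) :=
  {s | s ∈ a.sublevel.faces ∧ a ∈ s}

/-- The descending link: the faces of the simplices of the descending star that do not contain
`a` themselves. -/
def descendingLink (a : AuterVertex n) : PreAbstractSimplicialComplex (AuterVertex n) where
  faces := {t | t.Nonempty ∧ a ∉ t ∧ ∃ s ∈ a.descendingStar, t ⊆ s}
  isRelLowerSet_faces := by
    rintro t ⟨ht, hat, s, hs, hts⟩
    exact ⟨ht, fun u hut hu => ⟨hu, fun h => hat (hut h), s, hs, hut.trans hts⟩⟩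

/-- The down-link: the complex of descending blow-downs. -/
def downLink (a : AuterVertex n) : PreAbstractSimplicialComplex (AuterVertex n) :=
  (cactusSpace n).fullOn fun b => b.IsBlowDown a ∧ b.height < a.height

/-- The up-link: the complex of descending blow-ups to marked cactus graphs. -/
def upLink (a : AuterVertex n) : PreAbstractSimplicialComplex (AuterVertex n) :=
  (cactusSpace n).fullOn fun b => a.IsBlowDown b ∧ b.height < a.height

end AuterVertex

/-! Heights. The collapse of a non-empty forest `F` lowers the height exactly if, among the cycles
of least level i that meet `F`, one is collapsed at its root (`IsDescending`). Such a collapse keeps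
all entries before c_i and lowers c_i, because a cycle rooted at a vertex of Λ_{i+1} becomes rooted
in Λ_i. Any other collapse keeps all entries up to c_i and identifies two vertices of Λ_{i+1}, so
n_{i+1} grows (`height_lt_of_isDescending`, `height_gt_of_not_isDescending`). Hence comparable
marked cactus graphs have different heights, and the vertices of the descending link are the
strictly lower blow-downs and blow-ups. Every blow-down lies below every blow-up in the collapse
order, so the descending link is the order complex of an ordinal sum, and a join.

Down-link. A marked reduced graph has at most one collapse onto a given marked graph (`lab_unique`),
so lower blow-downs are the descending forests, ordered by reverse inclusion. Let B be the set of
edges incident to the root of their cycle. If some cycle has at least three edges, choose an edge e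
of it at its root; the zigzag F ⊇ F ∩ B ⊆ (F ∩ B) ∪ {e} ⊇ {e} contracts the poset of descending
forests, and also its ordinal sum with the blow-ups. In a thin graph all edges lie in B and every
non-empty forest descends. A forest there omits an edge of each two-edge cycle and contains no loop;
there is one two-edge cycle for each vertex other than p, so forests form the join of V - 1 copies
of S^0.

Up-link of a thin graph. In a blow-up, collapsing the forest edges that the forest joins to the root
of their cycle is a retraction of the poset of lower blow-ups onto the trimmed ones
(`exists_reduction`). In a trimmed blow-up each vertex v ≠ p is expanded to a path inside its parent
cycle, and the cycles rooted at v are distributed over the vertices of the path. The edges of the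
path become a chain of proper non-empty subsets of the cycles rooted at v, and every choice of such
chains arises from exactly one trimmed blow-up (`nonempty_splitting_orderIso_reducedUpSet`). So
trimmed blow-ups form the face poset of the join, over all v ≠ p, of the subdivided boundaries of
simplices on the k_v cycles rooted at v. As the k_v add up to c, this is a sphere of dimension c -
V.

Two tools. Homotopy equivalences come from comparable monotone maps (`orderMap_homotopic`). Spheres
are recognised by complete fans: if the cone over a finite complex is identified with a vector
space, linearly on each cone, the realization is the unit sphere (`Fan.homeoSphere`). Boundaries of
simplices have fans, and fans pass to joins, ordinal sums and barycentric subdivisions, with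
dimensions adding up; thus no topological join is needed. The graph theory is linear algebra modulo
two: two vertices are joined in `A` if and only if their sum bounds a chain in `A`, and closed
chains of a cactus graph are constant on every cycle (`IsCactus.closed_const`). -/

namespace PreAbstractSimplicialComplex

/-! ### Maps and homotopies on geometric realizations -/

variable {α β Z : Type*} [TopologicalSpace Z]

/-- The inclusion of a closed simplex in the realization. -/
def closedSimplex.incl (K : PreAbstractSimplicialComplex α) (s : Finset α) :
    K.closedSimplex s → K.Realization := fun x => x.1

theorem closedSimplex.continuous_coord (K : PreAbstractSimplicialComplex α) (s : Finset α) (a : α) :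
    Continuous fun x : K.closedSimplex s => x.1.1 a := by
  by_cases h : a ∈ s
  · exact (continuous_apply (⟨a, h⟩ : s)).comp
      (continuous_induced_dom (f := fun (x : K.closedSimplex s) (a : s) => x.1.1 a))
  · have : (fun x : K.closedSimplex s => x.1.1 a) = fun _ => 0 := by
      funext x
      by_contra hx
      exact h (x.2 (Finsupp.mem_support_iff.2 hx))
    rw [this]
    exact continuous_const

theorem closedSimplex.continuous_incl {K : PreAbstractSimplicialComplex α} {s : Finset α}
    (hs : s ∈ K.faces) : Continuous (closedSimplex.incl K s) :=
  continuous_iff_coinduced_le.2 (le_iSup (fun s : K.faces => TopologicalSpace.coinduced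
    (fun x : K.closedSimplex s.1 => (x.1 : K.Realization)) inferInstance) ⟨s, hs⟩)

/-- The weak topology is final for the closed simplices, so they test continuity. -/
theorem continuous_dom_iff {K : PreAbstractSimplicialComplex α} {f : K.Realization → Z} :
    Continuous f ↔ ∀ s ∈ K.faces, Continuous fun x : K.closedSimplex s => f x.1 := by
  rw [continuous_iSup_dom]
  simp only [continuous_coinduced_dom]
  exact ⟨fun h s hs => h ⟨s, hs⟩, fun h s => h s.1 s.2⟩

theorem continuous_coord (K : PreAbstractSimplicialComplex α) (a : α) :
    Continuous fun x : K.Realization => x.1 a :=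
  continuous_dom_iff.2 fun s _ => closedSimplex.continuous_coord K s a

theorem continuous_of_support_subset {K : PreAbstractSimplicialComplex α} {h : Z → K.Realization}
    {s : Finset α} (hs : s ∈ K.faces) (hsupp : ∀ z, (h z).1.support ⊆ s)
    (hc : ∀ a, Continuous fun z => (h z).1 a) : Continuous h := by
  let h' : Z → K.closedSimplex s := fun z => ⟨h z, hsupp z⟩
  have : Continuous h' := continuous_induced_rng.2 (continuous_pi fun a => hc a)
  exact (closedSimplex.continuous_incl hs).comp this

/-- The set `u` need not be a face. It contains only finitely many faces, and the points `z` whose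
support lies in a given one form a closed set; these sets cover `Z`, so the map can be glued. -/
theorem continuous_of_support_subset_finset {K : PreAbstractSimplicialComplex α}
    {h : Z → K.Realization} (u : Finset α) (hsupp : ∀ z, (h z).1.support ⊆ u)
    (hc : ∀ a, Continuous fun z => (h z).1 a) : Continuous h := by
  let J := {s : u.powerset // s.1 ∈ K.faces}
  let C : J → Set Z := fun s => {z | (h z).1.support ⊆ s.1.1}
  refine (locallyFinite_of_finite C).continuous ?_ ?_ ?_
  · ext z
    simp only [Set.mem_iUnion, Set.mem_univ, iff_true]
    exact ⟨⟨⟨_, Finset.mem_powerset.2 (hsupp z)⟩, (h z).2.2.1⟩, Finset.Subset.refl _⟩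
  · intro s
    have : C s = ⋂ a ∈ {a | a ∉ s.1.1}, {z | (h z).1 a = 0} := by
      ext z
      simp only [C, Set.mem_ofPred_eq, Set.mem_iInter]
      refine ⟨fun hz a ha => ?_, fun hz a ha => ?_⟩
      · by_contra h0
        exact ha (hz (Finsupp.mem_support_iff.2 h0))
      · by_contra h0
        exact (Finsupp.mem_support_iff.1 ha) (hz a h0)
    rw [this]
    exact isClosed_biInter fun a _ => isClosed_eq (hc a) continuous_const
  · intro s
    rw [continuousOn_iff_continuous_domRestrict]
    exact continuous_of_support_subset s.2 (fun z => z.2)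
      fun a => (hc a).comp continuous_subtype_val

theorem continuous_of_finite [Fintype α] {K : PreAbstractSimplicialComplex α}
    {h : Z → K.Realization} (hc : ∀ a, Continuous fun z => (h z).1 a) : Continuous h :=
  continuous_of_support_subset_finset Finset.univ (fun _ => Finset.subset_univ _) hc

/-- Homotopies on the realization may be checked on closed simplices. -/
theorem continuous_prod_dom {K : PreAbstractSimplicialComplex α}
    {H : unitInterval × K.Realization → Z}
    (h : ∀ s ∈ K.faces, Continuous fun q : unitInterval × K.closedSimplex s => H (q.1, q.2.1)) :
    Continuous H := by
  have hcurry : ∀ x : K.Realization, Continuous fun t : unitInterval => H (t, x) := fun x => by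
    let y : K.closedSimplex x.1.support := ⟨x, Finset.Subset.refl _⟩
    exact (h _ x.2.2.1).comp (f := fun t : unitInterval => (t, y))
      (continuous_id.prodMk continuous_const)
  -- The weak topology says nothing directly about a product with the interval. Since the interval
  -- is locally compact, the homotopy may be curried to a map into the path space, where the test on
  -- closed simplices applies.
  let c : K.Realization → C(unitInterval, Z) := fun x => ⟨_, hcurry x⟩
  have hc : Continuous c := by
    refine continuous_dom_iff.2 fun s hs => ?_
    exact ContinuousMap.continuous_of_continuous_uncurry _ ((h s hs).comp continuous_swap)
  have := ContinuousMap.continuous_uncurry_of_continuous ⟨c, hc⟩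
  exact this.comp continuous_swap

/-- The total mass of a formal combination. -/
noncomputable def mass : (α →₀ ℝ) →ₗ[ℝ] ℝ := Finsupp.linearCombination ℝ fun _ => (1 : ℝ)

theorem mass_apply (x : α →₀ ℝ) : mass x = ∑ a ∈ x.support, x a := by
  simp [mass, Finsupp.linearCombination_apply, Finsupp.sum]

theorem mass_mapDomain (f : α → β) (x : α →₀ ℝ) : mass (x.mapDomain f) = mass x := by
  simp [mass, Finsupp.linearCombination_mapDomain, Function.comp_def]

theorem mapDomain_nonneg (f : α → β) {x : α →₀ ℝ} (hx : ∀ a, 0 ≤ x a) (b : β) :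
    0 ≤ x.mapDomain f b := by
  rw [Finsupp.mapDomain, Finsupp.sum, Finsupp.finsetSum_apply]
  refine Finset.sum_nonneg fun a _ => ?_
  classical
  rw [Finsupp.single_apply]
  split_ifs
  exacts [hx a, le_rfl]

theorem exists_of_mem_support_mapDomain {f : α → β} {x : α →₀ ℝ} {b : β}
    (h : b ∈ (x.mapDomain f).support) : ∃ a ∈ x.support, f a = b := by
  classical
  simpa using Finsupp.mapDomain_support h

theorem mapDomain_apply_of_support_subset [DecidableEq β] (f : α → β) {x : α →₀ ℝ} {s : Finset α}
    (hs : x.support ⊆ s) (b : β) :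
    x.mapDomain f b = ∑ a ∈ s, if f a = b then x a else 0 := by
  rw [Finsupp.mapDomain, Finsupp.sum_of_support_subset _ hs _ (by simp), Finsupp.finsetSum_apply]
  simp [Finsupp.single_apply]

open Classical in
/-- The map of realizations induced by a simplicial map. -/
noncomputable def mapRealization {K : PreAbstractSimplicialComplex α}
    {L : PreAbstractSimplicialComplex β} (f : α → β)
    (hf : ∀ s ∈ K.faces, s.image f ∈ L.faces) : C(K.Realization, L.Realization) where
  toFun x := ⟨x.1.mapDomain f, mapDomain_nonneg f x.2.1, by
    have hm : (x.1.mapDomain f).support.Nonempty := by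
      rw [Finsupp.support_nonempty_iff]
      intro h0
      have := mass_mapDomain f x.1
      rw [h0, mass_apply x.1, x.2.2.2] at this
      simp at this
    exact (L.isRelLowerSet_faces (hf _ x.2.2.1)).2 Finsupp.mapDomain_support hm, by
    rw [← mass_apply, mass_mapDomain, mass_apply, x.2.2.2]⟩
  continuous_toFun := by
    refine continuous_dom_iff.2 fun s hs => continuous_of_support_subset (hf s hs) (fun x => ?_) ?_
    · exact Finsupp.mapDomain_support.trans (Finset.image_subset_image x.2)
    · intro b
      simp only [fun x : K.closedSimplex s => mapDomain_apply_of_support_subset f x.2 b]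
      refine continuous_finsetSum _ fun a _ => ?_
      split_ifs
      exacts [closedSimplex.continuous_coord K s a, continuous_const]

open Classical in
/-- An injection of vertices that matches the faces induces a homeomorphism. -/
noncomputable def realizationHomeo {K : PreAbstractSimplicialComplex α}
    {L : PreAbstractSimplicialComplex β} (f : α → β) (hf : Function.Injective f)
    (h : ∀ s, s ∈ K.faces ↔ s.image f ∈ L.faces)
    (hL : ∀ t ∈ L.faces, ∀ b ∈ t, b ∈ Set.range f) : K.Realization ≃ₜ L.Realization := by
  have hmem : ∀ t ∈ L.faces, t.preimage f hf.injOn ∈ K.faces := fun t ht => by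
    rw [h, Finset.image_preimage, Finset.filter_true_of_mem (hL t ht)]
    exact ht
  have hsurj : ∀ x : L.Realization,
      (x.1.comapDomain f hf.injOn).mapDomain f = x.1 := fun x => by
    refine Finsupp.mapDomain_comapDomain f hf x.1 fun b hb => hL _ x.2.2.1 b hb
  refine
  { toFun := mapRealization (L := L) f fun s hs => (h s).1 hs
    invFun := fun x => ⟨x.1.comapDomain f hf.injOn, fun a => x.2.1 _, hmem _ x.2.2.1, by
      rw [← mass_apply, ← mass_mapDomain f, hsurj, mass_apply, x.2.2.2]⟩
    left_inv := fun x => Subtype.ext (Finsupp.comapDomain_mapDomain f hf x.1)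
    right_inv := fun x => Subtype.ext (hsurj x)
    continuous_toFun := (mapRealization (L := L) f fun s hs => (h s).1 hs).continuous
    continuous_invFun := ?_ }
  refine continuous_dom_iff.2 fun s hs => continuous_of_support_subset (hmem s hs) ?_ ?_
  · intro x a ha
    rw [Finset.mem_preimage]
    exact x.2 (by simpa using ha)
  · exact fun a => closedSimplex.continuous_coord L s (f a)

end PreAbstractSimplicialComplex

/-! ### Order complexes and comparable monotone maps -/

open PreAbstractSimplicialComplex

/-- The complex of non-empty finite chains of a partially ordered set. -/
def orderComplex (P : Type*) [PartialOrder P] : PreAbstractSimplicialComplex P where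
  faces := {s | s.Nonempty ∧ IsChain (· ≤ ·) (s : Set P)}
  isRelLowerSet_faces := fun _ hs =>
    ⟨hs.1, fun _ hts ht => ⟨ht, hs.2.mono (Finset.coe_subset.2 hts)⟩⟩

section Order

variable {P Q : Type*} [PartialOrder P] [PartialOrder Q]

theorem image_mem_orderComplex [DecidableEq Q] (f : P →o Q) (s : Finset P)
    (hs : s ∈ (orderComplex P).faces) : s.image f ∈ (orderComplex Q).faces := by
  refine ⟨hs.1.image _, ?_⟩
  rw [Finset.coe_image]
  rintro _ ⟨a, ha, rfl⟩ _ ⟨b, hb, rfl⟩ _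
  exact (hs.2.total ha hb).imp (fun h => f.monotone h) fun h => f.monotone h

/-- The map of order complexes induced by a monotone map. -/
noncomputable def orderMap (f : P →o Q) :
    C((orderComplex P).Realization, (orderComplex Q).Realization) :=
  mapRealization f fun s hs => by classical exact image_mem_orderComplex f s hs

/-- The part of the mass of `x` that has been moved at time `t`, from the bottom upwards. -/
noncomputable def movedMass (x : P →₀ ℝ) (t : ℝ) : P →₀ ℝ := by
  classical
  exact Finsupp.onFinset x.support
    (fun b => min (x b) (max 0 (t - ∑ a ∈ x.support with a < b, x a))) (fun b hb => by
      by_contra h0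
      rw [Finsupp.notMem_support_iff] at h0
      rw [h0] at hb
      exact hb (min_eq_left (le_max_left _ _)))

theorem movedMass_apply [DecidableLT P] (x : P →₀ ℝ) (t : ℝ) (b : P) :
    movedMass x t b = min (x b) (max 0 (t - ∑ a ∈ x.support with a < b, x a)) := by
  simp only [movedMass, Finsupp.onFinset_apply]
  congr!

theorem movedMass_nonneg {x : P →₀ ℝ} (hx : ∀ a, 0 ≤ x a) (t : ℝ) (b : P) :
    0 ≤ movedMass x t b := by
  classical
  rw [movedMass_apply]
  exact le_min (hx b) (le_max_left _ _)

theorem movedMass_le (x : P →₀ ℝ) (t : ℝ) (b : P) : movedMass x t b ≤ x b := by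
  classical
  rw [movedMass_apply]
  exact min_le_left _ _

theorem movedMass_zero {x : P →₀ ℝ} (hx : ∀ a, 0 ≤ x a) : movedMass x 0 = 0 := by
  classical
  ext b
  rw [movedMass_apply, max_eq_left]
  · exact min_eq_right (hx b)
  · rw [zero_sub, neg_nonpos]
    exact Finset.sum_nonneg fun a _ => hx a

theorem movedMass_one {x : P →₀ ℝ} (hx : ∀ a, 0 ≤ x a) (h1 : ∑ a ∈ x.support, x a = 1) :
    movedMass x 1 = x := by
  classical
  ext b
  rw [movedMass_apply]
  refine min_eq_left ?_
  by_cases hb : b ∈ x.support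
  · refine le_max_of_le_right ?_
    have : x b + ∑ a ∈ x.support with a < b, x a ≤ ∑ a ∈ x.support, x a := by
      rw [← Finset.sum_insert (s := x.support.filter (· < b)) (a := b) (by simp)]
      exact Finset.sum_le_sum_of_subset_of_nonneg
        (Finset.insert_subset hb (Finset.filter_subset _ _)) fun a _ _ => hx a
    linarith
  · rw [Finsupp.notMem_support_iff.1 hb]
    exact le_max_left _ _

/-- Mass moves from the bottom of the chain upwards. If `c < b` and `c` is not completely moved,
then `t` is less than the mass up to and including `c`, hence less than the mass below `b`, and
nothing of `b` has moved. -/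
theorem movedMass_order {x : P →₀ ℝ} (hx : ∀ a, 0 ≤ x a)
    (hchain : IsChain (· ≤ ·) (x.support : Set P)) {t : ℝ} {b c : P}
    (hb : movedMass x t b ≠ 0) (hc : movedMass x t c ≠ x c) : b ≤ c := by
  classical
  have hbs : b ∈ x.support := by
    rw [Finsupp.mem_support_iff]
    intro h0
    exact hb (le_antisymm (h0 ▸ movedMass_le x t b) (movedMass_nonneg hx t b))
  have hcs : c ∈ x.support := by
    rw [Finsupp.mem_support_iff]
    intro h0
    exact hc (le_antisymm (movedMass_le x t c) (h0 ▸ movedMass_nonneg hx t c))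
  refine (hchain.total hbs hcs).elim id fun hcb => ?_
  by_contra hbc
  have hlt : c < b := lt_of_le_not_ge hcb hbc
  have h1 : t - ∑ a ∈ x.support with a < c, x a < x c := by
    by_contra! h
    refine hc ?_
    rw [movedMass_apply]
    exact min_eq_left (h.trans (le_max_right _ _))
  have h2 : x c + ∑ a ∈ x.support with a < c, x a ≤ ∑ a ∈ x.support with a < b, x a := by
    rw [← Finset.sum_insert (s := x.support.filter (· < c)) (a := c) (by simp)]
    refine Finset.sum_le_sum_of_subset_of_nonneg (fun a ha => ?_) fun a _ _ => hx a
    rw [Finset.mem_insert, Finset.mem_filter] at ha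
    rw [Finset.mem_filter]
    rcases ha with rfl | ha
    · exact ⟨hcs, hlt⟩
    · exact ⟨ha.1, ha.2.trans hlt⟩
  refine hb ?_
  rw [movedMass_apply, max_eq_left (by linarith)]
  exact min_eq_right (hx b)

/-- Trades the support, which varies with `x`, for a fixed finite set, so that continuity on a
closed simplex is visible. -/
theorem movedMass_apply_of_subset [DecidableLT P] {x : P →₀ ℝ} {s : Finset P}
    (hs : x.support ⊆ s) (t : ℝ) (b : P) :
    movedMass x t b = min (x b) (max 0 (t - ∑ a ∈ s with a < b, x a)) := by
  rw [movedMass_apply]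
  congr 3
  refine Finset.sum_subset (Finset.filter_subset_filter _ hs) fun a ha h => ?_
  rw [Finset.mem_filter] at ha
  by_contra h0
  exact h (Finset.mem_filter.2 ⟨Finsupp.mem_support_iff.2 h0, ha.2⟩)

/-- The combination of `g x` and `f x` in which the moved mass lies over `f`. -/
noncomputable def pushMass {Q : Type*} (f g : P → Q) (x : P →₀ ℝ) (t : ℝ) : Q →₀ ℝ :=
  (x - movedMass x t).mapDomain g + (movedMass x t).mapDomain f

theorem mass_pushMass {Q : Type*} (f g : P → Q) (x : P →₀ ℝ) (t : ℝ) : mass (pushMass f g x t) = mass x := by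
  rw [pushMass, map_add, mass_mapDomain, mass_mapDomain, ← map_add, sub_add_cancel]

theorem pushMass_nonneg {Q : Type*} (f g : P → Q) {x : P →₀ ℝ} (hx : ∀ a, 0 ≤ x a) (t : ℝ) (b : Q) :
    0 ≤ pushMass f g x t b :=
  add_nonneg (mapDomain_nonneg g (fun a => sub_nonneg.2 (movedMass_le x t a)) b)
    (mapDomain_nonneg f (movedMass_nonneg hx t) b)

theorem pushMass_support {Q : Type*} (f g : P → Q) {x : P →₀ ℝ} {t : ℝ} {q : Q}
    (h : q ∈ (pushMass f g x t).support) :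
    (∃ c, movedMass x t c ≠ x c ∧ g c = q) ∨ ∃ b, movedMass x t b ≠ 0 ∧ f b = q := by
  classical
  rcases Finset.mem_union.1 (Finsupp.support_add h) with h | h
  · obtain ⟨c, hc, rfl⟩ := exists_of_mem_support_mapDomain h
    refine Or.inl ⟨c, fun h0 => ?_, rfl⟩
    rw [Finsupp.mem_support_iff, Finsupp.sub_apply, h0, sub_self] at hc
    exact hc rfl
  · obtain ⟨b, hb, rfl⟩ := exists_of_mem_support_mapDomain h
    exact Or.inr ⟨b, Finsupp.mem_support_iff.1 hb, rfl⟩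

theorem support_movedMass_subset (x : P →₀ ℝ) (t : ℝ) : (movedMass x t).support ⊆ x.support :=
  Finsupp.support_onFinset_subset

/-- The only mixed comparison is between `f b` with `b` moved and `g c` with `c` not yet moved; then
`b ≤ c` by `movedMass_order`, so `f b ≤ f c ≤ g c`. -/
theorem pushMass_chain {f g : P →o Q} (hfg : f ≤ g) {x : P →₀ ℝ} (hx : ∀ a, 0 ≤ x a)
    (hchain : IsChain (· ≤ ·) (x.support : Set P)) (t : ℝ) :
    IsChain (· ≤ ·) ((pushMass f g x t).support : Set Q) := by
  have hsup : ∀ c, movedMass x t c ≠ x c → c ∈ x.support := fun c hc => by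
    rw [Finsupp.mem_support_iff]
    intro h0
    exact hc (le_antisymm (movedMass_le x t c) (h0 ▸ movedMass_nonneg hx t c))
  have hsup' : ∀ c, movedMass x t c ≠ 0 → c ∈ x.support := fun c hc =>
    support_movedMass_subset x t (Finsupp.mem_support_iff.2 hc)
  intro q hq r hr _
  rcases pushMass_support f g hq with ⟨c, hc, rfl⟩ | ⟨c, hc, rfl⟩ <;>
    rcases pushMass_support f g hr with ⟨d, hd, rfl⟩ | ⟨d, hd, rfl⟩
  · exact (hchain.total (hsup c hc) (hsup d hd)).imp (fun h => g.monotone h) fun h => g.monotone h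
  · exact Or.inr ((f.monotone (movedMass_order hx hchain hd hc)).trans (hfg c))
  · exact Or.inl ((f.monotone (movedMass_order hx hchain hc hd)).trans (hfg d))
  · exact (hchain.total (hsup' c hc) (hsup' d hd)).imp (fun h => f.monotone h)
      fun h => f.monotone h

/-- Comparable monotone maps induce homotopic maps of order complexes. -/
theorem orderMap_homotopic {f g : P →o Q} (hfg : f ≤ g) :
    (orderMap g).Homotopic (orderMap f) := by
  classical
  have hne : ∀ (x : (orderComplex P).Realization) (t : ℝ),
      (pushMass f g x.1 t).support.Nonempty := fun x t => by
    rw [Finsupp.support_nonempty_iff]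
    intro h0
    have := mass_pushMass f g x.1 t
    rw [h0, mass_apply x.1, x.2.2.2] at this
    simp at this
  let H : unitInterval × (orderComplex P).Realization → (orderComplex Q).Realization :=
    fun q => ⟨pushMass f g q.2.1 q.1, pushMass_nonneg f g q.2.2.1 _,
      ⟨hne q.2 q.1, pushMass_chain hfg q.2.2.1 q.2.2.2.1.2 _⟩, by
      rw [← mass_apply, mass_pushMass, mass_apply, q.2.2.2.2]⟩
  have hH : Continuous H := by
    refine continuous_prod_dom fun s hs => ?_
    have hm : ∀ b, Continuous fun q : unitInterval × (orderComplex P).closedSimplex s =>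
        movedMass q.2.1.1 q.1 b := fun b => by
      simp only [fun q : unitInterval × (orderComplex P).closedSimplex s =>
        movedMass_apply_of_subset q.2.2 q.1 b]
      have hx : ∀ a, Continuous fun q : unitInterval × (orderComplex P).closedSimplex s =>
        q.2.1.1 a := fun a => (closedSimplex.continuous_coord _ s a).comp continuous_snd
      refine (hx b).min (continuous_const.max ?_)
      exact (continuous_subtype_val.comp continuous_fst).sub
        (continuous_finsetSum _ fun a _ => hx a)
    have hcoord : ∀ q, Continuous fun z : unitInterval × (orderComplex P).closedSimplex s =>
        (H (z.1, z.2.1)).1 q := fun q => by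
      have hz : ∀ z : unitInterval × (orderComplex P).closedSimplex s, (H (z.1, z.2.1)).1 q =
          (∑ a ∈ s, if g a = q then z.2.1.1 a - movedMass z.2.1.1 z.1 a else 0) +
          ∑ a ∈ s, if f a = q then movedMass z.2.1.1 z.1 a else 0 := fun z => by
        have h1 : (movedMass z.2.1.1 z.1).support ⊆ s :=
          (support_movedMass_subset _ _).trans z.2.2
        have h2 : (z.2.1.1 - movedMass z.2.1.1 z.1).support ⊆ s :=
          Finsupp.support_sub.trans (Finset.union_subset z.2.2 h1)
        change ((z.2.1.1 - movedMass z.2.1.1 z.1).mapDomain g +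
          (movedMass z.2.1.1 z.1).mapDomain f) q = _
        rw [Finsupp.add_apply, mapDomain_apply_of_support_subset g h2,
          mapDomain_apply_of_support_subset f h1]
        rfl
      simp only [hz]
      refine (continuous_finsetSum _ fun a _ => ?_).add (continuous_finsetSum _ fun a _ => ?_)
      · split_ifs
        exacts [((closedSimplex.continuous_coord _ s a).comp continuous_snd).sub (hm a),
          continuous_const]
      · split_ifs
        exacts [hm a, continuous_const]
    -- The union of the images of `s` under `f` and `g` need not be a chain; only the support of
    -- each single point is. Hence the version for finite sets that are not faces.
    refine continuous_of_support_subset_finset (s.image f ∪ s.image g) (fun z q hq => ?_) hcoord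
    · rcases pushMass_support f g hq with ⟨c, hc, rfl⟩ | ⟨c, hc, rfl⟩
      · refine Finset.mem_union_right _ (Finset.mem_image_of_mem _ (z.2.2 ?_))
        rw [Finsupp.mem_support_iff]
        intro h0
        exact hc (le_antisymm (movedMass_le _ _ c)
          (h0.trans_le (movedMass_nonneg z.2.1.2.1 _ c)))
      · exact Finset.mem_union_left _ (Finset.mem_image_of_mem _
          (z.2.2 (support_movedMass_subset _ _ (Finsupp.mem_support_iff.2 hc))))
  refine ⟨⟨⟨H, hH⟩, fun x => Subtype.ext ?_, fun x => Subtype.ext ?_⟩⟩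
  · change pushMass f g x.1 ((0 : unitInterval) : ℝ) = x.1.mapDomain g
    rw [pushMass, Set.Icc.coe_zero, movedMass_zero x.2.1]
    simp
  · change pushMass f g x.1 ((1 : unitInterval) : ℝ) = x.1.mapDomain f
    rw [pushMass, Set.Icc.coe_one, movedMass_one x.2.1 x.2.2.2]
    simp

theorem orderMap_comp {R : Type*} [PartialOrder R] (g : Q →o R) (f : P →o Q) :
    orderMap (g.comp f) = (orderMap g).comp (orderMap f) :=
  ContinuousMap.ext fun x => Subtype.ext (Finsupp.mapDomain_comp (f := f) (g := g) (v := x.1))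

theorem orderMap_id : orderMap (OrderHom.id : P →o P) = ContinuousMap.id _ :=
  ContinuousMap.ext fun _ => Subtype.ext Finsupp.mapDomain_id

theorem homotopic_orderMap_of_le_or_ge {f g : P →o Q} (h : f ≤ g ∨ g ≤ f) :
    (orderMap f).Homotopic (orderMap g) :=
  h.elim (fun h => (orderMap_homotopic h).symm) fun h => orderMap_homotopic h

/-- Monotone maps that are inverse to each other up to comparison give a homotopy equivalence of
order complexes. -/
noncomputable def orderHomotopyEquiv (f : P →o Q) (g : Q →o P)
    (h : g.comp f ≤ OrderHom.id ∨ OrderHom.id ≤ g.comp f)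
    (h' : f.comp g ≤ OrderHom.id ∨ OrderHom.id ≤ f.comp g) :
    (orderComplex P).Realization ≃ₕ (orderComplex Q).Realization where
  toFun := orderMap f
  invFun := orderMap g
  left_inv := by
    rw [← orderMap_comp, ← orderMap_id]
    exact homotopic_orderMap_of_le_or_ge h
  right_inv := by
    rw [← orderMap_comp, ← orderMap_id]
    exact homotopic_orderMap_of_le_or_ge h'

/-- The inclusion of the fixed set of a retraction that moves all elements down is a homotopy
equivalence. -/
noncomputable def orderRetractEquiv (S : Set P) (r : P → P) (hr : Monotone r) (hle : ∀ x, r x ≤ x)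
    (hS : ∀ x, r x ∈ S) (hfix : ∀ x ∈ S, r x = x) :
    (orderComplex P).Realization ≃ₕ (orderComplex S).Realization :=
  orderHomotopyEquiv ⟨fun x => ⟨r x, hS x⟩, fun _ _ h => hr h⟩ ⟨Subtype.val, fun _ _ h => h⟩
    (Or.inl fun x => hle x) (Or.inl fun x => (hfix x.1 x.2).le)

/-- A poset with a zigzag from the identity to a constant map has a contractible order complex. -/
theorem contractible_orderComplex (r q : P →o P) (c : P) (hr : ∀ x, x ≤ r x)
    (hq : ∀ x, q (r x) ≤ r x) (hc : ∀ x, q (r x) ≤ c) :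
    ContractibleSpace (orderComplex P).Realization := by
  rw [contractible_iff_id_nullhomotopic]
  have h1 := homotopic_orderMap_of_le_or_ge (f := (OrderHom.id : P →o P)) (g := r) (Or.inl hr)
  have h2 := homotopic_orderMap_of_le_or_ge (f := r) (g := q.comp r) (Or.inr hq)
  have h3 := homotopic_orderMap_of_le_or_ge (f := q.comp r) (g := ⟨fun _ => c, fun _ _ _ => le_rfl⟩)
    (Or.inl hc)
  rw [orderMap_id] at h1
  refine ⟨⟨Finsupp.single c 1, fun a => ?_, ⟨?_, ?_⟩, ?_⟩, ?_⟩
  · classical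
    rw [Finsupp.single_apply]
    split_ifs <;> norm_num
  · simp
  · rw [Finsupp.support_single _ one_ne_zero]
    simp
  · simp
  · convert (h1.trans h2).trans h3 using 1
    refine ContinuousMap.ext fun x => Subtype.ext (Eq.symm ?_)
    change x.1.mapDomain (fun _ => c) = Finsupp.single c 1
    have hx := x.2.2.2
    rw [Finsupp.mapDomain, Finsupp.sum, ← Finsupp.single_finsetSum, hx]

end Order


open PreAbstractSimplicialComplex

open scoped NNReal

/-! ### Complete fans -/

section Fan

variable {α : Type*}

/-- The support of `y` is empty or a face. -/
def PreAbstractSimplicialComplex.Supports (K : PreAbstractSimplicialComplex α) (y : α → ℝ≥0) :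
    Prop :=
  ∀ s : Finset α, s.Nonempty → (∀ a ∈ s, y a ≠ 0) → s ∈ K.faces

/-- A complete simplicial fan in `E` with the combinatorics of the finite complex `K`: the vertex
`a` is placed at `p a`, and the coordinate functions `G` exhibit the resulting map from the cone
over `K` to `E` as a bijection with continuous inverse. -/
structure Fan [Fintype α] (K : PreAbstractSimplicialComplex α) (E : Type*) [NormedAddCommGroup E]
    [NormedSpace ℝ E] where
  p : α → E
  G : E → α → ℝ≥0
  cont : ∀ a, Continuous fun x => G x a
  supp : ∀ x, K.Supports (G x)
  right_inv : ∀ x, ∑ a, (G x a : ℝ) • p a = x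
  left_inv : ∀ y, K.Supports y → G (∑ a, (y a : ℝ) • p a) = y

namespace Fan

section

variable [Fintype α] {K : PreAbstractSimplicialComplex α} {E : Type*} [NormedAddCommGroup E]
  [NormedSpace ℝ E] (Φ : Fan K E)

theorem G_zero : Φ.G 0 = 0 := by
  have := Φ.left_inv 0 (fun s hs h => absurd rfl (h _ hs.choose_spec))
  simpa using this

/-- Scaling weights keeps their support within a face, and weights supported in a face are
determined by the point they represent. -/
theorem G_smul (c : ℝ≥0) (x : E) : Φ.G ((c : ℝ) • x) = c • Φ.G x := by
  have := Φ.left_inv (c • Φ.G x) (fun s hs h => Φ.supp x s hs fun a ha h0 =>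
    h a ha (by simp [h0]))
  rw [← this]
  congr 1
  conv_lhs => rw [← Φ.right_inv x]
  rw [Finset.smul_sum]
  refine Finset.sum_congr rfl fun a _ => ?_
  simp [mul_smul]

/-- The realization of the complex of a complete fan is a sphere. -/
noncomputable def homeoSphere {k : ℕ} (L : E ≃L[ℝ] EuclideanSpace ℝ (Fin k)) :
    K.Realization ≃ₜ UnitSphere k := by
  classical
  let f : K.Realization → E := fun x => ∑ a, x.1 a • Φ.p a
  let y : K.Realization → α → ℝ≥0 := fun x a => ⟨x.1 a, x.2.1 a⟩
  have hy : ∀ x, K.Supports (y x) := fun x s hs h =>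
    (K.isRelLowerSet_faces x.2.2.1).2 (fun a ha => Finsupp.mem_support_iff.2 fun h0 =>
      h a ha (Subtype.ext h0)) hs
  have hGf : ∀ x, Φ.G (f x) = y x := fun x => Φ.left_inv (y x) (hy x)
  have hsum : ∀ x : K.Realization, ∑ a, x.1 a = 1 := fun x => by
    refine Eq.trans (Finset.sum_subset (Finset.subset_univ x.1.support) fun a _ h =>
      Finsupp.notMem_support_iff.1 h).symm x.2.2.2
  have hf0 : ∀ x, f x ≠ 0 := fun x h0 => by
    have h1 := hGf x
    rw [h0, Φ.G_zero] at h1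
    have h2 := hsum x
    have h3 : ∀ a, x.1 a = 0 := fun a => congrArg NNReal.toReal (congrFun h1 a).symm
    simp [h3] at h2
  have hLf0 : ∀ x, L (f x) ≠ 0 := fun x h0 => hf0 x (L.injective (h0.trans (map_zero L).symm))
  have hfc : Continuous f := continuous_finsetSum _ fun a _ =>
    (continuous_coord K a).smul continuous_const
  -- The total weight of the direction `v`. Dividing the weights by it gives barycentric
  -- coordinates, which inverts the radial projection of the realization to the sphere.
  let m : UnitSphere k → ℝ≥0 := fun v => ∑ a, Φ.G (L.symm v.1) a
  have hm0 : ∀ v, m v ≠ 0 := fun v h0 => by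
    have h1 : ∀ a, Φ.G (L.symm v.1) a = 0 := fun a =>
      (Finset.sum_eq_zero_iff.1 h0) a (Finset.mem_univ a)
    have h2 := Φ.right_inv (L.symm v.1)
    simp only [h1, NNReal.coe_zero, zero_smul, Finset.sum_const_zero] at h2
    have h3 : v.1 = 0 := by rw [← L.apply_symm_apply v.1, ← h2, map_zero]
    have h4 := norm_eq_of_mem_sphere v
    rw [h3, norm_zero] at h4
    exact zero_ne_one h4
  have hGc : ∀ a, Continuous fun v : UnitSphere k => Φ.G (L.symm v.1) a := fun a =>
    (Φ.cont a).comp (L.symm.continuous.comp continuous_subtype_val)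
  let g : UnitSphere k → K.Realization := fun v =>
    ⟨Finsupp.equivFunOnFinite.symm fun a => ((m v)⁻¹ * Φ.G (L.symm v.1) a : ℝ≥0),
      fun a => NNReal.coe_nonneg _, by
        refine Φ.supp (L.symm v.1) _ ?_ fun a ha h0 => ?_
        · by_contra h
          rw [Finset.not_nonempty_iff_eq_empty, Finsupp.support_eq_empty] at h
          refine hm0 v (Finset.sum_eq_zero fun a _ => ?_)
          have := DFunLike.congr_fun h a
          simpa [hm0 v] using this
        · rw [Finsupp.mem_support_iff] at ha
          exact ha (by simp [h0]), by
        rw [Finset.sum_subset (Finset.subset_univ _) fun a _ h => Finsupp.notMem_support_iff.1 h]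
        simp only [Finsupp.equivFunOnFinite_symm_apply_apply]
        rw [← NNReal.coe_sum, ← Finset.mul_sum]
        change (((m v)⁻¹ * m v : ℝ≥0) : ℝ) = 1
        rw [inv_mul_cancel₀ (hm0 v), NNReal.coe_one]⟩
  have hfg : ∀ v, f (g v) = ((m v)⁻¹ : ℝ≥0) • L.symm v.1 := fun v => by
    conv_rhs => rw [← Φ.right_inv (L.symm v.1), Finset.smul_sum]
    refine Finset.sum_congr rfl fun a _ => ?_
    change (((m v)⁻¹ * Φ.G (L.symm v.1) a : ℝ≥0) : ℝ) • Φ.p a = _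
    rw [NNReal.coe_mul, mul_smul]
    rfl
  refine
  { toFun := fun x => ⟨‖L (f x)‖⁻¹ • L (f x), by
      rw [mem_sphere_zero_iff_norm, norm_smul, norm_inv, norm_norm,
        inv_mul_cancel₀ (norm_ne_zero_iff.2 (hLf0 x))]⟩
    invFun := g
    left_inv := fun x => Subtype.ext (Finsupp.ext fun a => ?_)
    right_inv := fun v => Subtype.ext ?_
    continuous_toFun := ?_
    continuous_invFun := continuous_of_finite fun a => ?_ }
  · have hn : ‖L (f x)‖₊ ≠ 0 := nnnorm_ne_zero_iff.2 (hLf0 x)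
    have h1 : ∀ a, Φ.G (L.symm (‖L (f x)‖⁻¹ • L (f x))) a = ‖L (f x)‖₊⁻¹ * y x a := fun a => by
      rw [map_smul, L.symm_apply_apply]
      have := congrFun (Φ.G_smul (‖L (f x)‖₊⁻¹) (f x)) a
      rw [hGf] at this
      simpa using this
    have h2 : ∑ a, y x a = 1 := by
      apply NNReal.coe_injective
      push_cast
      exact hsum x
    change (((∑ a, Φ.G (L.symm (‖L (f x)‖⁻¹ • L (f x))) a)⁻¹ *
      Φ.G (L.symm (‖L (f x)‖⁻¹ • L (f x))) a : ℝ≥0) : ℝ) = x.1 a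
    simp only [h1]
    rw [← Finset.mul_sum, h2, mul_one, inv_inv, mul_inv_cancel_left₀ hn]
    rfl
  · change ‖L (f (g v))‖⁻¹ • L (f (g v)) = v.1
    rw [hfg]
    have h1 : L (((m v)⁻¹ : ℝ≥0) • L.symm v.1) = (((m v)⁻¹ : ℝ≥0) : ℝ) • v.1 := by
      rw [NNReal.smul_def, map_smul, L.apply_symm_apply]
    rw [h1, norm_smul, norm_eq_of_mem_sphere, mul_one, smul_smul]
    have : (((m v)⁻¹ : ℝ≥0) : ℝ) ≠ 0 := by
      simpa using hm0 v
    rw [Real.norm_of_nonneg (NNReal.coe_nonneg _), inv_mul_cancel₀ this, one_smul]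
  · have h1 : Continuous fun x => L (f x) := L.continuous.comp hfc
    exact ((h1.norm.inv₀ fun x => norm_ne_zero_iff.2 (hLf0 x)).smul h1).subtype_mk _
  · have h1 : Continuous m := continuous_finsetSum _ fun a _ => hGc a
    exact NNReal.continuous_coe.comp ((h1.inv₀ hm0).mul (hGc a))

end

/-! Barycentric subdivision -/

section

open Classical in
/-- The length of the interval of levels at which the superlevel set of `z` is `s`. -/
noncomputable def chainCoeff [Fintype α] (z : α → ℝ≥0) (s : Finset α) : ℝ≥0 :=
  if h : s.Nonempty then s.inf' h z - sᶜ.sup z else 0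

variable [Fintype α]

open Classical in
theorem chainCoeff_pos {z : α → ℝ≥0} {s : Finset α} (h : chainCoeff z s ≠ 0) {a b : α}
    (ha : a ∈ s) (hb : b ∉ s) : z b < z a := by
  have hs : s.Nonempty := ⟨a, ha⟩
  rw [chainCoeff, dif_pos hs] at h
  exact (Finset.le_sup (Finset.mem_compl.2 hb)).trans_lt
    ((tsub_pos_iff_lt.1 (pos_iff_ne_zero.2 h)).trans_le (Finset.inf'_le z ha))

theorem ne_zero_of_chainCoeff {z : α → ℝ≥0} {s : Finset α} (h : chainCoeff z s ≠ 0) {a : α}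
    (ha : a ∈ s) : z a ≠ 0 := by
  classical
  have hs : s.Nonempty := ⟨a, ha⟩
  rw [chainCoeff, dif_pos hs] at h
  exact ((zero_le).trans_lt
    ((tsub_pos_iff_lt.1 (pos_iff_ne_zero.2 h)).trans_le (Finset.inf'_le z ha))).ne'

/-- A set with non-zero coefficient is a superlevel set of `z`, and superlevel sets are nested. -/
theorem chainCoeff_total {z : α → ℝ≥0} {s t : Finset α} (hs : chainCoeff z s ≠ 0)
    (ht : chainCoeff z t ≠ 0) : s ⊆ t ∨ t ⊆ s := by
  by_contra! h
  obtain ⟨a, ha, hat⟩ := Finset.not_subset.1 h.1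
  obtain ⟨b, hb, hbs⟩ := Finset.not_subset.1 h.2
  exact lt_asymm (chainCoeff_pos hs ha hbs) (chainCoeff_pos ht hb hat)

open MeasureTheory in
open Classical in
-- Layer-cake formula: the levels `t` in `[0, z a)` are sorted by the superlevel set `{b | t < z
-- b}`, which contains `a`. The levels that belong to `s` form an interval of length `chainCoeff z
-- s`, and Lebesgue measure adds these lengths.
theorem sum_chainCoeff (z : α → ℝ≥0) (a : α) :
    ∑ s : Finset α with a ∈ s, chainCoeff z s = z a := by
  let A : Finset α → Set ℝ := fun s => {t | 0 ≤ t ∧ ∀ b, t < z b ↔ b ∈ s}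
  have hA : ∀ s : Finset α, a ∈ s → volume (A s) = chainCoeff z s := fun s has => by
    have hs : s.Nonempty := ⟨a, has⟩
    have : A s = Set.Ico ((sᶜ.sup z : ℝ≥0) : ℝ) (s.inf' hs z : ℝ≥0) := by
      ext t
      simp only [A, Set.mem_ofPred_eq, Set.mem_Ico]
      constructor
      · rintro ⟨h0, h⟩
        lift t to ℝ≥0 using h0
        simp only [NNReal.coe_lt_coe] at h
        rw [NNReal.coe_le_coe, NNReal.coe_lt_coe, Finset.sup_le_iff, Finset.lt_inf'_iff]
        exact ⟨fun b hb => not_lt.1 fun hlt => Finset.mem_compl.1 hb ((h b).1 hlt),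
          fun b hb => (h b).2 hb⟩
      · rintro ⟨h1, h2⟩
        have h0 : 0 ≤ t := (NNReal.coe_nonneg _).trans h1
        lift t to ℝ≥0 using h0
        rw [NNReal.coe_le_coe, Finset.sup_le_iff] at h1
        rw [NNReal.coe_lt_coe, Finset.lt_inf'_iff] at h2
        refine ⟨NNReal.coe_nonneg _, fun b => ?_⟩
        rw [NNReal.coe_lt_coe]
        refine ⟨fun hb => ?_, h2 b⟩
        by_contra hbs
        exact absurd hb (not_lt.2 (h1 b (Finset.mem_compl.2 hbs)))
    rw [this, Real.volume_Ico, chainCoeff, dif_pos hs, NNReal.sub_def]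
    rfl
  have hmeas : ∀ s : Finset α, MeasurableSet (A s) := fun s => by
    have : A s = Set.Ici 0 ∩ ⋂ b, {t : ℝ | t < z b ↔ b ∈ s} := by
      ext t
      simp [A]
    rw [this]
    refine measurableSet_Ici.inter (MeasurableSet.iInter fun b => ?_)
    by_cases hb : b ∈ s
    · simp only [hb, iff_true]
      exact measurableSet_Iio
    · simp only [hb, iff_false, not_lt]
      exact measurableSet_Ici
  have hdisj : Set.PairwiseDisjoint
      (↑(Finset.univ.filter fun s : Finset α => a ∈ s) : Set (Finset α)) A := by
    intro s _ t _ hst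
    refine Set.disjoint_left.2 fun r hr hr' => hst ?_
    ext b
    exact (hr.2 b).symm.trans (hr'.2 b)
  have hunion : (⋃ s ∈ Finset.univ.filter fun s : Finset α => a ∈ s, A s) = Set.Ico 0 (z a : ℝ) := by
    ext t
    simp only [Set.mem_iUnion, Finset.mem_filter, Finset.mem_univ, true_and, Set.mem_Ico,
      exists_prop]
    constructor
    · rintro ⟨s, has, h⟩
      exact ⟨h.1, (h.2 a).2 has⟩
    · rintro ⟨h0, h⟩
      exact ⟨Finset.univ.filter fun b => t < z b, by simpa using h, h0, fun b => by simp⟩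
  have := measure_biUnion_finset (μ := volume) hdisj fun s _ => hmeas s
  rw [hunion, Real.volume_Ico, sub_zero, ENNReal.ofReal_coe_nnreal,
    Finset.sum_congr rfl fun s hs => hA s (Finset.mem_filter.1 hs).2] at this
  rw [← ENNReal.ofNNReal_finsetSum, ENNReal.coe_inj] at this
  exact this.symm

open Classical in
-- If `b ∉ s`, every set of the chain that contains `b` contains `s`. So for `a ∈ s` the sum at `a`
-- has all terms of the sum at `b`, and `w s` in addition.
theorem le_chainCoeff {w : Finset α → ℝ≥0} (hw0 : w ∅ = 0)
    (hw : ∀ s t, w s ≠ 0 → w t ≠ 0 → s ⊆ t ∨ t ⊆ s) (s : Finset α) :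
    w s ≤ chainCoeff (fun a => ∑ t with a ∈ t, w t) s := by
  by_cases h0 : w s = 0
  · rw [h0]
    exact zero_le
  have hs : s.Nonempty := by
    rw [Finset.nonempty_iff_ne_empty]
    rintro rfl
    exact h0 hw0
  rw [chainCoeff, dif_pos hs]
  refine le_tsub_of_add_le_right ?_
  rw [Finset.le_inf'_iff]
  intro a ha
  obtain hempty | hne := sᶜ.eq_empty_or_nonempty
  · rw [hempty, Finset.sup_empty, bot_eq_zero, add_zero]
    exact Finset.single_le_sum (f := w) (fun _ _ => zero_le) (by simpa using ha)
  obtain ⟨b, hb, hbsup⟩ := Finset.exists_mem_eq_sup sᶜ hne fun a => ∑ t with a ∈ t, w t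
  rw [hbsup]
  have hb' := Finset.mem_compl.1 hb
  rw [← Finset.sum_filter_ne_zero]
  rw [← Finset.sum_insert (f := w) (a := s) (by simp [hb'])]
  refine Finset.sum_le_sum_of_subset fun t ht => ?_
  simp only [Finset.mem_insert, Finset.mem_filter, Finset.mem_univ, true_and] at ht ⊢
  rcases ht with rfl | ⟨hbt, ht⟩
  · exact ha
  · rcases hw s t h0 ht with h | h
    · exact h ha
    · exact absurd (h hbt) hb'

open Classical in
-- `le_chainCoeff` compares the two functions termwise, and by `sum_chainCoeff` their sums over the
-- sets containing a fixed point agree; so all terms agree.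
theorem chainCoeff_sum {w : Finset α → ℝ≥0} (hw0 : w ∅ = 0)
    (hw : ∀ s t, w s ≠ 0 → w t ≠ 0 → s ⊆ t ∨ t ⊆ s) :
    chainCoeff (fun a => ∑ t with a ∈ t, w t) = w := by
  funext s
  obtain rfl | ⟨a, ha⟩ := s.eq_empty_or_nonempty
  · simp [chainCoeff, hw0]
  have h1 := sum_chainCoeff (fun a => ∑ t with a ∈ t, w t) a
  exact (((Finset.sum_eq_sum_iff_of_le fun s _ => le_chainCoeff hw0 hw s).1 h1.symm) s
    (by simpa using ha)).symm

theorem continuous_chainCoeff {Z : Type*} [TopologicalSpace Z] {z : Z → α → ℝ≥0}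
    (hz : ∀ a, Continuous fun x => z x a) (s : Finset α) :
    Continuous fun x => chainCoeff (z x) s := by
  classical
  unfold chainCoeff
  split_ifs with h
  · refine Continuous.sub ?_ ?_
    · exact Continuous.finset_inf'_apply h fun a _ => hz a
    · exact Continuous.finset_sup_apply fun a _ => hz a
  · exact continuous_const

variable {K : PreAbstractSimplicialComplex α} {E : Type*} [NormedAddCommGroup E]
  [NormedSpace ℝ E]

open Classical in
theorem sum_smul_sum (w : Finset α → ℝ≥0) (p : α → E) :
    ∑ s, (w s : ℝ) • ∑ a ∈ s, p a = ∑ a, ((∑ s with a ∈ s, w s : ℝ≥0) : ℝ) • p a := by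
  simp_rw [Finset.smul_sum, NNReal.coe_sum, Finset.sum_smul]
  exact Finset.sum_comm' (by simp)

open Classical in
/-- The barycentric subdivision of a fan. -/
noncomputable def sd (Φ : Fan K E) [Fintype K.faces] : Fan (orderComplex K.faces) E where
  p s := ∑ a ∈ s.1, Φ.p a
  G x s := chainCoeff (Φ.G x) s.1
  cont s := continuous_chainCoeff Φ.cont s.1
  supp x s hs h := ⟨hs, fun a ha b hb _ => chainCoeff_total (h a ha) (h b hb)⟩
  right_inv x := by
    conv_rhs => rw [← Φ.right_inv x]
    rw [Fintype.sum_of_injective (Subtype.val : K.faces → Finset α) Subtype.val_injective _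
      (fun s => (chainCoeff (Φ.G x) s : ℝ) • ∑ a ∈ s, Φ.p a) _ fun _ => rfl]
    · rw [sum_smul_sum]
      simp only [sum_chainCoeff]
    · intro s hs
      obtain rfl | hne := s.eq_empty_or_nonempty
      · simp
      have : chainCoeff (Φ.G x) s = 0 := by
        by_contra h
        exact hs ⟨⟨s, Φ.supp x s hne fun a ha => ne_zero_of_chainCoeff h ha⟩, rfl⟩
      simp [this]
  left_inv y hy := by
    let w : Finset α → ℝ≥0 := fun s => if h : s ∈ K.faces then y ⟨s, h⟩ else 0
    have hws : ∀ s : K.faces, w s.1 = y s := fun s => dif_pos s.2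
    have hwn : ∀ s, w s ≠ 0 → ∃ h : s ∈ K.faces, y ⟨s, h⟩ ≠ 0 := fun s h => by
      by_cases hs : s ∈ K.faces
      · exact ⟨hs, by rwa [← hws ⟨s, hs⟩]⟩
      · exact absurd (dif_neg hs) h
    have hw0 : w ∅ = 0 := by
      by_contra h
      exact Finset.not_nonempty_empty ((K.isRelLowerSet_faces (hwn _ h).1).1)
    have hw : ∀ s t, w s ≠ 0 → w t ≠ 0 → s ⊆ t ∨ t ⊆ s := fun s t hs ht => by
      obtain ⟨hs, hs'⟩ := hwn s hs
      obtain ⟨ht, ht'⟩ := hwn t ht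
      refine (hy {⟨s, hs⟩, ⟨t, ht⟩} (by simp) ?_).2.total (x := ⟨s, hs⟩) (y := ⟨t, ht⟩)
        (by simp) (by simp)
      intro a ha
      rw [Finset.mem_insert, Finset.mem_singleton] at ha
      rcases ha with rfl | rfl <;> assumption
    have h1 : ∑ s : K.faces, (y s : ℝ) • ∑ a ∈ s.1, Φ.p a =
        ∑ a, ((∑ s with a ∈ s, w s : ℝ≥0) : ℝ) • Φ.p a := by
      rw [← sum_smul_sum]
      refine Fintype.sum_of_injective (Subtype.val : K.faces → Finset α) Subtype.val_injective _ _
        (fun s hs => ?_) fun s => by rw [hws]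
      have : w s = 0 := by
        by_contra h
        exact hs ⟨⟨s, (hwn s h).1⟩, rfl⟩
      simp [this]
    have h2 : K.Supports fun a => ∑ s with a ∈ s, w s := fun t htn ht => by
      have hmem : ∀ a ∈ t, ∃ s, a ∈ s ∧ w s ≠ 0 := fun a ha => by
        obtain ⟨s, hs, h⟩ := Finset.exists_ne_zero_of_sum_ne_zero (ht a ha)
        exact ⟨s, (Finset.mem_filter.1 hs).2, h⟩
      obtain ⟨a, ha⟩ := htn
      obtain ⟨s₀, _, hs₀⟩ := hmem a ha
      -- The sets of non-zero weight form a chain of faces; the largest of them contains `t`.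
      obtain ⟨m, hm, hmax⟩ := Finset.exists_max_image (Finset.univ.filter fun s => w s ≠ 0)
        Finset.card ⟨s₀, by simpa using hs₀⟩
      rw [Finset.mem_filter] at hm
      refine (K.isRelLowerSet_faces (hwn m hm.2).1).2 (fun b hb => ?_) ⟨a, ha⟩
      obtain ⟨s, hbs, hs⟩ := hmem b hb
      rcases hw s m hs hm.2 with h | h
      · exact h hbs
      · rw [Finset.eq_of_subset_of_card_le h (hmax s (by simpa using hs))]
        exact hbs
    rw [h1, Φ.left_inv _ h2, chainCoeff_sum hw0 hw]
    exact funext hws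

end

end Fan

/-! Joins -/

/-- The join of a family of complexes. -/
def familyJoin {ι : Type*} {α : ι → Type*} (K : ∀ i, PreAbstractSimplicialComplex (α i)) :
    PreAbstractSimplicialComplex (Σ i, α i) where
  faces := {s | s.Nonempty ∧ ∀ i (t : Finset (α i)), t.Nonempty → (∀ a ∈ t, ⟨i, a⟩ ∈ s) →
    t ∈ (K i).faces}
  isRelLowerSet_faces := fun _ hs => ⟨hs.1, fun _ hts ht => ⟨ht, fun i u hu h =>
    hs.2 i u hu fun a ha => hts (h a ha)⟩⟩

namespace Fan

/-- The fan of a join lives in the product of the spaces. -/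
noncomputable def join {ι : Type*} [Fintype ι] {α : ι → Type*} [∀ i, Fintype (α i)]
    {K : ∀ i, PreAbstractSimplicialComplex (α i)} {E : ι → Type*} [∀ i, NormedAddCommGroup (E i)]
    [∀ i, NormedSpace ℝ (E i)] (Φ : ∀ i, Fan (K i) (E i)) : Fan (familyJoin K) (∀ i, E i) := by
  classical
  have key : ∀ (y : (Σ i, α i) → ℝ≥0) (j : ι),
      (∑ a, (y a : ℝ) • (Pi.single a.1 ((Φ a.1).p a.2) : ∀ i, E i)) j =
        ∑ b, (y ⟨j, b⟩ : ℝ) • (Φ j).p b := fun y j => by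
    rw [Fintype.sum_sigma, Finset.sum_apply, Fintype.sum_eq_single j]
    · simp
    · intro i hi
      rw [Finset.sum_apply]
      refine Finset.sum_eq_zero fun b _ => ?_
      simp [Pi.single_eq_of_ne hi.symm]
  refine
  { p := fun a => Pi.single a.1 ((Φ a.1).p a.2)
    G := fun x a => (Φ a.1).G (x a.1) a.2
    cont := fun a => ((Φ a.1).cont a.2).comp (continuous_apply a.1)
    supp := fun x s hs h => ⟨hs, fun i t ht hts => (Φ i).supp (x i) t ht fun a ha =>
      h ⟨i, a⟩ (hts a ha)⟩
    right_inv := fun x => funext fun j => (key _ j).trans ((Φ j).right_inv (x j))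
    left_inv := fun y hy => ?_ }
  funext ⟨j, b⟩
  change (Φ j).G _ b = _
  rw [key, (Φ j).left_inv (fun b => y ⟨j, b⟩)]
  intro t ht h
  refine (hy (t.map ⟨Sigma.mk j, sigma_mk_injective⟩) (ht.map) ?_).2 j t ht ?_
  · intro a ha
    obtain ⟨b, hb, rfl⟩ := Finset.mem_map.1 ha
    exact h b hb
  · exact fun a ha => Finset.mem_map_of_mem _ ha

/-- The fan of an ordinal sum. -/
noncomputable def lexSum {P Q E E' : Type*} [PartialOrder P] [PartialOrder Q] [Fintype P]
    [Fintype Q] [Fintype (P ⊕ₗ Q)] [NormedAddCommGroup E] [NormedSpace ℝ E]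
    [NormedAddCommGroup E'] [NormedSpace ℝ E']
    (Φ : Fan (orderComplex P) E) (Ψ : Fan (orderComplex Q) E') :
    Fan (orderComplex (P ⊕ₗ Q)) (E × E') := by
  have key : ∀ y : P ⊕ₗ Q → ℝ≥0,
      ∑ a, (y a : ℝ) • (Sum.elim (fun a => (Φ.p a, 0)) (fun b => (0, Ψ.p b)) (ofLex a) : E × E') =
        (∑ a, (y (Sum.inlₗ a) : ℝ) • Φ.p a, ∑ b, (y (Sum.inrₗ b) : ℝ) • Ψ.p b) := fun y => by
    refine (Fintype.sum_equiv ofLex _ (fun a => (y (toLex a) : ℝ) •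
      (Sum.elim (fun a => (Φ.p a, 0)) (fun b => (0, Ψ.p b)) a : E × E')) fun a => rfl).trans ?_
    rw [Fintype.sum_sum_type]
    refine Prod.ext ?_ ?_ <;> simp [Prod.fst_sum, Prod.snd_sum]
  refine
  { p := fun a => Sum.elim (fun a => (Φ.p a, 0)) (fun b => (0, Ψ.p b)) (ofLex a)
    G := fun x a => Sum.elim (Φ.G x.1) (Ψ.G x.2) (ofLex a)
    cont := fun a => ?_
    supp := fun x s hs h => ⟨hs, fun a ha b hb hab => ?_⟩
    right_inv := fun x => (key _).trans (Prod.ext (Φ.right_inv x.1) (Ψ.right_inv x.2))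
    left_inv := fun y hy => ?_ }
  · obtain ⟨a, rfl⟩ := toLex.surjective a
    cases a with
    | inl a => exact (Φ.cont a).comp continuous_fst
    | inr b => exact (Ψ.cont b).comp continuous_snd
  · classical
    have ha' := h a ha
    have hb' := h b hb
    obtain ⟨a, rfl⟩ := toLex.surjective a
    obtain ⟨b, rfl⟩ := toLex.surjective b
    rcases a with a | a <;> rcases b with b | b
    · simp only [Sum.Lex.inl_le_inl_iff]
      refine (Φ.supp x.1 {a, b} (by simp) ?_).2.total (by simp) (by simp)
      intro c hc
      rw [Finset.mem_insert, Finset.mem_singleton] at hc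
      rcases hc with rfl | rfl <;> assumption
    · exact Or.inl (Sum.Lex.inl_le_inr _ _)
    · exact Or.inr (Sum.Lex.inl_le_inr _ _)
    · simp only [Sum.Lex.inr_le_inr_iff]
      refine (Ψ.supp x.2 {a, b} (by simp) ?_).2.total (by simp) (by simp)
      intro c hc
      rw [Finset.mem_insert, Finset.mem_singleton] at hc
      rcases hc with rfl | rfl <;> assumption
  · classical
    have hmono : ∀ {a b : P ⊕ₗ Q}, y a ≠ 0 → y b ≠ 0 → a ≤ b ∨ b ≤ a := fun {a b} ha hb => by
      refine (hy {a, b} (by simp) ?_).2.total (by simp) (by simp)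
      intro c hc
      rw [Finset.mem_insert, Finset.mem_singleton] at hc
      rcases hc with rfl | rfl <;> assumption
    rw [key]
    funext a
    obtain ⟨a, rfl⟩ := toLex.surjective a
    rcases a with a | a
    · refine congrFun (Φ.left_inv (fun a => y (Sum.inlₗ a)) fun s hs h => ⟨hs, ?_⟩) a
      exact fun a ha b hb _ => (hmono (h a ha) (h b hb)).imp Sum.Lex.inl_le_inl_iff.1
        Sum.Lex.inl_le_inl_iff.1
    · refine congrFun (Ψ.left_inv (fun a => y (Sum.inrₗ a)) fun s hs h => ⟨hs, ?_⟩) a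
      exact fun a ha b hb _ => (hmono (h a ha) (h b hb)).imp Sum.Lex.inr_le_inr_iff.1
        Sum.Lex.inr_le_inr_iff.1

/-- A poset and its order dual have the same chains. -/
noncomputable def dual {P E : Type*} [PartialOrder P] [Fintype P] [Fintype Pᵒᵈ]
    [NormedAddCommGroup E] [NormedSpace ℝ E] (Φ : Fan (orderComplex P) E) :
    Fan (orderComplex Pᵒᵈ) E where
  p a := Φ.p (OrderDual.ofDual a)
  G x a := Φ.G x (OrderDual.ofDual a)
  cont a := Φ.cont _
  supp x s hs h := ⟨hs, fun a ha b hb hab =>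
    ((Φ.supp x (s.map OrderDual.ofDual.toEmbedding) hs.map fun a ha => by
      obtain ⟨b, hb, rfl⟩ := Finset.mem_map.1 ha
      exact h b hb).2.total (x := OrderDual.ofDual a) (y := OrderDual.ofDual b)
        (Finset.mem_map.2 ⟨a, ha, rfl⟩) (Finset.mem_map.2 ⟨b, hb, rfl⟩)).symm⟩
  right_inv x := (Fintype.sum_equiv OrderDual.ofDual _ _ fun a => rfl).trans (Φ.right_inv x)
  left_inv y hy := by
    funext a
    have h1 := Fintype.sum_equiv OrderDual.ofDual
      (fun a => (y a : ℝ) • Φ.p (OrderDual.ofDual a))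
      (fun a => (y (OrderDual.toDual a) : ℝ) • Φ.p a) fun a => rfl
    refine (congrFun (congrArg Φ.G h1) _).trans ?_
    refine congrFun (Φ.left_inv (fun a => y (OrderDual.toDual a)) fun s hs h => ⟨hs, ?_⟩)
      (OrderDual.ofDual a)
    exact fun a ha b hb hab => ((hy (s.map OrderDual.toDual.toEmbedding) hs.map fun a ha => by
      obtain ⟨b, hb, rfl⟩ := Finset.mem_map.1 ha
      exact h b hb).2.total (x := OrderDual.toDual a) (y := OrderDual.toDual b)
        (Finset.mem_map.2 ⟨a, ha, rfl⟩) (Finset.mem_map.2 ⟨b, hb, rfl⟩)).symm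

end Fan

/-- The boundary of the simplex with vertex set `κ`. -/
def simplexBoundary (κ : Type*) : PreAbstractSimplicialComplex κ where
  faces := {s | s.Nonempty ∧ ∃ a, a ∉ s}
  isRelLowerSet_faces := fun _ hs => ⟨hs.1, fun _ hts ht => ⟨ht, hs.2.imp fun _ ha h => ha (hts h)⟩⟩

namespace Fan

open Classical in
/-- The fan of the boundary of a simplex; the vertex `d` is placed at minus the sum of the
others. -/
noncomputable def boundary {κ : Type*} [Fintype κ] (d : κ) [Fintype {a // a ≠ d}] :
    Fan (simplexBoundary κ) ({a // a ≠ d} → ℝ) := by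
  have hne : (Finset.univ : Finset κ).Nonempty := ⟨d, Finset.mem_univ d⟩
  -- By `hsum` below, a point determines its weights up to a common constant: `e x` is the choice
  -- that vanishes at `d`. Subtracting the minimum `m x` gives the only non-negative choice with
  -- some weight zero, that is, supported in the boundary.
  let e : ({a // a ≠ d} → ℝ) → κ → ℝ := fun x a => if h : a ≠ d then x ⟨a, h⟩ else 0
  let m : ({a // a ≠ d} → ℝ) → ℝ := fun x => Finset.univ.inf' hne (e x)
  have hm : ∀ x a, m x ≤ e x a := fun x a => Finset.inf'_le _ (Finset.mem_univ a)
  let p : κ → {a // a ≠ d} → ℝ := fun a b => if a = d then -1 else if a = b then 1 else 0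
  have hsum : ∀ (y : κ → ℝ) (b : {a // a ≠ d}), (∑ a, y a • p a) b = y b - y d := fun y b => by
    rw [Finset.sum_apply, ← Finset.add_sum_erase _ _ (Finset.mem_univ d),
      Finset.sum_eq_single_of_mem b.1 (by simp [b.2])]
    · simp [p, b.2]
      ring
    · intro c hc hcb
      have := Finset.ne_of_mem_erase hc
      simp [p, this, hcb]
  have hec : ∀ a, Continuous fun x => e x a := fun a => by
    by_cases h : a ≠ d
    · simp only [e, dif_pos h]
      exact continuous_apply _
    · simp only [e, dif_neg h]
      exact continuous_const
  refine
  { p := p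
    G := fun x a => ⟨e x a - m x, sub_nonneg.2 (hm x a)⟩
    cont := fun a => ((hec a).sub
      (Continuous.finset_inf'_apply hne fun a _ => hec a)).subtype_mk _
    supp := fun x s hs h => ⟨hs, ?_⟩
    right_inv := fun x => ?_
    left_inv := fun y hy => ?_ }
  · obtain ⟨a, _, ha⟩ := Finset.exists_mem_eq_inf' hne (e x)
    exact ⟨a, fun has => h a has (Subtype.ext (sub_eq_zero.2 ha.symm))⟩
  · funext b
    refine (hsum (fun a => e x a - m x) b).trans ?_
    simp [e, b.2]
  · have he : ∀ a, e (∑ a, (y a : ℝ) • p a) a = y a - y d := fun a => by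
      by_cases h : a ≠ d
      · simp only [e, dif_pos h]
        exact hsum (fun a => (y a : ℝ)) ⟨a, h⟩
      · rw [not_not] at h
        subst h
        simp [e]
    have hz : ∃ a, y a = 0 := by
      by_contra! h
      obtain ⟨a, ha⟩ := (hy Finset.univ hne fun a _ => h a).2
      exact ha (Finset.mem_univ a)
    have hmin : m (∑ a, (y a : ℝ) • p a) = - y d := by
      obtain ⟨a, ha⟩ := hz
      refine le_antisymm ?_ ((Finset.le_inf'_iff _ _).2 fun a _ => ?_)
      · refine (hm _ a).trans ?_
        rw [he, ha]
        simp
      · rw [he]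
        have := (y a).2
        linarith [NNReal.coe_nonneg (y a)]
    funext a
    refine Subtype.ext ?_
    change e _ a - m _ = y a
    rw [he, hmin]
    ring

end Fan

end Fan


/-! ### Chains modulo two -/

namespace BasedGraph

variable {G : BasedGraph}

noncomputable instance fintypeV (G : BasedGraph) : Fintype G.V := Fintype.ofFinite _
noncomputable instance fintypeE (G : BasedGraph) : Fintype G.E := Fintype.ofFinite _

open Classical in
/-- The basis vector of a vertex. -/
noncomputable def pt (G : BasedGraph) (v : G.V) : G.V → ZMod 2 := Pi.single v 1

open Classical in
/-- The boundary of a chain with coefficients modulo two. -/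
noncomputable def bdry (G : BasedGraph) : (G.E → ZMod 2) →ₗ[ZMod 2] (G.V → ZMod 2) :=
  Fintype.linearCombination (ZMod 2) fun e => G.pt (G.src e) + G.pt (G.tgt e)

theorem bdry_apply (x : G.E → ZMod 2) :
    G.bdry x = ∑ e, x e • (G.pt (G.src e) + G.pt (G.tgt e)) := rfl

open Classical in
/-- The chain of a set of edges. -/
noncomputable def chain (G : BasedGraph) (A : Set G.E) : G.E → ZMod 2 := fun e =>
  if e ∈ A then 1 else 0

theorem chain_of_mem {A : Set G.E} {e : G.E} (h : e ∈ A) : G.chain A e = 1 := if_pos h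

theorem chain_of_notMem {A : Set G.E} {e : G.E} (h : e ∉ A) : G.chain A e = 0 := if_neg h

theorem chain_ne_zero {A : Set G.E} {e : G.E} : G.chain A e ≠ 0 ↔ e ∈ A := by
  by_cases h : e ∈ A
  · simp [chain_of_mem h, h]
  · simp [chain_of_notMem h, h]

theorem zmod_two_eq_one {a : ZMod 2} (h : a ≠ 0) : a = 1 := by
  revert a; decide

theorem add_self_fun {ι : Type*} (x : ι → ZMod 2) : x + x = 0 := funext fun _ => CharTwo.add_self_eq_zero _

theorem bdry_single [DecidableEq G.E] (e : G.E) :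
    G.bdry (Pi.single e 1) = G.pt (G.src e) + G.pt (G.tgt e) := by
  rw [bdry, Fintype.linearCombination_apply_single, one_smul]

/-- Connectivity becomes solvability of a linear equation. Paths give chains; conversely, the sum of
coefficients over the component of `u` vanishes on boundaries of chains in `A`, but equals one on
`pt u + pt v` if `v` is outside that component. -/
theorem joinedIn_iff {A : Set G.E} {u v : G.V} : G.joinedIn A u v ↔
    ∃ x : G.E → ZMod 2, (∀ e, x e ≠ 0 → e ∈ A) ∧ G.bdry x = G.pt u + G.pt v := by
  classical
  constructor
  · intro h
    induction h with
    | rel a b h =>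
      obtain ⟨e, he, rfl, rfl⟩ := h
      refine ⟨Pi.single e 1, fun e' he' => ?_, bdry_single e⟩
      by_cases h : e' = e
      · exact h ▸ he
      · exact absurd (Pi.single_eq_of_ne h _) he'
    | refl a => exact ⟨0, fun e he => absurd rfl he, by rw [map_zero, add_self_fun]⟩
    | symm a b _ ih => rw [add_comm]; exact ih
    | trans a b c _ _ ih ih' =>
      obtain ⟨x, hx, hx'⟩ := ih
      obtain ⟨y, hy, hy'⟩ := ih'
      refine ⟨x + y, fun e he => ?_, ?_⟩
      · by_cases h : x e = 0
        · exact hy e fun h' => he (by simp [h, h'])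
        · exact hx e h
      · rw [map_add, hx', hy', show G.pt a + G.pt b + (G.pt b + G.pt c) =
          G.pt a + G.pt c + (G.pt b + G.pt b) by abel, add_self_fun, add_zero]
  · rintro ⟨x, hx, hb⟩
    by_contra hn
    let φ : (G.V → ZMod 2) →ₗ[ZMod 2] ZMod 2 :=
      ∑ w with G.joinedIn A u w, LinearMap.proj w
    have hφ : ∀ w, φ (G.pt w) = if G.joinedIn A u w then 1 else 0 := fun w => by
      simp only [φ, LinearMap.sum_apply, LinearMap.proj_apply, pt]
      simp [Pi.single_apply]
    have h0 : φ (G.bdry x) = 0 := by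
      rw [bdry_apply, map_sum]
      refine Finset.sum_eq_zero fun e _ => ?_
      by_cases h : x e = 0
      · simp [h]
      · have hst : G.joinedIn A (G.src e) (G.tgt e) := .rel _ _ ⟨e, hx e h, rfl, rfl⟩
        have : G.joinedIn A u (G.src e) ↔ G.joinedIn A u (G.tgt e) :=
          ⟨fun h => h.trans _ _ _ hst, fun h => h.trans _ _ _ (hst.symm _ _)⟩
        rw [map_smul, map_add, hφ, hφ]
        simp only [this, CharTwo.add_self_eq_zero, smul_zero]
    rw [hb, map_add, hφ, hφ, if_pos (Setoid.refl' _ u), if_neg hn, add_zero] at h0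
    exact one_ne_zero h0

theorem joinedIn_mono {A B : Set G.E} (h : A ⊆ B) {u v : G.V} (hj : G.joinedIn A u v) :
    G.joinedIn B u v := by
  obtain ⟨x, hx, hb⟩ := joinedIn_iff.1 hj
  exact joinedIn_iff.2 ⟨x, fun e he => h (hx e he), hb⟩

theorem joinedIn_edge {A : Set G.E} {e : G.E} (h : e ∈ A) : G.joinedIn A (G.src e) (G.tgt e) :=
  .rel _ _ ⟨e, h, rfl, rfl⟩

/-- A closed chain joins the ends of each of its edges without that edge. -/
theorem joinedIn_diff {x : G.E → ZMod 2} (hx : G.bdry x = 0) {e : G.E} (he : x e ≠ 0) :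
    G.joinedIn ({e | x e ≠ 0} \ {e}) (G.tgt e) (G.src e) := by
  classical
  refine joinedIn_iff.2 ⟨x + Pi.single e 1, fun e' he' => ?_, ?_⟩
  · by_cases h : e' = e
    · subst h
      exact absurd (by simp [zmod_two_eq_one he, CharTwo.add_self_eq_zero]) he'
    · exact ⟨by simpa [Pi.single_eq_of_ne h] using he', h⟩
  · rw [map_add, hx, bdry_single, zero_add, add_comm]

/-- There is an edge path with `m` steps from `u` to `w` in `A`. -/
def HasPath (G : BasedGraph) (A : Set G.E) (u w : G.V) (m : ℕ) : Prop :=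
  ∃ (v : ℕ → G.V) (e : ℕ → G.E), v 0 = u ∧ v m = w ∧ ∀ i < m, e i ∈ A ∧
    ((G.src (e i) = v i ∧ G.tgt (e i) = v (i + 1)) ∨
      (G.src (e i) = v (i + 1) ∧ G.tgt (e i) = v i))

theorem HasPath.extend {A : Set G.E} {u w z : G.V} {m : ℕ} (h : G.HasPath A u w m) {e : G.E}
    (he : e ∈ A) (hwz : (G.src e = w ∧ G.tgt e = z) ∨ (G.src e = z ∧ G.tgt e = w)) :
    G.HasPath A u z (m + 1) := by
  obtain ⟨v, f, h0, hm, hs⟩ := h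
  refine ⟨fun i => if i ≤ m then v i else z, fun i => if i < m then f i else e, by simpa, by simp,
    fun i hi => ?_⟩
  rcases (Nat.lt_succ_iff.1 hi).lt_or_eq with h | rfl
  · have h1 : i ≤ m := h.le
    have h2 : i + 1 ≤ m := h
    simpa [h, h1, h2] using hs i h
  · simpa [he, hm] using hwz

theorem exists_hasPath (e₀ : G.E) {A : Set G.E} {u w : G.V} (h : G.joinedIn A u w) :
    ∃ m, G.HasPath A u w m := by
  -- In this form the claim is an equivalence, so the symmetric and transitive cases of the
  -- induction are immediate. The edge `e₀` only fills the unused entries of the empty path.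
  suffices ∀ z, (∃ m, G.HasPath A z u m) ↔ ∃ m, G.HasPath A z w m from
    (this u).1 ⟨0, fun _ => u, fun _ => e₀, rfl, rfl, fun i hi => absurd hi (by simp)⟩
  induction h with
  | rel a b h =>
    obtain ⟨e, he, rfl, rfl⟩ := h
    exact fun z => ⟨fun ⟨m, h⟩ => ⟨m + 1, h.extend he (Or.inl ⟨rfl, rfl⟩)⟩,
      fun ⟨m, h⟩ => ⟨m + 1, h.extend he (Or.inr ⟨rfl, rfl⟩)⟩⟩
  | refl a => exact fun z => Iff.rfl
  | symm a b _ ih => exact fun z => (ih z).symm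
  | trans a b c _ _ ih ih' => exact fun z => (ih z).trans (ih' z)

/-- An edge whose ends are joined without it lies on a cycle. -/
theorem exists_isCycle_of_joinedIn {A : Set G.E} {e : G.E} (he : e ∉ A)
    (h : G.joinedIn A (G.tgt e) (G.src e)) : ∃ C, G.IsCycle C ∧ C ⊆ insert e A := by
  classical
  have hex := exists_hasPath e h
  obtain ⟨v, f, h0, hm, hs⟩ := Nat.find_spec hex
  set m := Nat.find hex with hmdef
  have hmin : ∀ k < m, ¬ G.HasPath A (G.tgt e) (G.src e) k := fun k hk => Nat.find_min hex hk
  -- A repeated vertex would allow the part of the path in between to be cut out, against minimal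
  -- length.
  have hv : ∀ i j, i < j → j ≤ m → v i ≠ v j := by
    intro i j hij hjm hvij
    refine hmin (m - (j - i)) (by omega) ⟨fun k => if k ≤ i then v k else v (k + (j - i)),
      fun k => if k < i then f k else f (k + (j - i)), by simpa using h0, ?_, fun k hk => ?_⟩
    · by_cases h : m - (j - i) ≤ i
      · have : j = m := by omega
        subst this
        simp only [h, if_true]
        rw [show m - (m - i) = i by omega, hvij, hm]
      · simp only [h, if_false]
        rw [show m - (j - i) + (j - i) = m by omega, hm]
    · rcases lt_trichotomy k i with h | rfl | h
      · have h1 : k ≤ i := h.le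
        have h2 : k + 1 ≤ i := h
        simpa [h, h1, h2] using hs k (by omega)
      · have := hs j (by omega)
        simp only [lt_irrefl, if_false, le_refl, if_true, hvij]
        rw [if_neg (by omega), show k + (j - k) = j by omega,
          show k + 1 + (j - k) = j + 1 by omega]
        exact this
      · have h1 : ¬ k ≤ i := by omega
        have h2 : ¬ k + 1 ≤ i := by omega
        have h3 : ¬ k < i := by omega
        simp only [h1, h2, h3, if_false]
        rw [show k + 1 + (j - i) = k + (j - i) + 1 by omega]
        exact hs _ (by omega)
  have hv' : ∀ i j, i ≤ m → j ≤ m → v i = v j → i = j := fun i j hi hj h => by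
    rcases lt_trichotomy i j with h' | h' | h'
    · exact absurd h (hv i j h' hj)
    · exact h'
    · exact absurd h.symm (hv j i h' hi)
  -- The shortest path of `m` edges from the target of `e` to its source, closed up by `e` as the
  -- last edge.
  let e' : Fin (m + 1) → G.E := fun i => if i.1 < m then f i else e
  have hlast : ∀ i : Fin (m + 1), ¬ i.1 < m → i = Fin.last m := fun i h =>
    Fin.ext (by have := i.2; simp only [Fin.val_last]; omega)
  have he'e : ∀ i : Fin (m + 1), i.1 < m → e' i ≠ e := fun i hi h => by
    simp only [e', hi, if_true] at h
    exact he (h ▸ (hs i hi).1)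
  refine ⟨Set.range e', ⟨m, fun i => v i, e', fun i j h => Fin.ext (hv' _ _ (by omega) (by omega) h),
    fun i j h => ?_, rfl, fun i => ?_⟩, ?_⟩
  · by_cases hi : i.1 < m <;> by_cases hj : j.1 < m
    · simp only [e', hi, hj, if_true] at h
      have h1 := (hs i hi).2
      have h2 := (hs j hj).2
      rw [h] at h1
      refine Fin.ext ?_
      rcases h1 with ⟨a, b⟩ | ⟨a, b⟩ <;> rcases h2 with ⟨c, d⟩ | ⟨c, d⟩
      · exact hv' _ _ hi.le hj.le (a.symm.trans c)
      · have := hv' _ _ hi.le hj (a.symm.trans c)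
        have := hv' _ _ hi hj.le (b.symm.trans d)
        omega
      · have := hv' _ _ hi hj.le (a.symm.trans c)
        have := hv' _ _ hi.le hj (b.symm.trans d)
        omega
      · exact hv' _ _ hi.le hj.le (b.symm.trans d)
    · refine absurd ?_ (he'e i hi)
      rw [h]
      simp [e', hj]
    · refine absurd ?_ (he'e j hj)
      rw [← h]
      simp [e', hi]
    · rw [hlast i hi, hlast j hj]
  · by_cases hi : i.1 < m
    · have h1 : ((i + 1 : Fin (m + 1)) : ℕ) = i.1 + 1 := by
        rw [Fin.val_add_one, if_neg]
        rintro rfl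
        simp at hi
      simp only [e', hi, if_true, h1]
      exact (hs i hi).2
    · obtain rfl := hlast i hi
      simp only [e', Fin.last_add_one, Fin.val_last, Fin.val_zero, h0, hm, lt_irrefl, if_false]
      exact Or.inl ⟨trivial, trivial⟩
  · rintro _ ⟨i, rfl⟩
    by_cases hi : i.1 < m
    · simp only [e', hi, if_true]
      exact Or.inr (hs i hi).1
    · simp [e', hi]

/-- An edge of the support has its ends joined by the rest of the support, so it closes up to a
cycle there. -/
theorem exists_isCycle_of_bdry {x : G.E → ZMod 2} (hx : G.bdry x = 0) (h0 : x ≠ 0) :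
    ∃ C, G.IsCycle C ∧ ∀ e ∈ C, x e ≠ 0 := by
  obtain ⟨e, he⟩ := Function.ne_iff.1 h0
  obtain ⟨C, hC, hCA⟩ := exists_isCycle_of_joinedIn (by simp) (joinedIn_diff hx he)
  refine ⟨C, hC, fun e' he' => ?_⟩
  rcases hCA he' with rfl | h
  exacts [he, h.1]

theorem bdry_eq_sum_cycle {m : ℕ} {v : Fin (m + 1) → G.V} {e : Fin (m + 1) → G.E}
    (he : Function.Injective e)
    (hve : ∀ i, (G.src (e i) = v i ∧ G.tgt (e i) = v (i + 1)) ∨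
      (G.src (e i) = v (i + 1) ∧ G.tgt (e i) = v i))
    {x : G.E → ZMod 2} (hx : ∀ a, x a ≠ 0 → a ∈ Set.range e) :
    G.bdry x = ∑ i, x (e i) • (G.pt (v i) + G.pt (v (i + 1))) := by
  rw [bdry_apply]
  refine (Fintype.sum_of_injective e he _ _ (fun a ha => ?_) fun i => ?_).symm
  · rw [not_imp_comm.1 (hx a) ha, zero_smul]
  · rcases hve i with ⟨h1, h2⟩ | ⟨h1, h2⟩
    · rw [h1, h2]
    · rw [h1, h2, add_comm (G.pt (v i))]

namespace IsCycle

variable {C : Set G.E}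

theorem bdry_chain (h : G.IsCycle C) : G.bdry (G.chain C) = 0 := by
  obtain ⟨m, v, e, hv, he, rfl, hve⟩ := h
  rw [bdry_eq_sum_cycle he hve fun a ha => chain_ne_zero.1 ha]
  have h1 : ∀ i, G.chain (Set.range e) (e i) = 1 := fun i => chain_of_mem ⟨i, rfl⟩
  simp only [h1, one_smul, Finset.sum_add_distrib]
  rw [show ∑ i, G.pt (v (i + 1)) = ∑ i, G.pt (v i) from
    Equiv.sum_comp (Equiv.addRight (1 : Fin (m + 1))) fun i => G.pt (v i), add_self_fun]

theorem nonempty (h : G.IsCycle C) : C.Nonempty := by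
  obtain ⟨m, v, e, hv, he, rfl, hve⟩ := h
  exact ⟨_, 0, rfl⟩

/-- Minimality of cycles: the coefficient of the boundary at a vertex of the circle is the sum of
the coefficients of the two consecutive edges there, so a closed chain on the circle is constant. -/
theorem eq_chain_of_bdry (h : G.IsCycle C) {x : G.E → ZMod 2} (hx : G.bdry x = 0)
    (hxC : ∀ e, x e ≠ 0 → e ∈ C) (h0 : x ≠ 0) : x = G.chain C := by
  classical
  obtain ⟨m, v, e, hv, he, rfl, hve⟩ := h
  rw [bdry_eq_sum_cycle he hve hxC] at hx
  have h1 : ∀ j, x (e j) = x (e (j + 1)) := fun j => by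
    have := congrFun hx (v (j + 1))
    rw [Finset.sum_apply] at this
    simp only [Pi.smul_apply, Pi.add_apply, pt, Pi.single_apply, hv.eq_iff, smul_eq_mul, mul_add,
      Finset.sum_add_distrib, mul_ite, mul_one, mul_zero, Finset.sum_ite_eq, Finset.mem_univ,
      add_left_inj, Pi.zero_apply, if_true] at this
    exact (CharTwo.add_eq_zero.1 this).symm
  have h2 : ∀ j, x (e j) = x (e 0) := fun j => by
    induction j using Fin.induction with
    | zero => rfl
    | succ i ih =>
      rw [← ih, h1 i.castSucc]
      simp
  funext a
  by_cases ha : a ∈ Set.range e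
  · obtain ⟨j, rfl⟩ := ha
    rw [chain_of_mem (Set.mem_range_self j)]
    refine zmod_two_eq_one fun h => h0 (funext fun b => ?_)
    by_contra hb
    obtain ⟨i, rfl⟩ := hxC b hb
    exact hb ((h2 i).trans ((h2 j).symm.trans h))
  · rw [chain_of_notMem ha]
    exact not_imp_comm.1 (hxC a) ha

theorem joinedIn (h : G.IsCycle C) {u w : G.V} (hu : u ∈ G.verts C) (hw : w ∈ G.verts C) :
    G.joinedIn C u w := by
  obtain ⟨m, v, e, hv, he, rfl, hve⟩ := h
  have h1 : ∀ i, G.joinedIn (Set.range e) (v i) (v (i + 1)) := fun i => by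
    have := joinedIn_edge (G := G) (A := Set.range e) ⟨i, rfl⟩
    rcases hve i with ⟨h1, h2⟩ | ⟨h1, h2⟩
    · rwa [h1, h2] at this
    · rw [h1, h2] at this
      exact Setoid.symm' _ this
  have h2 : ∀ i, G.joinedIn (Set.range e) (v 0) (v i) := fun i => by
    induction i using Fin.induction with
    | zero => exact Setoid.refl' _ _
    | succ i ih =>
      have := h1 i.castSucc
      rw [Fin.coeSucc_eq_succ] at this
      exact Setoid.trans' _ ih this
  have h3 : ∀ z ∈ G.verts (Set.range e), G.joinedIn (Set.range e) (v 0) z := by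
    rintro z ⟨_, ⟨i, rfl⟩, h⟩
    rcases hve i with ⟨h1, h2'⟩ | ⟨h1, h2'⟩ <;> rcases h with rfl | rfl
    · exact h1 ▸ h2 _
    · exact h2' ▸ h2 _
    · exact h1 ▸ h2 _
    · exact h2' ▸ h2 _
  exact Setoid.trans' _ (Setoid.symm' _ (h3 u hu)) (h3 w hw)

/-- A cycle has at most two half-edges at a vertex. -/
theorem degree_le (h : G.IsCycle C) (w : G.V) :
    {e | e ∈ C ∧ G.src e = w}.ncard + {e | e ∈ C ∧ G.tgt e = w}.ncard ≤ 2 := by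
  classical
  obtain ⟨m, v, e, hv, he, rfl, hve⟩ := h
  have key : ∀ f : G.E → G.V, {a | a ∈ Set.range e ∧ f a = w}.ncard =
      ∑ i, if f (e i) = w then 1 else 0 := fun f => by
    have : {a | a ∈ Set.range e ∧ f a = w} = e '' {i | f (e i) = w} := by
      ext a
      constructor
      · rintro ⟨⟨i, rfl⟩, h⟩
        exact ⟨i, h, rfl⟩
      · rintro ⟨i, h, rfl⟩
        exact ⟨⟨i, rfl⟩, h⟩
    rw [this, Set.ncard_image_of_injective _ he, Set.ncard_eq_toFinset_card']
    simp
  rw [key, key, ← Finset.sum_add_distrib]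
  have h1 : ∀ i, ((if G.src (e i) = w then 1 else 0) + if G.tgt (e i) = w then 1 else 0) =
      (if v i = w then 1 else 0) + if v (i + 1) = w then 1 else 0 := fun i => by
    rcases hve i with ⟨h1, h2⟩ | ⟨h1, h2⟩
    · rw [h1, h2]
    · rw [h1, h2, add_comm]
  rw [Finset.sum_congr rfl fun i _ => h1 i, Finset.sum_add_distrib,
    show (∑ i, if v (i + 1) = w then 1 else 0) = ∑ i, if v i = w then 1 else 0 from
    Equiv.sum_comp (Equiv.addRight (1 : Fin (m + 1))) fun i => if v i = w then 1 else 0]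
  have h2 : (∑ i, if v i = w then 1 else 0) ≤ 1 := by
    rw [← Finset.card_filter, Finset.card_le_one]
    intro i hi j hj
    exact hv ((Finset.mem_filter.1 hi).2.trans (Finset.mem_filter.1 hj).2.symm)
  omega

end IsCycle

/-- Acyclicity as injectivity of the boundary on chains in `F`: a non-zero closed chain contains a
cycle, and a cycle is a closed chain. -/
theorem isForest_iff {F : Set G.E} : G.IsForest F ↔
    ∀ x : G.E → ZMod 2, G.bdry x = 0 → (∀ e, x e ≠ 0 → e ∈ F) → x = 0 := by
  constructor
  · intro h x hx hxF
    by_contra h0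
    obtain ⟨C, hC, hCx⟩ := exists_isCycle_of_bdry hx h0
    exact h C hC fun e he => hxF e (hCx e he)
  · intro h C hC hCF
    obtain ⟨e, he⟩ := hC.nonempty
    exact chain_ne_zero.2 he (congrFun (h _ hC.bdry_chain fun e he => hCF (chain_ne_zero.1 he)) e)

theorem IsForest.mono {F F' : Set G.E} (h : G.IsForest F) (hF : F' ⊆ F) : G.IsForest F' :=
  fun C hC hCF => h C hC (hCF.trans hF)

/-! ### Cactus graphs -/

/-- The cycle of a cactus graph that contains an edge. -/
noncomputable def IsCactus.cyc (hG : G.IsCactus) (e : G.E) : Set G.E := (hG e).choose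

namespace IsCactus

theorem isCycle_cyc (hG : G.IsCactus) (e : G.E) : G.IsCycle (hG.cyc e) := (hG e).choose_spec.1.1

theorem mem_cyc (hG : G.IsCactus) (e : G.E) : e ∈ hG.cyc e := (hG e).choose_spec.1.2

theorem eq_cyc (hG : G.IsCactus) {C : Set G.E} (hC : G.IsCycle C) {e : G.E} (he : e ∈ C) : C = hG.cyc e :=
  (hG e).choose_spec.2 C ⟨hC, he⟩

theorem cyc_eq_of_mem (hG : G.IsCactus) {e e' : G.E} (h : e' ∈ hG.cyc e) : hG.cyc e = hG.cyc e' :=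
  hG.eq_cyc (hG.isCycle_cyc e) h

theorem cycle_eq (hG : G.IsCactus) {C D : Set G.E} (hC : G.IsCycle C) (hD : G.IsCycle D) {e : G.E} (h : e ∈ C)
    (h' : e ∈ D) : C = D :=
  (hG.eq_cyc hC h).trans (hG.eq_cyc hD h').symm

/-- Closed chains of a cactus graph are sums of cycles. -/
theorem closed_const (hG : G.IsCactus) {x : G.E → ZMod 2} (hx : G.bdry x = 0) {C : Set G.E} (hC : G.IsCycle C)
    {e e' : G.E} (he : e ∈ C) (he' : e' ∈ C) : x e = x e' := by
  classical
  induction hn : (Finset.univ.filter fun a => x a ≠ 0).card using Nat.strong_induction_on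
    generalizing x with
  | _ n ih =>
    by_cases h0 : x = 0
    · simp [h0]
    obtain ⟨D, hD, hDx⟩ := exists_isCycle_of_bdry hx h0
    have h1 : G.chain D e = G.chain D e' := by
      by_cases h : e ∈ D
      · rw [chain_of_mem h, chain_of_mem (hG.cycle_eq hC hD he h ▸ he')]
      · rw [chain_of_notMem h, chain_of_notMem fun h' => h (hG.cycle_eq hC hD he' h' ▸ he)]
    -- Adding the cycle `D` removes it from the support of `x`; it changes the coefficients of `e`
    -- and `e'` equally, as `D` contains both or neither.
    have h2 := ih _ ?_ (x := x + G.chain D) (by rw [map_add, hx, hD.bdry_chain, add_zero]) rfl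
    · rw [Pi.add_apply, Pi.add_apply, h1] at h2
      exact add_right_cancel h2
    · rw [← hn]
      refine Finset.card_lt_card ⟨fun a ha => ?_, fun h => ?_⟩
      · simp only [Finset.mem_filter, Finset.mem_univ, true_and] at ha ⊢
        by_cases h : a ∈ D
        · exact hDx a h
        · simpa [chain_of_notMem h] using ha
      · obtain ⟨a, ha⟩ := hD.nonempty
        have := h (show a ∈ _ by simpa using hDx a ha)
        simp [chain_of_mem ha, zmod_two_eq_one (hDx a ha), CharTwo.add_self_eq_zero] at this

end IsCactus

/-- A criterion for cactus graphs: the edges are partitioned into closed sets of which all closed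
sets are unions. -/
theorem isCactus_of_partition {I : Type*} (κ : G.E → I)
    (h1 : ∀ e, G.bdry (G.chain {e' | κ e' = κ e}) = 0)
    (h2 : ∀ x, G.bdry x = 0 → ∀ e e', κ e = κ e' → x e = x e') :
    G.IsCactus ∧ ∀ e, G.IsCycle {e' | κ e' = κ e} := by
  -- As a closed chain, a cycle is a union of blocks by `h2`; each block is closed by `h1`, and a
  -- cycle contains no smaller non-zero closed chain.
  have h3 : ∀ C, G.IsCycle C → ∀ e ∈ C, C = {e' | κ e' = κ e} := fun C hC e he => by
    have h4 : {e' | κ e' = κ e} ⊆ C := fun e' he' => by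
      rw [← chain_ne_zero, h2 _ hC.bdry_chain e' e he']
      exact chain_ne_zero.2 he
    have := hC.eq_chain_of_bdry (h1 e) (fun e' he' => h4 (chain_ne_zero.1 he'))
      fun h0 => chain_ne_zero.2 (show e ∈ {e' | κ e' = κ e} from rfl) (congrFun h0 e)
    ext e'
    rw [← chain_ne_zero, ← this, chain_ne_zero]
  have h4 : ∀ e, G.IsCycle {e' | κ e' = κ e} := fun e => by
    obtain ⟨C, hC, hCx⟩ := exists_isCycle_of_bdry (h1 e)
      fun h0 => chain_ne_zero.2 (show e ∈ {e' | κ e' = κ e} from rfl) (congrFun h0 e)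
    obtain ⟨a, ha⟩ := hC.nonempty
    have : κ a = κ e := chain_ne_zero.1 (hCx a ha)
    rw [← this, ← h3 C hC a ha]
    exact hC
  exact ⟨fun e => ⟨_, ⟨h4 e, rfl⟩, fun C hC => h3 C hC.1 e hC.2⟩, h4⟩

theorem natCast_ncard (A : Set G.E) (f : G.E → G.V) (w : G.V) :
    (({e | e ∈ A ∧ f e = w}.ncard : ℕ) : ZMod 2) = ∑ e, G.chain A e * G.pt (f e) w := by
  classical
  rw [Set.ncard_eq_toFinset_card', show {e | e ∈ A ∧ f e = w}.toFinset =
    Finset.univ.filter fun e => e ∈ A ∧ f e = w by ext; simp, Finset.natCast_card_filter]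
  refine Finset.sum_congr rfl fun e _ => ?_
  by_cases h : e ∈ A <;> by_cases h' : f e = w <;>
    simp [chain, pt, h, h']

/-- The boundary at `w` is the number of half-edges of `A` at `w` modulo two, so this number is
even; it is positive because `w` lies on `A`. -/
theorem two_le_degree {A : Set G.E} (hA : G.bdry (G.chain A) = 0) {w : G.V} (hw : w ∈ G.verts A) :
    2 ≤ {e | e ∈ A ∧ G.src e = w}.ncard + {e | e ∈ A ∧ G.tgt e = w}.ncard := by
  have h1 : (({e | e ∈ A ∧ G.src e = w}.ncard + {e | e ∈ A ∧ G.tgt e = w}.ncard : ℕ) : ZMod 2)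
      = 0 := by
    rw [Nat.cast_add, natCast_ncard, natCast_ncard, ← Finset.sum_add_distrib, 
      ← show G.bdry (G.chain A) w = 0 from congrFun hA w, bdry_apply, Finset.sum_apply]
    exact Finset.sum_congr rfl fun e _ => (mul_add _ _ _).symm
  have h2 : 1 ≤ {e | e ∈ A ∧ G.src e = w}.ncard + {e | e ∈ A ∧ G.tgt e = w}.ncard := by
    obtain ⟨e, he, h | h⟩ := hw
    · exact le_add_right ((Set.ncard_pos (Set.toFinite _)).2 ⟨e, he, h⟩)
    · exact le_add_left ((Set.ncard_pos (Set.toFinite _)).2 ⟨e, he, h⟩)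
  rw [ZMod.natCast_eq_zero_iff] at h1
  omega

theorem degree_le_valence {A B : Set G.E} (hAB : Disjoint A B) (w : G.V) :
    {e | e ∈ A ∧ G.src e = w}.ncard + {e | e ∈ A ∧ G.tgt e = w}.ncard +
    ({e | e ∈ B ∧ G.src e = w}.ncard + {e | e ∈ B ∧ G.tgt e = w}.ncard) ≤ G.valence w := by
  have key : ∀ f : G.E → G.V, {e | e ∈ A ∧ f e = w}.ncard + {e | e ∈ B ∧ f e = w}.ncard ≤
      {e | f e = w}.ncard := fun f => by
    rw [← Set.ncard_union_eq]
    · exact Set.ncard_le_ncard (Set.union_subset (fun e h => h.2) fun e h => h.2)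
    · exact Set.disjoint_left.2 fun e h h' => Set.disjoint_left.1 hAB h.1 h'.1
  have h1 := key G.src
  have h2 := key G.tgt
  rw [valence]
  omega

/-- Every non-base vertex lies on two cycles, and the base vertex on one. -/
def HasTwoCycles (G : BasedGraph) : Prop :=
  (∃ C, G.IsCycle C ∧ G.base ∈ G.verts C) ∧ ∀ v, v ≠ G.base →
    ∃ C D, G.IsCycle C ∧ G.IsCycle D ∧ C ≠ D ∧ v ∈ G.verts C ∧ v ∈ G.verts D

/-- An edge on a cycle does not separate. Distinct cycles are edge-disjoint and each contributes two
half-edges, so two cycles at a vertex give valence at least four. -/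
theorem IsCactus.isReduced (hG : G.IsCactus) (hconn : ∀ u v, G.joinedIn Set.univ u v)
    (h : G.HasTwoCycles) : G.IsReduced := by
  refine ⟨hconn, fun e u v => ?_, ?_, fun v hv => ?_⟩
  · have key : ∀ u v, G.joinedIn Set.univ u v → G.joinedIn {e}ᶜ u v := fun u v h => by
      induction h with
      | rel a b h =>
        obtain ⟨e', _, rfl, rfl⟩ := h
        by_cases he : e' = e
        · subst he
          refine Setoid.symm' _ (joinedIn_mono ?_ (joinedIn_diff (hG.isCycle_cyc e').bdry_chain
            (chain_ne_zero.2 (hG.mem_cyc e'))))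
          exact fun a ha => ha.2
        · exact joinedIn_edge he
      | refl a => exact Setoid.refl' _ _
      | symm a b _ ih => exact Setoid.symm' _ ih
      | trans a b c _ _ ih ih' => exact Setoid.trans' _ ih ih'
    exact key u v (hconn u v)
  · obtain ⟨C, hC, hb⟩ := h.1
    have h1 := two_le_degree hC.bdry_chain hb
    have h2 := degree_le_valence (Set.disjoint_empty C) G.base
    omega
  · obtain ⟨C, D, hC, hD, hCD, hvC, hvD⟩ := h.2 v hv
    have h1 := two_le_degree hC.bdry_chain hvC
    have h2 := two_le_degree hD.bdry_chain hvD
    have h3 := degree_le_valence (A := C) (B := D)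
      (Set.disjoint_left.2 fun e he he' => hCD (hG.cycle_eq hC hD he he')) v
    omega

/-- If all edges at `v` belonged to `C`, the valence of `v` would be at most two. -/
theorem IsReduced.exists_cycle_ne (h : G.IsReduced) (hG : G.IsCactus) {v : G.V} (hv : v ≠ G.base)
    (C : Set G.E) (hC : G.IsCycle C) :
    ∃ D, G.IsCycle D ∧ D ≠ C ∧ v ∈ G.verts D := by
  by_contra! hn
  have h1 : ∀ e, (G.src e = v ∨ G.tgt e = v) → e ∈ C := fun e he => by
    by_contra heC
    exact hn (hG.cyc e) (hG.isCycle_cyc e) (fun h => heC (h ▸ hG.mem_cyc e)) ⟨e, hG.mem_cyc e, he⟩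
  have h2 := hC.degree_le v
  have h3 := h.valence_ne_base v hv
  rw [valence] at h3
  rw [show {e | e ∈ C ∧ G.src e = v} = {e | G.src e = v} from
      Set.ext fun e => and_iff_right_of_imp fun h => h1 e (Or.inl h),
    show {e | e ∈ C ∧ G.tgt e = v} = {e | G.tgt e = v} from
      Set.ext fun e => and_iff_right_of_imp fun h => h1 e (Or.inr h)] at h2
  omega

theorem IsReduced.exists_cycle_base (h : G.IsReduced) (hG : G.IsCactus) :
    ∃ C, G.IsCycle C ∧ G.base ∈ G.verts C := by
  have h1 := h.valence_base
  rw [valence] at h1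
  have : ∃ e, G.src e = G.base ∨ G.tgt e = G.base := by
    by_contra! hn
    rw [show {e | G.src e = G.base} = ∅ from Set.eq_empty_of_forall_notMem fun e he => (hn e).1 he,
      show {e | G.tgt e = G.base} = ∅ from Set.eq_empty_of_forall_notMem fun e he => (hn e).2 he]
      at h1
    simp at h1
  obtain ⟨e, he⟩ := this
  exact ⟨_, hG.isCycle_cyc e, e, hG.mem_cyc e, he⟩

/-- For connected cactus graphs this is the converse of `IsCactus.isReduced`. The condition on
cycles is easier to carry through collapses and blow-ups than the valences. -/
theorem IsReduced.hasTwoCycles (h : G.IsReduced) (hG : G.IsCactus) : G.HasTwoCycles := by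
  obtain ⟨C, hC⟩ := h.exists_cycle_base hG
  refine ⟨⟨C, hC⟩, fun v hv => ?_⟩
  obtain ⟨D, hD, _, hDv⟩ := h.exists_cycle_ne hG hv C hC.1
  obtain ⟨D', hD', hne, hDv'⟩ := h.exists_cycle_ne hG hv D hD
  exact ⟨D, D', hD, hD', hne.symm, hDv, hDv'⟩

/-! ### Chains and cycles of a collapse -/

section Collapse

variable {F : Set G.E}

/-- The image of a vertex in a collapse. -/
def proj (G : BasedGraph) (F : Set G.E) (v : G.V) : (G.collapse F).V := Quotient.mk _ v

theorem proj_eq_iff {u v : G.V} : G.proj F u = G.proj F v ↔ G.joinedIn F u v := Quotient.eq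

theorem proj_surjective : Function.Surjective (G.proj F) := Quotient.exists_rep

/-- A preimage of a vertex of a collapse. -/
noncomputable def rep (q : (G.collapse F).V) : G.V := Quotient.out q

theorem proj_rep (q : (G.collapse F).V) : G.proj F (rep q) = q := Quotient.out_eq q

theorem proj_edge {e : G.E} (h : e ∈ F) : G.proj F (G.src e) = G.proj F (G.tgt e) :=
  proj_eq_iff.2 (joinedIn_edge h)

theorem collapse_joinedIn_iff {B : Set (G.collapse F).E} {u v : G.V} :
    (G.collapse F).joinedIn B (G.proj F u) (G.proj F v) ↔
      G.joinedIn (Subtype.val '' B ∪ F) u v := by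
  constructor
  · intro h
    suffices ∀ q q', (G.collapse F).joinedIn B q q' → ∀ u v, G.proj F u = q →
        G.proj F v = q' → G.joinedIn (Subtype.val '' B ∪ F) u v from
      this _ _ h u v rfl rfl
    intro q q' h
    have hF : ∀ {u v}, G.proj F u = G.proj F v →
        G.joinedIn (Subtype.val '' B ∪ F) u v := fun h =>
      joinedIn_mono Set.subset_union_right (proj_eq_iff.1 h)
    induction h with
    | rel a b h =>
      obtain ⟨e, he, rfl, rfl⟩ := h
      intro u v hu hv
      have h1 : G.joinedIn (Subtype.val '' B ∪ F) (G.src e.1) (G.tgt e.1) :=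
        joinedIn_edge (Or.inl ⟨e, he, rfl⟩)
      exact Setoid.trans' _ (hF hu) (Setoid.trans' _ h1 (hF hv.symm))
    | refl a => exact fun u v hu hv => hF (hu.trans hv.symm)
    | symm a b _ ih => exact fun u v hu hv => Setoid.symm' _ (ih v u hv hu)
    | trans a b c _ _ ih ih' =>
      intro u v hu hv
      obtain ⟨w, hw⟩ := proj_surjective b
      exact Setoid.trans' _ (ih u w hu hw) (ih' w v hw hv)
  · intro h
    induction h with
    | rel a b h =>
      obtain ⟨e, he, rfl, rfl⟩ := h
      by_cases heF : e ∈ F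
      · rw [show G.proj F (G.src e) = G.proj F (G.tgt e) from
          proj_edge heF]
      · obtain ⟨e', he', rfl⟩ := he.resolve_right heF
        exact .rel _ _ ⟨e', he', rfl, rfl⟩
    | refl a => exact Setoid.refl' _ _
    | symm a b _ ih => exact Setoid.symm' _ ih
    | trans a b c _ _ ih ih' => exact Setoid.trans' _ ih ih'

open Classical in
/-- The map on sums of vertices induced by a collapse. -/
noncomputable def pushV (G : BasedGraph) (F : Set G.E) :
    (G.V → ZMod 2) →ₗ[ZMod 2] ((G.collapse F).V → ZMod 2) :=
  Fintype.linearCombination (ZMod 2) fun v => (G.collapse F).pt (G.proj F v)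

theorem pushV_pt (v : G.V) : G.pushV F (G.pt v) = (G.collapse F).pt (G.proj F v) := by
  classical
  rw [pushV, pt, Fintype.linearCombination_apply_single, one_smul]

theorem sum_smul_pt (f : G.V → ZMod 2) : ∑ v, f v • G.pt v = f := by
  classical
  funext w
  simp [Finset.sum_apply, pt, Pi.single_apply]

theorem bdry_collapse (x : G.E → ZMod 2) :
    (G.collapse F).bdry (fun e => x e.1) = G.pushV F (G.bdry x) := by
  rw [bdry_apply, bdry_apply, map_sum]
  refine Fintype.sum_of_injective (fun e : (G.collapse F).E => (e.1 : G.E))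
    Subtype.val_injective _ _ (fun e he => ?_) fun e => ?_
  · have heF : e ∈ F := by
      by_contra h
      exact he ⟨⟨e, h⟩, rfl⟩
    rw [map_smul, map_add, pushV_pt, pushV_pt, proj_edge heF, add_self_fun, smul_zero]
  · rw [map_smul, map_add, pushV_pt, pushV_pt]
    rfl

/-- Chains in `F` move every vertex to the representative of its class. What arrives at the
representatives is determined by the image of `f` in the collapse, which is zero. -/
theorem exists_bdry_eq {f : G.V → ZMod 2} (hf : G.pushV F f = 0) :
    ∃ z : G.E → ZMod 2, (∀ e, z e ≠ 0 → e ∈ F) ∧ G.bdry z = f := by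
  have h1 : ∀ v, ∃ z : G.E → ZMod 2, (∀ e, z e ≠ 0 → e ∈ F) ∧
      G.bdry z = G.pt v + G.pt (rep (G.proj F v)) := fun v =>
    joinedIn_iff.1 (proj_eq_iff.1 (proj_rep (G.proj F v)).symm)
  choose z hz hz' using h1
  refine ⟨∑ v, f v • z v, fun e he => ?_, ?_⟩
  · rw [Finset.sum_apply] at he
    obtain ⟨v, _, hv⟩ := Finset.exists_ne_zero_of_sum_ne_zero he
    exact hz v e fun h => hv (by simp [h])
  · simp only [map_sum, map_smul, hz', smul_add, Finset.sum_add_distrib]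
    rw [sum_smul_pt]
    have : ∑ v, f v • G.pt (rep (G.proj F v)) =
        Fintype.linearCombination (ZMod 2)
          (fun q : (G.collapse F).V => G.pt (rep q)) (G.pushV F f) := by
      conv_rhs => rw [← sum_smul_pt f]
      rw [map_sum, map_sum]
      refine Finset.sum_congr rfl fun v _ => ?_
      classical
      rw [map_smul, map_smul, pushV_pt, pt.eq_1 (G.collapse F),
        Fintype.linearCombination_apply_single, one_smul]
    rw [this, hf, map_zero, add_zero]

/-- Closed chains lift along collapses. -/
theorem exists_lift_closed {y : (G.collapse F).E → ZMod 2} (hy : (G.collapse F).bdry y = 0) :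
    ∃ x : G.E → ZMod 2, G.bdry x = 0 ∧ ∀ e : (G.collapse F).E, x e.1 = y e := by
  classical
  let y' : G.E → ZMod 2 := fun e => if h : e ∉ F then y ⟨e, h⟩ else 0
  have hy' : ∀ e : (G.collapse F).E, y' e.1 = y e := fun e => dif_pos e.2
  have h1 : G.pushV F (G.bdry y') = 0 := by
    rw [← bdry_collapse, ← hy]
    exact congrArg _ (funext hy')
  obtain ⟨z, hz, hz'⟩ := exists_bdry_eq h1
  refine ⟨y' + z, by rw [map_add, hz', add_self_fun], fun e => ?_⟩
  rw [Pi.add_apply, not_imp_comm.1 (hz e.1) e.2, add_zero, hy']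

/-- The part of an edge set that survives in a collapse. -/
def restr (G : BasedGraph) (F : Set G.E) (C : Set G.E) : Set (G.collapse F).E := {e | e.1 ∈ C}

/-- The surviving edges are partitioned by their old cycles. Traces of closed chains are closed, and
since closed chains lift, those of the collapse are constant on the blocks; `isCactus_of_partition`
applies. -/
theorem collapse_cactus_aux (hG : G.IsCactus) : (G.collapse F).IsCactus ∧
    ∀ e : (G.collapse F).E, (G.collapse F).IsCycle {e' | hG.cyc e'.1 = hG.cyc e.1} := by
  refine isCactus_of_partition (fun e : (G.collapse F).E => hG.cyc e.1) (fun e => ?_) fun y hy e e' hee => ?_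
  · rw [show (G.collapse F).chain {e' | hG.cyc e'.1 = hG.cyc e.1} =
      fun e' => G.chain (hG.cyc e.1) e'.1 from ?_, bdry_collapse,
      (hG.isCycle_cyc e.1).bdry_chain, map_zero]
    funext e'
    by_cases h : hG.cyc e'.1 = hG.cyc e.1
    · rw [chain_of_mem h, chain_of_mem (h ▸ hG.mem_cyc e'.1)]
    · rw [chain_of_notMem h, chain_of_notMem fun h' => h (hG.cyc_eq_of_mem h').symm]
  · obtain ⟨x, hx, hxy⟩ := exists_lift_closed hy
    rw [← hxy, ← hxy]
    exact hG.closed_const hx (hG.isCycle_cyc e.1) (hG.mem_cyc _) (hee ▸ hG.mem_cyc _)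

theorem IsCactus.collapse (hG : G.IsCactus) (F : Set G.E) : (G.collapse F).IsCactus :=
  (collapse_cactus_aux hG).1

theorem IsCycle.restr (hG : G.IsCactus) {C : Set G.E} (hC : G.IsCycle C) (hCF : ¬ C ⊆ F) :
    (G.collapse F).IsCycle (G.restr F C) := by
  obtain ⟨e, heC, heF⟩ := Set.not_subset.1 hCF
  convert (collapse_cactus_aux (F := F) hG).2 ⟨e, heF⟩ using 1
  ext e'
  rw [hG.eq_cyc hC heC]
  exact ⟨fun h => (hG.cyc_eq_of_mem h).symm, fun h => h ▸ hG.mem_cyc e'.1⟩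

theorem restr_isCycle_iff (hG : G.IsCactus) (hF : G.IsForest F) {D : Set (G.collapse F).E} :
    (G.collapse F).IsCycle D ↔ ∃ C, G.IsCycle C ∧ D = G.restr F C := by
  constructor
  · intro hD
    obtain ⟨e, he⟩ := hD.nonempty
    have h1 := (hG.isCycle_cyc e.1).restr (F := F) hG fun h => e.2 (h (hG.mem_cyc e.1))
    exact ⟨_, hG.isCycle_cyc e.1, (hG.collapse F).cycle_eq hD h1 he (hG.mem_cyc e.1)⟩
  · rintro ⟨C, hC, rfl⟩
    exact hC.restr hG (hF C hC)

theorem restr_injective (hG : G.IsCactus) (hF : G.IsForest F) {C D : Set G.E} (hC : G.IsCycle C)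
    (hD : G.IsCycle D) (h : G.restr F C = G.restr F D) : C = D := by
  obtain ⟨e, heC, heF⟩ := Set.not_subset.1 (hF C hC)
  have : (⟨e, heF⟩ : (G.collapse F).E) ∈ G.restr F D := h ▸ heC
  exact hG.cycle_eq hC hD heC this

/-- Vertices of a cycle give vertices of its image in a collapse. -/
theorem mem_verts_restr {C : Set G.E} (hC : G.IsCycle C) (hCF : ¬ C ⊆ F) {v : G.V}
    (hv : v ∈ G.verts C) :
    G.proj F v ∈ (G.collapse F).verts (G.restr F C) := by
  by_contra hn
  obtain ⟨e, heC, heF⟩ := Set.not_subset.1 hCF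
  have h1 : ∀ w, G.joinedIn C v w → ∀ u, G.joinedIn C w u →
      (G.proj F w = G.proj F v ↔
        G.proj F u = G.proj F v) := by
    intro w _ u hwu
    induction hwu with
    | rel a b h =>
      obtain ⟨e', he', rfl, rfl⟩ := h
      by_cases h : e' ∈ F
      · rw [show G.proj F (G.src e') = G.proj F (G.tgt e') from
          proj_edge h]
      · exact iff_of_false (fun h' => hn ⟨⟨e', h⟩, he', Or.inl h'⟩)
          fun h' => hn ⟨⟨e', h⟩, he', Or.inr h'⟩
    | refl a => exact Iff.rfl
    | symm a b hab ih =>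
      rename_i hvb
      exact (ih (Setoid.trans' _ hvb (Setoid.symm' _ hab))).symm
    | trans a b c hab hbc ih ih' =>
      rename_i hva
      exact (ih hva).trans (ih' (Setoid.trans' _ hva hab))
  have h2 := (h1 v (Setoid.refl' _ v) _ (hC.joinedIn hv ⟨e, heC, Or.inl rfl⟩)).1 rfl
  exact hn ⟨⟨e, heF⟩, heC, Or.inl h2⟩

theorem collapse_connected (hconn : ∀ u v, G.joinedIn Set.univ u v) (q q' : (G.collapse F).V) :
    (G.collapse F).joinedIn Set.univ q q' := by
  obtain ⟨u, rfl⟩ := proj_surjective q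
  obtain ⟨v, rfl⟩ := proj_surjective q'
  refine collapse_joinedIn_iff.2 (joinedIn_mono (fun e _ => ?_) (hconn u v))
  by_cases h : e ∈ F
  · exact Or.inr h
  · exact Or.inl ⟨⟨e, h⟩, trivial, rfl⟩

/-- A forest swallows no cycle, and distinct cycles keep distinct traces, so each vertex of the
collapse inherits the required cycles from a preimage. -/
theorem collapse_isReduced (hG : G.IsCactus) (hr : G.IsReduced) (hF : G.IsForest F) :
    (G.collapse F).IsReduced := by
  refine (hG.collapse F).isReduced (collapse_connected hr.connected) ⟨?_, fun q hq => ?_⟩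
  · obtain ⟨C, hC, hb⟩ := (hr.hasTwoCycles hG).1
    exact ⟨_, hC.restr hG (hF C hC), mem_verts_restr hC (hF C hC) hb⟩
  · obtain ⟨v, rfl⟩ := proj_surjective q
    obtain ⟨C, D, hC, hD, hCD, hvC, hvD⟩ := (hr.hasTwoCycles hG).2 v fun h => hq (h ▸ rfl)
    exact ⟨_, _, hC.restr hG (hF C hC), hD.restr hG (hF D hD),
      fun h => hCD (restr_injective hG hF hC hD h), mem_verts_restr hC (hF C hC) hvC,
      mem_verts_restr hD (hF D hD) hvD⟩

end Collapse

end BasedGraph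


/-! ### Walks and the fundamental group -/

namespace BasedGraph

variable {G : BasedGraph}

theorem isWalk_append_iff {u v : G.V} {w w' : List (G.E × Bool)} :
    G.IsWalk u (w ++ w') v ↔ ∃ z, G.IsWalk u w z ∧ G.IsWalk z w' v := by
  induction w generalizing u with
  | nil => exact ⟨fun h => ⟨u, rfl, h⟩, by rintro ⟨_, rfl, h⟩; exact h⟩
  | cons x w ih =>
    simp only [List.cons_append, IsWalk, ih]
    exact ⟨fun ⟨h, z, h1, h2⟩ => ⟨z, ⟨h, h1⟩, h2⟩, fun ⟨z, ⟨h, h1⟩, h2⟩ => ⟨h, z, h1, h2⟩⟩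

theorem isWalk_singleton (x : G.E × Bool) : G.IsWalk (G.start x) [x] (G.start (x.1, !x.2)) :=
  ⟨rfl, rfl⟩

theorem start_joined {A : Set G.E} {x : G.E × Bool} (h : x.1 ∈ A) :
    G.joinedIn A (G.start x) (G.start (x.1, !x.2)) := by
  obtain ⟨e, b⟩ := x
  cases b
  · exact Setoid.symm' _ (joinedIn_edge h)
  · exact joinedIn_edge h

theorem IsWalk.joinedIn {A : Set G.E} {u v : G.V} {w : List (G.E × Bool)} (h : G.IsWalk u w v)
    (hA : ∀ x ∈ w, x.1 ∈ A) : G.joinedIn A u v := by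
  induction w generalizing u with
  | nil => cases h; exact Setoid.refl' _ _
  | cons x w ih =>
    refine Setoid.trans' _ ?_ (ih h.2 fun y hy => hA y (List.mem_cons_of_mem _ hy))
    rw [← h.1]
    exact start_joined (hA x List.mem_cons_self)

theorem exists_walk {A : Set G.E} {u v : G.V} (h : G.joinedIn A u v) :
    ∃ w, G.IsWalk u w v ∧ ∀ x ∈ w, x.1 ∈ A := by
  induction h with
  | rel a b h =>
    obtain ⟨e, he, rfl, rfl⟩ := h
    exact ⟨[(e, true)], isWalk_singleton (e, true), by simpa⟩
  | refl a => exact ⟨[], rfl, by simp⟩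
  | symm a b _ ih =>
    obtain ⟨w, hw, hA⟩ := ih
    refine ⟨_, hw.invRev, fun x hx => ?_⟩
    simp only [FreeGroup.invRev, List.mem_reverse, List.mem_map] at hx
    obtain ⟨y, hy, rfl⟩ := hx
    exact hA y hy
  | trans a b c _ _ ih ih' =>
    obtain ⟨w, hw, hA⟩ := ih
    obtain ⟨w', hw', hA'⟩ := ih'
    exact ⟨w ++ w', hw.append hw', fun x hx => (List.mem_append.1 hx).elim (hA x) (hA' x)⟩

theorem IsWalk.red {u v : G.V} {w w' : List (G.E × Bool)} (h : G.IsWalk u w v)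
    (hr : FreeGroup.Red w w') : G.IsWalk u w' v := by
  induction hr with
  | refl => exact h
  | tail _ hs ih =>
    obtain ⟨⟩ := hs
    rename_i L₁ L₂ x b _
    obtain ⟨z, h1, h2, h3, h4⟩ := isWalk_append_iff.1 ih
    refine h1.append ?_
    rw [Bool.not_not, h2] at h4
    exact h4

/-- Every walk reduces to a reduced walk in the same set of edges. -/
theorem IsWalk.exists_reduced {u v : G.V} {w : List (G.E × Bool)} (h : G.IsWalk u w v) :
    ∃ w', G.IsWalk u w' v ∧ FreeGroup.IsReduced w' ∧ FreeGroup.mk w' = FreeGroup.mk w ∧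
      ∀ x ∈ w', x ∈ w := by
  classical
  refine ⟨FreeGroup.reduce w, h.red FreeGroup.reduce.red, ?_, FreeGroup.reduce.self, fun x hx =>
    (FreeGroup.Red.sublist FreeGroup.reduce.red).subset hx⟩
  exact FreeGroup.IsReduced.of_reduce_eq FreeGroup.reduce.idem

theorem exists_reduced_walk {A : Set G.E} {u v : G.V} (h : G.joinedIn A u v) :
    ∃ w, G.IsWalk u w v ∧ FreeGroup.IsReduced w ∧ ∀ x ∈ w, x.1 ∈ A := by
  obtain ⟨w, hw, hA⟩ := exists_walk h
  obtain ⟨w', h1, h2, _, h4⟩ := hw.exists_reduced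
  exact ⟨w', h1, h2, fun x hx => hA x (h4 x hx)⟩

theorem isReduced_append_iff {α : Type*} {w w' : List (α × Bool)} :
    FreeGroup.IsReduced (w ++ w') ↔ FreeGroup.IsReduced w ∧ FreeGroup.IsReduced w' ∧
      ∀ x ∈ w.getLast?, ∀ y ∈ w'.head?, x.1 = y.1 → x.2 = y.2 := List.isChain_append

theorem eq_of_isReduced {α : Type*} {w w' : List (α × Bool)} (h : FreeGroup.IsReduced w)
    (h' : FreeGroup.IsReduced w') (hm : FreeGroup.mk w = FreeGroup.mk w') : w = w' := by
  classical
  rw [← h.reduce_eq, ← h'.reduce_eq]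
  exact FreeGroup.reduce.sound hm

/-- An edge of a forest separates its ends in the forest. -/
theorem IsForest.not_joinedIn {F : Set G.E} (hF : G.IsForest F) {e : G.E} (he : e ∈ F) :
    ¬ G.joinedIn (F \ {e}) (G.src e) (G.tgt e) := by
  classical
  intro h
  obtain ⟨x, hx, hb⟩ := joinedIn_iff.1 h
  have h0 := isForest_iff.1 hF (x + Pi.single e 1)
    (by rw [map_add, hb, bdry_single, add_self_fun]) fun e' he' => by
      by_cases h : e' = e
      · exact h ▸ he
      · exact (hx e' (by simpa [Pi.single_eq_of_ne h] using he')).1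
  have h1 := congrFun h0 e
  have h2 : x e = 0 := by
    by_contra h
    exact (hx e h).2 rfl
  simp [h2] at h1

/-- In a forest, closed reduced walks are trivial. -/
theorem IsForest.eq_nil {F : Set G.E} (hF : G.IsForest F) {u : G.V} {w : List (G.E × Bool)}
    (hw : G.IsWalk u w u) (hr : FreeGroup.IsReduced w) (hwF : ∀ x ∈ w, x.1 ∈ F) : w = [] := by
  classical
  induction hn : w.length using Nat.strong_induction_on generalizing u w with
  | _ n ih =>
    rcases w with _ | ⟨x, w⟩
    · rfl
    have hxF : x.1 ∈ F := hwF x List.mem_cons_self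
    have hsep : ¬ G.joinedIn (F \ {x.1}) (G.start (x.1, !x.2)) (G.start x) := by
      intro h
      clear hw hr hwF hn
      obtain ⟨e, b⟩ := x
      cases b
      · exact hF.not_joinedIn hxF h
      · exact hF.not_joinedIn hxF (Setoid.symm' _ h)
    obtain ⟨rfl, hw⟩ := hw
    by_cases hx : ∀ y ∈ w, y.1 ≠ x.1
    · exact (hsep (hw.joinedIn fun y hy => ⟨hwF y (List.mem_cons_of_mem _ hy), hx y hy⟩)).elim
    · push Not at hx
      -- `y` is the first return to the edge of `x`. In the same direction it would join the ends of
      -- that edge without the edge. So it goes backwards, the closed walk `f` in between is empty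
      -- by induction, and a backtrack remains.
      obtain ⟨f, y, w', rfl, hf, hy⟩ : ∃ f y w', w = f ++ y :: w' ∧ (∀ z ∈ f, z.1 ≠ x.1) ∧
          y.1 = x.1 := by
        clear hw hr hwF hn
        induction w with
        | nil => simp at hx
        | cons z w ihw =>
          by_cases hz : z.1 = x.1
          · exact ⟨[], z, w, rfl, by simp, hz⟩
          · obtain ⟨f, y, w', rfl, hf, hy⟩ := ihw (by simpa [hz] using hx)
            exact ⟨z :: f, y, w', rfl, by simpa [hz] using hf, hy⟩
      obtain ⟨z, h1, h2, h3⟩ := isWalk_append_iff.1 hw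
      have hfF : ∀ z ∈ f, z.1 ∈ F := fun z hz =>
        hwF z (List.mem_cons_of_mem _ (List.mem_append_left _ hz))
      by_cases hyx : y = x
      · subst hyx
        rw [← h2] at h1
        exact (hsep (h1.joinedIn fun z hz => ⟨hfF z hz, hf z hz⟩)).elim
      · have hy2 : y = (x.1, !x.2) := by
          refine Prod.ext hy ?_
          rw [Bool.eq_not]
          exact fun h => hyx (Prod.ext hy h)
        rw [← h2, hy2] at h1
        have hf1 : f <:+: x :: (f ++ y :: w') := ⟨[x], y :: w', by simp⟩
        have hf0 := ih f.length (by simp at hn; omega) h1 (hr.infix hf1) hfF rfl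
        subst hf0
        have := (FreeGroup.isReduced_cons_cons.1 hr).1 hy.symm
        rw [hy2] at this
        simp at this

/-! ### Labels: the effect of a collapse on edge paths -/

section Label

variable {Γ : BasedGraph} {F : Set G.E} (φ : Iso (G.collapse F) Γ)

/-- The edge of a collapse given by an edge that is not collapsed. -/
def surv (e : G.E) (h : e ∉ F) : (G.collapse F).E := ⟨e, h⟩

open Classical in
/-- The oriented edge of the collapsed graph that corresponds to an oriented edge. -/
noncomputable def lab (x : G.E × Bool) : Option (Γ.E × Bool) :=
  if h : x.1 ∈ F then none else
    some (φ.onE (surv x.1 h), xor (φ.flip (surv x.1 h)) x.2)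

theorem lab_of_mem {x : G.E × Bool} (h : x.1 ∈ F) : lab φ x = none := dif_pos h

theorem lab_of_notMem {x : G.E × Bool} (h : x.1 ∉ F) : lab φ x =
    some (φ.onE (surv x.1 h), xor (φ.flip (surv x.1 h)) x.2) := dif_neg h

theorem lab_eq_none {x : G.E × Bool} : lab φ x = none ↔ x.1 ∈ F := by
  by_cases h : x.1 ∈ F
  · simp [lab_of_mem φ h, h]
  · simp [lab_of_notMem φ h, h]

theorem lab_eq_some {x : G.E × Bool} {y : Γ.E × Bool} (h : lab φ x = some y) : ∃ h : x.1 ∉ F,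
    φ.onE (surv x.1 h) = y.1 ∧
      xor (φ.flip (surv x.1 h)) x.2 = y.2 := by
  have hx : x.1 ∉ F := fun h' => by simp [lab_of_mem φ h'] at h
  rw [lab_of_notMem φ hx, Option.some_inj] at h
  subst h
  exact ⟨hx, rfl, rfl⟩

theorem lab_start {x : G.E × Bool} {y : Γ.E × Bool} (h : lab φ x = some y) :
    Γ.start y = φ.onV (G.proj F (G.start x)) := by
  obtain ⟨hx, h1, h2⟩ := lab_eq_some φ h
  obtain ⟨y1, y2⟩ := y
  obtain ⟨x1, x2⟩ := x
  dsimp only at h1 h2 hx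
  rw [← h1, ← h2, φ.start_map]
  cases x2 <;> rfl

theorem lab_not {x : G.E × Bool} {y : Γ.E × Bool} (h : lab φ x = some y) :
    lab φ (x.1, !x.2) = some (y.1, !y.2) := by
  obtain ⟨hx, h1, h2⟩ := lab_eq_some φ h
  rw [lab_of_notMem φ (x := (x.1, !x.2)) hx, Option.some_inj]
  exact Prod.ext h1 (by rw [← h2, Bool.xor_not])

theorem lab_injective {x x' : G.E × Bool} {y : Γ.E × Bool} (h : lab φ x = some y)
    (h' : lab φ x' = some y) : x = x' := by
  obtain ⟨hx, h1, h2⟩ := lab_eq_some φ h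
  obtain ⟨hx', h1', h2'⟩ := lab_eq_some φ h'
  have h3 : x.1 = x'.1 := congrArg Subtype.val (φ.onE.injective (h1.trans h1'.symm))
  obtain ⟨x1, x2⟩ := x
  obtain ⟨x1', x2'⟩ := x'
  obtain rfl : x1 = x1' := h3
  exact Prod.ext rfl (Bool.xor_right_inj.1 (h2.trans h2'.symm))

theorem lab_surjective (y : Γ.E × Bool) : ∃ x, lab φ x = some y := by
  obtain ⟨⟨e, he⟩, h⟩ : ∃ e : (G.collapse F).E, φ.onE e = y.1 := φ.onE.surjective y.1
  refine ⟨(e, xor (φ.flip (surv e he)) y.2), ?_⟩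
  rw [lab_of_notMem φ he, Option.some_inj]
  exact Prod.ext h (by simp)

theorem isWalk_lab {u v : G.V} {w : List (G.E × Bool)} (h : G.IsWalk u w v) :
    Γ.IsWalk (φ.onV (G.proj F u)) (w.filterMap (lab φ)) (φ.onV (G.proj F v)) := by
  induction w generalizing u with
  | nil => cases h; rfl
  | cons x w ih =>
    obtain ⟨rfl, hw⟩ := h
    by_cases hx : x.1 ∈ F
    · rw [List.filterMap_cons_none (lab_of_mem φ hx),
        proj_eq_iff.2 (start_joined (x := x) hx)]
      exact ih hw
    · obtain ⟨y, hy⟩ := Option.ne_none_iff_exists'.1 (mt (lab_eq_none φ).1 hx)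
      rw [List.filterMap_cons_some hy]
      refine ⟨lab_start φ hy, ?_⟩
      rw [lab_start φ (lab_not φ hy)]
      exact ih hw

open Classical in
theorem collapseHom_of (e : G.E) : G.collapseHom F (FreeGroup.of e) =
    if h : e ∈ F then 1 else FreeGroup.of (surv e h) := by
  rw [collapseHom, FreeGroup.lift_apply_of]
  rfl

theorem hom_collapseHom (w : List (G.E × Bool)) :
    φ.hom (G.collapseHom F (FreeGroup.mk w)) = FreeGroup.mk (w.filterMap (lab φ)) := by
  induction w with
  | nil =>
    rw [List.filterMap_nil, ← FreeGroup.one_eq_mk, ← FreeGroup.one_eq_mk, map_one, map_one]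
  | cons x w ih =>
    have key : φ.hom (G.collapseHom F (FreeGroup.mk [x])) =
        FreeGroup.mk ([x].filterMap (lab φ)) := by
      have hsingle : FreeGroup.mk [x] =
          (cond x.2 (FreeGroup.of x.1) (FreeGroup.of x.1)⁻¹) := by
        obtain ⟨e, b⟩ := x
        cases b <;> rfl
      have h1 := collapseHom_of (F := F) x.1
      by_cases hx : x.1 ∈ F
      · rw [dif_pos hx] at h1
        rw [List.filterMap_cons_none (lab_of_mem φ hx), List.filterMap_nil, hsingle,
          ← FreeGroup.one_eq_mk]
        cases x.2 <;> simp [h1]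
      · rw [dif_neg hx] at h1
        rw [List.filterMap_cons_some (lab_of_notMem φ hx), List.filterMap_nil, hsingle]
        have h2 : φ.hom (FreeGroup.of (surv x.1 hx)) =
            if φ.flip (surv x.1 hx) then
              (FreeGroup.of (φ.onE (surv x.1 hx)))⁻¹
            else FreeGroup.of (φ.onE (surv x.1 hx)) := by
          rw [Iso.hom]
          exact FreeGroup.lift_apply_of
        obtain ⟨e, b⟩ := x
        dsimp only at h1 h2 hx ⊢
        cases hf : φ.flip (surv e hx) <;> cases b <;>
          simp only [cond_true, cond_false, map_inv] <;> rw [h1, h2, hf] <;> simp <;> rfl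
    rw [show x :: w = [x] ++ w from rfl, ← FreeGroup.mul_mk, map_mul, map_mul, ih, key,
      FreeGroup.mul_mk, ← List.filterMap_append]

/-- A cancellation in the image comes from an oriented edge and its reverse with only forest edges
in between. These form a reduced closed walk in the forest, which is empty, so the original walk had
a backtrack. -/
theorem isReduced_lab (hF : G.IsForest F) {u v : G.V} {w : List (G.E × Bool)}
    (h : G.IsWalk u w v) (hr : FreeGroup.IsReduced w) :
    FreeGroup.IsReduced (w.filterMap (lab φ)) := by
  induction w generalizing u with
  | nil => exact FreeGroup.IsReduced.nil
  | cons x w ih =>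
    have ih := ih h.2 (hr.infix ⟨[x], [], by simp⟩)
    by_cases hx : x.1 ∈ F
    · rwa [List.filterMap_cons_none (lab_of_mem φ hx)]
    obtain ⟨y, hy⟩ := Option.ne_none_iff_exists'.1 (mt (lab_eq_none φ).1 hx)
    rw [List.filterMap_cons_some hy]
    cases hl : w.filterMap (lab φ) with
    | nil => exact FreeGroup.IsReduced.singleton
    | cons y' l =>
      rw [hl] at ih
      refine FreeGroup.isReduced_cons_cons.2 ⟨fun hyy => ?_, ih⟩
      by_contra hne
      obtain ⟨f, x', w', rfl, hf, hx', _⟩ := List.filterMap_eq_cons_iff.1 hl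
      have h1 : y' = (y.1, !y.2) := Prod.ext hyy.symm (Bool.eq_not.2 (Ne.symm hne))
      have h2 : x' = (x.1, !x.2) := lab_injective φ hx' (h1 ▸ lab_not φ hy)
      obtain ⟨z, h3, h4, _⟩ := isWalk_append_iff.1 h.2
      rw [← h4, h2] at h3
      have hf1 : f <:+: x :: (f ++ x' :: w') := ⟨[x], x' :: w', by simp⟩
      have h5 := hF.eq_nil h3 (hr.infix hf1)
        fun a ha => (lab_eq_none φ).1 (hf a ha)
      subst h5
      have := (FreeGroup.isReduced_cons_cons.1 hr).1 (by rw [h2])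
      rw [h2] at this
      simp at this

theorem eq_nil_of_lab (hF : G.IsForest F) {u : G.V} {w : List (G.E × Bool)}
    (h : G.IsWalk u w u) (hr : FreeGroup.IsReduced w) (h0 : w.filterMap (lab φ) = []) : w = [] :=
  hF.eq_nil h hr fun x hx => (lab_eq_none φ).1 (List.filterMap_eq_nil_iff.1 h0 x hx)

/-- Consecutive edges lift to edges whose ends agree after the collapse; a path in `F`, which has
empty label, fills the gap. -/
theorem exists_lift_walk {u v : G.V} {w : List (Γ.E × Bool)}
    (h : Γ.IsWalk (φ.onV (G.proj F u)) w (φ.onV (G.proj F v))) :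
    ∃ w', G.IsWalk u w' v ∧ w'.filterMap (lab φ) = w := by
  have hnone : ∀ f : List (G.E × Bool), (∀ x ∈ f, x.1 ∈ F) → f.filterMap (lab φ) = [] :=
    fun f hf => List.filterMap_eq_nil_iff.2 fun x hx => lab_of_mem φ (hf x hx)
  induction w generalizing u with
  | nil =>
    obtain ⟨f, hf, hfF⟩ := exists_walk (proj_eq_iff.1 (φ.onV.injective h))
    exact ⟨f, hf, hnone f hfF⟩
  | cons y w ih =>
    obtain ⟨h1, h2⟩ := h
    obtain ⟨x, hx⟩ := lab_surjective φ y
    rw [lab_start φ hx] at h1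
    rw [lab_start φ (lab_not φ hx)] at h2
    obtain ⟨f, hf, hfF⟩ := exists_walk (proj_eq_iff.1 (φ.onV.injective h1.symm))
    obtain ⟨w', hw', hl⟩ := ih h2
    refine ⟨f ++ x :: w', hf.append ⟨rfl, hw'⟩, ?_⟩
    rw [List.filterMap_append, hnone f hfF, List.filterMap_cons_some hx, hl, List.nil_append]

theorem lab_mem_fundamentalGroup {g : FreeGroup G.E} (hg : g ∈ G.fundamentalGroup) :
    φ.hom (G.collapseHom F g) ∈ Γ.fundamentalGroup := by
  obtain ⟨w, hw, rfl⟩ := hg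
  refine ⟨w.filterMap (lab φ), ?_, (hom_collapseHom φ w).symm⟩
  have := isWalk_lab φ hw
  rwa [show φ.onV (G.proj F G.base) = Γ.base from φ.base_map] at this

/-- The isomorphism of fundamental groups induced by a forest collapse. -/
noncomputable def collapseEquiv (hF : G.IsForest F) : G.fundamentalGroup ≃* Γ.fundamentalGroup :=
  MulEquiv.ofBijective
    (((φ.hom.comp (G.collapseHom F)).comp G.fundamentalGroup.subtype).codRestrict
      Γ.fundamentalGroup fun g => lab_mem_fundamentalGroup φ g.2) (by
    constructor
    · rw [injective_iff_map_eq_one]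
      rintro ⟨g, w, hw, rfl⟩ h1
      have h2 : φ.hom (G.collapseHom F (FreeGroup.mk w)) = 1 := congrArg Subtype.val h1
      -- Injectivity: the label of a reduced representative is again reduced, so it represents the
      -- identity only if it is empty.
      obtain ⟨w', hw', hr, hm, _⟩ := hw.exists_reduced
      rw [← hm, hom_collapseHom, FreeGroup.one_eq_mk] at h2
      have h3 := eq_nil_of_lab φ hF hw' hr
        (eq_of_isReduced (isReduced_lab φ hF hw' hr) FreeGroup.IsReduced.nil h2)
      refine Subtype.ext (hm.symm.trans ?_)
      rw [h3]
      rfl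
    · rintro ⟨g, w, hw, rfl⟩
      rw [← φ.base_map] at hw
      obtain ⟨w', hw', hl⟩ := exists_lift_walk φ (u := G.base) (v := G.base) hw
      refine ⟨⟨_, w', hw', rfl⟩, Subtype.ext ?_⟩
      change φ.hom (G.collapseHom F (FreeGroup.mk w')) = _
      rw [hom_collapseHom, hl])

end Label

/-! ### Rigidity -/

theorem ncard_start (v : G.V) : {x : G.E × Bool | G.start x = v}.ncard = G.valence v := by
  have h1 : {x : G.E × Bool | G.start x = v} =
      (fun e => (e, true)) '' {e | G.src e = v} ∪ (fun e => (e, false)) '' {e | G.tgt e = v} := by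
    ext ⟨e, b⟩
    cases b <;> simp [start]
  rw [h1, Set.ncard_union_eq, Set.ncard_image_of_injective, Set.ncard_image_of_injective, valence]
  · exact fun a b h => congrArg Prod.fst h
  · exact fun a b h => congrArg Prod.fst h
  · refine Set.disjoint_left.2 ?_
    rintro _ ⟨a, _, rfl⟩ ⟨b, _, h⟩
    simpa using congrArg Prod.snd h

/-- No edge separates, so after `x` the base vertex can be reached without using the edge of `x`
again; hence no backtrack occurs at the junction. -/
theorem IsReduced.exists_return (hG : G.IsReduced) (x : G.E × Bool) :
    ∃ r, G.IsWalk (G.start x) (x :: r) G.base ∧ FreeGroup.IsReduced (x :: r) := by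
  obtain ⟨r, hr, hred, hrA⟩ := exists_reduced_walk (hG.not_separating x.1 (G.start (x.1, !x.2)) G.base)
  refine ⟨r, ⟨rfl, hr⟩, List.isChain_cons.2 ⟨fun y hy h => ?_, hred⟩⟩
  exact absurd h.symm (hrA y (List.mem_of_mem_head? hy))

theorem isReduced_invRev {α : Type*} {w : List (α × Bool)} (h : FreeGroup.IsReduced w) :
    FreeGroup.IsReduced (FreeGroup.invRev w) := by
  rw [FreeGroup.IsReduced, FreeGroup.invRev, List.isChain_reverse, List.isChain_map]
  exact h.imp fun a b hab h1 => congrArg Bool.not (hab h1.symm).symm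

section Rigidity

variable {Γ : BasedGraph} {F F' : Set G.E} (φ : Iso (G.collapse F) Γ) (φ' : Iso (G.collapse F') Γ)

/-- Both labels are reduced words for the same element of the free group. -/
theorem lab_eq_of_closed (hF : G.IsForest F) (hF' : G.IsForest F')
    (h : ∀ g ∈ G.fundamentalGroup, φ.hom (G.collapseHom F g) = φ'.hom (G.collapseHom F' g))
    {w : List (G.E × Bool)} (hw : G.IsWalk G.base w G.base) (hr : FreeGroup.IsReduced w) :
    w.filterMap (lab φ) = w.filterMap (lab φ') := by
  have := h _ ⟨w, hw, rfl⟩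
  rw [hom_collapseHom, hom_collapseHom] at this
  exact eq_of_isReduced (isReduced_lab φ hF hw hr) (isReduced_lab φ' hF' hw hr) this

/-- If the end `u` of `s` is not the base vertex, it has valence at least three, so `s` has two
different reduced continuations `r₁`, `r₂` back to the base. The closed walks `s r₁`, `s r₂` and
`r₁⁻¹ r₂` are reduced and have equal labels under both collapses; the three lengths determine the
length of the label of `s`, which is therefore the same prefix in both cases. -/
theorem lab_eq_of_walk (hG : G.IsReduced) (hF : G.IsForest F) (hF' : G.IsForest F')
    (h : ∀ g ∈ G.fundamentalGroup, φ.hom (G.collapseHom F g) = φ'.hom (G.collapseHom F' g))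
    {s : List (G.E × Bool)} {u : G.V} (hs : G.IsWalk G.base s u) (hr : FreeGroup.IsReduced s) :
    s.filterMap (lab φ) = s.filterMap (lab φ') := by
  by_cases hu : u = G.base
  · subst hu
    exact lab_eq_of_closed φ φ' hF hF' h hs hr
  obtain ⟨y₁, y₂, hy₁, hy₂, hne, hs₁, hs₂⟩ : ∃ y₁ y₂ : G.E × Bool, G.start y₁ = u ∧
      G.start y₂ = u ∧ y₁ ≠ y₂ ∧ (∀ x ∈ s.getLast?, x.1 = y₁.1 → x.2 = y₁.2) ∧
        ∀ x ∈ s.getLast?, x.1 = y₂.1 → x.2 = y₂.2 := by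
    have h3 := hG.valence_ne_base u hu
    rw [← ncard_start] at h3
    have h4 : ∃ z : G.E × Bool, ∀ y, y ≠ z → ∀ x ∈ s.getLast?, x.1 = y.1 → x.2 = y.2 := by
      cases hl : s.getLast? with
      | none =>
        have : Nonempty {x : G.E × Bool | G.start x = u} := by
          rw [Set.nonempty_coe_sort, ← Set.ncard_pos]
          omega
        exact ⟨this.some, by simp⟩
      | some x =>
        refine ⟨(x.1, !x.2), fun y hy x' hx' h1 => ?_⟩
        obtain rfl : x = x' := by simpa using hx'
        by_contra h2
        exact hy (Prod.ext h1.symm (Bool.eq_not.2 (Ne.symm h2)))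
    obtain ⟨z, hz⟩ := h4
    have h5 : 1 < ({x : G.E × Bool | G.start x = u} \ {z}).ncard := by
      have := Set.ncard_le_ncard_sdiff_add_ncard {x : G.E × Bool | G.start x = u} {z}
      rw [Set.ncard_singleton] at this
      omega
    obtain ⟨y₁, hy₁, y₂, hy₂, hne⟩ := (Set.one_lt_ncard).1 h5
    exact ⟨y₁, y₂, hy₁.1, hy₂.1, hne, hz _ hy₁.2, hz _ hy₂.2⟩
  obtain ⟨r₁, hw₁, hr₁⟩ := hG.exists_return y₁
  obtain ⟨r₂, hw₂, hr₂⟩ := hG.exists_return y₂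
  rw [hy₁] at hw₁
  rw [hy₂] at hw₂
  have e1 := lab_eq_of_closed φ φ' hF hF' h (hs.append hw₁)
    (isReduced_append_iff.2 ⟨hr, hr₁, by simpa using hs₁⟩)
  have e2 := lab_eq_of_closed φ φ' hF hF' h (hs.append hw₂)
    (isReduced_append_iff.2 ⟨hr, hr₂, by simpa using hs₂⟩)
  have hinv : FreeGroup.invRev (y₁ :: r₁) = FreeGroup.invRev r₁ ++ [(y₁.1, !y₁.2)] := by
    simp [FreeGroup.invRev]
  have e3 := lab_eq_of_closed φ φ' hF hF' h (hw₁.invRev.append hw₂)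
    (isReduced_append_iff.2 ⟨isReduced_invRev hr₁, hr₂, by
      rw [hinv]
      simp only [List.getLast?_append, List.getLast?_singleton, Option.some_or, Option.mem_def,
        Option.some_inj, List.head?_cons, forall_eq']
      intro h1
      by_contra h2
      exact hne (Prod.ext h1 (by simpa using h2))⟩)
  have hlen : ∀ {Δ : BasedGraph} {B : Set G.E} (χ : Iso (G.collapse B) Δ) (l : List (G.E × Bool)),
      ((FreeGroup.invRev l).filterMap (lab χ)).length = (l.filterMap (lab χ)).length := by
    intro Δ B χ l
    induction l with
    | nil => rfl
    | cons x l ih =>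
      rw [show FreeGroup.invRev (x :: l) = FreeGroup.invRev l ++ [(x.1, !x.2)] by
        simp [FreeGroup.invRev], List.filterMap_append, List.length_append, ih]
      by_cases hx : x.1 ∈ B
      · rw [List.filterMap_cons_none (lab_of_mem χ hx),
          List.filterMap_cons_none (lab_of_mem χ (x := (x.1, !x.2)) hx)]
        rfl
      · rw [List.filterMap_cons_some (lab_of_notMem χ hx),
          List.filterMap_cons_some (lab_of_notMem χ (x := (x.1, !x.2)) hx)]
        rfl
  rw [List.filterMap_append, List.filterMap_append] at e1 e2 e3
  have l1 := congrArg List.length e1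
  have l2 := congrArg List.length e2
  have l3 := congrArg List.length e3
  simp only [List.length_append, hlen] at l1 l2 l3
  exact (List.append_inj e1 (by omega)).1

/-- A marked reduced graph has at most one collapse to a given marked graph. -/
theorem lab_unique (hG : G.IsReduced) (hF : G.IsForest F) (hF' : G.IsForest F')
    (h : ∀ g ∈ G.fundamentalGroup, φ.hom (G.collapseHom F g) = φ'.hom (G.collapseHom F' g)) :
    lab φ = lab φ' := by
  have key : ∀ (s : List (G.E × Bool)) (x : G.E × Bool) (u : G.V), G.IsWalk G.base (s ++ [x]) u →
      FreeGroup.IsReduced (s ++ [x]) → lab φ x = lab φ' x := fun s x u hs hr => by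
    have h1 := lab_eq_of_walk φ φ' hG hF hF' h hs hr
    obtain ⟨z, hz, _⟩ := isWalk_append_iff.1 hs
    have h2 := lab_eq_of_walk φ φ' hG hF hF' h hz (hr.infix ⟨[], [x], by simp⟩)
    rw [List.filterMap_append, List.filterMap_append, h2] at h1
    have h3 := List.append_cancel_left h1
    cases hx : lab φ x <;> cases hx' : lab φ' x <;> simp_all
  have key2 : ∀ x : G.E × Bool, lab φ x = lab φ' x → lab φ (x.1, !x.2) = lab φ' (x.1, !x.2) :=
    fun x hx => by
    cases hl : lab φ x with
    | none =>
      have h1 : x.1 ∈ F := (lab_eq_none φ).1 hl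
      have h2 : x.1 ∈ F' := (lab_eq_none φ').1 (hx ▸ hl)
      rw [lab_of_mem φ (x := (x.1, !x.2)) h1, lab_of_mem φ' (x := (x.1, !x.2)) h2]
    | some y => rw [lab_not φ hl, lab_not φ' (hx ▸ hl)]
  -- A reduced walk to the source of `e` either can be continued by `e`, or ends with the reverse of
  -- `e`; in both cases some orientation of `e` is the last letter of a reduced walk.
  have key3 : ∀ e, lab φ (e, true) = lab φ' (e, true) := fun e => by
    obtain ⟨r, hw, hr, _⟩ := exists_reduced_walk (hG.connected G.base (G.src e))
    by_cases hlast : ∀ x ∈ r.getLast?, x.1 = e → x.2 = true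
    · exact key r (e, true) _ (hw.append ⟨rfl, rfl⟩)
        (isReduced_append_iff.2 ⟨hr, FreeGroup.IsReduced.singleton, by simpa using hlast⟩)
    · push Not at hlast
      obtain ⟨⟨x1, x2⟩, hx, h1, h2⟩ := hlast
      obtain rfl : x1 = e := h1
      obtain rfl : x2 = false := by simpa using h2
      obtain ⟨s, rfl⟩ := List.getLast?_eq_some_iff.1 hx
      exact key2 (x1, false) (key s _ _ hw hr)
  funext ⟨e, b⟩
  cases b
  · exact key2 (e, true) (key3 e)
  · exact key3 e

end Rigidity

end BasedGraph


/-! ### Separation in cactus graphs -/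

namespace BasedGraph

variable {G : BasedGraph}

/-- Connected cactus graphs. -/
structure IsConnectedCactus (G : BasedGraph) : Prop where
  cactus : G.IsCactus
  conn : ∀ u v, G.joinedIn Set.univ u v

theorem pt_injective : Function.Injective G.pt := fun u v h => by
  classical
  by_contra hne
  have := congrFun h u
  simp [pt, Pi.single_eq_of_ne hne] at this

theorem pt_add_eq_zero {u v : G.V} (h : G.pt u + G.pt v = 0) : u = v := by
  refine pt_injective ?_
  funext w
  exact CharTwo.add_eq_zero.1 (congrFun h w)

theorem eq_of_joinedIn_empty {u v : G.V} (h : G.joinedIn ∅ u v) : u = v := by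
  obtain ⟨x, hx, hb⟩ := joinedIn_iff.1 h
  have : x = 0 := funext fun e => by
    by_contra h
    exact hx e h
  rw [this, map_zero] at hb
  exact pt_add_eq_zero hb.symm

theorem joinedIn_trans {A : Set G.E} {u v w : G.V} (h : G.joinedIn A u v) (h' : G.joinedIn A v w) :
    G.joinedIn A u w := Setoid.trans' _ h h'

theorem joinedIn_symm {A : Set G.E} {u v : G.V} (h : G.joinedIn A u v) : G.joinedIn A v u :=
  Setoid.symm' _ h

theorem joinedIn_refl {A : Set G.E} (u : G.V) : G.joinedIn A u u := Setoid.refl' _ u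

/-- A vertex without edges in `A` is joined to no other vertex. -/
theorem eq_of_joinedIn_isolated {A : Set G.E} {u v : G.V}
    (hv : ∀ e ∈ A, G.src e ≠ v ∧ G.tgt e ≠ v) (h : G.joinedIn A u v) : u = v := by
  suffices ∀ a b, G.joinedIn A a b → (a = v ↔ b = v) from (this u v h).2 rfl
  intro a b h
  induction h with
  | rel a b h =>
    obtain ⟨e, he, rfl, rfl⟩ := h
    exact iff_of_false (hv e he).1 (hv e he).2
  | refl a => exact Iff.rfl
  | symm a b _ ih => exact ih.symm
  | trans a b c _ _ ih ih' => exact ih.trans ih'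

/-- Whether `A` can be reached without using its edges is the same for both ends of every edge,
hence for all vertices of a connected graph. -/
theorem exists_gate (hc : ∀ u v, G.joinedIn Set.univ u v) {A : Set G.E} (hA : A.Nonempty)
    (v : G.V) : ∃ w ∈ G.verts A, G.joinedIn Aᶜ v w := by
  obtain ⟨e, he⟩ := hA
  suffices ∀ a b, G.joinedIn Set.univ a b → ((∃ w ∈ G.verts A, G.joinedIn Aᶜ a w) ↔
      ∃ w ∈ G.verts A, G.joinedIn Aᶜ b w) from
    (this v _ (hc v (G.src e))).2 ⟨_, ⟨e, he, Or.inl rfl⟩, joinedIn_refl _⟩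
  intro a b h
  induction h with
  | rel a b h =>
    obtain ⟨e, _, rfl, rfl⟩ := h
    by_cases heA : e ∈ A
    · exact iff_of_true ⟨_, ⟨e, heA, Or.inl rfl⟩, joinedIn_refl _⟩
        ⟨_, ⟨e, heA, Or.inr rfl⟩, joinedIn_refl _⟩
    · have := joinedIn_edge (A := Aᶜ) heA
      exact exists_congr fun w => and_congr_right fun _ =>
        ⟨fun h => joinedIn_trans (joinedIn_symm this) h, fun h => joinedIn_trans this h⟩
  | refl a => exact Iff.rfl
  | symm a b _ ih => exact ih.symm
  | trans a b c _ _ ih ih' => exact ih.trans ih'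

/-- Vertices of a cycle that are joined are joined within the cycle. -/
theorem IsCactus.joinedIn_inter (hG : G.IsCactus) {C B : Set G.E} (hC : G.IsCycle C) {u v : G.V}
    (hu : u ∈ G.verts C) (hv : v ∈ G.verts C) (h : G.joinedIn B u v) : G.joinedIn (B ∩ C) u v := by
  obtain ⟨x, hx, hxb⟩ := joinedIn_iff.1 h
  obtain ⟨z, hz, hzb⟩ := joinedIn_iff.1 (hC.joinedIn hu hv)
  have h0 : G.bdry (x + z) = 0 := by rw [map_add, hxb, hzb, add_self_fun]
  refine joinedIn_iff.2 ⟨fun e => x e * G.chain C e, fun e he => ⟨hx e (left_ne_zero_of_mul he),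
    chain_ne_zero.1 (right_ne_zero_of_mul he)⟩, ?_⟩
  obtain ⟨e, he⟩ := hC.nonempty
  have hz0 : ∀ a ∉ C, z a = 0 := fun a ha => not_imp_comm.1 (hz a) ha
  -- The closed chain `x + z` is constant on `C`. So on `C` the chain `x` equals either `z` or its
  -- complement `z + chain C`, and both have the boundary of `z`.
  by_cases h1 : (x + z) e = 0
  · rw [← hzb]
    refine congrArg _ (funext fun a => ?_)
    by_cases ha : a ∈ C
    · rw [chain_of_mem ha, mul_one]
      have := hG.closed_const h0 hC ha he
      rw [h1] at this
      exact CharTwo.add_eq_zero.1 this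
    · rw [chain_of_notMem ha, mul_zero, hz0 a ha]
  · rw [← hzb, ← add_zero (G.bdry z), ← hC.bdry_chain, ← map_add]
    refine congrArg _ (funext fun a => ?_)
    by_cases ha : a ∈ C
    · rw [Pi.add_apply, chain_of_mem ha, mul_one]
      have := hG.closed_const h0 hC ha he
      rw [zmod_two_eq_one h1, Pi.add_apply] at this
      rw [← this, add_comm (x a), ← add_assoc, CharTwo.add_self_eq_zero, zero_add]
    · rw [Pi.add_apply, chain_of_notMem ha, mul_zero, hz0 a ha, zero_add]

theorem IsCactus.eq_of_joinedIn_compl (hG : G.IsCactus) {C : Set G.E} (hC : G.IsCycle C) {u v : G.V}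
    (hu : u ∈ G.verts C) (hv : v ∈ G.verts C) (h : G.joinedIn Cᶜ u v) : u = v := by
  have := hG.joinedIn_inter hC hu hv h
  rw [Set.compl_inter_self] at this
  exact eq_of_joinedIn_empty this

open Classical in
/-- The vertex of a cycle that is nearest to `v`. -/
noncomputable def gate (G : BasedGraph) (C : Set G.E) (v : G.V) : G.V :=
  if h : ∃ w ∈ G.verts C, G.joinedIn Cᶜ v w then h.choose else v

/-- The vertex of a cycle that is nearest to the base vertex. -/
noncomputable def root (G : BasedGraph) (C : Set G.E) : G.V := G.gate C G.base

theorem IsCactus.disjoint_cycles (hG : G.IsCactus) {C D : Set G.E} (hC : G.IsCycle C)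
    (hD : G.IsCycle D) (h : C ≠ D) : C ⊆ Dᶜ := fun _ he he' => h (hG.cycle_eq hC hD he he')

/-- The cycles that separate `v` from the base vertex after the collapse of `F`. -/
def sepSet (G : BasedGraph) (F : Set G.E) (v : G.V) : Set (Set G.E) :=
  {C | G.IsCycle C ∧ ¬ G.joinedIn (Cᶜ ∪ F) G.base v}

/-- The depth of a vertex in the collapse of `F`. -/
noncomputable def depth (G : BasedGraph) (F : Set G.E) (v : G.V) : ℕ := (G.sepSet F v).ncard

namespace IsConnectedCactus

variable {C D F : Set G.E} {u v : G.V}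

theorem gate_spec (h : G.IsConnectedCactus) (hC : G.IsCycle C) (v : G.V) :
    G.gate C v ∈ G.verts C ∧ G.joinedIn Cᶜ v (G.gate C v) := by
  have := exists_gate h.conn hC.nonempty v
  rw [gate, dif_pos this]
  exact this.choose_spec

theorem gate_eq (h : G.IsConnectedCactus) (hC : G.IsCycle C) (hu : u ∈ G.verts C)
    (hj : G.joinedIn Cᶜ v u) : G.gate C v = u :=
  h.cactus.eq_of_joinedIn_compl hC (h.gate_spec hC v).1 hu
    (joinedIn_trans (joinedIn_symm (h.gate_spec hC v).2) hj)

theorem gate_of_mem (h : G.IsConnectedCactus) (hC : G.IsCycle C) (hu : u ∈ G.verts C) :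
    G.gate C u = u := h.gate_eq hC hu (joinedIn_refl u)

theorem root_mem (h : G.IsConnectedCactus) (hC : G.IsCycle C) : G.root C ∈ G.verts C :=
  (h.gate_spec hC _).1

theorem joinedIn_root (h : G.IsConnectedCactus) (hC : G.IsCycle C) :
    G.joinedIn Cᶜ G.base (G.root C) := (h.gate_spec hC _).2

/-- The base vertex reaches the root, and `v` its gate, outside `C`; what remains to be decided
takes place inside the cycle. -/
theorem joinedIn_union_iff (h : G.IsConnectedCactus) (hC : G.IsCycle C) :
    G.joinedIn (Cᶜ ∪ F) G.base v ↔ G.joinedIn (C ∩ F) (G.root C) (G.gate C v) := by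
  have h1 : G.joinedIn (Cᶜ ∪ F) G.base (G.root C) :=
    joinedIn_mono Set.subset_union_left (h.joinedIn_root hC)
  have h2 : G.joinedIn (Cᶜ ∪ F) v (G.gate C v) :=
    joinedIn_mono Set.subset_union_left (h.gate_spec hC v).2
  constructor
  · intro hj
    have := h.cactus.joinedIn_inter hC (h.root_mem hC) (h.gate_spec hC v).1
      (joinedIn_trans (joinedIn_symm h1) (joinedIn_trans hj h2))
    refine joinedIn_mono ?_ this
    rintro e ⟨he | he, heC⟩
    exacts [absurd heC he, ⟨heC, he⟩]
  · intro hj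
    exact joinedIn_trans h1 (joinedIn_trans (joinedIn_mono
      (Set.inter_subset_right.trans Set.subset_union_right) hj) (joinedIn_symm h2))

/-- Every vertex that is not the base vertex has a unique parent cycle. -/
theorem exists_parent (h : G.IsConnectedCactus) (hv : v ≠ G.base) :
    ∃ C, G.IsCycle C ∧ v ∈ G.verts C ∧ G.root C ≠ v := by
  let A : Set G.E := {e | G.src e = v ∨ G.tgt e = v}
  have hA : ∀ e ∈ Aᶜ, G.src e ≠ v ∧ G.tgt e ≠ v := fun e he =>
    ⟨fun h => he (Or.inl h), fun h => he (Or.inr h)⟩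
  have hne : A.Nonempty := by
    by_contra hn
    rw [Set.not_nonempty_iff_eq_empty] at hn
    refine hv (eq_of_joinedIn_isolated (A := Set.univ) (fun e _ => hA e ?_) (h.conn G.base v)).symm
    rw [hn]
    exact fun h => h
  -- `e` is an edge at `v` that can be reached from the base vertex at its other end without passing
  -- through `v`; its cycle is the parent. Were `v` its root, the two ends of `e` would be joined in
  -- the cycle by edges away from `v`.
  obtain ⟨w, ⟨e, heA, hew⟩, hj⟩ := exists_gate h.conn hne G.base
  have hwv : w ≠ v := by
    rintro rfl
    exact hv (eq_of_joinedIn_isolated hA hj).symm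
  have hC := h.cactus.isCycle_cyc e
  have he := h.cactus.mem_cyc e
  refine ⟨_, hC, ⟨e, he, heA⟩, fun hroot => hwv ?_⟩
  have h1 : G.joinedIn (Aᶜ ∪ (h.cactus.cyc e)ᶜ) w v := by
    refine joinedIn_trans (joinedIn_symm (joinedIn_mono Set.subset_union_left hj))
      (joinedIn_mono Set.subset_union_right ?_)
    have := h.joinedIn_root hC
    rwa [hroot] at this
  refine eq_of_joinedIn_isolated (fun a ha => ?_)
    (h.cactus.joinedIn_inter hC ⟨e, he, hew⟩ ⟨e, he, heA⟩ h1)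
  exact hA a (ha.1.resolve_right fun h' => h' ha.2)

/-- Let the base vertex first reach `C ∪ D` on `C`, say. Continuing inside `C` to `v` avoids `D`, so
`v` is the root of `D`. -/
theorem parent_unique (h : G.IsConnectedCactus) (hC : G.IsCycle C) (hD : G.IsCycle D)
    (hvC : v ∈ G.verts C) (hvD : v ∈ G.verts D) (hrC : G.root C ≠ v) (hrD : G.root D ≠ v) :
    C = D := by
  by_contra hne
  have key : ∀ {C D : Set G.E}, G.IsCycle C → G.IsCycle D → v ∈ G.verts C → v ∈ G.verts D →
      G.root D ≠ v → C ≠ D → ∀ w ∈ G.verts C, ¬ G.joinedIn (C ∪ D)ᶜ G.base w := by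
    intro C D hC hD hvC hvD hrD hne w hw hj
    refine hrD (h.gate_eq hD hvD (joinedIn_trans (v := w) (joinedIn_mono ?_ hj) ?_))
    · exact fun e he he' => he (Or.inr he')
    · exact joinedIn_mono (h.cactus.disjoint_cycles hC hD hne) (hC.joinedIn hw hvC)
  obtain ⟨w, ⟨e, he, hw⟩, hj⟩ := exists_gate h.conn (A := C ∪ D)
    (hC.nonempty.mono Set.subset_union_left) G.base
  rcases he with he | he
  · exact key hC hD hvC hvD hrD hne w ⟨e, he, hw⟩ hj
  · rw [Set.union_comm] at hj
    exact key hD hC hvD hvC hrC (Ne.symm hne) w ⟨e, he, hw⟩ hj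

theorem mem_sepSet_iff (h : G.IsConnectedCactus) (hC : G.IsCycle C) :
    C ∈ G.sepSet F v ↔ ¬ G.joinedIn (C ∩ F) (G.root C) (G.gate C v) :=
  (and_iff_right hC).trans (not_congr (h.joinedIn_union_iff hC))

/-- Two vertices of `C` are joined inside `C`, which no other cycle `D` can interrupt. -/
theorem mem_sepSet_congr (h : G.IsConnectedCactus) (hC : G.IsCycle C) (hu : u ∈ G.verts C)
    (hv : v ∈ G.verts C) (hD : G.IsCycle D) (hne : C ≠ D) : D ∈ G.sepSet F u ↔ D ∈ G.sepSet F v := by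
  have h1 : G.joinedIn (Dᶜ ∪ F) u v := joinedIn_mono
    ((h.cactus.disjoint_cycles hC hD hne).trans Set.subset_union_left) (hC.joinedIn hu hv)
  exact and_congr_right fun _ => not_congr ⟨fun h => joinedIn_trans h h1,
    fun h => joinedIn_trans h (joinedIn_symm h1)⟩

theorem depth_of_joined
    (hj : G.joinedIn (C ∩ F) (G.root C) v) : G.depth F v = G.depth F (G.root C) := by
  refine congrArg Set.ncard (Set.ext fun D => ?_)
  by_cases hD : G.IsCycle D
  · have h1 : G.joinedIn (Dᶜ ∪ F) (G.root C) v := joinedIn_mono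
      (Set.inter_subset_right.trans Set.subset_union_right) hj
    exact and_congr_right fun _ => not_congr ⟨fun h => joinedIn_trans h (joinedIn_symm h1),
      fun h => joinedIn_trans h h1⟩
  · exact iff_of_false (fun h => hD h.1) fun h => hD h.1

/-- Passing from the root of `C` to `v` changes the set of separating cycles only by `C` itself. -/
theorem depth_of_not_joined (h : G.IsConnectedCactus) (hC : G.IsCycle C) (hv : v ∈ G.verts C)
    (hj : ¬ G.joinedIn (C ∩ F) (G.root C) v) : G.depth F v = G.depth F (G.root C) + 1 := by
  have h1 : C ∉ G.sepSet F (G.root C) := fun h' => h'.2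
    (joinedIn_mono Set.subset_union_left (h.joinedIn_root hC))
  rw [depth, depth, ← Set.ncard_insert_of_notMem h1 (Set.toFinite _)]
  refine congrArg Set.ncard (Set.ext fun D => ?_)
  rw [Set.mem_insert_iff]
  by_cases hDC : D = C
  · subst hDC
    refine iff_of_true ((h.mem_sepSet_iff hC).2 ?_) (Or.inl rfl)
    rwa [h.gate_of_mem hC hv]
  · rw [or_iff_right hDC]
    by_cases hD : G.IsCycle D
    · exact h.mem_sepSet_congr hC hv (h.root_mem hC) hD (Ne.symm hDC)
    · exact iff_of_false (fun h => hD h.1) fun h => hD h.1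

theorem depth_base (F : Set G.E) : G.depth F G.base = 0 := by
  rw [depth, show G.sepSet F G.base = ∅ from
    Set.eq_empty_of_forall_notMem fun C hC => hC.2 (joinedIn_refl _), Set.ncard_empty]

theorem depth_succ (h : G.IsConnectedCactus) (hC : G.IsCycle C) (hv : v ∈ G.verts C)
    (hr : G.root C ≠ v) : G.depth ∅ v = G.depth ∅ (G.root C) + 1 := by
  refine h.depth_of_not_joined hC hv fun hj => hr ?_
  rw [Set.inter_empty] at hj
  exact eq_of_joinedIn_empty hj

/-- Induction along the parent cycles. -/
theorem parent_induction (h : G.IsConnectedCactus) {P : G.V → Prop} (base : P G.base)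
    (step : ∀ C v, G.IsCycle C → v ∈ G.verts C → G.root C ≠ v → P (G.root C) → P v) (v : G.V) :
    P v := by
  induction hn : G.depth ∅ v using Nat.strong_induction_on generalizing v with
  | _ n ih =>
    by_cases hv : v = G.base
    · exact hv ▸ base
    · obtain ⟨C, hC, hvC, hr⟩ := h.exists_parent hv
      exact step C v hC hvC hr (ih _ (by rw [← hn, h.depth_succ hC hvC hr]; omega) _ rfl)

/-- Along the parent cycles of `v` the separating set grows by one cycle at a time, so a separating
cycle `D` is one of these, and its root lies below `v`. -/
theorem root_mem_sepSet (h : G.IsConnectedCactus) (hD : D ∈ G.sepSet ∅ v) :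
    G.depth ∅ (G.root D) + 1 ≤ G.depth ∅ v := by
  induction v using h.parent_induction with
  | base => exact absurd (joinedIn_refl _) hD.2
  | step C v hC hvC hr ih =>
    by_cases hDC : C = D
    · subst hDC
      exact (h.depth_succ hC hvC hr).ge
    · have := ih ((h.mem_sepSet_congr hC hvC (h.root_mem hC) hD.1 hDC).1 hD)
      rw [h.depth_succ hC hvC hr]
      omega

/-! Distances -/

theorem exists_first {a v : G.V} {l : List (G.E × Bool)} (hl : G.IsWalk a l v)
    (hx : ∃ x ∈ l, x.1 ∈ C) : ∃ z ∈ G.verts C, ∃ l₁ l₂, l = l₁ ++ l₂ ∧ G.IsWalk a l₁ z ∧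
      G.IsWalk z l₂ v ∧ (∀ x ∈ l₁, x.1 ∈ Cᶜ) ∧ ∃ x ∈ l₂, x.1 ∈ C := by
  induction l generalizing a with
  | nil => simp at hx
  | cons x l ih =>
    by_cases hxC : x.1 ∈ C
    · refine ⟨a, ⟨x.1, hxC, ?_⟩, [], x :: l, rfl, rfl, hl, by simp, x, List.mem_cons_self, hxC⟩
      rw [← hl.1]
      obtain ⟨e, b⟩ := x
      cases b
      exacts [Or.inr rfl, Or.inl rfl]
    · obtain ⟨y, hy, hyC⟩ := hx
      have hyl : y ∈ l := (List.mem_cons.1 hy).resolve_left fun h => hxC (h ▸ hyC)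
      obtain ⟨z, hz, l₁, l₂, rfl, h1, h2, h3, h4⟩ := ih hl.2 ⟨y, hyl, hyC⟩
      exact ⟨z, hz, x :: l₁, l₂, rfl, ⟨hl.1, h1⟩, h2, by simpa [hxC] using h3, h4⟩

theorem exists_last {a v : G.V} {l : List (G.E × Bool)} (hl : G.IsWalk a l v)
    (hx : ∃ x ∈ l, x.1 ∈ C) : ∃ z ∈ G.verts C, ∃ l', G.IsWalk z l' v ∧ (∀ x ∈ l', x.1 ∈ Cᶜ) ∧
      l'.length < l.length := by
  induction l generalizing a with
  | nil => simp at hx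
  | cons x l ih =>
    by_cases hxl : ∃ y ∈ l, y.1 ∈ C
    · obtain ⟨z, hz, l', h1, h2, h3⟩ := ih hl.2 hxl
      exact ⟨z, hz, l', h1, h2, h3.trans (Nat.lt_succ_self _)⟩
    · obtain ⟨y, hy, hyC⟩ := hx
      have hyx : y = x := (List.mem_cons.1 hy).resolve_right fun h => hxl ⟨y, h, hyC⟩
      subst hyx
      refine ⟨_, ⟨y.1, hyC, ?_⟩, l, hl.2, fun x hx hxC => hxl ⟨x, hx, hxC⟩, Nat.lt_succ_self _⟩
      obtain ⟨e, b⟩ := y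
      cases b
      exacts [Or.inl rfl, Or.inr rfl]

/-- A geodesic from the base vertex meets exactly the separating cycles. If it met another cycle
`C`, the vertices where it first reaches and last leaves `C` would be joined outside `C`, hence
equal, and the walk could be shortened. -/
theorem dist_base (h : G.IsConnectedCactus) (v : G.V) : G.dist G.base v = G.depth ∅ v := by
  have key : ∀ w, G.IsGeodesic G.base w v →
      {C | G.IsCycle C ∧ ∃ x ∈ w, x.1 ∈ C} = G.sepSet ∅ v := by
    rintro w ⟨hw, hmin⟩
    ext C
    refine and_congr_right fun hC => ?_
    rw [Set.union_empty]
    constructor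
    · intro hx hj
      obtain ⟨z, hz, l₁, l₂, rfl, h1, h2, h3, h4⟩ := exists_first hw hx
      obtain ⟨z', hz', l', h1', h3', h4'⟩ := exists_last h2 h4
      have e1 := h.cactus.eq_of_joinedIn_compl hC hz hz' (joinedIn_trans
        (joinedIn_symm (h1.joinedIn h3)) (joinedIn_trans hj (joinedIn_symm (h1'.joinedIn h3'))))
      subst e1
      have := hmin _ (h1.append h1')
      simp only [List.length_append] at this
      omega
    · intro hj
      by_contra hx
      push Not at hx
      exact hj (hw.joinedIn hx)
  obtain ⟨w₀, hw₀, _⟩ := exists_walk (h.conn G.base v)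
  have hex : ∃ w, G.IsGeodesic G.base w v := by
    classical
    have hn : ∃ n, ∃ w, G.IsWalk G.base w v ∧ w.length = n := ⟨_, w₀, hw₀, rfl⟩
    obtain ⟨w, hw, hl⟩ := Nat.find_spec hn
    exact ⟨w, hw, fun w' hw' => hl ▸ Nat.find_min' hn ⟨w', hw', rfl⟩⟩
  rw [dist]
  have : {k | ∃ w, G.IsGeodesic G.base w v ∧
      k = {C | G.IsCycle C ∧ ∃ x ∈ w, x.1 ∈ C}.ncard} = {G.depth ∅ v} := by
    ext k
    constructor
    · rintro ⟨w, hw, rfl⟩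
      rw [key w hw]
      rfl
    · rintro rfl
      obtain ⟨w, hw⟩ := hex
      exact ⟨w, hw, by rw [key w hw]; rfl⟩
  rw [this, csInf_singleton]

theorem isBaseOf_iff (h : G.IsConnectedCactus) (hC : G.IsCycle C) :
    G.IsBaseOf v C ↔ v = G.root C := by
  rw [IsBaseOf]
  simp only [h.dist_base]
  constructor
  · rintro ⟨hv, hlt⟩
    by_contra hne
    have h1 := hlt _ (h.root_mem hC) (Ne.symm hne)
    rw [h.depth_succ hC hv (Ne.symm hne)] at h1
    omega
  · rintro rfl
    exact ⟨h.root_mem hC, fun u hu hne => by rw [h.depth_succ hC hu (Ne.symm hne)]; omega⟩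

theorem localCoweight_eq (h : G.IsConnectedCactus) (i : ℕ) :
    G.localCoweight i = {C | G.IsCycle C ∧ G.depth ∅ (G.root C) ≠ i}.ncard := by
  refine congrArg Set.ncard (Set.ext fun C => and_congr_right fun hC => not_congr ?_)
  simp only [h.isBaseOf_iff hC, exists_eq_right, level, Set.mem_ofPred_eq, h.dist_base]

theorem level_eq (h : G.IsConnectedCactus) (i : ℕ) : G.level i = {v | G.depth ∅ v = i} := by
  ext v
  simp only [level, Set.mem_ofPred_eq, h.dist_base]

/-! Collapses -/

theorem collapse (h : G.IsConnectedCactus) (F : Set G.E) : (G.collapse F).IsConnectedCactus :=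
  ⟨h.cactus.collapse F, collapse_connected h.conn⟩

theorem restr_joinedIn_iff {u v : G.V} :
    (G.collapse F).joinedIn (G.restr F C)ᶜ (G.proj F u) (G.proj F v) ↔
      G.joinedIn (Cᶜ ∪ F) u v := by
  rw [collapse_joinedIn_iff]
  refine iff_of_eq (congrArg (fun A => G.joinedIn A u v) ?_)
  · ext e
    constructor
    · rintro (⟨e, he, rfl⟩ | he)
      exacts [Or.inl he, Or.inr he]
    · rintro (he | he)
      · by_cases heF : e ∈ F
        · exact Or.inr heF
        · exact Or.inl ⟨⟨e, heF⟩, he, rfl⟩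
      · exact Or.inr he

/-- The cycles of the collapse are the traces of the cycles of `G`, and the trace of `C` separates
exactly if `Cᶜ ∪ F` does not join. This makes all entries of the height of a collapse computable in
`G`. -/
theorem depth_proj (h : G.IsConnectedCactus) (hF : G.IsForest F) (v : G.V) :
    (G.collapse F).depth ∅ (G.proj F v) = G.depth F v := by
  have : (G.collapse F).sepSet ∅ (G.proj F v) = G.restr F '' G.sepSet F v := by
    ext D
    constructor
    · rintro ⟨hD, hj⟩
      obtain ⟨C, hC, rfl⟩ := (restr_isCycle_iff h.cactus hF).1 hD
      rw [Set.union_empty] at hj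
      exact ⟨C, ⟨hC, fun h' => hj (restr_joinedIn_iff.2 h')⟩, rfl⟩
    · rintro ⟨C, ⟨hC, hj⟩, rfl⟩
      refine ⟨hC.restr h.cactus (hF C hC), fun h' => hj (restr_joinedIn_iff.1 ?_)⟩
      rwa [Set.union_empty] at h'
  rw [depth, this]
  exact Set.InjOn.ncard_image fun C hC D hD hCD => restr_injective h.cactus hF hC.1 hD.1 hCD

theorem root_restr (h : G.IsConnectedCactus) (hF : G.IsForest F) (hC : G.IsCycle C) :
    (G.collapse F).root (G.restr F C) = G.proj F (G.root C) := by
  refine (h.collapse F).gate_eq (hC.restr h.cactus (hF C hC))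
    (mem_verts_restr hC (hF C hC) (h.root_mem hC)) ?_
  exact restr_joinedIn_iff.2 (joinedIn_mono Set.subset_union_left (h.joinedIn_root hC))

theorem localCoweight_collapse (h : G.IsConnectedCactus) (hF : G.IsForest F) (i : ℕ) :
    (G.collapse F).localCoweight i =
      {C | G.IsCycle C ∧ G.depth F (G.root C) ≠ i}.ncard := by
  rw [(h.collapse F).localCoweight_eq]
  have : {D | (G.collapse F).IsCycle D ∧ (G.collapse F).depth ∅ ((G.collapse F).root D) ≠ i} =
      G.restr F '' {C | G.IsCycle C ∧ G.depth F (G.root C) ≠ i} := by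
    ext D
    constructor
    · rintro ⟨hD, hj⟩
      obtain ⟨C, hC, rfl⟩ := (restr_isCycle_iff h.cactus hF).1 hD
      rw [h.root_restr hF hC, h.depth_proj hF] at hj
      exact ⟨C, ⟨hC, hj⟩, rfl⟩
    · rintro ⟨C, ⟨hC, hj⟩, rfl⟩
      refine ⟨hC.restr h.cactus (hF C hC), ?_⟩
      rwa [h.root_restr hF hC, h.depth_proj hF]
  rw [this]
  exact Set.InjOn.ncard_image fun C hC D hD hCD => restr_injective h.cactus hF hC.1 hD.1 hCD

theorem level_collapse (h : G.IsConnectedCactus) (hF : G.IsForest F) (i : ℕ) :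
    (G.collapse F).level i = G.proj F '' {v | G.depth F v = i} := by
  rw [(h.collapse F).level_eq]
  ext q
  obtain ⟨v, rfl⟩ := proj_surjective q
  constructor
  · intro hv
    exact ⟨v, (h.depth_proj hF v).symm.trans hv, rfl⟩
  · rintro ⟨w, hw, hwv⟩
    rw [← hwv]
    exact (h.depth_proj hF w).trans hw

end IsConnectedCactus

/-! ### Comparison of heights -/

/-- The depth of the root of a cycle. -/
noncomputable def cycleLevel (G : BasedGraph) (C : Set G.E) : ℕ := G.depth ∅ (G.root C)

/-- `F` joins the root of a cycle `C` to another vertex of `C`. -/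
def RootJoined (G : BasedGraph) (F C : Set G.E) : Prop :=
  ∃ u ∈ G.verts C, u ≠ G.root C ∧ G.joinedIn (C ∩ F) (G.root C) u

/-- Among the cycles of minimal level that meet `F`, one is collapsed at its root. -/
def IsDescending (G : BasedGraph) (F : Set G.E) : Prop :=
  ∃ C, G.IsCycle C ∧ (∀ D, G.IsCycle D → (D ∩ F).Nonempty → G.cycleLevel C ≤ G.cycleLevel D) ∧
    G.RootJoined F C

theorem RootJoined.nonempty {F C : Set G.E} (h : G.RootJoined F C) : (C ∩ F).Nonempty := by
  obtain ⟨u, _, hne, hj⟩ := h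
  by_contra hn
  rw [Set.not_nonempty_iff_eq_empty] at hn
  rw [hn] at hj
  exact hne (eq_of_joinedIn_empty hj).symm

theorem IsForest.src_ne_tgt {F : Set G.E} (hF : G.IsForest F) {e : G.E} (he : e ∈ F) :
    G.src e ≠ G.tgt e := fun h => hF.not_joinedIn he (h ▸ joinedIn_refl _)

namespace IsConnectedCactus

variable {F : Set G.E} {i : ℕ}

theorem depth_le (v : G.V) : G.depth F v ≤ G.depth ∅ v := by
  refine Set.ncard_le_ncard (fun C hC => ⟨hC.1, fun hj => hC.2 (joinedIn_mono ?_ hj)⟩)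
    (Set.toFinite _)
  rw [Set.union_empty]
  exact Set.subset_union_left

/-- Depth is lost only on crossing a cycle that meets `F`, and such a crossing starts at a root of
depth at least `i`. -/
theorem le_depth (h : G.IsConnectedCactus)
    (hi : ∀ D, G.IsCycle D → (D ∩ F).Nonempty → i ≤ G.cycleLevel D) (v : G.V) :
    min (G.depth ∅ v) i ≤ G.depth F v := by
  induction v using h.parent_induction with
  | base => simp [depth_base]
  | step C v hC hvC hr ih =>
    have h1 := h.depth_succ hC hvC hr
    by_cases hj : G.joinedIn (C ∩ F) (G.root C) v
    · have h2 := hi C hC (RootJoined.nonempty ⟨v, hvC, Ne.symm hr, hj⟩)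
      rw [cycleLevel] at h2
      rw [depth_of_joined hj]
      omega
    · rw [h.depth_of_not_joined hC hvC hj]
      omega

/-- One level better than `le_depth`: cycles of level `i` are not collapsed at their roots, so depth
is lost only from depth `i + 1` onwards. -/
theorem le_depth_of_ascending (h : G.IsConnectedCactus)
    (hi : ∀ D, G.IsCycle D → (D ∩ F).Nonempty → i ≤ G.cycleLevel D)
    (hn : ∀ C, G.IsCycle C → G.cycleLevel C = i → ¬ G.RootJoined F C) (v : G.V) :
    min (G.depth ∅ v) (i + 1) ≤ G.depth F v := by
  induction v using h.parent_induction with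
  | base => simp [depth_base]
  | step C v hC hvC hr ih =>
    have h1 := h.depth_succ hC hvC hr
    by_cases hj : G.joinedIn (C ∩ F) (G.root C) v
    · have hr' : G.RootJoined F C := ⟨v, hvC, Ne.symm hr, hj⟩
      have h2 := hi C hC hr'.nonempty
      have h3 : G.cycleLevel C ≠ i := fun h => hn C hC h hr'
      rw [cycleLevel] at h2 h3
      rw [depth_of_joined hj]
      omega
    · rw [h.depth_of_not_joined hC hvC hj]
      omega

/-- Climbing down through parent cycles collapsed at their roots stays in the class of `v` and ends
at a vertex whose depth is the same before and after the collapse. -/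
theorem exists_joined_depth (h : G.IsConnectedCactus) {k j : ℕ}
    (hk : ∀ v, min (G.depth ∅ v) k ≤ G.depth F v) (hjk : j ≤ k) (v : G.V)
    (hv : G.depth F v = j) : ∃ v', G.depth ∅ v' = j ∧ G.joinedIn F v' v := by
  induction v using h.parent_induction with
  | base =>
    rw [depth_base] at hv
    exact ⟨G.base, by rw [depth_base, hv], joinedIn_refl _⟩
  | step C v hC hvC hr ih =>
    by_cases hj : G.joinedIn (C ∩ F) (G.root C) v
    · rw [depth_of_joined hj] at hv
      obtain ⟨v', hv', hj'⟩ := ih hv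
      exact ⟨v', hv', joinedIn_trans hj' (joinedIn_mono Set.inter_subset_right hj)⟩
    · refine ⟨v, ?_, joinedIn_refl _⟩
      have h1 := h.depth_succ hC hvC hr
      have h2 := h.depth_of_not_joined hC hvC hj
      have h3 := hk (G.root C)
      have h4 := depth_le (F := F) (G.root C)
      omega

/-- Suppose a chain in `F` joins two vertices of depth at most `i`. The cycle of one of its edges
separates them, as otherwise the whole cycle would lie in `F`; so it separates one of them from the
base vertex, whose depth then exceeds the level of the cycle. -/
theorem injOn_proj (h : G.IsConnectedCactus) (hF : G.IsForest F)
    (hi : ∀ D, G.IsCycle D → (D ∩ F).Nonempty → i ≤ G.cycleLevel D) :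
    Set.InjOn (G.proj F) {v | G.depth ∅ v ≤ i} := by
  intro u hu v hv huv
  by_contra hne
  obtain ⟨x, hx, hxb⟩ := joinedIn_iff.1 (proj_eq_iff.1 huv)
  have hx0 : x ≠ 0 := by
    rintro rfl
    rw [map_zero] at hxb
    exact hne (pt_add_eq_zero hxb.symm)
  obtain ⟨e, he⟩ := Function.ne_iff.1 hx0
  have hD := h.cactus.isCycle_cyc e
  have hsep : ¬ G.joinedIn (h.cactus.cyc e)ᶜ u v := fun hj => by
    obtain ⟨y, hy, hyb⟩ := joinedIn_iff.1 hj
    have h0 : G.bdry (x + y) = 0 := by rw [map_add, hxb, hyb, add_self_fun]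
    have hy0 : ∀ a ∈ h.cactus.cyc e, y a = 0 := fun a ha => by
      by_contra h'
      exact hy a h' ha
    refine hF _ hD fun a ha => hx a ?_
    have := h.cactus.closed_const h0 hD ha (h.cactus.mem_cyc e)
    rw [Pi.add_apply, Pi.add_apply, hy0 a ha, hy0 e (h.cactus.mem_cyc e), add_zero, add_zero] at this
    rw [this]
    exact he
  have hle := hi _ hD ⟨e, h.cactus.mem_cyc e, hx e he⟩
  have key : ∀ w, h.cactus.cyc e ∈ G.sepSet ∅ w → ¬ G.depth ∅ w ≤ i := fun w hw hwi => by
    have := h.root_mem_sepSet hw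
    rw [cycleLevel] at hle
    omega
  by_cases h1 : h.cactus.cyc e ∈ G.sepSet ∅ u
  · exact key u h1 hu
  · have h2 : h.cactus.cyc e ∉ G.sepSet ∅ v := fun h2 => key v h2 hv
    have h3 : ∀ w, h.cactus.cyc e ∉ G.sepSet ∅ w → G.joinedIn (h.cactus.cyc e)ᶜ G.base w :=
      fun w hw => by
        by_contra h4
        rw [← Set.union_empty (h.cactus.cyc e)ᶜ] at h4
        exact hw ⟨hD, h4⟩
    exact hsep (joinedIn_trans (joinedIn_symm (h3 u h1)) (h3 v h2))

theorem ncard_level_collapse (h : G.IsConnectedCactus) (hF : G.IsForest F) {k j : ℕ}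
    (hk : ∀ v, min (G.depth ∅ v) k ≤ G.depth F v) (hjk : j ≤ k) :
    (G.collapse F).level j = G.proj F '' G.level j := by
  rw [h.level_collapse hF, h.level_eq]
  ext q
  constructor
  · rintro ⟨v, hv, rfl⟩
    obtain ⟨v', hv', hj⟩ := h.exists_joined_depth hk hjk v hv
    exact ⟨v', hv', proj_eq_iff.2 hj⟩
  · rintro ⟨v, hv, rfl⟩
    refine ⟨v, ?_, rfl⟩
    have h1 := hk v
    have h2 := depth_le (F := F) v
    simp only [Set.mem_ofPred_eq] at hv ⊢
    omega

theorem localCoweight_collapse_eq (h : G.IsConnectedCactus) (hF : G.IsForest F) {k j : ℕ}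
    (hk : ∀ v, min (G.depth ∅ v) k ≤ G.depth F v) (hjk : j < k) :
    (G.collapse F).localCoweight j = G.localCoweight j := by
  rw [h.localCoweight_collapse hF, h.localCoweight_eq]
  refine congrArg Set.ncard (Set.ext fun C => and_congr_right fun hC => not_congr ?_)
  have h1 := hk (G.root C)
  have h2 := depth_le (F := F) (G.root C)
  omega

theorem ncard_level_eq (h : G.IsConnectedCactus) (hF : G.IsForest F)
    (hi : ∀ D, G.IsCycle D → (D ∩ F).Nonempty → i ≤ G.cycleLevel D) {j : ℕ} (hj : j ≤ i) :
    ((G.collapse F).level j).ncard = (G.level j).ncard := by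
  rw [h.ncard_level_collapse hF (h.le_depth hi) hj]
  refine Set.InjOn.ncard_image ((h.injOn_proj hF hi).mono fun v hv => ?_)
  rw [h.level_eq] at hv
  exact hv.le.trans hj

/-- The entries of the height. -/
noncomputable def _root_.BasedGraph.heightCoord (G : BasedGraph) (k : ℕ) : ℤ :=
  if k % 2 = 0 then (G.localCoweight (k / 2) : ℤ) else -((G.level ((k + 1) / 2)).ncard : ℤ)

theorem _root_.BasedGraph.height_lt {G H : BasedGraph} (k : ℕ)
    (h1 : ∀ j < k, G.heightCoord j = H.heightCoord j) (h2 : G.heightCoord k < H.heightCoord k) :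
    G.height < H.height := ⟨k, h1, h2⟩

/-- A descending collapse decreases the height. -/
theorem height_lt_of_isDescending (h : G.IsConnectedCactus) (hr : G.IsReduced) (hF : G.IsForest F)
    (hd : G.IsDescending F) : (G.collapse F).height < G.height := by
  obtain ⟨C, hC, hi, u, hu, hne, hj⟩ := hd
  -- Entry `2 * i` is c_i and entry `2 * i - 1` is n_i. The collapse merges `u`, of depth `i + 1`,
  -- with the root of `C`, of depth `i`. Another cycle `D` is rooted at `u`; its root drops to depth
  -- `i`, so c_i decreases.
  refine height_lt (2 * G.cycleLevel C) (fun k hk => ?_) ?_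
  · simp only [heightCoord]
    split_ifs with hk2
    · rw [h.localCoweight_collapse_eq hF (h.le_depth hi) (by omega)]
    · rw [h.ncard_level_eq hF hi (by omega)]
  · simp only [heightCoord]
    rw [if_pos (by omega), if_pos (by omega), Nat.cast_lt, Nat.mul_div_cancel_left _ two_pos,
      h.localCoweight_collapse hF, h.localCoweight_eq]
    refine Set.ncard_lt_ncard ⟨fun D hD => ⟨hD.1, fun h' => hD.2 ?_⟩, fun hsub => ?_⟩
      (Set.toFinite _)
    · have h1 := h.le_depth hi (G.root D)
      have h2 := depth_le (F := F) (G.root D)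
      omega
    · have h1 := h.depth_succ hC hu (Ne.symm hne)
      have hub : u ≠ G.base := by
        rintro rfl
        rw [depth_base] at h1
        omega
      obtain ⟨D, hD, hDC, huD⟩ := hr.exists_cycle_ne h.cactus hub C hC
      have hrD : G.root D = u := by
        by_contra hrD
        exact hDC (h.parent_unique hD hC huD hu hrD (Ne.symm hne))
      refine (hsub (a := D) ⟨hD, ?_⟩).2 ?_
      · rw [hrD, h1, cycleLevel]
        omega
      · rw [hrD, depth_of_joined hj]
        have h3 := h.le_depth hi (G.root C)
        have h4 := depth_le (F := F) (G.root C)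
        rw [cycleLevel] at *
        omega

/-- A collapse that is not descending increases the height. -/
theorem height_gt_of_not_isDescending (h : G.IsConnectedCactus) (hF : G.IsForest F)
    (hF0 : F.Nonempty) (hd : ¬ G.IsDescending F) : G.height < (G.collapse F).height := by
  obtain ⟨C, ⟨hC, e, heC, heF⟩, hi⟩ : ∃ C, (G.IsCycle C ∧ (C ∩ F).Nonempty) ∧
      ∀ D, G.IsCycle D → (D ∩ F).Nonempty → G.cycleLevel C ≤ G.cycleLevel D := by
    obtain ⟨e, he⟩ := hF0
    obtain ⟨C, hC, hmin⟩ := Set.exists_min_image {C | G.IsCycle C ∧ (C ∩ F).Nonempty} G.cycleLevel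
      (Set.toFinite _) ⟨_, h.cactus.isCycle_cyc e, e, h.cactus.mem_cyc e, he⟩
    exact ⟨C, hC, fun D hD hDF => hmin D ⟨hD, hDF⟩⟩
  have hn : ∀ D, G.IsCycle D → G.cycleLevel D = G.cycleLevel C → ¬ G.RootJoined F D :=
    fun D hD hDC hr => hd ⟨D, hD, hDC ▸ hi, hr⟩
  have hk := h.le_depth_of_ascending hi hn
  -- Entry `2 * i + 1` is n_{i+1}. Both ends of the edge `e` of `C ∩ F` differ from the root, so
  -- they are two vertices of Λ_{i+1}, and they become equal.
  refine height_lt (2 * G.cycleLevel C + 1) (fun k hk' => ?_) ?_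
  · simp only [heightCoord]
    split_ifs with hk2
    · rw [h.localCoweight_collapse_eq hF hk (by omega)]
    · rw [h.ncard_level_eq hF hi (by omega)]
  · simp only [heightCoord]
    rw [if_neg (by omega), if_neg (by omega), neg_lt_neg_iff, Nat.cast_lt,
      show (2 * G.cycleLevel C + 1 + 1) / 2 = G.cycleLevel C + 1 by omega,
      h.ncard_level_collapse hF hk le_rfl]
    have hne := hF.src_ne_tgt heF
    have hj : G.joinedIn (C ∩ F) (G.src e) (G.tgt e) := joinedIn_edge ⟨heC, heF⟩
    have hs : G.src e ≠ G.root C := fun h' => hn C hC rfl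
      ⟨G.tgt e, ⟨e, heC, Or.inr rfl⟩, h' ▸ hne.symm, h' ▸ hj⟩
    have ht : G.tgt e ≠ G.root C := fun h' => hn C hC rfl
      ⟨G.src e, ⟨e, heC, Or.inl rfl⟩, h' ▸ hne, h' ▸ joinedIn_symm hj⟩
    refine lt_of_le_of_ne (Set.ncard_image_le (Set.toFinite _)) fun heq => hne ?_
    refine (Set.ncard_image_iff (Set.toFinite _)).1 heq ?_ ?_ (proj_edge heF)
    · rw [h.level_eq]
      exact h.depth_succ hC ⟨e, heC, Or.inl rfl⟩ hs.symm
    · rw [h.level_eq]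
      exact h.depth_succ hC ⟨e, heC, Or.inr rfl⟩ ht.symm

end IsConnectedCactus

end BasedGraph


/-! ### Forest collapses as morphisms -/

namespace BasedGraph

variable {G H K : BasedGraph}

theorem joinedIn_map {A : Set G.E} {B : Set H.E} (f : G.V → H.V)
    (hf : ∀ e ∈ A, H.joinedIn B (f (G.src e)) (f (G.tgt e))) {u v : G.V} (h : G.joinedIn A u v) :
    H.joinedIn B (f u) (f v) := by
  induction h with
  | rel a b h =>
    obtain ⟨e, he, rfl, rfl⟩ := h
    exact hf e he
  | refl a => exact joinedIn_refl _
  | symm a b _ ih => exact joinedIn_symm ih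
  | trans a b c _ _ ih ih' => exact joinedIn_trans ih ih'

theorem Iso.joinedIn_map (φ : Iso G H) {A : Set G.E} {u v : G.V} (h : G.joinedIn A u v) :
    H.joinedIn (φ.onE '' A) (φ.onV u) (φ.onV v) := by
  refine BasedGraph.joinedIn_map φ.onV (fun e he => ?_) h
  have := joinedIn_edge (G := H) (Set.mem_image_of_mem φ.onE he)
  rcases φ.src_tgt e with ⟨h1, h2⟩ | ⟨h1, h2⟩
  · rwa [h1, h2] at this
  · rw [h1, h2] at this
    exact joinedIn_symm this

theorem Iso.joinedIn_iff (φ : Iso G H) {B : Set H.E} {u v : G.V} :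
    H.joinedIn B (φ.onV u) (φ.onV v) ↔ G.joinedIn (φ.onE ⁻¹' B) u v := by
  constructor
  · intro h
    have := φ.symm.joinedIn_map h
    simp only [symm, Equiv.symm_apply_apply] at this
    refine joinedIn_mono ?_ this
    rintro _ ⟨e, he, rfl⟩
    change φ.onE (φ.onE.symm e) ∈ B
    rwa [Equiv.apply_symm_apply]
  · intro h
    exact joinedIn_mono (Set.image_preimage_subset _ _) (φ.joinedIn_map h)

theorem Iso.isCactus (φ : Iso G H) (h : G.IsCactus) : H.IsCactus := fun e => by
  obtain ⟨e, rfl⟩ := φ.onE.surjective e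
  refine ⟨φ.onE '' h.cyc e, ⟨φ.isCycle_image (h.isCycle_cyc e), e, h.mem_cyc e, rfl⟩, ?_⟩
  rintro D ⟨hD, he⟩
  rw [← φ.image_symm_image D] at hD he ⊢
  rw [h.eq_cyc (φ.isCycle_image_iff.1 hD) (φ.onE.injective.mem_set_image.1 he)]

theorem Iso.root_image (φ : Iso G H) (h : G.IsConnectedCactus) {C : Set G.E} (hC : G.IsCycle C) :
    H.root (φ.onE '' C) = φ.onV (G.root C) := by
  have hH : H.IsConnectedCactus := ⟨φ.isCactus h.cactus, fun u v => by
    obtain ⟨u, rfl⟩ := φ.onV.surjective u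
    obtain ⟨v, rfl⟩ := φ.onV.surjective v
    exact φ.joinedIn_iff.2 (h.conn u v)⟩
  refine hH.gate_eq (φ.isCycle_image hC) (φ.mem_verts_image.2 (h.root_mem hC)) ?_
  rw [← φ.base_map, φ.joinedIn_iff]
  refine joinedIn_mono (A := Cᶜ) (fun e he => ?_) (h.joinedIn_root hC)
  exact fun h' => he (φ.onE.injective.mem_set_image.1 h')

theorem IsCycle.joinedIn_diff {C : Set G.E} (hC : G.IsCycle C) {e : G.E} (he : e ∈ C) :
    G.joinedIn (C \ {e}) (G.src e) (G.tgt e) := by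
  refine joinedIn_mono ?_ (joinedIn_symm (BasedGraph.joinedIn_diff hC.bdry_chain (chain_ne_zero.2 he)))
  exact fun a ha => ⟨chain_ne_zero.1 ha.1, ha.2⟩

theorem IsForest.not_joinedIn_start {F : Set G.E} (hF : G.IsForest F) {x : G.E × Bool}
    (hx : x.1 ∈ F) : ¬ G.joinedIn (F \ {x.1}) (G.start x) (G.start (x.1, !x.2)) := by
  obtain ⟨e, b⟩ := x
  cases b
  · exact fun h => hF.not_joinedIn hx (joinedIn_symm h)
  · exact hF.not_joinedIn hx

/-- A forest in `G` and an identification of the collapse with `H`. -/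
structure Collapse (G H : BasedGraph) where
  F : Set G.E
  forest : G.IsForest F
  iso : Iso (G.collapse F) H

namespace Collapse

variable (c : Collapse G H)

/-- The effect of a collapse on half-edges; `none` for the collapsed ones. -/
noncomputable def label (x : G.E × Bool) : Option (H.E × Bool) := lab c.iso x

/-- The effect of a collapse on vertices. -/
def onV (v : G.V) : H.V := c.iso.onV (G.proj c.F v)

/-- The effect of a collapse on edge paths. -/
noncomputable def hom : FreeGroup G.E →* FreeGroup H.E := c.iso.hom.comp (G.collapseHom c.F)

/-- The edges that are collapsed or mapped to `B`. -/
def pull (B : Set H.E) : Set G.E := {e | ∀ y, c.label (e, true) = some y → y.1 ∈ B}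

/-- The image of a cycle. -/
def mapC (C : Set G.E) : Set H.E := c.iso.onE '' G.restr c.F C

theorem hom_mk (w : List (G.E × Bool)) :
    c.hom (FreeGroup.mk w) = FreeGroup.mk (w.filterMap c.label) := hom_collapseHom c.iso w

theorem label_eq_none {x : G.E × Bool} : c.label x = none ↔ x.1 ∈ c.F := lab_eq_none c.iso

theorem exists_label {x : G.E × Bool} (h : x.1 ∉ c.F) : ∃ y, c.label x = some y :=
  Option.ne_none_iff_exists'.1 (mt c.label_eq_none.1 h)

theorem notMem_of_label {x : G.E × Bool} {y : H.E × Bool} (h : c.label x = some y) : x.1 ∉ c.F :=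
  fun h' => by simp [c.label_eq_none.2 h'] at h

theorem label_not {x : G.E × Bool} {y : H.E × Bool} (h : c.label x = some y) :
    c.label (x.1, !x.2) = some (y.1, !y.2) := lab_not c.iso h

theorem label_injective {x x' : G.E × Bool} {y : H.E × Bool} (h : c.label x = some y)
    (h' : c.label x' = some y) : x = x' := lab_injective c.iso h h'

theorem label_surjective (y : H.E × Bool) : ∃ x, c.label x = some y := lab_surjective c.iso y

theorem label_start {x : G.E × Bool} {y : H.E × Bool} (h : c.label x = some y) :
    H.start y = c.onV (G.start x) := lab_start c.iso h

/-- The two orientations of an edge have labels with the same edge. -/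
theorem label_fst {e : G.E} {b b' : Bool} {y y' : H.E × Bool} (h : c.label (e, b) = some y)
    (h' : c.label (e, b') = some y') : y.1 = y'.1 := by
  by_cases hb : b' = b
  · subst hb
    rw [h, Option.some_inj] at h'
    rw [h']
  · have h1 : b' = !b := Bool.eq_not.2 hb
    subst h1
    have := c.label_not h
    rw [h', Option.some_inj] at this
    rw [this]

theorem label_fst_injective {e e' : G.E} {b b' : Bool} {y y' : H.E × Bool}
    (h : c.label (e, b) = some y) (h' : c.label (e', b') = some y') (hy : y.1 = y'.1) : e = e' := by
  by_cases h2 : y = y'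
  · subst h2
    exact congrArg Prod.fst (c.label_injective h h')
  · have h3 : y' = (y.1, !y.2) :=
      Prod.ext hy.symm (Bool.eq_not.2 fun h4 => h2 (Prod.ext hy h4.symm))
    have := c.label_injective (h3 ▸ h') (c.label_not h)
    exact (congrArg Prod.fst this).symm

theorem mem_pull {B : Set H.E} {e : G.E} {b : Bool} {y : H.E × Bool}
    (h : c.label (e, b) = some y) : e ∈ c.pull B ↔ y.1 ∈ B := by
  constructor
  · intro he
    obtain ⟨y', hy'⟩ := c.exists_label (x := (e, true)) (c.notMem_of_label (x := (e, b)) h)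
    rw [c.label_fst h hy']
    exact he y' hy'
  · intro hy y' hy'
    rwa [← c.label_fst h hy']

theorem subset_pull (B : Set H.E) : c.F ⊆ c.pull B := fun _ he _ hy =>
  (c.notMem_of_label hy he).elim

theorem onV_surjective : Function.Surjective c.onV :=
  c.iso.onV.surjective.comp proj_surjective

theorem onV_eq_iff {u v : G.V} : c.onV u = c.onV v ↔ G.joinedIn c.F u v :=
  c.iso.onV.injective.eq_iff.trans proj_eq_iff

theorem onV_base : c.onV G.base = H.base := c.iso.base_map

theorem joinedIn_iff {B : Set H.E} {u v : G.V} :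
    H.joinedIn B (c.onV u) (c.onV v) ↔ G.joinedIn (c.pull B) u v := by
  rw [onV, onV, c.iso.joinedIn_iff, collapse_joinedIn_iff]
  refine iff_of_eq (congrArg (fun A => G.joinedIn A u v) ?_)
  ext e
  by_cases he : e ∈ c.F
  · exact iff_of_true (Or.inr he) (c.subset_pull B he)
  · rw [c.mem_pull (b := true) (lab_of_notMem c.iso (x := (e, true)) he), Set.mem_union,
      or_iff_left he]
    constructor
    · rintro ⟨e', he', rfl⟩
      exact he'
    · intro h
      exact ⟨surv e he, h, rfl⟩

theorem mem_mapC {C : Set G.E} {e : G.E} {b : Bool} {y : H.E × Bool}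
    (h : c.label (e, b) = some y) : y.1 ∈ c.mapC C ↔ e ∈ C := by
  obtain ⟨hx, h1, -⟩ := lab_eq_some c.iso h
  rw [← h1, mapC, c.iso.onE.injective.mem_set_image]
  rfl

theorem isConnectedCactus (c : Collapse G H) (h : G.IsConnectedCactus) : H.IsConnectedCactus :=
  ⟨c.iso.isCactus (h.cactus.collapse _), fun u v => by
    obtain ⟨u, rfl⟩ := c.onV_surjective u
    obtain ⟨v, rfl⟩ := c.onV_surjective v
    refine c.joinedIn_iff.2 (joinedIn_mono (A := Set.univ) ?_ (h.conn u v))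
    exact fun _ _ _ _ => trivial⟩

theorem isCycle_mapC (h : G.IsConnectedCactus) {C : Set G.E} (hC : G.IsCycle C) :
    H.IsCycle (c.mapC C) := c.iso.isCycle_image (hC.restr h.cactus (c.forest C hC))

theorem isCycle_iff (h : G.IsConnectedCactus) {D : Set H.E} :
    H.IsCycle D ↔ ∃ C, G.IsCycle C ∧ D = c.mapC C := by
  constructor
  · intro hD
    rw [← c.iso.image_symm_image D, c.iso.isCycle_image_iff] at hD
    obtain ⟨C, hC, hDC⟩ := (restr_isCycle_iff h.cactus c.forest).1 hD
    exact ⟨C, hC, by rw [mapC, ← hDC, c.iso.image_symm_image D]⟩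
  · rintro ⟨C, hC, rfl⟩
    exact c.isCycle_mapC h hC

theorem mapC_injective (h : G.IsConnectedCactus) {C D : Set G.E} (hC : G.IsCycle C)
    (hD : G.IsCycle D) (hCD : c.mapC C = c.mapC D) : C = D :=
  restr_injective h.cactus c.forest hC hD (c.iso.onE.injective.image_injective hCD)

theorem root_mapC (h : G.IsConnectedCactus) {C : Set G.E} (hC : G.IsCycle C) :
    H.root (c.mapC C) = c.onV (G.root C) := by
  rw [mapC, c.iso.root_image (h.collapse _) (hC.restr h.cactus (c.forest C hC)),
    h.root_restr c.forest hC, onV]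

theorem mem_verts_mapC {C : Set G.E} (hC : G.IsCycle C) {v : G.V}
    (hv : v ∈ G.verts C) : c.onV v ∈ H.verts (c.mapC C) :=
  c.iso.mem_verts_image.2 (mem_verts_restr hC (c.forest C hC) hv)

theorem height_eq : H.height = (G.collapse c.F).height := c.iso.height_eq

/-- A collapse is given by the labels of the edges and a vertex map. -/
noncomputable def ofLabel (ℓ : G.E × Bool → Option (H.E × Bool))
    (hnot : ∀ x y, ℓ x = some y → ℓ (x.1, !x.2) = some (y.1, !y.2))
    (hinj : ∀ x x' y, ℓ x = some y → ℓ x' = some y → x = x') (hsurj : ∀ y, ∃ x, ℓ x = some y)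
    (p : G.V → H.V) (hp : Function.Surjective p) (hb : p G.base = H.base)
    (hpF : ∀ u v, p u = p v ↔ G.joinedIn {e | ℓ (e, true) = none} u v)
    (hs : ∀ x y, ℓ x = some y → H.start y = p (G.start x))
    (hF : G.IsForest {e | ℓ (e, true) = none}) : Collapse G H where
  F := {e | ℓ (e, true) = none}
  forest := hF
  iso :=
    have hl (e : {e // e ∉ {e | ℓ (e, true) = none}}) : (ℓ (e.1, true)).isSome :=
      Option.isSome_iff_ne_none.2 e.2
    { onV := Equiv.ofBijective (Quotient.lift p fun u v h => (hpF u v).2 h) (by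
        refine ⟨?_, fun v => ?_⟩
        · rintro ⟨u⟩ ⟨v⟩ h
          exact Quotient.sound ((hpF u v).1 h)
        · obtain ⟨u, rfl⟩ := hp v
          exact ⟨Quotient.mk _ u, rfl⟩)
      onE := Equiv.ofBijective (fun e : {e // e ∉ {e | ℓ (e, true) = none}} =>
          ((ℓ (e.1, true)).get (hl e)).1) (by
        constructor
        · intro e e' h
          have h1 : ℓ (e.1, true) = some ((ℓ (e.1, true)).get (hl e)) := (Option.some_get _).symm
          have h2 : ℓ (e'.1, true) = some ((ℓ (e'.1, true)).get (hl e')) := (Option.some_get _).symm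
          dsimp only at h
          generalize (ℓ (e.1, true)).get (hl e) = y at h h1
          generalize (ℓ (e'.1, true)).get (hl e') = y' at h h2
          refine Subtype.ext ?_
          by_cases hy : y = y'
          · subst hy
            exact congrArg Prod.fst (hinj _ _ _ h1 h2)
          · have h3 : y' = (y.1, !y.2) :=
              Prod.ext h.symm (Bool.eq_not.2 fun h4 => hy (Prod.ext h h4.symm))
            exact (congrArg Prod.fst (hinj _ _ _ (h3 ▸ h2) (hnot _ _ h1))).symm
        · intro a
          obtain ⟨⟨e, b⟩, he⟩ := hsurj (a, true)
          obtain ⟨b', he'⟩ : ∃ b', ℓ (e, true) = some (a, b') := by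
            cases b
            · exact ⟨false, hnot _ _ he⟩
            · exact ⟨true, he⟩
          refine ⟨⟨e, fun h => ?_⟩, ?_⟩
          · rw [Set.mem_ofPred_eq, he'] at h
            cases h
          · simp only [he', Option.get_some])
      flip := fun e => !((ℓ (e.1, true)).get (hl e)).2
      start_map := fun e b => by
        have h1 : ℓ (e.1, true) = some ((ℓ (e.1, true)).get (hl e)) := (Option.some_get _).symm
        change H.start (((ℓ (e.1, true)).get (hl e)).1, xor (!((ℓ (e.1, true)).get (hl e)).2) b) =
          Quotient.lift p _ _
        generalize (ℓ (e.1, true)).get (hl e) = y at h1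
        cases b
        · rw [Bool.xor_false]
          exact hs (e.1, false) _ (hnot _ _ h1)
        · rw [Bool.xor_true, Bool.not_not]
          exact hs (e.1, true) _ h1
      base_map := hb }

section ofLabel

variable {ℓ : G.E × Bool → Option (H.E × Bool)}
    {hnot : ∀ x y, ℓ x = some y → ℓ (x.1, !x.2) = some (y.1, !y.2)}
    {hinj : ∀ x x' y, ℓ x = some y → ℓ x' = some y → x = x'} {hsurj : ∀ y, ∃ x, ℓ x = some y}
    {p : G.V → H.V} {hp : Function.Surjective p} {hb : p G.base = H.base}
    {hpF : ∀ u v, p u = p v ↔ G.joinedIn {e | ℓ (e, true) = none} u v}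
    {hs : ∀ x y, ℓ x = some y → H.start y = p (G.start x)}
    {hF : G.IsForest {e | ℓ (e, true) = none}}

theorem label_ofLabel (x : G.E × Bool) :
    (ofLabel ℓ hnot hinj hsurj p hp hb hpF hs hF).label x = ℓ x := by
  obtain ⟨e, b⟩ := x
  cases he : ℓ (e, true) with
  | none =>
    have h1 : ℓ (e, b) = none := by
      cases b
      · by_contra h
        obtain ⟨y, hy⟩ := Option.ne_none_iff_exists'.1 h
        have := hnot _ _ hy
        rw [show ((e, false).1, !(e, false).2) = (e, true) from rfl, he] at this
        cases this
      · exact he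
    rw [h1]
    exact lab_of_mem _ he
  | some y =>
    have h1 : ∀ b, ℓ (e, b) = some (y.1, xor (!y.2) b) := fun b => by
      cases b
      · rw [Bool.xor_false]
        exact hnot _ _ he
      · rw [Bool.xor_true, Bool.not_not]
        exact he
    rw [h1]
    have h2 : e ∉ {e | ℓ (e, true) = none} := fun h => by
      rw [Set.mem_ofPred_eq, he] at h
      cases h
    refine (lab_of_notMem (ofLabel ℓ hnot hinj hsurj p hp hb hpF hs hF).iso (x := (e, b)) h2).trans ?_
    refine Option.some_inj.2 ?_
    refine Prod.ext ?_ ?_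
    · change ((ℓ (e, true)).get _).1 = y.1
      simp only [he, Option.get_some]
    · change xor (!((ℓ (e, true)).get _).2) b = xor (!y.2) b
      simp only [he, Option.get_some]

end ofLabel

/-- The collapse of a given forest. -/
def std (G : BasedGraph) {F : Set G.E} (hF : G.IsForest F) : Collapse G (G.collapse F) :=
  ⟨F, hF, Iso.refl _⟩

/-- In both directions an edge of a cycle has its ends joined by the other edges of the cycle; this
transfers along the collapse and contradicts `not_joinedIn_start` on the other side. -/
theorem isForest_iff_pull {B : Set H.E} : H.IsForest B ↔ G.IsForest (c.pull B) := by
  constructor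
  · intro hB C hC hCB
    obtain ⟨e, heC, heF⟩ := Set.not_subset.1 (c.forest C hC)
    obtain ⟨y, hy⟩ := c.exists_label (x := (e, true)) heF
    have h1 : G.joinedIn (c.pull (B \ {y.1})) (G.start (e, true)) (G.start (e, false)) := by
      refine joinedIn_mono (fun a ha z hz => ⟨hCB ha.1 z hz, fun h => ha.2 ?_⟩)
        (hC.joinedIn_diff heC)
      exact c.label_fst_injective hz hy h
    have hy' : c.label (e, false) = some (y.1, !y.2) := c.label_not hy
    rw [← c.joinedIn_iff, ← c.label_start hy, ← c.label_start hy'] at h1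
    exact hB.not_joinedIn_start ((c.mem_pull hy).1 (hCB heC)) h1
  · intro hP D hD hDB
    obtain ⟨b, hb⟩ := hD.nonempty
    obtain ⟨x, hx⟩ := c.label_surjective (b, true)
    have h1 : H.joinedIn (D \ {b}) (H.start (b, true)) (H.start (b, false)) := hD.joinedIn_diff hb
    have hx' : c.label (x.1, !x.2) = some (b, false) := c.label_not hx
    rw [c.label_start hx, c.label_start hx', c.joinedIn_iff] at h1
    refine hP.not_joinedIn_start (x := x) ((c.mem_pull hx).2 (hDB hb)) (joinedIn_mono ?_ h1)
    refine fun a ha => ⟨fun z hz => hDB (ha z hz).1, ?_⟩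
    rintro rfl
    exact ((c.mem_pull (b := x.2) hx).1 ha).2 rfl

theorem hom_congr {c d : Collapse G H} (h : c.label = d.label) : c.hom = d.hom := by
  ext e
  rw [show FreeGroup.of e = FreeGroup.mk [(e, true)] from rfl, hom_mk, hom_mk, h]

theorem F_congr {c d : Collapse G H} (h : c.label = d.label) : c.F = d.F := by
  ext e
  rw [← c.label_eq_none (x := (e, true)), ← d.label_eq_none (x := (e, true)), h]

/-! Composition -/

theorem pull_eq (d : Collapse H K) :
    {e | (c.label (e, true)).bind d.label = none} = c.pull d.F := by
  ext e
  rw [Set.mem_ofPred_eq]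
  by_cases he : e ∈ c.F
  · rw [c.label_eq_none.2 he]
    exact iff_of_true rfl (c.subset_pull _ he)
  · obtain ⟨y, hy⟩ := c.exists_label (x := (e, true)) he
    rw [hy, Option.bind_some, d.label_eq_none, c.mem_pull hy]

/-- The composite of two collapses. -/
noncomputable def comp (d : Collapse H K) : Collapse G K :=
  ofLabel (fun x => (c.label x).bind d.label)
    (fun x z h => by
      obtain ⟨y, hy, hz⟩ := Option.bind_eq_some_iff.1 h
      exact Option.bind_eq_some_iff.2 ⟨_, c.label_not hy, d.label_not hz⟩)
    (fun x x' z h h' => by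
      obtain ⟨y, hy, hz⟩ := Option.bind_eq_some_iff.1 h
      obtain ⟨y', hy', hz'⟩ := Option.bind_eq_some_iff.1 h'
      obtain rfl := d.label_injective hz hz'
      exact c.label_injective hy hy')
    (fun z => by
      obtain ⟨y, hy⟩ := d.label_surjective z
      obtain ⟨x, hx⟩ := c.label_surjective y
      exact ⟨x, Option.bind_eq_some_iff.2 ⟨y, hx, hy⟩⟩)
    (d.onV ∘ c.onV) (d.onV_surjective.comp c.onV_surjective)
    (by rw [Function.comp_apply, c.onV_base, d.onV_base])
    (fun u v => by
      rw [Function.comp_apply, Function.comp_apply, d.onV_eq_iff, c.joinedIn_iff, c.pull_eq])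
    (fun x z h => by
      obtain ⟨y, hy, hz⟩ := Option.bind_eq_some_iff.1 h
      rw [d.label_start hz, c.label_start hy]
      rfl)
    (by rw [c.pull_eq, ← c.isForest_iff_pull]; exact d.forest)

theorem label_comp (d : Collapse H K) (x : G.E × Bool) :
    (c.comp d).label x = (c.label x).bind d.label := label_ofLabel x

theorem F_comp (d : Collapse H K) : (c.comp d).F = c.pull d.F := c.pull_eq d

theorem subset_F_comp (d : Collapse H K) : c.F ⊆ (c.comp d).F := c.F_comp d ▸ c.subset_pull d.F

theorem hom_comp (d : Collapse H K) (g : FreeGroup G.E) : (c.comp d).hom g = d.hom (c.hom g) := by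
  obtain ⟨w, rfl⟩ := Quot.exists_rep g
  change (c.comp d).hom (FreeGroup.mk w) = d.hom (c.hom (FreeGroup.mk w))
  rw [hom_mk, hom_mk, hom_mk, List.filterMap_filterMap]
  congr 2
  funext x
  exact c.label_comp d x

/-! Factorization -/

/-- The half-edge over a half-edge of the target. -/
noncomputable def unlabel (y : H.E × Bool) : G.E × Bool := (c.label_surjective y).choose

theorem label_unlabel (y : H.E × Bool) : c.label (c.unlabel y) = some y :=
  (c.label_surjective y).choose_spec

theorem unlabel_eq {x : G.E × Bool} {y : H.E × Bool} (h : c.label x = some y) : c.unlabel y = x :=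
  c.label_injective (c.label_unlabel y) h

theorem pull_factor (d : Collapse G K) (h : c.F ⊆ d.F) :
    c.pull {b | d.label (c.unlabel (b, true)) = none} = d.F := by
  ext e
  by_cases he : e ∈ c.F
  · exact iff_of_true (c.subset_pull _ he) (h he)
  · obtain ⟨y, hy⟩ := c.exists_label (x := (e, true)) he
    rw [c.mem_pull hy, Set.mem_ofPred_eq, d.label_eq_none,
      c.label_fst_injective (e := (c.unlabel (y.1, true)).1) (c.label_unlabel (y.1, true)) hy rfl]

/-- The collapse of the remaining edges. -/
noncomputable def factor (d : Collapse G K) (h : c.F ⊆ d.F) : Collapse H K :=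
  have hp : ∀ u, d.onV (Function.surjInv c.onV_surjective (c.onV u)) = d.onV u := fun u => by
    rw [d.onV_eq_iff]
    exact joinedIn_mono h (c.onV_eq_iff.1 (Function.surjInv_eq c.onV_surjective _))
  ofLabel (fun y => d.label (c.unlabel y))
    (fun y z hz => by
      rw [c.unlabel_eq (c.label_not (c.label_unlabel y))]
      exact d.label_not hz)
    (fun y y' z hz hz' => by
      have := c.label_unlabel y
      rw [d.label_injective hz hz', c.label_unlabel, Option.some_inj] at this
      exact this.symm)
    (fun z => by
      obtain ⟨x, hx⟩ := d.label_surjective z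
      obtain ⟨y, hy⟩ := c.exists_label fun h' => d.notMem_of_label hx (h h')
      exact ⟨y, by rw [c.unlabel_eq hy, hx]⟩)
    (fun w => d.onV (Function.surjInv c.onV_surjective w))
    (fun w => by
      obtain ⟨u, rfl⟩ := d.onV_surjective w
      exact ⟨c.onV u, hp u⟩)
    (by rw [← c.onV_base, hp, d.onV_base])
    (fun w w' => by
      obtain ⟨u, rfl⟩ := c.onV_surjective w
      obtain ⟨u', rfl⟩ := c.onV_surjective w'
      rw [hp, hp, c.joinedIn_iff, d.onV_eq_iff, c.pull_factor d h])
    (fun y z hz => by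
      rw [d.label_start hz, ← hp, ← c.label_start (c.label_unlabel y)])
    (by rw [c.isForest_iff_pull, c.pull_factor d h]; exact d.forest)

theorem label_factor (d : Collapse G K) (h : c.F ⊆ d.F) {x : G.E × Bool} {y : H.E × Bool}
    (hx : c.label x = some y) : (c.factor d h).label y = d.label x := by
  rw [← c.unlabel_eq hx]
  exact label_ofLabel y

theorem pull_F_factor (d : Collapse G K) (h : c.F ⊆ d.F) : c.pull (c.factor d h).F = d.F :=
  c.pull_factor d h

theorem label_comp_factor (d : Collapse G K) (h : c.F ⊆ d.F) :
    (c.comp (c.factor d h)).label = d.label := by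
  funext x
  rw [c.label_comp]
  by_cases hx : x.1 ∈ c.F
  · rw [c.label_eq_none.2 hx, d.label_eq_none.2 (h hx), Option.bind_none]
  · obtain ⟨y, hy⟩ := c.exists_label hx
    rw [hy, Option.bind_some, c.label_factor d h hy]

theorem F_factor_eq_empty (d : Collapse G K) (h : c.F = d.F) : (c.factor d h.le).F = ∅ :=
  Set.eq_empty_of_forall_notMem fun b hb => by
    obtain ⟨x, hx⟩ := c.label_surjective (b, true)
    have h2 := (c.mem_pull hx).2 hb
    rw [c.pull_F_factor d h.le, ← h] at h2
    exact c.notMem_of_label hx h2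

theorem hom_factor (d : Collapse G K) (h : c.F ⊆ d.F) (g : FreeGroup G.E) :
    (c.factor d h).hom (c.hom g) = d.hom g := by
  rw [← hom_comp, hom_congr (c.label_comp_factor d h)]

/-! Isomorphisms -/

theorem isForest_empty : G.IsForest ∅ := fun _ hC h => hC.nonempty.not_subset_empty h

theorem _root_.BasedGraph.joinedIn_empty_iff {u v : G.V} : G.joinedIn ∅ u v ↔ u = v :=
  ⟨eq_of_joinedIn_empty, fun h => h ▸ joinedIn_refl u⟩

/-- An isomorphism as the collapse of the empty forest. -/
noncomputable def ofIso (ψ : Iso G H) : Collapse G H :=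
  have h0 : {e | (some (ψ.onE e, xor (ψ.flip e) true) : Option (H.E × Bool)) = none} =
      (∅ : Set G.E) := Set.eq_empty_of_forall_notMem fun e he => by cases he
  ofLabel (fun x => some (ψ.onE x.1, xor (ψ.flip x.1) x.2))
    (fun x y h => by
      rw [Option.some_inj] at h ⊢
      subst h
      simp)
    (fun x x' y h h' => by
      rw [← h', Option.some_inj, Prod.mk.injEq] at h
      have h1 := ψ.onE.injective h.1
      rw [h1] at h
      exact Prod.ext h1 (Bool.xor_right_inj.1 h.2))
    (fun y => ⟨(ψ.onE.symm y.1, xor (ψ.flip (ψ.onE.symm y.1)) y.2), by simp⟩)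
    ψ.onV ψ.onV.surjective ψ.base_map
    (fun u v => by
      rw [h0, joinedIn_empty_iff, ψ.onV.injective.eq_iff])
    (fun x y h => by
      rw [Option.some_inj] at h
      subst h
      exact ψ.start_map x.1 x.2)
    (by rw [h0]; exact isForest_empty)

theorem label_ofIso (ψ : Iso G H) (x : G.E × Bool) :
    (ofIso ψ).label x = some (ψ.onE x.1, xor (ψ.flip x.1) x.2) := label_ofLabel x

theorem F_ofIso (ψ : Iso G H) : (ofIso ψ).F = ∅ :=
  Set.eq_empty_of_forall_notMem fun e he => by
    have := (ofIso ψ).label_eq_none (x := (e, true)).2 he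
    rw [label_ofIso] at this
    cases this

theorem hom_ofIso (ψ : Iso G H) : (ofIso ψ).hom = ψ.hom := by
  ext e
  rw [show FreeGroup.of e = FreeGroup.mk [(e, true)] from rfl, hom_mk,
    List.filterMap_cons_some (label_ofIso ψ _), List.filterMap_nil]
  rw [show FreeGroup.mk [(e, true)] = FreeGroup.of e from rfl, Iso.hom, FreeGroup.lift_apply_of]
  cases ψ.flip e <;> simp <;> rfl

/-- A collapse of the empty forest is an isomorphism. -/
theorem exists_iso (h : c.F = ∅) : ∃ ψ : Iso G H, ψ.hom = c.hom := by
  have he : ∀ e, e ∉ c.F := fun e => by rw [h]; exact id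
  refine ⟨
    { onV := Equiv.ofBijective c.onV ⟨fun u v huv => ?_, c.onV_surjective⟩
      onE := (Equiv.ofBijective (fun e => surv e (he e))
        ⟨fun e e' h => congrArg Subtype.val h, fun e => ⟨e.1, rfl⟩⟩).trans c.iso.onE
      flip := fun e => c.iso.flip (surv e (he e))
      start_map := fun e b => ?_
      base_map := c.onV_base }, ?_⟩
  · rwa [c.onV_eq_iff, h, joinedIn_empty_iff] at huv
  · exact c.label_start (lab_of_notMem c.iso (x := (e, b)) (he e))
  · rw [← hom_ofIso]
    refine hom_congr (funext fun x => ?_)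
    rw [label_ofIso]
    exact (lab_of_notMem c.iso (he x.1)).symm

end Collapse

end BasedGraph


/-! ### Maximal trees and loops around cycles -/

namespace BasedGraph

variable {G R : BasedGraph}

/-- In a maximal forest, adding an edge whose ends are not yet joined creates no cycle; so all ends
are joined. -/
theorem exists_isMaximalTree (hc : ∀ u v, G.joinedIn Set.univ u v) : ∃ T, G.IsMaximalTree T := by
  obtain ⟨T, -, hT⟩ := (Set.toFinite {F | G.IsForest F}).exists_le_maximal Collapse.isForest_empty
  refine ⟨T, hT.1, fun u v => ?_⟩
  refine joinedIn_map id (fun e _ => ?_) (hc u v)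
  by_contra hn
  have hins : G.IsForest (insert e T) := fun C hC hCT => by
    have he : e ∈ C := by
      by_contra he
      exact hT.1 C hC fun a ha => (hCT ha).resolve_left fun h => he (h ▸ ha)
    refine hn (joinedIn_mono ?_ (hC.joinedIn_diff he))
    exact fun a ha => (hCT ha.1).resolve_left ha.2
  exact hn (joinedIn_edge (hT.2 hins (Set.subset_insert _ _) (Set.mem_insert _ _)))

/-- A path in `T` between the ends of `e` closes up with `e` to a cycle. It must be `C`, whose other
edges therefore lie in `T`. -/
theorem IsMaximalTree.eq_of_notMem {T : Set G.E} (hG : G.IsCactus) (hT : G.IsMaximalTree T)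
    {C : Set G.E} (hC : G.IsCycle C) {e e' : G.E} (he : e ∈ C) (he' : e' ∈ C) (heT : e ∉ T)
    (heT' : e' ∉ T) : e' = e := by
  obtain ⟨D, hD, hDT⟩ := exists_isCycle_of_joinedIn heT (hT.2 (G.tgt e) (G.src e))
  have heD : e ∈ D := by
    by_contra he
    exact hT.1 D hD fun a ha => (hDT ha).resolve_left fun h => he (h ▸ ha)
  rw [hG.cycle_eq hC hD he heD] at he'
  exact (hDT he').resolve_right heT'

/-- `g` is represented by a path to a cycle, followed by the cycle and the inverse path. -/
def IsLoopOf (G : BasedGraph) (C : Set G.E) (g : FreeGroup G.E) : Prop :=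
  ∃ u t w, G.IsWalk G.base t u ∧ G.IsWalk u w u ∧ (w.map Prod.fst).Nodup ∧
    (∀ e, e ∈ w.map Prod.fst ↔ e ∈ C) ∧
    g = FreeGroup.mk t * FreeGroup.mk w * (FreeGroup.mk t)⁻¹

theorem IsLoopOf.mem {C : Set G.E} {g : FreeGroup G.E} (h : G.IsLoopOf C g) :
    g ∈ G.fundamentalGroup := by
  obtain ⟨u, t, w, ht, hw, _, _, rfl⟩ := h
  exact ⟨t ++ w ++ FreeGroup.invRev t, (ht.append hw).append ht.invRev, by simp⟩

theorem exists_isLoopOf (hc : ∀ u v, G.joinedIn Set.univ u v) {C : Set G.E} (hC : G.IsCycle C) :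
    ∃ g, G.IsLoopOf C g := by
  classical
  obtain ⟨m, v, e, hv, he, rfl, hve⟩ := hC
  obtain ⟨t, ht, _⟩ := exists_walk (hc G.base (v 0))
  let f : Fin (m + 1) → G.E × Bool := fun i =>
    (e i, decide (G.src (e i) = v i ∧ G.tgt (e i) = v (i + 1)))
  have hf : ∀ i, G.start (f i) = v i ∧ G.start ((f i).1, !(f i).2) = v (i + 1) := fun i => by
    by_cases h : G.src (e i) = v i ∧ G.tgt (e i) = v (i + 1)
    · simp only [f, h, and_self, decide_true, Bool.not_true]
      exact h
    · have h' := (hve i).resolve_left h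
      simp only [f, h, decide_false, Bool.not_false]
      exact ⟨h'.2, h'.1⟩
  have hw : ∀ k : ℕ, G.IsWalk (v 0) ((List.range k).map fun i => f (Fin.ofNat (m + 1) i))
      (v (Fin.ofNat (m + 1) k)) := fun k => by
    induction k with
    | zero => rfl
    | succ k ih =>
      rw [List.range_succ, List.map_append]
      refine ih.append ⟨(hf _).1, ?_⟩
      refine (hf _).2.trans (congrArg v (Fin.ext ?_))
      simp [Fin.val_add]
  have hw1 := hw (m + 1)
  rw [show Fin.ofNat (m + 1) (m + 1) = 0 from Fin.ext (by simp)] at hw1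
  refine ⟨_, v 0, t, _, ht, hw1, ?_, fun a => ?_, rfl⟩
  · rw [List.map_map]
    refine List.Nodup.map_on (fun i hi j hj hij => ?_) List.nodup_range
    have := congrArg Fin.val (he hij)
    simpa [Nat.mod_eq_of_lt (List.mem_range.1 hi), Nat.mod_eq_of_lt (List.mem_range.1 hj)] using this
  · simp only [List.map_map, List.mem_map, List.mem_range, Set.mem_range]
    constructor
    · rintro ⟨i, _, rfl⟩
      exact ⟨_, rfl⟩
    · rintro ⟨i, rfl⟩
      exact ⟨i, i.2, by simp [f]⟩

namespace Collapse

/-- The tree contains all edges of the cycle but one, so a single letter of the loop survives,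
conjugated by the image of the path to the cycle. -/
theorem hom_isLoopOf (hG : G.IsCactus) (d : Collapse G R) (hd : G.IsMaximalTree d.F) {C : Set G.E}
    (hC : G.IsCycle C) {g : FreeGroup G.E} (hg : G.IsLoopOf C g) {x : G.E × Bool} {a : R.E × Bool}
    (hx : x.1 ∈ C) (hxa : d.label x = some a) :
    IsConj (d.hom g) (FreeGroup.of a.1) ∨ IsConj (d.hom g) (FreeGroup.of a.1)⁻¹ := by
  obtain ⟨u, t, w, _, _, hnd, hmem, rfl⟩ := hg
  obtain ⟨z, hz, hzx⟩ := List.mem_map.1 ((hmem x.1).2 hx)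
  obtain ⟨l₁, l₂, rfl⟩ := List.append_of_mem hz
  rw [List.map_append, List.map_cons, List.nodup_append, List.nodup_cons] at hnd
  obtain ⟨y, hy⟩ := d.exists_label (x := z) (by rw [hzx]; exact d.notMem_of_label hxa)
  have hF : ∀ x' ∈ l₁ ++ z :: l₂, x'.1 ≠ z.1 → x'.1 ∈ d.F := fun x' hx' hne => by
    by_contra h
    refine hne ?_
    rw [hzx]
    exact hd.eq_of_notMem hG hC hx ((hmem _).1 (List.mem_map_of_mem hx'))
      (d.notMem_of_label hxa) h
  have h1 : l₁.filterMap d.label = [] := List.filterMap_eq_nil_iff.2 fun x' hx' =>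
    d.label_eq_none.2 (hF x' (by simp [hx']) fun h =>
      hnd.2.2 _ (List.mem_map_of_mem hx') _ List.mem_cons_self h)
  have h2 : l₂.filterMap d.label = [] := List.filterMap_eq_nil_iff.2 fun x' hx' =>
    d.label_eq_none.2 (hF x' (by simp [hx']) fun h =>
      hnd.2.1.1 (h ▸ List.mem_map_of_mem hx'))
  have h3 : y.1 = a.1 := d.label_fst (e := x.1) (b := z.2) (b' := x.2)
    (by rw [← hzx]; exact hy) hxa
  have h4 : d.hom (FreeGroup.mk (l₁ ++ z :: l₂)) = FreeGroup.mk [y] := by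
    rw [hom_mk, List.filterMap_append, List.filterMap_cons_some hy, h1, h2, List.nil_append]
  have h5 : IsConj (d.hom (FreeGroup.mk t * FreeGroup.mk (l₁ ++ z :: l₂) * (FreeGroup.mk t)⁻¹))
      (FreeGroup.mk [y]) := by
    rw [map_mul, map_mul, h4, map_inv]
    exact (isConj_iff.2 ⟨_, rfl⟩).symm
  obtain ⟨y1, y2⟩ := y
  dsimp only at h3
  subst h3
  cases y2
  · exact Or.inr h5
  · exact Or.inl h5

theorem mem_fundamentalGroup_of_subsingleton (h : ∀ u v : R.V, u = v) (g : FreeGroup R.E) :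
    g ∈ R.fundamentalGroup := by
  obtain ⟨w, rfl⟩ := Quot.exists_rep g
  refine ⟨w, ?_, rfl⟩
  induction w with
  | nil => rfl
  | cons x w ih =>
    refine ⟨h _ _, ?_⟩
    rw [h (R.start _) R.base]
    exact ih

/-- After the collapse of a maximal tree there is one vertex left, so every element of the free
group is a loop; the conjugating element lifts because the collapse is an isomorphism of fundamental
groups. -/
theorem exists_conj (d : Collapse G R) (hd : G.IsMaximalTree d.F) {g g' : G.fundamentalGroup}
    (h : IsConj (d.hom g) (d.hom g')) : IsConj g g' := by
  have hR : ∀ u v : R.V, u = v := fun u v => by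
    obtain ⟨u, rfl⟩ := d.onV_surjective u
    obtain ⟨v, rfl⟩ := d.onV_surjective v
    exact d.onV_eq_iff.2 (hd.2 u v)
  obtain ⟨k, hk⟩ := isConj_iff.1 h
  obtain ⟨k', hk'⟩ := (collapseEquiv d.iso d.forest).surjective
    ⟨k, mem_fundamentalGroup_of_subsingleton hR k⟩
  refine isConj_iff.2 ⟨k', (collapseEquiv d.iso d.forest).injective (Subtype.ext ?_)⟩
  rw [map_mul, map_mul, map_inv, hk']
  exact hk

theorem isMaximalTree_comp {K : BasedGraph} (c : Collapse G K) (d : Collapse K R)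
    (hd : K.IsMaximalTree d.F) : G.IsMaximalTree (c.comp d).F :=
  ⟨(c.comp d).forest, fun u v => by
    rw [F_comp, ← c.joinedIn_iff]
    exact hd.2 _ _⟩

end Collapse

end BasedGraph

/-! ### Symmetric markings -/

namespace MarkedGraph

open BasedGraph

variable {n : ℕ} {X Y Z : MarkedGraph n} {R : BasedGraph}

theorem isConnectedCactus (h : X.graph.IsCactus) : X.graph.IsConnectedCactus :=
  ⟨h, X.reduced.connected⟩

/-- After the collapse, the generators are conjugate to edges and inverses of edges. -/
def SymmetricVia (X : MarkedGraph n) (d : Collapse X.graph R) : Prop :=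
  ∀ i, ∃ e : R.E, IsConj (d.hom (X.marking (FreeGroup.of i))) (FreeGroup.of e) ∨
    IsConj (d.hom (X.marking (FreeGroup.of i))) (FreeGroup.of e)⁻¹

/-- Loops around the cycles of a cactus graph do not depend on a tree, and in each tree quotient
they become conjugates of petals or inverse petals. So the condition says that each generator is
conjugate to a loop around a cycle or to its inverse, for one tree as for all. -/
theorem SymmetricVia.change (hX : X.graph.IsCactus) {R' : BasedGraph} {d : Collapse X.graph R}
    {d' : Collapse X.graph R'} (hd : X.graph.IsMaximalTree d.F) (hd' : X.graph.IsMaximalTree d'.F)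
    (h : X.SymmetricVia d) : X.SymmetricVia d' := fun i => by
  obtain ⟨e, he⟩ := h i
  obtain ⟨x, hx⟩ := d.label_surjective (e, true)
  have hC := hX.isCycle_cyc x.1
  obtain ⟨g, hg⟩ := exists_isLoopOf X.reduced.connected hC
  have h1 := d.hom_isLoopOf hX hd hC hg (hX.mem_cyc x.1) hx
  have h2 : IsConj (X.marking (FreeGroup.of i)) ⟨g, hg.mem⟩ ∨
      IsConj (X.marking (FreeGroup.of i)) ⟨g, hg.mem⟩⁻¹ := by
    have hinv : ∀ {a b : FreeGroup R.E}, IsConj a b → IsConj a⁻¹ b⁻¹ := fun h => by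
      obtain ⟨c, hc⟩ := isConj_iff.1 h
      exact isConj_iff.2 ⟨c, by rw [← hc]; group⟩
    have hg' : d.hom ((⟨g, hg.mem⟩ : X.graph.fundamentalGroup)⁻¹ : X.graph.fundamentalGroup) =
      (d.hom g)⁻¹ := map_inv d.hom g
    rcases he with he | he <;> rcases h1 with h1 | h1
    · exact Or.inl (d.exists_conj hd (he.trans h1.symm))
    · refine Or.inr (d.exists_conj hd ?_)
      rw [hg']
      have := hinv h1.symm
      rw [inv_inv] at this
      exact he.trans this
    · refine Or.inr (d.exists_conj hd ?_)
      rw [hg']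
      exact he.trans (hinv h1.symm)
    · exact Or.inl (d.exists_conj hd (he.trans h1.symm))
  obtain ⟨a, haC, haF⟩ := Set.not_subset.1 (d'.forest _ hC)
  obtain ⟨y, hy⟩ := d'.exists_label (x := (a, true)) haF
  have h3 := d'.hom_isLoopOf hX hd' hC hg haC hy
  have hmap : ∀ {g g' : X.graph.fundamentalGroup}, IsConj g g' → IsConj (d'.hom g) (d'.hom g') :=
    fun h => (d'.hom.comp X.graph.fundamentalGroup.subtype).map_isConj h
  have hinv : ∀ {a b : FreeGroup R'.E}, IsConj a b → IsConj a⁻¹ b⁻¹ := fun h => by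
    obtain ⟨c, hc⟩ := isConj_iff.1 h
    exact isConj_iff.2 ⟨c, by rw [← hc]; group⟩
  have hg' : d'.hom ((⟨g, hg.mem⟩ : X.graph.fundamentalGroup)⁻¹ : X.graph.fundamentalGroup) =
      (d'.hom g)⁻¹ := map_inv d'.hom g
  refine ⟨y.1, ?_⟩
  rcases h2 with h2 | h2 <;> have h2 := hmap h2 <;> rcases h3 with h3 | h3
  · exact Or.inl (h2.trans h3)
  · exact Or.inr (h2.trans h3)
  · rw [hg'] at h2
    exact Or.inr (h2.trans (hinv h3))
  · rw [hg'] at h2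
    have := hinv h3
    rw [inv_inv] at this
    exact Or.inl (h2.trans this)

theorem std_hom {T : Set X.graph.E} (hT : X.graph.IsForest T) (g : FreeGroup X.graph.E) :
    (Collapse.std X.graph hT).hom g = X.graph.collapseHom T g :=
  Iso.hom_refl _

theorem isSymmetric_iff : X.IsSymmetric ↔ ∀ T (hT : X.graph.IsMaximalTree T),
    X.SymmetricVia (Collapse.std X.graph hT.1) := by
  refine forall₂_congr fun T hT => ?_
  have hR : ∀ u v : (X.graph.collapse T).V, u = v := fun u v => by
    obtain ⟨u, rfl⟩ := proj_surjective u
    obtain ⟨v, rfl⟩ := proj_surjective v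
    exact proj_eq_iff.2 (hT.2 u v)
  constructor
  · rintro ⟨τ, φ, hφ, h⟩ i
    obtain ⟨j, hj⟩ := hφ i
    have h1 : (Collapse.std X.graph hT.1).hom (X.marking (FreeGroup.of i)) =
        (FreeGroup.freeGroupCongr τ).symm (φ (FreeGroup.of i)) := by
      rw [std_hom, ← h]
      exact ((FreeGroup.freeGroupCongr τ).symm_apply_apply _).symm
    have h2 : (FreeGroup.freeGroupCongr τ).symm (FreeGroup.of j) = FreeGroup.of (τ.symm j) := by
      simp
    refine ⟨τ.symm j, ?_⟩
    rw [h1]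
    rcases hj with hj | hj
    · left
      have := (FreeGroup.freeGroupCongr τ).symm.toMonoidHom.map_isConj hj
      exact h2 ▸ this
    · right
      have := (FreeGroup.freeGroupCongr τ).symm.toMonoidHom.map_isConj hj
      rw [map_inv] at this
      exact h2 ▸ this
  · intro h
    let ε : FreeGroup (Fin n) ≃* FreeGroup {e // e ∉ T} :=
      (X.marking.trans (collapseEquiv (Iso.refl _) hT.1)).trans
        ((MulEquiv.subgroupCongr ((Subgroup.eq_top_iff' _).2 fun g =>
          Collapse.mem_fundamentalGroup_of_subsingleton hR g)).trans Subgroup.topEquiv)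
    -- Bases of isomorphic free groups are equinumerous, which provides an identification of the
    -- petals; any one will do.
    let τ : {e // e ∉ T} ≃ Fin n := Equiv.ofFreeGroupEquiv ε.symm
    have hε : ∀ g, ε g = X.graph.collapseHom T (X.marking g) := fun g => Iso.hom_refl _
    have hτ : ∀ e : {e // e ∉ T}, FreeGroup.freeGroupCongr τ (FreeGroup.of e) = FreeGroup.of (τ e) :=
      fun e => by simp
    refine ⟨τ, ε.trans (FreeGroup.freeGroupCongr τ), fun i => ?_, fun g => ?_⟩
    · obtain ⟨e, he⟩ := h i
      rw [std_hom, ← hε] at he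
      refine ⟨τ e, he.imp (fun he => ?_) fun he => ?_⟩
      · have := (FreeGroup.freeGroupCongr τ).toMonoidHom.map_isConj he
        exact hτ e ▸ this
      · have := (FreeGroup.freeGroupCongr τ).toMonoidHom.map_isConj he
        exact ((map_inv (FreeGroup.freeGroupCongr τ).toMonoidHom (FreeGroup.of e)).trans
          (congrArg _ (hτ e))) ▸ this
    · rw [← hε]
      rfl

theorem isSymmetric_of_symmetricVia (hX : X.graph.IsCactus) {d : Collapse X.graph R}
    (hd : X.graph.IsMaximalTree d.F) (h : X.SymmetricVia d) : X.IsSymmetric :=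
  isSymmetric_iff.2 fun _ hT => h.change hX hd hT

theorem IsSymmetric.symmetricVia (hX : X.graph.IsCactus) (h : X.IsSymmetric)
    {d : Collapse X.graph R} (hd : X.graph.IsMaximalTree d.F) : X.SymmetricVia d := by
  obtain ⟨T, hT⟩ := exists_isMaximalTree X.reduced.connected
  exact (isSymmetric_iff.1 h T hT).change hX hT hd

/-! ### Marked collapses -/

/-- The collapse is compatible with the markings. -/
def Compatible (X Y : MarkedGraph n) (c : Collapse X.graph Y.graph) : Prop :=
  ∀ g, c.hom (X.marking g) = Y.marking g

theorem collapsesTo_iff : X.CollapsesTo Y ↔ ∃ c, X.Compatible Y c :=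
  ⟨fun ⟨F, hF, φ, h⟩ => ⟨⟨F, hF, φ⟩, h⟩, fun ⟨⟨F, hF, φ⟩, h⟩ => ⟨F, hF, φ, h⟩⟩

theorem Compatible.comp {c : Collapse X.graph Y.graph} {d : Collapse Y.graph Z.graph}
    (hc : X.Compatible Y c) (hd : Y.Compatible Z d) : X.Compatible Z (c.comp d) := fun g => by
  rw [Collapse.hom_comp, hc, hd]

theorem Compatible.factor {c : Collapse X.graph Y.graph} {d : Collapse X.graph Z.graph}
    (hc : X.Compatible Y c) (hd : X.Compatible Z d) (h : c.F ⊆ d.F) :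
    Y.Compatible Z (c.factor d h) := fun g => by
  rw [← hc, Collapse.hom_factor, hd]

/-- Rigidity (`lab_unique`), with markings in place of elements of the fundamental group. -/
theorem Compatible.label_eq {c c' : Collapse X.graph Y.graph} (hc : X.Compatible Y c)
    (hc' : X.Compatible Y c') : c.label = c'.label := by
  refine lab_unique c.iso c'.iso X.reduced c.forest c'.forest fun g hg => ?_
  obtain ⟨a, ha⟩ := X.marking.surjective ⟨g, hg⟩
  have h1 := hc a
  have h2 := hc' a
  rw [ha] at h1 h2
  exact h1.trans h2.symm

theorem compatible_refl (X : MarkedGraph n) : X.Compatible X (Collapse.ofIso (Iso.refl _)) :=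
  fun g => by rw [Collapse.hom_ofIso, Iso.hom_refl]

theorem mk_eq_iff : AuterVertex.mk X = AuterVertex.mk Y ↔
    ∃ c : Collapse X.graph Y.graph, X.Compatible Y c ∧ c.F = ∅ := by
  refine Quotient.eq.trans ⟨?_, ?_⟩
  · rintro ⟨φ, hφ⟩
    exact ⟨.ofIso φ, fun g => by rw [Collapse.hom_ofIso, hφ], Collapse.F_ofIso φ⟩
  · rintro ⟨c, hc, hF⟩
    obtain ⟨ψ, hψ⟩ := c.exists_iso hF
    exact ⟨ψ, fun g => by rw [hψ, hc]⟩

/-- The relation on classes asks for some representatives; composing with isomorphisms, seen as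
collapses of the empty forest, gives a collapse between the chosen ones. -/
theorem mk_collapsesTo_iff : (AuterVertex.mk X).CollapsesTo (AuterVertex.mk Y) ↔
    ∃ c, X.Compatible Y c := by
  constructor
  · rintro ⟨X', Y', hX, hY, h⟩
    obtain ⟨c, hc⟩ := collapsesTo_iff.1 h
    obtain ⟨a, ha, -⟩ := mk_eq_iff.1 hX.symm
    obtain ⟨b, hb, -⟩ := mk_eq_iff.1 hY
    exact ⟨_, (ha.comp hc).comp hb⟩
  · intro h
    exact ⟨X, Y, rfl, rfl, collapsesTo_iff.2 h⟩

theorem Compatible.F_eq_empty {c : Collapse X.graph Y.graph} (hc : X.Compatible Y c)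
    (h : AuterVertex.mk X = AuterVertex.mk Y) : c.F = ∅ := by
  obtain ⟨d, hd, hF⟩ := mk_eq_iff.1 h
  rw [Collapse.F_congr (hc.label_eq hd), hF]

end MarkedGraph

/-! ### The collapse order on the vertices of the spine -/

namespace AuterVertex

open BasedGraph MarkedGraph

variable {n : ℕ}

/-- Vertices of the spine are ordered by collapses; `b ≤ a` if `a` collapses to `b`. -/
instance : PartialOrder (AuterVertex n) where
  le b a := a.CollapsesTo b
  le_refl a := by
    obtain ⟨X, rfl⟩ := Quotient.exists_rep a
    exact mk_collapsesTo_iff.2 ⟨_, compatible_refl X⟩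
  le_trans c b a hcb hba := by
    obtain ⟨X, rfl⟩ := Quotient.exists_rep a
    obtain ⟨Y, rfl⟩ := Quotient.exists_rep b
    obtain ⟨Z, rfl⟩ := Quotient.exists_rep c
    obtain ⟨c, hc⟩ := mk_collapsesTo_iff.1 hba
    obtain ⟨d, hd⟩ := mk_collapsesTo_iff.1 hcb
    exact mk_collapsesTo_iff.2 ⟨_, hc.comp hd⟩
  le_antisymm b a hba hab := by
    obtain ⟨X, rfl⟩ := Quotient.exists_rep a
    obtain ⟨Y, rfl⟩ := Quotient.exists_rep b
    obtain ⟨c, hc⟩ := mk_collapsesTo_iff.1 hba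
    obtain ⟨d, hd⟩ := mk_collapsesTo_iff.1 hab
    refine (mk_eq_iff.2 ⟨c, hc, ?_⟩).symm
    -- By rigidity the composite of the two collapses has the same forest as the identity, so the
    -- first collapses nothing.
    have h1 := Collapse.F_congr ((hc.comp hd).label_eq (compatible_refl X))
    rw [Collapse.F_comp, Collapse.F_ofIso] at h1
    exact Set.subset_empty_iff.1 (h1 ▸ c.subset_pull _)

theorem mk_le_mk {X Y : MarkedGraph n} : mk Y ≤ mk X ↔ ∃ c, X.Compatible Y c := mk_collapsesTo_iff

theorem isBlowDown_iff {a b : AuterVertex n} : b.IsBlowDown a ↔ b < a :=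
  (lt_iff_le_and_ne (a := b) (b := a)).symm

end AuterVertex

namespace MarkedGraph

open BasedGraph

variable {n : ℕ} {X Y Z : MarkedGraph n}

/-- The collapse of a forest in a marked cactus graph. -/
noncomputable def collapse (X : MarkedGraph n) (hX : X.graph.IsCactus) {F : Set X.graph.E}
    (hF : X.graph.IsForest F) : MarkedGraph n where
  graph := X.graph.collapse F
  reduced := collapse_isReduced hX X.reduced hF
  marking := X.marking.trans (collapseEquiv (Iso.refl _) hF)

theorem compatible_collapse (hX : X.graph.IsCactus) {F : Set X.graph.E}
    (hF : X.graph.IsForest F) : X.Compatible (X.collapse hX hF) (Collapse.std X.graph hF) :=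
  fun _ => rfl

/-- The marked graph given by a collapse onto a marked graph. -/
noncomputable def blowUp (X : MarkedGraph n) {H : BasedGraph} (hH : H.IsReduced)
    (c : Collapse H X.graph) : MarkedGraph n where
  graph := H
  reduced := hH
  marking := X.marking.trans (collapseEquiv c.iso c.forest).symm

theorem compatible_blowUp {H : BasedGraph} (hH : H.IsReduced) (c : Collapse H X.graph) :
    (X.blowUp hH c).Compatible X c := fun g =>
  congrArg Subtype.val ((collapseEquiv c.iso c.forest).apply_symm_apply (X.marking g))

theorem Compatible.symmetricVia_iff {R : BasedGraph} {c : Collapse X.graph Y.graph}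
    (hc : X.Compatible Y c) (d : Collapse Y.graph R) :
    X.SymmetricVia (c.comp d) ↔ Y.SymmetricVia d := by
  simp only [SymmetricVia, Collapse.hom_comp, hc _]

/-- A maximal tree of the collapse pulls back to one of `X` with the same quotient, so both symmetry
conditions are the same. -/
theorem Compatible.isMarkedCactus {c : Collapse X.graph Y.graph} (hc : X.Compatible Y c)
    (hX : X.IsMarkedCactus) : Y.IsMarkedCactus := by
  have hY := (c.isConnectedCactus (isConnectedCactus hX.1)).cactus
  obtain ⟨T, hT⟩ := exists_isMaximalTree Y.reduced.connected
  exact ⟨hY, isSymmetric_of_symmetricVia (d := Collapse.std Y.graph hT.1) hY hT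
    ((hc.symmetricVia_iff _).1 (hX.2.symmetricVia hX.1 (c.isMaximalTree_comp _ hT)))⟩

/-- For blow-ups the symmetry of the marking is automatic; only the cactus property has to be
checked. -/
theorem Compatible.isMarkedCactus_of_isCactus {c : Collapse X.graph Y.graph}
    (hc : X.Compatible Y c) (hX : X.graph.IsCactus) (hY : Y.IsMarkedCactus) :
    X.IsMarkedCactus := by
  obtain ⟨T, hT⟩ := exists_isMaximalTree Y.reduced.connected
  refine ⟨hX, isSymmetric_of_symmetricVia hX
    (c.isMaximalTree_comp (Collapse.std Y.graph hT.1) hT) ((hc.symmetricVia_iff _).2 ?_)⟩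
  exact hY.2.symmetricVia hY.1 hT

theorem mk_isMarkedCactus : (AuterVertex.mk X).IsMarkedCactus ↔ X.IsMarkedCactus := by
  constructor
  · rintro ⟨Y, hY, h⟩
    obtain ⟨c, hc, -⟩ := mk_eq_iff.1 hY
    exact hc.isMarkedCactus h
  · exact fun h => ⟨X, rfl, h⟩

/-- The vertices below a marked cactus graph are its collapses. -/
theorem exists_eq_collapse (hX : X.graph.IsCactus) {b : AuterVertex n} (h : b ≤ AuterVertex.mk X) :
    ∃ (F : Set X.graph.E) (hF : X.graph.IsForest F), b = AuterVertex.mk (X.collapse hX hF) := by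
  obtain ⟨Y, rfl⟩ := Quotient.exists_rep b
  obtain ⟨c, hc⟩ := AuterVertex.mk_le_mk.1 h
  exact ⟨c.F, c.forest, (mk_eq_iff.2 ⟨_, (compatible_collapse hX c.forest).factor hc le_rfl,
    Collapse.F_factor_eq_empty (Collapse.std X.graph c.forest) c rfl⟩).symm⟩

/-- A collapse of a larger forest is a collapse. -/
theorem mk_collapse_le_iff (hX : X.graph.IsCactus) {F F' : Set X.graph.E}
    (hF : X.graph.IsForest F) (hF' : X.graph.IsForest F') :
    AuterVertex.mk (X.collapse hX hF') ≤ AuterVertex.mk (X.collapse hX hF) ↔ F ⊆ F' := by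
  constructor
  · intro h
    obtain ⟨c, hc⟩ := AuterVertex.mk_le_mk.1 h
    have h1 := Collapse.F_congr
      (((compatible_collapse hX hF).comp hc).label_eq (compatible_collapse hX hF'))
    exact ((Collapse.std X.graph hF).subset_F_comp c).trans h1.le
  · intro h
    exact AuterVertex.mk_le_mk.2 ⟨_, (compatible_collapse hX hF).factor (compatible_collapse hX hF') h⟩

end MarkedGraph


/-! ### Order complexes of ordinal sums -/

section LexSum

open Sum PreAbstractSimplicialComplex

variable {P Q R : Type*} [PartialOrder P] [PartialOrder Q] [PartialOrder R]

/-- The monotone map of ordinal sums given by monotone maps of the summands. -/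
def lexSumMap {P' Q' : Type*} [PartialOrder P'] [PartialOrder Q'] (f : P →o P') (g : Q →o Q') :
    P ⊕ₗ Q →o P' ⊕ₗ Q' where
  toFun x := toLex (Sum.map f g (ofLex x))
  monotone' x y h := by
    rcases x with x | x <;> rcases y with y | y
    · exact Lex.inl_le_inl_iff.2 (f.monotone (Lex.inl_le_inl_iff.1 h))
    · exact Lex.inl_le_inr _ _
    · exact absurd h Lex.not_inr_le_inl
    · exact Lex.inr_le_inr_iff.2 (g.monotone (Lex.inr_le_inr_iff.1 h))

/-- An ordinal sum is contractible if its lower summand has a zigzag to a constant map. -/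
theorem contractible_lexSum (r q : P →o P) (c : P) (hr : ∀ x, x ≤ r x)
    (hq : ∀ x, q (r x) ≤ r x) (hc : ∀ x, q x ≤ c) :
    ContractibleSpace (orderComplex (P ⊕ₗ Q)).Realization := by
  refine contractible_orderComplex (lexSumMap r OrderHom.id)
    ⟨fun x => toLex (Sum.inl (Sum.elim q (fun _ => c) (ofLex x))), fun x y h => ?_⟩
    (toLex (Sum.inl c)) (fun x => ?_) (fun x => ?_) fun x => ?_
  · refine Lex.inl_le_inl_iff.2 ?_
    rcases x with x | x <;> rcases y with y | y
    · exact q.monotone (Lex.inl_le_inl_iff.1 h)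
    · exact hc x
    · exact absurd h Lex.not_inr_le_inl
    · exact le_rfl
  · rcases x with x | x
    · exact Lex.inl_le_inl_iff.2 (hr x)
    · exact le_rfl
  · rcases x with x | x
    · exact Lex.inl_le_inl_iff.2 (hq x)
    · exact Lex.inl_le_inr _ _
  · refine Lex.inl_le_inl_iff.2 ?_
    rcases x with x | x
    · exact hc _
    · exact le_rfl

theorem orderIso_of_lt {S T : Set P} (h : ∀ s ∈ S, ∀ t ∈ T, s < t) :
    Nonempty (S ⊕ₗ T ≃o (S ∪ T : Set P)) := by
  let f : S ⊕ₗ T → (S ∪ T : Set P) := fun x =>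
    Sum.elim (fun s => ⟨s.1, Or.inl s.2⟩) (fun t => ⟨t.1, Or.inr t.2⟩) (ofLex x)
  have hf : ∀ x y, f x ≤ f y ↔ x ≤ y := fun x y => by
    rcases x with x | x <;> rcases y with y | y
    · exact (Lex.inl_le_inl_iff (a := x) (b := y)).symm
    · exact iff_of_true (h _ x.2 _ y.2).le (Lex.inl_le_inr x y)
    · exact iff_of_false (h _ y.2 _ x.2).not_ge (Lex.not_inr_le_inl (a := y) (b := x))
    · exact (Lex.inr_le_inr_iff (a := x) (b := y)).symm
  refine ⟨RelIso.ofSurjective (OrderEmbedding.ofMapLEIff f hf) ?_⟩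
  rintro ⟨x, hx | hx⟩
  · exact ⟨toLex (Sum.inl ⟨x, hx⟩), rfl⟩
  · exact ⟨toLex (Sum.inr ⟨x, hx⟩), rfl⟩

noncomputable def orderIsoEquiv (e : P ≃o Q) :
    (orderComplex P).Realization ≃ₕ (orderComplex Q).Realization :=
  orderHomotopyEquiv (e : P →o Q) (e.symm : Q →o P)
    (Or.inl fun x => (e.symm_apply_apply x).le) (Or.inl fun x => (e.apply_symm_apply x).le)

noncomputable def lexRetractEquiv (S : Set Q) (r : Q → Q) (hr : Monotone r) (hle : ∀ x, r x ≤ x)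
    (hS : ∀ x, r x ∈ S) (hfix : ∀ x ∈ S, r x = x) :
    (orderComplex (P ⊕ₗ Q)).Realization ≃ₕ (orderComplex (P ⊕ₗ S)).Realization := by
  refine orderHomotopyEquiv (lexSumMap OrderHom.id ⟨fun x => ⟨r x, hS x⟩, fun _ _ h => hr h⟩)
    (lexSumMap OrderHom.id ⟨Subtype.val, fun _ _ h => h⟩) (Or.inl fun x => ?_) (Or.inl fun x => ?_)
  · rcases x with x | x
    · exact le_rfl
    · exact Lex.inr_le_inr_iff.2 (hle x)
  · rcases x with x | x
    · exact le_rfl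
    · exact Lex.inr_le_inr_iff.2 (hfix x.1 x.2).le

/-- A retraction exists if every element has a largest element of `S` below it. -/
theorem exists_retraction {S : Set Q} (h : ∀ x, ∃ y ∈ S, y ≤ x ∧ ∀ z ∈ S, z ≤ x → z ≤ y) :
    ∃ r : Q → Q, Monotone r ∧ (∀ x, r x ≤ x) ∧ (∀ x, r x ∈ S) ∧ ∀ x ∈ S, r x = x := by
  choose r hS hle hmax using h
  exact ⟨r, fun x y hxy => hmax y _ (hS x) ((hle x).trans hxy), hle, hS,
    fun x hx => le_antisymm (hle x) (hmax x x hx le_rfl)⟩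

open Classical in
/-- The chains in a set of vertices. -/
noncomputable def orderComplexHomeo {S : Set P} {K : PreAbstractSimplicialComplex P}
    (h : ∀ s, s ∈ K.faces ↔ s.Nonempty ∧ IsChain (· ≤ ·) (s : Set P) ∧ ∀ a ∈ s, a ∈ S) :
    (orderComplex S).Realization ≃ₜ K.Realization := by
  refine realizationHomeo Subtype.val Subtype.val_injective (fun s => ?_) fun t ht a ha =>
    ⟨⟨a, ((h t).1 ht).2.2 a ha⟩, rfl⟩
  rw [h, Finset.image_nonempty, Finset.coe_image]
  refine and_congr_right fun _ => ⟨fun hc => ⟨?_, ?_⟩, fun hc => ?_⟩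
  · rintro _ ⟨a, ha, rfl⟩ _ ⟨b, hb, rfl⟩ hne
    exact hc ha hb fun h => hne (h ▸ rfl)
  · rintro _ ha
    obtain ⟨b, _, rfl⟩ := Finset.mem_image.1 ha
    exact b.2
  · intro a ha b hb hne
    exact hc.1 ⟨a, ha, rfl⟩ ⟨b, hb, rfl⟩ fun h => hne (Subtype.ext h)

end LexSum

/-! ### The descending link as an order complex -/

namespace AuterVertex

open BasedGraph MarkedGraph

variable {n : ℕ} {a b : AuterVertex n}

/-- The blow-downs of smaller height. -/
def downSet (a : AuterVertex n) : Set (AuterVertex n) :=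
  {b | b.IsMarkedCactus ∧ b < a ∧ b.height < a.height}

/-- The blow-ups of smaller height. -/
def upSet (a : AuterVertex n) : Set (AuterVertex n) :=
  {b | b.IsMarkedCactus ∧ a < b ∧ b.height < a.height}

theorem isChain_iff {s : Set (AuterVertex n)} :
    IsChain CollapsesTo s ↔ IsChain (· ≤ ·) s := by
  constructor <;> exact fun h x hx y hy hne => (h hx hy hne).symm

theorem mem_cactusSpace {s : Finset (AuterVertex n)} : s ∈ (cactusSpace n).faces ↔
    s.Nonempty ∧ IsChain (· ≤ ·) (s : Set (AuterVertex n)) ∧ ∀ b ∈ s, b.IsMarkedCactus := by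
  rw [← isChain_iff]
  exact and_assoc

theorem mem_downLink {s : Finset (AuterVertex n)} : s ∈ a.downLink.faces ↔
    s.Nonempty ∧ IsChain (· ≤ ·) (s : Set (AuterVertex n)) ∧ ∀ b ∈ s, b ∈ a.downSet := by
  refine (and_congr_left' mem_cactusSpace).trans ?_
  simp only [isBlowDown_iff, and_assoc, downSet, Set.mem_ofPred_eq, ← forall₂_and]

theorem mem_upLink {s : Finset (AuterVertex n)} : s ∈ a.upLink.faces ↔
    s.Nonempty ∧ IsChain (· ≤ ·) (s : Set (AuterVertex n)) ∧ ∀ b ∈ s, b ∈ a.upSet := by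
  refine (and_congr_left' mem_cactusSpace).trans ?_
  simp only [isBlowDown_iff, and_assoc, upSet, Set.mem_ofPred_eq, ← forall₂_and]

/-- Descending collapses lower the height and all other non-trivial ones raise it, so each
implication is an equivalence. -/
theorem _root_.MarkedGraph.Compatible.height_lt_iff {X Y : MarkedGraph n} (hX : X.graph.IsCactus)
    {c : Collapse X.graph Y.graph} (hF : c.F.Nonempty) :
    Y.graph.height < X.graph.height ↔ X.graph.IsDescending c.F := by
  rw [c.height_eq]
  refine ⟨fun h => ?_, (isConnectedCactus hX).height_lt_of_isDescending X.reduced c.forest⟩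
  by_contra hd
  exact h.asymm ((isConnectedCactus hX).height_gt_of_not_isDescending c.forest hF hd)

theorem _root_.MarkedGraph.Compatible.height_gt_iff {X Y : MarkedGraph n} (hX : X.graph.IsCactus)
    {c : Collapse X.graph Y.graph} (hF : c.F.Nonempty) :
    X.graph.height < Y.graph.height ↔ ¬ X.graph.IsDescending c.F := by
  rw [c.height_eq]
  refine ⟨fun h hd => ?_, (isConnectedCactus hX).height_gt_of_not_isDescending c.forest hF⟩
  exact h.asymm ((isConnectedCactus hX).height_lt_of_isDescending X.reduced c.forest hd)

theorem _root_.MarkedGraph.Compatible.nonempty {X Y : MarkedGraph n}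
    {c : Collapse X.graph Y.graph} (hc : X.Compatible Y c) (hne : mk X ≠ mk Y) : c.F.Nonempty := by
  rw [Set.nonempty_iff_ne_empty]
  exact fun h => hne (mk_eq_iff.2 ⟨c, hc, h⟩)

/-- Comparable distinct marked cactus graphs have different heights. -/
theorem height_ne (ha : a.IsMarkedCactus) (h : b < a) : b.height ≠ a.height := by
  obtain ⟨X, rfl⟩ := Quotient.exists_rep a
  obtain ⟨Y, rfl⟩ := Quotient.exists_rep b
  obtain ⟨c, hc⟩ := mk_le_mk.1 h.le
  have hX := (mk_isMarkedCactus.1 ha).1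
  have hF := hc.nonempty h.ne'
  by_cases hd : X.graph.IsDescending c.F
  · exact ((Compatible.height_lt_iff hX hF).2 hd).ne
  · exact ((Compatible.height_gt_iff hX hF).2 hd).ne'

/-- The definition only bounds heights by that of `a`; the bound is strict because comparable
vertices differ in height. Conversely `a` can be added to any such chain, as it is comparable with
all of its elements. -/
theorem mem_descendingLink (ha : a.IsMarkedCactus) {t : Finset (AuterVertex n)} :
    t ∈ a.descendingLink.faces ↔ t.Nonempty ∧ IsChain (· ≤ ·) (t : Set (AuterVertex n)) ∧
      ∀ b ∈ t, b ∈ a.downSet ∪ a.upSet := by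
  classical
  constructor
  · rintro ⟨ht, hat, s, ⟨⟨hs, hle⟩, has⟩, hts⟩
    obtain ⟨_, hchain, hcactus⟩ := mem_cactusSpace.1 hs
    refine ⟨ht, hchain.mono (Finset.coe_subset.2 hts), fun b hb => ?_⟩
    have hbc := hcactus b (hts hb)
    have hba : b ≠ a := fun h => hat (h ▸ hb)
    rcases hchain.total (hts hb) has with h | h
    · have h' := lt_of_le_of_ne h hba
      exact Or.inl ⟨hbc, h', lt_of_le_of_ne (hle b (hts hb)) (height_ne ha h')⟩
    · have h' := lt_of_le_of_ne h hba.symm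
      exact Or.inr ⟨hbc, h', lt_of_le_of_ne (hle b (hts hb)) (height_ne hbc h').symm⟩
  · rintro ⟨ht, hchain, hmem⟩
    refine ⟨ht, fun hat => ?_, insert a t, ⟨⟨mem_cactusSpace.2 ⟨Finset.insert_nonempty a t, ?_, ?_⟩,
      ?_⟩, Finset.mem_insert_self a t⟩, Finset.subset_insert a t⟩
    · rcases hmem a hat with h | h
      exacts [lt_irrefl _ h.2.1, lt_irrefl _ h.2.1]
    · rw [Finset.coe_insert]
      refine hchain.insert fun b hb _ => ?_
      rcases hmem b hb with h | h
      exacts [Or.inr h.2.1.le, Or.inl h.2.1.le]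
    · intro b hb
      rcases Finset.mem_insert.1 hb with rfl | hb
      · exact ha
      · rcases hmem b hb with h | h
        exacts [h.1, h.1]
    · intro b hb
      rcases Finset.mem_insert.1 hb with rfl | hb
      · exact le_rfl
      · rcases hmem b hb with h | h
        exacts [h.2.2.le, h.2.2.le]

/-- Every element of the down-set is below every element of the up-set, so unions of chains are
chains. Thinness plays no part here. -/
theorem isJoin_descendingLink (ha : a.IsMarkedCactus) :
    a.descendingLink.IsJoin a.downLink a.upLink := by
  classical
  have hlt : ∀ x ∈ a.downSet, ∀ y ∈ a.upSet, x < y := fun x hx y hy => hx.2.1.trans hy.2.1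
  refine ⟨fun s hs t ht => Finset.disjoint_left.2 fun x hxs hxt =>
    lt_irrefl x (hlt x ((mem_downLink.1 hs).2.2 x hxs) x ((mem_upLink.1 ht).2.2 x hxt)), fun σ => ?_⟩
  rw [mem_descendingLink ha]
  refine and_congr_right fun hσ => ⟨fun ⟨hc, hm⟩ => ?_, ?_⟩
  · refine ⟨σ.filter (· ∈ a.downSet), σ.filter (· ∈ a.upSet), ?_, ?_, ?_⟩
    · rw [← Finset.not_nonempty_iff_eq_empty, mem_downLink, ← imp_iff_not_or]
      exact fun h => ⟨h, hc.mono fun _ h => (Finset.mem_filter.1 h).1, by simp⟩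
    · rw [← Finset.not_nonempty_iff_eq_empty, mem_upLink, ← imp_iff_not_or]
      exact fun h => ⟨h, hc.mono fun _ h => (Finset.mem_filter.1 h).1, by simp⟩
    · rw [← Finset.coe_union, ← Finset.filter_or, Finset.filter_true_of_mem]
      exact hm
  · rintro ⟨s, t, hs, ht, hst⟩
    have hs' : IsChain (· ≤ ·) (s : Set (AuterVertex n)) ∧ ∀ b ∈ s, b ∈ a.downSet := by
      rcases hs with rfl | hs
      · simp
      · exact (mem_downLink.1 hs).2
    have ht' : IsChain (· ≤ ·) (t : Set (AuterVertex n)) ∧ ∀ b ∈ t, b ∈ a.upSet := by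
      rcases ht with rfl | ht
      · simp
      · exact (mem_upLink.1 ht).2
    rw [hst]
    refine ⟨?_, fun b hb => ?_⟩
    · rintro x (hx | hx) y (hy | hy) hne
      · exact hs'.1 hx hy hne
      · exact Or.inl (hlt x (hs'.2 x hx) y (ht'.2 y hy)).le
      · exact Or.inr (hlt y (hs'.2 y hy) x (ht'.2 x hx)).le
      · exact ht'.1 hx hy hne
    · have : b ∈ (σ : Set (AuterVertex n)) := hb
      rw [hst] at this
      exact this.imp (hs'.2 b) (ht'.2 b)

end AuterVertex

/-! ### Descending forests -/

namespace BasedGraph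

variable {G H : BasedGraph}

/-- The edges that are incident to the root of their cycle. -/
def rootEdges (hG : G.IsCactus) : Set G.E :=
  {e | G.src e = G.root (hG.cyc e) ∨ G.tgt e = G.root (hG.cyc e)}

/-- The non-empty forests whose collapse decreases the height. -/
def DescendingForest (G : BasedGraph) : Type :=
  {F : Set G.E // G.IsForest F ∧ F.Nonempty ∧ G.IsDescending F}

instance : PartialOrder G.DescendingForest := inferInstanceAs (PartialOrder (Subtype _))

/-- Any edge of `F` in a cycle of least level touches the root of that cycle, and its other end is a
different vertex since a forest has no loops. -/
theorem isDescending_of_subset (hG : G.IsCactus) {F : Set G.E} (hF : G.IsForest F)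
    (hF0 : F.Nonempty) (hFB : F ⊆ rootEdges hG) : G.IsDescending F := by
  obtain ⟨C, ⟨hC, e, heC, heF⟩, hi⟩ : ∃ C, (G.IsCycle C ∧ (C ∩ F).Nonempty) ∧
      ∀ D, G.IsCycle D → (D ∩ F).Nonempty → G.cycleLevel C ≤ G.cycleLevel D := by
    obtain ⟨e, he⟩ := hF0
    obtain ⟨C, hC, hmin⟩ := Set.exists_min_image {C | G.IsCycle C ∧ (C ∩ F).Nonempty} G.cycleLevel
      (Set.toFinite _) ⟨_, hG.isCycle_cyc e, e, hG.mem_cyc e, he⟩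
    exact ⟨C, hC, fun D hD hDF => hmin D ⟨hD, hDF⟩⟩
  refine ⟨C, hC, hi, ?_⟩
  have hj : G.joinedIn (C ∩ F) (G.src e) (G.tgt e) := joinedIn_edge ⟨heC, heF⟩
  have hne := hF.src_ne_tgt heF
  rw [hG.eq_cyc hC heC] at hj ⊢
  rcases hFB heF with h | h
  · exact ⟨G.tgt e, ⟨e, hG.mem_cyc e, Or.inr rfl⟩, fun h' => hne (h.trans h'.symm), h ▸ hj⟩
  · exact ⟨G.src e, ⟨e, hG.mem_cyc e, Or.inl rfl⟩, fun h' => hne (h'.trans h.symm),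
      h ▸ joinedIn_symm hj⟩

theorem RootJoined.exists_edge {F C : Set G.E} (h : G.RootJoined F C) :
    ∃ e ∈ C ∩ F, G.src e = G.root C ∨ G.tgt e = G.root C := by
  obtain ⟨u, hu, hne, hj⟩ := h
  by_contra! hn
  exact hne (eq_of_joinedIn_isolated (fun e he => hn e he) (joinedIn_symm hj))

/-- A path in `F` that leaves the root of its cycle begins with an edge at the root. -/
theorem IsDescending.inter (hG : G.IsCactus) {F : Set G.E} (hF : G.IsForest F)
    (h : G.IsDescending F) :
    (F ∩ rootEdges hG).Nonempty ∧ G.IsDescending (F ∩ rootEdges hG) := by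
  obtain ⟨C, hC, -, hr⟩ := h
  obtain ⟨e, ⟨heC, heF⟩, he⟩ := hr.exists_edge
  rw [hG.eq_cyc hC heC] at he
  have h0 : (F ∩ rootEdges hG).Nonempty := ⟨e, heF, he⟩
  exact ⟨h0, isDescending_of_subset hG (hF.mono Set.inter_subset_left) h0 Set.inter_subset_right⟩

/-- A cycle has at most two edges at its root. So the cycle `C` of `e`, having at least three, is
not contained in the root edges; every other cycle avoids `e` and would lie in `F`. -/
theorem isForest_insert (h : G.IsConnectedCactus) {C : Set G.E} (hC : G.IsCycle C)
    (hC2 : ¬ C.ncard ≤ 2) {e : G.E} (he : e ∈ C) (heB : e ∈ rootEdges h.cactus) {F : Set G.E}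
    (hF : G.IsForest F) : G.IsForest (insert e (F ∩ rootEdges h.cactus)) := by
  intro D hD hDF
  by_cases hDC : D = C
  · subst hDC
    refine hC2 (le_trans ?_ (hD.degree_le (G.root D)))
    refine le_trans (Set.ncard_le_ncard (fun a ha => ?_) (Set.toFinite _)) (Set.ncard_union_le _ _)
    have hB : a ∈ rootEdges h.cactus := by
      rcases hDF ha with rfl | ha
      exacts [heB, ha.2]
    rw [rootEdges, Set.mem_ofPred_eq, ← h.cactus.eq_cyc hD ha] at hB
    exact hB.imp (fun h => ⟨ha, h⟩) fun h => ⟨ha, h⟩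
  · refine hF D hD fun a ha => ((hDF ha).resolve_left ?_).1
    rintro rfl
    exact hDC (h.cactus.cycle_eq hD hC ha he)

/-- If there is a cycle of length at least three, the descending link is contractible. -/
theorem contractible_of_not_isThin (h : G.IsConnectedCactus) (hn : ¬ G.IsThin) {Q : Type*}
    [PartialOrder Q] :
    ContractibleSpace (orderComplex (G.DescendingForestᵒᵈ ⊕ₗ Q)).Realization := by
  rw [IsThin] at hn
  push Not at hn
  obtain ⟨C, hC, hC2⟩ := hn
  obtain ⟨e, he, her⟩ := h.root_mem hC
  have heB : e ∈ rootEdges h.cactus := by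
    rw [rootEdges, Set.mem_ofPred_eq, ← h.cactus.eq_cyc hC he]
    exact her
  have hins := fun {F} (hF : G.IsForest F) => isForest_insert h hC hC2.not_ge he heB hF
  have hdes : ∀ {F : Set G.E}, G.IsForest F → G.IsDescending (insert e (F ∩ rootEdges h.cactus)) :=
    fun hF => isDescending_of_subset h.cactus (hins hF) (Set.insert_nonempty _ _)
      (Set.insert_subset heB Set.inter_subset_right)
  let r : G.DescendingForest →o G.DescendingForest :=
    ⟨fun F => ⟨F.1 ∩ rootEdges h.cactus, F.2.1.mono Set.inter_subset_left,
      IsDescending.inter h.cactus F.2.1 F.2.2.2⟩, fun F F' hF => Set.inter_subset_inter_left _ hF⟩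
  let q : G.DescendingForest →o G.DescendingForest :=
    ⟨fun F => ⟨insert e (F.1 ∩ rootEdges h.cactus), hins F.2.1, Set.insert_nonempty _ _,
      hdes F.2.1⟩, fun F F' hF => Set.insert_subset_insert (Set.inter_subset_inter_left _ hF)⟩
  have hc : insert e (∅ ∩ rootEdges h.cactus) = {e} := by simp
  let c : G.DescendingForest := ⟨insert e (∅ ∩ rootEdges h.cactus), hins Collapse.isForest_empty,
    Set.insert_nonempty _ _, hdes Collapse.isForest_empty⟩
  -- The zigzag from `F` to its part of root edges, to that part with `e` added, to `{e}`.
  -- Inclusions are reversed because larger forests give smaller graphs.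
  refine contractible_lexSum r.dual q.dual (OrderDual.toDual c) (fun F => ?_) (fun F => ?_) fun F => ?_
  · exact Set.inter_subset_left (s := (OrderDual.ofDual F).1)
  · refine Set.Subset.trans ?_ (Set.subset_insert e _)
    exact fun a ha => ⟨ha, ha.2⟩
  · exact Set.insert_subset_insert (Set.inter_subset_inter_left _ (Set.empty_subset _))

end BasedGraph

namespace MarkedGraph

open BasedGraph AuterVertex

variable {n : ℕ} {X Y : MarkedGraph n}

theorem nonempty_downSet_orderIso (hX : X.IsMarkedCactus) :
    Nonempty (X.graph.DescendingForestᵒᵈ ≃o (AuterVertex.mk X).downSet) := by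
  have hle : ∀ {F : Set X.graph.E} (hF : X.graph.IsForest F), AuterVertex.mk (X.collapse hX.1 hF) ≤ AuterVertex.mk X :=
    fun hF => AuterVertex.mk_le_mk.2 ⟨_, compatible_collapse hX.1 hF⟩
  let f : X.graph.DescendingForestᵒᵈ → (AuterVertex.mk X).downSet := fun F =>
    ⟨AuterVertex.mk (X.collapse hX.1 (OrderDual.ofDual F).2.1), by
      have h1 : (AuterVertex.mk (X.collapse hX.1 (OrderDual.ofDual F).2.1)).height < (AuterVertex.mk X).height :=
        (Compatible.height_lt_iff hX.1 (Y := X.collapse hX.1 (OrderDual.ofDual F).2.1)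
          (c := Collapse.std _ (OrderDual.ofDual F).2.1) (OrderDual.ofDual F).2.2.1).2
          (OrderDual.ofDual F).2.2.2
      refine ⟨mk_isMarkedCactus.2 ((compatible_collapse hX.1 _).isMarkedCactus hX),
        lt_of_le_of_ne (hle _) fun h => ?_, h1⟩
      rw [h] at h1
      exact lt_irrefl _ h1⟩
  refine ⟨RelIso.ofSurjective (OrderEmbedding.ofMapLEIff f fun F F' => ?_) ?_⟩
  · exact mk_collapse_le_iff hX.1 _ _
  · rintro ⟨b, hb, hlt, hh⟩
    obtain ⟨F, hF, rfl⟩ := exists_eq_collapse hX.1 hlt.le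
    have hF0 : F.Nonempty := (compatible_collapse hX.1 hF).nonempty hlt.ne'
    exact ⟨OrderDual.toDual ⟨F, hF, hF0, (Compatible.height_lt_iff hX.1 (Y := X.collapse hX.1 hF)
      (c := Collapse.std _ hF) hF0).1 hh⟩, rfl⟩

theorem nonempty_descendingLink_equiv (hX : X.IsMarkedCactus) :
    Nonempty ((AuterVertex.mk X).descendingLink.Realization ≃ₕ
      (orderComplex (X.graph.DescendingForestᵒᵈ ⊕ₗ (AuterVertex.mk X).upSet)).Realization) := by
  have ha := mk_isMarkedCactus.2 hX
  obtain ⟨f⟩ := nonempty_downSet_orderIso hX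
  obtain ⟨g⟩ := orderIso_of_lt (S := (AuterVertex.mk X).downSet) (T := (AuterVertex.mk X).upSet)
    fun x hx y hy => hx.2.1.trans hy.2.1
  exact ⟨(orderComplexHomeo fun s => mem_descendingLink ha).symm.toHomotopyEquiv.trans
    (orderIsoEquiv (g.symm.trans (f.symm.sumLexCongr (OrderIso.refl _))))⟩

end MarkedGraph

/-! ### Reduction of the up-link -/

namespace BasedGraph

variable {G H K : BasedGraph}

/-- The edges of a forest that are joined to the root of their cycle. -/
def rootPart (hG : G.IsCactus) (F : Set G.E) : Set G.E :=
  {e | e ∈ F ∧ G.joinedIn F (G.root (hG.cyc e)) (G.src e)}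

theorem mem_rootPart_iff (hG : G.IsCactus) {F : Set G.E} {x : G.E × Bool} (hx : x.1 ∈ F) :
    x.1 ∈ rootPart hG F ↔ G.joinedIn F (G.root (hG.cyc x.1)) (G.start x) := by
  refine (and_iff_right hx).trans ?_
  obtain ⟨e, b⟩ := x
  have := joinedIn_edge (G := G) hx
  cases b
  · exact ⟨fun h => joinedIn_trans h this, fun h => joinedIn_trans h (joinedIn_symm this)⟩
  · exact Iff.rfl

/-- If a cycle is collapsed at its root, an edge of `F` touches that root and so belongs to the root
part. -/
theorem not_isDescending_of_rootPart (hG : G.IsCactus) {F : Set G.E} (h : rootPart hG F = ∅) :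
    ¬ G.IsDescending F := by
  rintro ⟨C, hC, -, hr⟩
  obtain ⟨e, ⟨heC, heF⟩, he⟩ := hr.exists_edge
  have : e ∈ rootPart hG F := by
    rcases he with he | he
    · refine (mem_rootPart_iff hG (x := (e, true)) heF).2 ?_
      rw [← hG.eq_cyc hC heC, ← he]
      exact joinedIn_refl _
    · refine (mem_rootPart_iff hG (x := (e, false)) heF).2 ?_
      rw [← hG.eq_cyc hC heC, ← he]
      exact joinedIn_refl _
  rw [h] at this
  exact this

/-- Take an edge of `F` in a cycle of least level. If `F` joined it to the root, it would do so
inside the cycle, and the collapse would descend. -/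
theorem exists_notMem_rootPart (h : G.IsConnectedCactus) {F : Set G.E} (hF : G.IsForest F)
    (hF0 : F.Nonempty) (hd : ¬ G.IsDescending F) : ∃ e ∈ F, e ∉ rootPart h.cactus F := by
  obtain ⟨C, ⟨hC, e, heC, heF⟩, hi⟩ : ∃ C, (G.IsCycle C ∧ (C ∩ F).Nonempty) ∧
      ∀ D, G.IsCycle D → (D ∩ F).Nonempty → G.cycleLevel C ≤ G.cycleLevel D := by
    obtain ⟨e, he⟩ := hF0
    obtain ⟨C, hC, hmin⟩ := Set.exists_min_image {C | G.IsCycle C ∧ (C ∩ F).Nonempty} G.cycleLevel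
      (Set.toFinite _) ⟨_, h.cactus.isCycle_cyc e, e, h.cactus.mem_cyc e, he⟩
    exact ⟨C, hC, fun D hD hDF => hmin D ⟨hD, hDF⟩⟩
  refine ⟨e, heF, fun her => hd ⟨C, hC, hi, ?_⟩⟩
  have h1 : ∀ b, G.start (e, b) ∈ G.verts C := fun b => by
    cases b
    exacts [⟨e, heC, Or.inr rfl⟩, ⟨e, heC, Or.inl rfl⟩]
  have h2 : ∀ b, G.joinedIn (C ∩ F) (G.root C) (G.start (e, b)) := fun b => by
    have := (mem_rootPart_iff h.cactus (x := (e, b)) heF).1 her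
    rw [← h.cactus.eq_cyc hC heC] at this
    rw [Set.inter_comm]
    exact h.cactus.joinedIn_inter hC (h.root_mem hC) (h1 b) this
  by_cases hs : G.start (e, true) = G.root C
  · refine ⟨_, h1 false, fun ht => hF.src_ne_tgt heF (hs.trans ht.symm), h2 false⟩
  · exact ⟨_, h1 true, hs, h2 true⟩

/-- Roots of cycles and connectivity in the forest are both compatible with partial collapses, so
the root part of the remaining collapse is the image of the old one. -/
theorem Collapse.mem_rootPart_factor (h : G.IsConnectedCactus) (hH : H.IsCactus)
    (d : Collapse G H) (c : Collapse G K) (hdc : d.F ⊆ c.F) {x : G.E × Bool} {y : H.E × Bool}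
    (hx : d.label x = some y) :
    y.1 ∈ rootPart hH (d.factor c hdc).F ↔ x.1 ∈ rootPart h.cactus c.F := by
  have h1 : y.1 ∈ (d.factor c hdc).F ↔ x.1 ∈ c.F := by
    rw [← d.mem_pull (b := x.2) hx, d.pull_F_factor c hdc]
  by_cases hxF : x.1 ∈ c.F
  · have h2 : hH.cyc y.1 = d.mapC (h.cactus.cyc x.1) :=
      (hH.eq_cyc (d.isCycle_mapC h (h.cactus.isCycle_cyc x.1))
        ((d.mem_mapC (b := x.2) hx).2 (h.cactus.mem_cyc x.1))).symm
    rw [mem_rootPart_iff hH (h1.2 hxF), mem_rootPart_iff h.cactus hxF, h2,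
      d.root_mapC h (h.cactus.isCycle_cyc x.1), d.label_start hx, d.joinedIn_iff, d.pull_F_factor]
  · exact iff_of_false (fun h' => hxF (h1.1 h'.1)) fun h' => hxF h'.1

end BasedGraph

namespace MarkedGraph

open BasedGraph AuterVertex

variable {n : ℕ} {X Y : MarkedGraph n}

/-- The descending blow-ups where no collapsed edge is joined to the root of its cycle. -/
def reducedUpSet (X : MarkedGraph n) : Set (AuterVertex n) :=
  {b | b ∈ (AuterVertex.mk X).upSet ∧ ∀ (Y : MarkedGraph n) (hY : Y.graph.IsCactus)
    (c : Collapse Y.graph X.graph), AuterVertex.mk Y = b → Y.Compatible X c → rootPart hY c.F = ∅}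

theorem exists_compatible (h : AuterVertex.mk X < AuterVertex.mk Y) :
    ∃ c : Collapse Y.graph X.graph, Y.Compatible X c ∧ c.F.Nonempty := by
  obtain ⟨c, hc⟩ := AuterVertex.mk_le_mk.1 h.le
  exact ⟨c, hc, hc.nonempty h.ne'⟩

/-- By rigidity an empty root part for one representative and one collapse is empty for all. -/
theorem mem_reducedUpSet (hX : X.IsMarkedCactus) (hY : Y.graph.IsCactus)
    {c : Collapse Y.graph X.graph} (hc : Y.Compatible X c) (hF : c.F.Nonempty)
    (h0 : rootPart hY c.F = ∅) : AuterVertex.mk Y ∈ X.reducedUpSet := by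
  refine ⟨⟨mk_isMarkedCactus.2 (hc.isMarkedCactus_of_isCactus hY hX), lt_of_le_of_ne
    (AuterVertex.mk_le_mk.2 ⟨c, hc⟩) fun h => ?_, (Compatible.height_gt_iff hY hF).2
    (not_isDescending_of_rootPart hY h0)⟩, fun Z hZ d hZY hd => ?_⟩
  · rw [hc.F_eq_empty h.symm] at hF
    exact hF.ne_empty rfl
  · obtain ⟨b, hb, hb0⟩ := mk_eq_iff.1 hZY
    have hsub : b.F ⊆ d.F := hb0 ▸ Set.empty_subset _
    have h1 := Collapse.F_congr ((hb.factor hd hsub).label_eq hc)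
    refine Set.eq_empty_of_forall_notMem fun e he => ?_
    obtain ⟨y, hy⟩ := b.exists_label (x := (e, true)) (by rw [hb0]; exact id)
    have h2 := (b.mem_rootPart_factor (isConnectedCactus hZ) hY d hsub hy).2 he
    rw [h1, h0] at h2
    exact h2

/-- `y` is the collapse of the root part. It is still a proper blow-up, since some forest edge lies
outside the root part. A reduced blow-up below `b` must have collapsed all edges of the root part,
as survivors would remain in the root part; so it lies below `y`. -/
theorem exists_reduction (hX : X.IsMarkedCactus) {b : AuterVertex n} (hb : b ∈ (AuterVertex.mk X).upSet) :
    ∃ y ∈ X.reducedUpSet, y ≤ b ∧ ∀ z ∈ X.reducedUpSet, z ≤ b → z ≤ y := by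
  obtain ⟨Y, rfl⟩ := Quotient.exists_rep b
  obtain ⟨hYc, hlt, hh⟩ := hb
  have hY := (mk_isMarkedCactus.1 hYc).1
  obtain ⟨c, hc, hF⟩ := exists_compatible hlt
  have hd := (Compatible.height_gt_iff (Y := X) hY hF).1 hh
  obtain ⟨e, heF, her⟩ := exists_notMem_rootPart (isConnectedCactus hY) c.forest hF hd
  have hsub : rootPart hY c.F ⊆ c.F := fun a ha => ha.1
  have hR : Y.graph.IsForest (rootPart hY c.F) := c.forest.mono hsub
  have hd := compatible_collapse hY hR
  let d := Collapse.std Y.graph hR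
  have hdsub : d.F ⊆ c.F := hsub
  have hfac := hd.factor hc hdsub
  have hY' : (Y.collapse hY hR).graph.IsCactus := (d.isConnectedCactus (isConnectedCactus hY)).cactus
  refine ⟨AuterVertex.mk (Y.collapse hY hR), mem_reducedUpSet hX hY' hfac ?_ ?_, AuterVertex.mk_le_mk.2 ⟨_, hd⟩, ?_⟩
  · obtain ⟨y, hy⟩ := d.exists_label (x := (e, true)) her
    refine ⟨y.1, (d.mem_pull hy).1 ?_⟩
    exact (d.pull_F_factor c hdsub).ge heF
  · refine Set.eq_empty_of_forall_notMem fun y hy => ?_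
    obtain ⟨x, hx⟩ := d.label_surjective (y, true)
    exact d.notMem_of_label hx
      ((d.mem_rootPart_factor (isConnectedCactus hY) hY' c hdsub hx).1 hy)
  · intro z hz hzY
    obtain ⟨F, hF', rfl⟩ := exists_eq_collapse hY hzY
    refine (mk_collapse_le_iff hY hR hF').2 fun e he => ?_
    by_contra heF'
    let d' := Collapse.std Y.graph hF'
    have hd' := compatible_collapse hY hF'
    obtain ⟨c', hc', -⟩ := exists_compatible hz.1.2.1
    have hlab := hc.label_eq (hd'.comp hc')
    have hsub' : d'.F ⊆ c.F := by
      rw [Collapse.F_congr hlab]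
      exact d'.subset_F_comp c'
    have hY'' : (Y.collapse hY hF').graph.IsCactus :=
      (d'.isConnectedCactus (isConnectedCactus hY)).cactus
    have h0 := hz.2 _ hY'' _ rfl (hd'.factor hc hsub')
    obtain ⟨y, hy⟩ := d'.exists_label (x := (e, true)) heF'
    have := (d'.mem_rootPart_factor (isConnectedCactus hY) hY'' c hsub' hy).2 he
    exact (Set.ext_iff.1 h0 y.1).1 this

end MarkedGraph


/-! ### Thin cactus graphs -/

namespace BasedGraph

variable {G H : BasedGraph}

namespace IsConnectedCactus

/-- The cycle between a vertex and the base vertex. -/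
noncomputable def parent (h : G.IsConnectedCactus) {v : G.V} (hv : v ≠ G.base) : Set G.E :=
  (h.exists_parent hv).choose

variable {v u : G.V} {C : Set G.E}

theorem parent_spec (h : G.IsConnectedCactus) (hv : v ≠ G.base) :
    G.IsCycle (h.parent hv) ∧ v ∈ G.verts (h.parent hv) ∧ G.root (h.parent hv) ≠ v :=
  (h.exists_parent hv).choose_spec

theorem eq_parent (h : G.IsConnectedCactus) (hv : v ≠ G.base) (hC : G.IsCycle C)
    (hvC : v ∈ G.verts C) (hr : G.root C ≠ v) : C = h.parent hv :=
  h.parent_unique hC (h.parent_spec hv).1 hvC (h.parent_spec hv).2.1 hr (h.parent_spec hv).2.2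

theorem ne_base (h : G.IsConnectedCactus) (hC : G.IsCycle C)
    (hvC : v ∈ G.verts C) (hr : G.root C ≠ v) : v ≠ G.base := by
  rintro rfl
  exact hr (h.gate_of_mem hC hvC)

/-- In a thin cactus graph, cycles with at least two vertices have exactly two edges. -/
theorem thin_cycle (h : G.IsConnectedCactus) (ht : G.IsThin) (hC : G.IsCycle C)
    (hvC : v ∈ G.verts C) (hr : G.root C ≠ v) : ∃ y₁ y₂ : G.E × Bool, y₁.1 ≠ y₂.1 ∧
      C = {y₁.1, y₂.1} ∧ G.start y₁ = v ∧ G.start y₂ = v ∧ G.start (y₁.1, !y₁.2) = G.root C ∧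
      G.start (y₂.1, !y₂.2) = G.root C := by
  have hrC := h.root_mem hC
  have h2 := ht C hC
  generalize G.root C = r at *
  obtain ⟨m, w, e, hw, he, rfl, hwe⟩ := hC
  have hvert : ∀ u ∈ G.verts (Set.range e), ∃ i, u = w i := by
    rintro u ⟨_, ⟨i, rfl⟩, hu⟩
    rcases hwe i with ⟨h1, h2⟩ | ⟨h1, h2⟩ <;> rcases hu with rfl | rfl
    exacts [⟨_, h1⟩, ⟨_, h2⟩, ⟨_, h1⟩, ⟨_, h2⟩]
  rw [← Set.image_univ, Set.ncard_image_of_injective _ he, Set.ncard_univ, Nat.card_fin] at h2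
  obtain ⟨i, rfl⟩ := hvert v hvC
  obtain ⟨j, rfl⟩ := hvert r hrC
  have hij : j ≠ i := fun h => hr (h ▸ rfl)
  have hm : m = 1 := by
    have h1 := i.2
    have h2 := j.2
    have h3 : j.1 ≠ i.1 := fun h => hij (Fin.ext h)
    omega
  subst hm
  have h01 : ∀ i j : Fin (1 + 1), j ≠ i → i + 1 = j ∧ j + 1 = i := by decide
  obtain ⟨hi1, hj1⟩ := h01 i j hij
  have key : ∀ a : G.E, (G.src a = w i ∧ G.tgt a = w j) ∨ (G.src a = w j ∧ G.tgt a = w i) →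
      ∃ b, G.start (a, b) = w i ∧ G.start (a, !b) = w j := by
    rintro a (⟨h1, h2⟩ | ⟨h1, h2⟩)
    exacts [⟨true, h1, h2⟩, ⟨false, h2, h1⟩]
  obtain ⟨b, hb⟩ := key (e i) (by have := hwe i; rwa [hi1] at this)
  obtain ⟨b', hb'⟩ := key (e j) (by have := hwe j; rw [hj1] at this; exact this.symm)
  refine ⟨(e i, b), (e j, b'), fun h => hij (he h).symm, ?_, hb.1, hb'.1, hb.2, hb'.2⟩
  ext a
  constructor
  · rintro ⟨k, rfl⟩
    have : k = i ∨ k = j := by omega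
    rcases this with rfl | rfl
    exacts [Or.inl rfl, Or.inr rfl]
  · rintro (rfl | rfl)
    exacts [⟨_, rfl⟩, ⟨_, rfl⟩]

/-- A cycle with one or two edges has all of them at its root. -/
theorem rootEdges_of_thin (h : G.IsConnectedCactus) (ht : G.IsThin) (e : G.E) :
    e ∈ rootEdges h.cactus := by
  by_cases hs : G.src e = G.root (h.cactus.cyc e)
  · exact Or.inl hs
  · have hC := h.cactus.isCycle_cyc e
    have he := h.cactus.mem_cyc e
    obtain ⟨y₁, y₂, -, hCy, h1, h2, h3, h4⟩ := h.thin_cycle ht hC ⟨e, he, Or.inl rfl⟩ (Ne.symm hs)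
    have key : ∀ y : G.E × Bool, e = y.1 → G.start y = G.src e →
        G.start (y.1, !y.2) = G.root (h.cactus.cyc e) → G.tgt e = G.root (h.cactus.cyc e) := by
      rintro ⟨a, b⟩ rfl h1 h2
      cases b
      · exact absurd h2 hs
      · exact h2
    right
    rw [hCy] at he
    rcases he with he | he
    · exact key y₁ he h1 h3
    · exact key y₂ he h2 h4

/-- A cycle of a thin cactus graph has at most one vertex that is not its root. -/
theorem thin_unique (h : G.IsConnectedCactus) (ht : G.IsThin) (hC : G.IsCycle C)
    (hvC : v ∈ G.verts C) (hr : G.root C ≠ v) (huC : u ∈ G.verts C) (hru : G.root C ≠ u) :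
    u = v := by
  obtain ⟨y₁, y₂, -, hCy, h1, h2, h3, h4⟩ := h.thin_cycle ht hC hvC hr
  obtain ⟨e, he, hu⟩ := huC
  have key : ∀ y : G.E × Bool, e = y.1 → G.start y = v → G.start (y.1, !y.2) = G.root C →
      u = v := by
    rintro ⟨a, b⟩ rfl h1 h2
    cases b <;> rcases hu with rfl | rfl
    exacts [absurd h2.symm hru, h1, h1, absurd h2.symm hru]
  have he' := he
  rw [hCy] at he'
  rcases he' with he' | he'
  · exact key y₁ he' h1 h3
  · exact key y₂ he' h2 h4

theorem parent_injective (h : G.IsConnectedCactus) (ht : G.IsThin) (hv : v ≠ G.base)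
    (hu : u ≠ G.base) (huv : h.parent hv = h.parent hu) : v = u := by
  obtain ⟨h1, h2, h3⟩ := h.parent_spec hv
  obtain ⟨-, h5, h6⟩ := h.parent_spec hu
  rw [huv] at h1 h2 h3
  exact h.thin_unique ht h1 h5 h6 h2 h3

end IsConnectedCactus

open Classical in
noncomputable instance : Fintype (Set G.E) := Fintype.ofFinite _

/-- The complex of the forests in a thin cactus graph: a join of boundaries of simplices. -/
def forestComplex (h : G.IsConnectedCactus) : PreAbstractSimplicialComplex
    (Σ v : {v // v ≠ G.base}, {e // e ∈ h.parent v.2}) :=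
  familyJoin fun v : {v // v ≠ G.base} => simplexBoundary {e // e ∈ h.parent v.2}

/-- All edges are root edges, so every non-empty forest descends. The edges that are not loops lie
in the parent cycles of the vertices other than the base, one cycle for each; a set of them is a
forest if it contains none of these cycles. -/
theorem nonempty_descendingForest_orderIso (h : G.IsConnectedCactus) (ht : G.IsThin) :
    Nonempty ((forestComplex h).faces ≃o G.DescendingForest) := by
  classical
  let ι : (Σ v : {v // v ≠ G.base}, {e // e ∈ h.parent v.2}) → G.E := fun a => a.2.1
  have hpar : ∀ a : (Σ v : {v // v ≠ G.base}, {e // e ∈ h.parent v.2}),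
      ∀ C, G.IsCycle C → ι a ∈ C → C = h.parent a.1.2 := fun a C hC ha =>
    h.cactus.cycle_eq hC (h.parent_spec a.1.2).1 ha a.2.2
  have hι : Function.Injective ι := by
    rintro ⟨⟨v, hv⟩, e, he⟩ ⟨⟨u, hu⟩, e', he'⟩ hee
    obtain rfl : e = e' := hee
    obtain rfl : v = u := h.parent_injective ht hv hu
      (h.cactus.cycle_eq (h.parent_spec hv).1 (h.parent_spec hu).1 he he')
    rfl
  have hsurj : ∀ e, G.src e ≠ G.tgt e → ∃ a, ι a = e := fun e hne => by
    have hC := h.cactus.isCycle_cyc e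
    have he := h.cactus.mem_cyc e
    have key : ∀ v ∈ G.verts (h.cactus.cyc e), G.root (h.cactus.cyc e) ≠ v → ∃ a, ι a = e :=
      fun v hvC hr => by
        have hv := h.ne_base hC hvC hr
        exact ⟨⟨⟨v, hv⟩, ⟨e, h.eq_parent hv hC hvC hr ▸ he⟩⟩, rfl⟩
    by_cases hs : G.root (h.cactus.cyc e) = G.src e
    · exact key (G.tgt e) ⟨e, he, Or.inr rfl⟩ (hs ▸ hne)
    · exact key (G.src e) ⟨e, he, Or.inl rfl⟩ hs
  have hforest : ∀ s ∈ (forestComplex h).faces, G.IsForest (ι '' (s : Set _)) := by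
    rintro s ⟨-, hs⟩ C hC hCs
    obtain ⟨e, he⟩ := hC.nonempty
    obtain ⟨a, -, rfl⟩ := hCs he
    have hCa := hpar a C hC he
    obtain ⟨-, e', he'⟩ := hs a.1 Finset.univ ⟨a.2, Finset.mem_univ _⟩ fun e' _ => by
      obtain ⟨b, hb, hbe⟩ := hCs (hCa ▸ e'.2 : e'.1 ∈ C)
      rwa [hι (a₁ := b) (a₂ := ⟨a.1, e'⟩) hbe] at hb
    exact he' (Finset.mem_univ _)
  have hdes : ∀ F, G.IsForest F → F.Nonempty → G.IsDescending F := fun F hF hF0 =>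
    isDescending_of_subset h.cactus hF hF0 fun e _ => h.rootEdges_of_thin ht e
  let f : (forestComplex h).faces → G.DescendingForest := fun s =>
    have h0 : (ι '' (s.1 : Set _)).Nonempty := Set.Nonempty.image ι (Finset.coe_nonempty.2 s.2.1)
    ⟨ι '' (s.1 : Set _), hforest _ s.2, h0, hdes _ (hforest _ s.2) h0⟩
  refine ⟨RelIso.ofSurjective (OrderEmbedding.ofMapLEIff f fun s t => ?_) ?_⟩
  · refine (Set.image_subset_image_iff hι).trans ?_
    exact Finset.coe_subset
  · rintro ⟨F, hF, hF0, hFd⟩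
    let s : Finset (Σ v : {v // v ≠ G.base}, {e // e ∈ h.parent v.2}) :=
      Finset.univ.filter fun a => ι a ∈ F
    have hs : ι '' (s : Set _) = F := by
      ext e
      constructor
      · rintro ⟨a, ha, rfl⟩
        exact (Finset.mem_filter.1 ha).2
      · intro he
        obtain ⟨a, rfl⟩ := hsurj e (hF.src_ne_tgt he)
        exact ⟨a, by simpa [s] using he, rfl⟩
    refine ⟨⟨s, ?_, fun v t htne hts => ⟨htne, ?_⟩⟩, Subtype.ext hs⟩
    · rw [← hs] at hF0
      obtain ⟨_, a, ha, -⟩ := hF0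
      exact ⟨a, ha⟩
    · by_contra! hall
      refine hF _ (h.parent_spec v.2).1 fun e he => ?_
      exact (Finset.mem_filter.1 (hts ⟨e, he⟩ (hall ⟨e, he⟩))).2

/-! ### Splittings -/

/-- The cycles with a given root. -/
def rootsAt (G : BasedGraph) (v : G.V) : Set (Set G.E) := {D | G.IsCycle D ∧ G.root D = v}

/-- A proper non-empty set of cycles based at a vertex other than the base vertex. -/
def IsSplit (G : BasedGraph) (q : G.V × Set (Set G.E)) : Prop :=
  q.1 ≠ G.base ∧ q.2.Nonempty ∧ q.2 ⊂ G.rootsAt q.1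

/-- Sets of splittings that form a chain at every vertex. -/
def IsSplitting (G : BasedGraph) (s : Set (G.V × Set (Set G.E))) : Prop :=
  (∀ q ∈ s, G.IsSplit q) ∧ ∀ q ∈ s, ∀ q' ∈ s, q.1 = q'.1 → q.2 ⊆ q'.2 ∨ q'.2 ⊆ q.2

def Splitting (G : BasedGraph) : Type :=
  {s : Set (G.V × Set (Set G.E)) // s.Nonempty ∧ G.IsSplitting s}

instance : PartialOrder G.Splitting := inferInstanceAs (PartialOrder (Subtype _))

/-- The complex of splittings: a join of subdivided boundaries of simplices. -/
def splittingComplex (G : BasedGraph) : PreAbstractSimplicialComplex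
    (Σ v : {v // v ≠ G.base}, (simplexBoundary (G.rootsAt v.1)).faces) :=
  familyJoin fun v : {v // v ≠ G.base} => orderComplex (simplexBoundary (G.rootsAt v.1)).faces

/-- A splitting at `v` is a face of the boundary of the simplex on the cycles rooted at `v`, and a
face of the join is a choice of chains of such faces at the various `v`. -/
theorem nonempty_splitting_orderIso (G : BasedGraph) :
    Nonempty (G.splittingComplex.faces ≃o G.Splitting) := by
  classical
  let ι : (Σ v : {v // v ≠ G.base}, (simplexBoundary (G.rootsAt v.1)).faces) →
      G.V × Set (Set G.E) := fun a => (a.1.1, Subtype.val '' (a.2.1 : Set (G.rootsAt a.1.1)))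
  have hsub : ∀ v : {v // v ≠ G.base}, ∀ S T : (simplexBoundary (G.rootsAt v.1)).faces,
      (ι ⟨v, S⟩).2 ⊆ (ι ⟨v, T⟩).2 ↔ S ≤ T := fun v S T =>
    (Set.image_subset_image_iff Subtype.val_injective).trans Finset.coe_subset
  have hι : Function.Injective ι := by
    rintro ⟨⟨v, hv⟩, S⟩ ⟨⟨u, hu⟩, T⟩ hST
    obtain rfl : v = u := congrArg Prod.fst hST
    have h2 : (ι ⟨⟨v, hv⟩, S⟩).2 = (ι ⟨⟨v, hv⟩, T⟩).2 := congrArg Prod.snd hST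
    rw [le_antisymm ((hsub ⟨v, hv⟩ S T).1 h2.le) ((hsub ⟨v, hv⟩ T S).1 h2.ge)]
  have hsplit : ∀ a, G.IsSplit (ι a) := by
    rintro ⟨⟨v, hv⟩, S, hS, D, hD⟩
    refine ⟨hv, Set.Nonempty.image _ (Finset.coe_nonempty.2 hS), ?_, fun h => ?_⟩
    · rintro _ ⟨D, _, rfl⟩
      exact D.2
    · obtain ⟨D', hD', hDD⟩ := h D.2
      exact hD (Subtype.ext hDD ▸ hD')
  have hsurj : ∀ q, G.IsSplit q → ∃ a, ι a = q := by
    rintro ⟨v, S⟩ ⟨hv, hS, hsub, hne⟩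
    obtain ⟨D, hD, hDS⟩ := Set.not_subset.1 hne
    obtain ⟨D', hD'⟩ := hS
    refine ⟨⟨⟨v, hv⟩, Finset.univ.filter fun D => D.1 ∈ S, ⟨⟨D', hsub hD'⟩, by simpa using hD'⟩,
      ⟨D, hD⟩, by simpa using hDS⟩, Prod.ext rfl ?_⟩
    ext D''
    simp only [ι, Finset.coe_filter, Finset.mem_univ, true_and, Set.mem_image, Set.mem_ofPred_eq]
    exact ⟨by rintro ⟨a, ha, rfl⟩; exact ha, fun h => ⟨⟨D'', hsub h⟩, h, rfl⟩⟩
  have hface : ∀ s : Finset _, s ∈ G.splittingComplex.faces ↔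
      (ι '' (s : Set _)).Nonempty ∧ G.IsSplitting (ι '' (s : Set _)) := fun s => by
    rw [Set.image_nonempty, Finset.coe_nonempty]
    refine and_congr_right fun hs => ⟨fun h => ⟨?_, ?_⟩, fun h v t ht hts => ⟨ht, ?_⟩⟩
    · rintro _ ⟨a, _, rfl⟩
      exact hsplit a
    · rintro _ ⟨⟨v, S⟩, hS, rfl⟩ _ ⟨⟨u, T⟩, hT, rfl⟩ hvu
      obtain rfl : v = u := Subtype.ext hvu
      rw [hsub, hsub]
      refine (h v {S, T} (by simp) fun a ha => ?_).2.total (by simp) (by simp)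
      rcases Finset.mem_insert.1 ha with rfl | ha
      · exact hS
      · rw [Finset.mem_singleton.1 ha]
        exact hT
    · intro S hS T hT _
      exact (h.2 _ ⟨_, hts S hS, rfl⟩ _ ⟨_, hts T hT, rfl⟩ rfl).imp (hsub v S T).1 (hsub v T S).1
  let f : G.splittingComplex.faces → G.Splitting := fun s => ⟨ι '' (s.1 : Set _), (hface s.1).1 s.2⟩
  refine ⟨RelIso.ofSurjective (OrderEmbedding.ofMapLEIff f fun s t => ?_) ?_⟩
  · refine (Set.image_subset_image_iff hι).trans ?_
    exact Finset.coe_subset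
  · rintro ⟨s, hs0, hs⟩
    let t : Finset (Σ v : {v // v ≠ G.base}, (simplexBoundary (G.rootsAt v.1)).faces) :=
      Finset.univ.filter fun a => ι a ∈ s
    have ht : ι '' (t : Set _) = s := by
      ext q
      constructor
      · rintro ⟨a, ha, rfl⟩
        exact (Finset.mem_filter.1 ha).2
      · intro hq
        obtain ⟨a, rfl⟩ := hsurj q (hs.1 q hq)
        exact ⟨a, by simpa [t] using hq, rfl⟩
    exact ⟨⟨t, (hface t).2 (ht.symm ▸ ⟨hs0, hs⟩)⟩, Subtype.ext ht⟩

end BasedGraph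


/-! ### Cuts -/

namespace BasedGraph

variable {G H K : BasedGraph}

theorem eq_of_joinedIn_const {α : Type*} {A : Set G.E} {f : G.V → α}
    (hf : ∀ e ∈ A, f (G.src e) = f (G.tgt e)) {u v : G.V} (h : G.joinedIn A u v) : f u = f v := by
  induction h with
  | rel a b h =>
    obtain ⟨e, he, rfl, rfl⟩ := h
    exact hf e he
  | refl a => rfl
  | symm a b _ ih => exact ih.symm
  | trans a b c _ _ ih ih' => exact ih.trans ih'

/-- The coboundary of `g`, summed along a chain, only depends on the ends. -/
theorem add_eq_sum_of_bdry (g : G.V → ZMod 2) {z : G.E → ZMod 2} {u v : G.V}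
    (hz : G.bdry z = G.pt u + G.pt v) :
    g u + g v = ∑ e, z e * (g (G.src e) + g (G.tgt e)) := by
  classical
  let L : (G.V → ZMod 2) →ₗ[ZMod 2] ZMod 2 := Fintype.linearCombination (ZMod 2) g
  have hL : ∀ v, L (G.pt v) = g v := fun v => by
    rw [pt, Fintype.linearCombination_apply_single, one_smul]
  rw [← hL u, ← hL v, ← map_add, ← hz, bdry_apply, map_sum]
  refine Finset.sum_congr rfl fun e _ => ?_
  rw [map_smul, map_add, hL, hL, smul_eq_mul]

/-- `g` is the potential, vanishing at the base vertex, that changes exactly along the edges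
in `A`. -/
structure IsCut (G : BasedGraph) (A : Set G.E) (g : G.V → ZMod 2) : Prop where
  base : g G.base = 0
  edge : ∀ e, g (G.src e) + g (G.tgt e) = G.chain A e

open Classical in
/-- The potential of a set of edges. -/
noncomputable def cut (G : BasedGraph) (A : Set G.E) : G.V → ZMod 2 :=
  if h : ∃ g, G.IsCut A g then h.choose else 0

namespace IsCut

variable {A : Set G.E} {g g' : G.V → ZMod 2}

theorem start_add (h : G.IsCut A g) (x : G.E × Bool) :
    g (G.start x) + g (G.start (x.1, !x.2)) = G.chain A x.1 := by
  rw [← h.edge]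
  obtain ⟨e, b⟩ := x
  cases b
  exacts [add_comm _ _, rfl]

theorem start_eq (h : G.IsCut A g) {x : G.E × Bool} (hx : x.1 ∉ A) :
    g (G.start x) = g (G.start (x.1, !x.2)) := by
  rw [← CharTwo.add_eq_zero, h.start_add, chain_of_notMem hx]

theorem start_ne (h : G.IsCut A g) {x : G.E × Bool} (hx : x.1 ∈ A) :
    g (G.start x) ≠ g (G.start (x.1, !x.2)) := fun h' => by
  rw [← CharTwo.add_eq_zero, h.start_add, chain_of_mem hx] at h'
  exact one_ne_zero h'

theorem eq_of_joinedIn (h : G.IsCut A g) {u v : G.V} (hj : G.joinedIn Aᶜ u v) : g u = g v :=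
  eq_of_joinedIn_const (fun e he => h.start_eq (x := (e, true)) he) hj

theorem unique (hc : ∀ u v, G.joinedIn Set.univ u v) (h : G.IsCut A g) (h' : G.IsCut A g') :
    g = g' := by
  funext v
  have : (g + g') v = (g + g') G.base := eq_of_joinedIn_const (fun e _ => by
    rw [← CharTwo.add_eq_zero, Pi.add_apply, Pi.add_apply, add_add_add_comm, h.edge, h'.edge,
      CharTwo.add_self_eq_zero]) (hc v G.base)
  rwa [Pi.add_apply, Pi.add_apply, h.base, h'.base, add_zero, CharTwo.add_eq_zero] at this

theorem cut_eq (hc : ∀ u v, G.joinedIn Set.univ u v) (h : G.IsCut A g) : G.cut A = g := by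
  have hex : ∃ g, G.IsCut A g := ⟨g, h⟩
  rw [cut, dif_pos hex]
  exact hex.choose_spec.unique hc h

theorem isCut_cut (h : G.IsCut A g) : G.IsCut A (G.cut A) := by
  have hex : ∃ g, G.IsCut A g := ⟨g, h⟩
  rw [cut, dif_pos hex]
  exact hex.choose_spec

theorem sum_eq (h : G.IsCut A g) {z : G.E → ZMod 2} {u v : G.V}
    (hz : G.bdry z = G.pt u + G.pt v) : g u + g v = ∑ e, z e * G.chain A e := by
  rw [add_eq_sum_of_bdry g hz]
  exact Finset.sum_congr rfl fun e _ => by rw [h.edge]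

end IsCut

/-- Two edges of a cycle of a cactus graph form a cut. -/
theorem IsConnectedCactus.exists_isCut (h : G.IsConnectedCactus) {C : Set G.E} (hC : G.IsCycle C)
    {a b : G.E} (ha : a ∈ C) (hb : b ∈ C) (hab : a ≠ b) : ∃ g, G.IsCut {a, b} g := by
  classical
  have h1 : ∀ w, ∃ x : G.E → ZMod 2, G.bdry x = G.pt G.base + G.pt w := fun w => by
    obtain ⟨x, -, hx⟩ := joinedIn_iff.1 (h.conn G.base w)
    exact ⟨x, hx⟩
  choose x hx using h1
  -- The potential of `w` is the parity with which a path from the base vertex to `w` uses `a` and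
  -- `b`. It does not depend on the path, since closed chains have equal coefficients at `a` and
  -- `b`.
  refine ⟨fun w => x w a + x w b, ?_, fun e => ?_⟩
  · have := h.cactus.closed_const (x := x G.base) (by rw [hx, add_self_fun]) hC ha hb
    change x G.base a + x G.base b = 0
    rw [this, CharTwo.add_self_eq_zero]
  · have h0 : G.bdry (x (G.src e) + x (G.tgt e) + Pi.single e 1) = 0 := by
      rw [map_add, map_add, hx, hx, bdry_single, add_add_add_comm (G.pt G.base), add_self_fun,
        zero_add, add_self_fun]
    have h2 := h.cactus.closed_const h0 hC ha hb
    simp only [Pi.add_apply] at h2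
    have h3 : G.chain {a, b} e = (Pi.single e 1 : G.E → ZMod 2) a + (Pi.single e 1 : G.E → ZMod 2) b := by
      by_cases hea : a = e
      · subst hea
        rw [chain_of_mem (Or.inl rfl), Pi.single_eq_same, Pi.single_eq_of_ne hab.symm, add_zero]
      · by_cases heb : b = e
        · subst heb
          rw [chain_of_mem (Or.inr rfl), Pi.single_eq_same, Pi.single_eq_of_ne hab, zero_add]
        · rw [chain_of_notMem (by rintro (rfl | rfl); exacts [hea rfl, heb rfl]),
            Pi.single_eq_of_ne hea, Pi.single_eq_of_ne heb, add_zero]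
    rw [h3]
    clear h3 h0 hx
    change x (G.src e) a + x (G.src e) b + (x (G.tgt e) a + x (G.tgt e) b) = _
    generalize (Pi.single e 1 : G.E → ZMod 2) a = p at *
    generalize (Pi.single e 1 : G.E → ZMod 2) b = q at *
    generalize x (G.src e) a = r1 at *
    generalize x (G.src e) b = r2 at *
    generalize x (G.tgt e) a = r3 at *
    generalize x (G.tgt e) b = r4 at *
    revert p q r1 r2 r3 r4
    decide

/-! ### The ends of the parent cycles -/

namespace IsConnectedCactus

variable {v : G.V}

theorem exists_ends (h : G.IsConnectedCactus) (ht : G.IsThin) (hv : v ≠ G.base) :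
    ∃ y₁ y₂ : G.E × Bool, y₁.1 ≠ y₂.1 ∧ h.parent hv = {y₁.1, y₂.1} ∧ G.start y₁ = v ∧
      G.start y₂ = v ∧ G.start (y₁.1, !y₁.2) = G.root (h.parent hv) ∧
      G.start (y₂.1, !y₂.2) = G.root (h.parent hv) :=
  h.thin_cycle ht (h.parent_spec hv).1 (h.parent_spec hv).2.1 (h.parent_spec hv).2.2

/-- The first half-edge at `v` in the cycle between `v` and the base vertex. -/
noncomputable def lo (h : G.IsConnectedCactus) (ht : G.IsThin) (hv : v ≠ G.base) : G.E × Bool :=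
  (h.exists_ends ht hv).choose

/-- The second half-edge at `v` in the cycle between `v` and the base vertex. -/
noncomputable def hi (h : G.IsConnectedCactus) (ht : G.IsThin) (hv : v ≠ G.base) : G.E × Bool :=
  (h.exists_ends ht hv).choose_spec.choose

theorem ends_spec (h : G.IsConnectedCactus) (ht : G.IsThin) (hv : v ≠ G.base) :
    (h.lo ht hv).1 ≠ (h.hi ht hv).1 ∧ h.parent hv = {(h.lo ht hv).1, (h.hi ht hv).1} ∧
      G.start (h.lo ht hv) = v ∧ G.start (h.hi ht hv) = v ∧
      G.start ((h.lo ht hv).1, !(h.lo ht hv).2) = G.root (h.parent hv) ∧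
      G.start ((h.hi ht hv).1, !(h.hi ht hv).2) = G.root (h.parent hv) :=
  (h.exists_ends ht hv).choose_spec.choose_spec

theorem lo_mem (h : G.IsConnectedCactus) (ht : G.IsThin) (hv : v ≠ G.base) :
    (h.lo ht hv).1 ∈ h.parent hv := (h.ends_spec ht hv).2.1 ▸ Or.inl rfl

theorem hi_mem (h : G.IsConnectedCactus) (ht : G.IsThin) (hv : v ≠ G.base) :
    (h.hi ht hv).1 ∈ h.parent hv := (h.ends_spec ht hv).2.1 ▸ Or.inr rfl

/-- If `v` is not the root of the cycle of `y`, that cycle is the parent of `v` and has two edges;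
the orientation is forced, as the reversed half-edges start at the root. -/
theorem root_eq_or (h : G.IsConnectedCactus) (ht : G.IsThin) {y : G.E × Bool}
    (hy : G.start y = v) : G.root (h.cactus.cyc y.1) = v ∨ ∃ hv : v ≠ G.base,
      h.cactus.cyc y.1 = h.parent hv ∧ (y = h.lo ht hv ∨ y = h.hi ht hv) := by
  by_cases hr : G.root (h.cactus.cyc y.1) = v
  · exact Or.inl hr
  · have hC := h.cactus.isCycle_cyc y.1
    have hvC : v ∈ G.verts (h.cactus.cyc y.1) := by
      refine ⟨y.1, h.cactus.mem_cyc _, ?_⟩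
      obtain ⟨e, b⟩ := y
      cases b
      exacts [Or.inr hy, Or.inl hy]
    have hv := h.ne_base hC hvC hr
    have hp := h.eq_parent hv hC hvC hr
    refine Or.inr ⟨hv, hp, ?_⟩
    obtain ⟨h1, h2, h3, h4, h5, h6⟩ := h.ends_spec ht hv
    have key : ∀ z : G.E × Bool, y.1 = z.1 → G.start (z.1, !z.2) = G.root (h.parent hv) → y = z :=
      fun z hyz hz => Prod.ext hyz (by
        by_contra hne
        rw [← hyz, ← Bool.eq_not.2 hne] at hz
        exact hr ((hp ▸ hz : G.start y = _).symm.trans hy))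
    have := h.cactus.mem_cyc y.1
    rw [hp, h2] at this
    rcases this with h' | h'
    · exact Or.inl (key _ h' h5)
    · exact Or.inr (key _ h' h6)

/-- The second half-edge at `v` in the parent cycle, as a relation. -/
def Tail (h : G.IsConnectedCactus) (ht : G.IsThin) (v : G.V) (y : G.E × Bool) : Prop :=
  ∃ hv : v ≠ G.base, y = h.hi ht hv

theorem Tail.root_ne {h : G.IsConnectedCactus} {ht : G.IsThin} {y : G.E × Bool}
    (hy : h.Tail ht v y) : G.root (h.cactus.cyc y.1) ≠ v := by
  obtain ⟨hv, rfl⟩ := hy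
  rw [← h.cactus.eq_cyc (h.parent_spec hv).1 (h.hi_mem ht hv)]
  exact (h.parent_spec hv).2.2

theorem not_tail_lo (h : G.IsConnectedCactus) (ht : G.IsThin) (hv : v ≠ G.base) :
    ¬ h.Tail ht v (h.lo ht hv) := fun ⟨_, h'⟩ =>
  (h.ends_spec ht hv).1 (congrArg Prod.fst h')

end IsConnectedCactus

theorem start_mem_verts {C : Set G.E} {x : G.E × Bool} (hx : x.1 ∈ C) : G.start x ∈ G.verts C := by
  obtain ⟨e, b⟩ := x
  cases b
  exacts [⟨e, hx, Or.inr rfl⟩, ⟨e, hx, Or.inl rfl⟩]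

/-! ### Trimmed collapses onto thin graphs and their splittings -/

namespace Collapse

variable {c : Collapse H G}

theorem onV_edge (c : Collapse H G) {e : H.E} (he : e ∈ c.F) : c.onV (H.src e) = c.onV (H.tgt e) :=
  c.onV_eq_iff.2 (joinedIn_edge he)

theorem onV_start (c : Collapse H G) {x : H.E × Bool} (he : x.1 ∈ c.F) :
    c.onV (H.start x) = c.onV (H.src x.1) := by
  obtain ⟨e, b⟩ := x
  cases b
  exacts [(c.onV_edge he).symm, rfl]

/-- Vertices with the same image are joined by the collapsed edges over that image. -/
theorem joinedIn_fibre (c : Collapse H G) {u w : H.V} (h : H.joinedIn c.F u w) :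
    H.joinedIn {e | e ∈ c.F ∧ c.onV (H.src e) = c.onV u} u w := by
  suffices ∀ v, c.onV u = v → H.joinedIn {e | e ∈ c.F ∧ c.onV (H.src e) = v} u w from this _ rfl
  induction h with
  | rel a b h =>
    obtain ⟨e, he, rfl, rfl⟩ := h
    exact fun v hv => joinedIn_edge ⟨he, hv⟩
  | refl a => exact fun v _ => joinedIn_refl a
  | symm a b h ih => exact fun v hv => joinedIn_symm (ih v ((c.onV_eq_iff.2 h).trans hv))
  | trans a b d h h' ih ih' =>
    exact fun v hv => joinedIn_trans (ih v hv) (ih' v ((c.onV_eq_iff.2 h).symm.trans hv))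

/-- A collapse onto a thin graph where no collapsed edge is joined to the root of its cycle. -/
structure IsTrimmed (c : Collapse H G) : Prop where
  source : H.IsConnectedCactus
  two : H.HasTwoCycles
  thin : G.IsThin
  rootPart_eq : rootPart source.cactus c.F = ∅

namespace IsTrimmed

theorem target (t : c.IsTrimmed) : G.IsConnectedCactus := c.isConnectedCactus t.source

/-- Otherwise the forest would join a vertex of `D` to its root inside `D`, and an edge of this path
at the root would belong to the root part. -/
theorem eq_root (t : c.IsTrimmed) {D : Set H.E} (hD : H.IsCycle D) {w : H.V} (hw : w ∈ H.verts D)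
    (h : c.onV w = c.onV (H.root D)) : w = H.root D := by
  by_contra hne
  have hj := t.source.cactus.joinedIn_inter hD (t.source.root_mem hD) hw (c.onV_eq_iff.1 h.symm)
  obtain ⟨e, ⟨heD, heF⟩, he⟩ := RootJoined.exists_edge (G := H) (F := c.F) (C := D)
    ⟨w, hw, hne, by rwa [Set.inter_comm]⟩
  refine (Set.ext_iff.1 t.rootPart_eq e).1 ?_
  rw [t.source.cactus.eq_cyc hD heD] at he
  rcases he with he | he
  · exact (mem_rootPart_iff t.source.cactus (x := (e, true)) heF).2 (he ▸ joinedIn_refl _)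
  · exact (mem_rootPart_iff t.source.cactus (x := (e, false)) heF).2 (he ▸ joinedIn_refl _)

/-- As `f` is not in the root part, the vertex to which it is collapsed is not the root of the image
cycle, which is therefore its parent cycle. -/
theorem mapC_cyc (t : c.IsTrimmed) {f : H.E} (hf : f ∈ c.F) :
    ∃ hv : c.onV (H.src f) ≠ G.base, c.mapC (t.source.cactus.cyc f) = t.target.parent hv := by
  have hC := t.source.cactus.isCycle_cyc f
  have hfC := t.source.cactus.mem_cyc f
  have hvC : c.onV (H.src f) ∈ G.verts (c.mapC (t.source.cactus.cyc f)) :=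
    c.mem_verts_mapC hC ⟨f, hfC, Or.inl rfl⟩
  have hr : G.root (c.mapC (t.source.cactus.cyc f)) ≠ c.onV (H.src f) := fun h => by
    rw [c.root_mapC t.source hC, c.onV_eq_iff] at h
    exact (Set.ext_iff.1 t.rootPart_eq f).1 ⟨hf, h⟩
  have hv := t.target.ne_base (c.isCycle_mapC t.source hC) hvC hr
  exact ⟨hv, t.target.eq_parent hv (c.isCycle_mapC t.source hC) hvC hr⟩

/-- A collapsed edge, together with the edge that cuts its cycle. -/
def cutSet (t : c.IsTrimmed) (f : H.E) : Set H.E :=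
  insert f {e | ∃ b y, c.label (e, b) = some y ∧ t.target.Tail t.thin (c.onV (H.src f)) y}

/-- The side of the collapsed edge `f` on which a vertex lies. -/
noncomputable def side (t : c.IsTrimmed) (f : H.E) : H.V → ZMod 2 := H.cut (t.cutSet f)

/-- The cycles beyond a collapsed edge. -/
def beyond (t : c.IsTrimmed) (f : H.E) : Set (Set G.E) :=
  c.mapC '' {D | H.IsCycle D ∧ c.onV (H.root D) = c.onV (H.src f) ∧ t.side f (H.root D) = 1}

/-- The splittings given by the collapsed edges. -/
def splitting (t : c.IsTrimmed) : Set (G.V × Set (Set G.E)) :=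
  (fun f => (c.onV (H.src f), t.beyond f)) '' c.F

theorem cutSet_eq (t : c.IsTrimmed) {f : H.E} (hv : c.onV (H.src f) ≠ G.base) :
    t.cutSet f = {f, (c.unlabel (t.target.hi t.thin hv)).1} := by
  refine congrArg (insert f) (Set.ext fun e => ⟨?_, ?_⟩)
  · rintro ⟨b, _, hy, _, rfl⟩
    exact (congrArg Prod.fst (c.unlabel_eq hy)).symm
  · rintro rfl
    exact ⟨_, _, c.label_unlabel _, hv, rfl⟩

theorem mem_cyc (t : c.IsTrimmed) {f : H.E} (hf : f ∈ c.F) (hv : c.onV (H.src f) ≠ G.base)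
    {x y} (hx : c.label x = some y) (hy : y.1 ∈ t.target.parent hv) :
    x.1 ∈ t.source.cactus.cyc f := by
  refine (c.mem_mapC (b := x.2) hx).1 ?_
  obtain ⟨_, h2⟩ := t.mapC_cyc hf
  rwa [h2]

/-- The two edges of the cut set lie in the same cycle, and they are distinct because one is
collapsed and the other is not. -/
theorem isCut (t : c.IsTrimmed) {f : H.E} (hf : f ∈ c.F) : H.IsCut (t.cutSet f) (t.side f) := by
  obtain ⟨hv, h2⟩ := t.mapC_cyc hf
  have hx := c.label_unlabel (t.target.hi t.thin hv)
  obtain ⟨g, hg⟩ := t.source.exists_isCut (t.source.cactus.isCycle_cyc f)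
    (t.source.cactus.mem_cyc f) (t.mem_cyc hf hv hx (t.target.hi_mem _ _))
    (fun h => c.notMem_of_label hx (h ▸ hf))
  rw [← t.cutSet_eq hv] at hg
  exact hg.isCut_cut

theorem notMem_cutSet (t : c.IsTrimmed) {f f' : H.E} (hf' : f' ∈ c.F) (hne : f' ≠ f) :
    f' ∉ t.cutSet f := by
  rintro (rfl | ⟨b, y, hy, -⟩)
  · exact hne rfl
  · exact c.notMem_of_label hy hf'

/-- The side of the ends of the edges between `v` and its parent. -/
theorem side_parent (t : c.IsTrimmed) {f : H.E} (hf : f ∈ c.F) (hv : c.onV (H.src f) ≠ G.base)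
    {x y} (hx : c.label x = some y) :
    (y = t.target.lo t.thin hv → t.side f (H.start x) = 0) ∧
    (y = t.target.hi t.thin hv → t.side f (H.start x) = 1) := by
  have hcut := t.isCut hf
  obtain ⟨h1, h2, h3, h4, h5, h6⟩ := t.target.ends_spec t.thin hv
  have hC := t.source.cactus.isCycle_cyc f
  obtain ⟨_, hmap⟩ := t.mapC_cyc hf
  have hroot : t.side f (H.root (t.source.cactus.cyc f)) = 0 := by
    rw [← hcut.base]
    refine hcut.eq_of_joinedIn (joinedIn_symm (joinedIn_mono ?_ (t.source.joinedIn_root hC)))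
    rw [t.cutSet_eq hv]
    rintro e he (rfl | rfl)
    · exact he (t.source.cactus.mem_cyc e)
    · exact he (t.mem_cyc hf hv (c.label_unlabel _) (t.target.hi_mem _ _))
  have hother : ∀ y', y'.1 ∈ t.target.parent hv → c.label x = some y' →
      G.start (y'.1, !y'.2) = G.root (t.target.parent hv) →
      t.side f (H.start (x.1, !x.2)) = 0 := fun y' hy' hxy hs => by
    rw [← hroot]
    have hxC := t.mem_cyc hf hv hxy hy'
    refine congrArg _ (t.eq_root hC (start_mem_verts (x := (x.1, !x.2)) hxC) ?_)
    rw [← c.label_start (c.label_not hxy), hs, ← hmap, c.root_mapC t.source hC]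
  constructor
  · rintro rfl
    rw [← hother _ (t.target.lo_mem _ _) hx h5]
    refine hcut.start_eq ?_
    rw [t.cutSet_eq hv]
    rintro (h | h)
    · exact c.notMem_of_label hx (h ▸ hf)
    · exact h1 (by
        have := c.label_unlabel (t.target.hi t.thin hv)
        rw [Set.mem_singleton_iff] at h
        rw [show c.unlabel (t.target.hi t.thin hv) =
          (x.1, (c.unlabel (t.target.hi t.thin hv)).2) from Prod.ext h.symm rfl] at this
        exact c.label_fst (e := x.1) (b := x.2) hx this)
  · rintro rfl
    have h0 := hother _ (t.target.hi_mem _ _) hx h6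
    have := hcut.start_ne (x := x) (by
      rw [t.cutSet_eq hv, c.unlabel_eq hx]
      exact Or.inr rfl)
    rw [h0] at this
    exact zmod_two_eq_one this

/-- The vertex lies on two cycles, and only one of them can be its parent. -/
theorem exists_root (t : c.IsTrimmed) {w : H.V} (hw : w ≠ H.base) :
    ∃ D, H.IsCycle D ∧ H.root D = w := by
  obtain ⟨C, D, hC, hD, hne, hwC, hwD⟩ := t.two.2 w hw
  by_contra! hn
  exact hne (t.source.parent_unique hC hD hwC hwD (hn C hC) (hn D hD))

theorem mapC_mem_beyond (t : c.IsTrimmed) {f : H.E} {D : Set H.E} (hD : H.IsCycle D) :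
    c.mapC D ∈ t.beyond f ↔ c.onV (H.root D) = c.onV (H.src f) ∧ t.side f (H.root D) = 1 := by
  constructor
  · rintro ⟨D', ⟨hD', h⟩, hDD⟩
    rwa [← c.mapC_injective t.source hD' hD hDD]
  · exact fun h => ⟨D, ⟨hD, h⟩, rfl⟩

theorem beyond_subset (t : c.IsTrimmed) (f : H.E) : t.beyond f ⊆ G.rootsAt (c.onV (H.src f)) := by
  rintro _ ⟨D, ⟨hD, h, -⟩, rfl⟩
  exact ⟨c.isCycle_mapC t.source hD, (c.root_mapC t.source hD).trans h⟩

/-- Every vertex over `v` is the root of a cycle that detects its side. -/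
theorem exists_mem_beyond (t : c.IsTrimmed) {v : G.V} (hv : v ≠ G.base) {w : H.V}
    (hw : c.onV w = v) : ∃ D ∈ G.rootsAt v, ∀ f ∈ c.F, c.onV (H.src f) = v →
      (D ∈ t.beyond f ↔ t.side f w = 1) := by
  obtain ⟨D, hD, rfl⟩ := t.exists_root (w := w) (by
    rintro rfl
    exact hv (hw.symm.trans c.onV_base))
  exact ⟨c.mapC D, ⟨c.isCycle_mapC t.source hD, (c.root_mapC t.source hD).trans hw⟩,
    fun f _ hf => (t.mapC_mem_beyond hD).trans (and_iff_right (hw.trans hf.symm))⟩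

/-- Of the two edges of the parent cycle, the first ends on side 0 of `f` and the second on side 1.
Each of these ends is the root of some cycle, so `beyond` is neither everything nor empty. -/
theorem isSplit (t : c.IsTrimmed) {f : H.E} (hf : f ∈ c.F) :
    G.IsSplit (c.onV (H.src f), t.beyond f) := by
  obtain ⟨hv, -⟩ := t.mapC_cyc hf
  obtain ⟨h1, h2, h3, h4, h5, h6⟩ := t.target.ends_spec t.thin hv
  have hlo := c.label_unlabel (t.target.lo t.thin hv)
  have hhi := c.label_unlabel (t.target.hi t.thin hv)
  obtain ⟨D, hD, hDf⟩ := t.exists_mem_beyond hv (w := H.start (c.unlabel (t.target.lo t.thin hv)))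
    (by rw [← c.label_start hlo, h3])
  obtain ⟨D', hD', hDf'⟩ := t.exists_mem_beyond hv (w := H.start (c.unlabel (t.target.hi t.thin hv)))
    (by rw [← c.label_start hhi, h4])
  refine ⟨hv, ⟨D', (hDf' f hf rfl).2 ((t.side_parent hf hv hhi).2 rfl)⟩, t.beyond_subset f,
    fun h => ?_⟩
  have := (hDf f hf rfl).1 (h hD)
  rw [(t.side_parent hf hv hlo).1 rfl] at this
  exact zero_ne_one this

theorem side_src_ne (t : c.IsTrimmed) {f : H.E} (hf : f ∈ c.F) :
    t.side f (H.src f) ≠ t.side f (H.tgt f) :=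
  (t.isCut hf).start_ne (x := (f, true)) (Or.inl rfl)

theorem side_src_eq (t : c.IsTrimmed) {f f' : H.E} (hf : f ∈ c.F) (hf' : f' ∈ c.F) (hne : f' ≠ f) :
    t.side f (H.src f') = t.side f (H.tgt f') :=
  (t.isCut hf).start_eq (x := (f', true)) (t.notMem_cutSet hf' hne)

/-- Cycles rooted at the two ends of `f` lie on different sides of `f`, but on the same side of any
other collapsed edge. -/
theorem beyond_injective (t : c.IsTrimmed) {f f' : H.E} (hf : f ∈ c.F) (hf' : f' ∈ c.F)
    (hv : c.onV (H.src f) = c.onV (H.src f')) (h : t.beyond f = t.beyond f') : f = f' := by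
  by_contra hne
  obtain ⟨hb, -⟩ := t.mapC_cyc hf
  obtain ⟨D, -, hDf⟩ := t.exists_mem_beyond hb (w := H.src f) rfl
  obtain ⟨D', -, hDf'⟩ := t.exists_mem_beyond hb (w := H.tgt f) (c.onV_edge hf).symm
  have h1 : t.side f (H.src f) = 1 ↔ t.side f (H.tgt f) = 1 := by
    rw [← hDf f hf rfl, ← hDf' f hf rfl, h, hDf f' hf' hv.symm, hDf' f' hf' hv.symm,
      t.side_src_eq hf' hf hne]
  have h2 := t.side_src_ne hf
  generalize t.side f (H.src f) = p at *
  generalize t.side f (H.tgt f) = q at *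
  revert p q
  decide

/-- If neither set contained the other, all four combinations of sides would occur over the vertex:
at the roots of `D` and `E` and at the two ends of the parent cycle. Let `k` say that a vertex is
beyond `f` as seen from `f'`, and beyond `f'` as seen from `f`. No collapsed edge changes `k`, so it
is constant over the vertex; yet it holds for exactly one of the four combinations. -/
theorem beyond_total (t : c.IsTrimmed) {f f' : H.E} (hf : f ∈ c.F) (hf' : f' ∈ c.F)
    (hv : c.onV (H.src f) = c.onV (H.src f')) :
    t.beyond f ⊆ t.beyond f' ∨ t.beyond f' ⊆ t.beyond f := by
  by_contra! hn
  obtain ⟨⟨D, hD, hD'⟩, E, hE, hE'⟩ := hn.imp Set.not_subset.1 Set.not_subset.1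
  obtain ⟨D, ⟨hDc, hDv, h10⟩, rfl⟩ := hD
  obtain ⟨E, ⟨hEc, hEv, h01⟩, rfl⟩ := hE
  rw [t.mapC_mem_beyond hDc, and_iff_right (hDv.trans hv)] at hD'
  rw [t.mapC_mem_beyond hEc, and_iff_right (hEv.trans hv.symm)] at hE'
  obtain ⟨hb, -⟩ := t.mapC_cyc hf
  have hb' : c.onV (H.src f') ≠ G.base := hv ▸ hb
  obtain ⟨h1, h2, h3, h4, h5, h6⟩ := t.target.ends_spec t.thin hb
  have hlo := c.label_unlabel (t.target.lo t.thin hb)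
  have hhi := c.label_unlabel (t.target.hi t.thin hb)
  have hlo' : ∀ v (hv' : v ≠ G.base), c.onV (H.src f) = v →
      t.target.lo t.thin hb = t.target.lo t.thin hv' ∧
      t.target.hi t.thin hb = t.target.hi t.thin hv' := by
    rintro v hv' rfl
    exact ⟨rfl, rfl⟩
  have hne : f ≠ f' := by
    rintro rfl
    exact hD' h10
  let k : H.V → Prop := fun w =>
    t.side f w ≠ t.side f (H.src f') ∧ t.side f' w ≠ t.side f' (H.src f)
  have hk : ∀ u w, c.onV u = c.onV w → k u = k w := fun u w huw =>
    eq_of_joinedIn_const (A := c.F) (fun e he => propext ?_) (c.onV_eq_iff.1 huw)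
  · have key : ∀ w, c.onV w = c.onV (H.src f) → k w = k (H.root D) := fun w hw =>
      hk _ _ (hw.trans hDv.symm)
    have k1 := key (H.root E) (hEv.trans hv.symm)
    have k2 := key (H.start (c.unlabel (t.target.lo t.thin hb))) (by rw [← c.label_start hlo, h3])
    have k3 := key (H.start (c.unlabel (t.target.hi t.thin hb))) (by rw [← c.label_start hhi, h4])
    simp only [k] at k1 k2 k3
    rw [(t.side_parent hf hb hlo).1 rfl, (t.side_parent hf' hb' hlo).1 (hlo' _ hb' hv).1] at k2
    rw [(t.side_parent hf hb hhi).2 rfl, (t.side_parent hf' hb' hhi).2 (hlo' _ hb' hv).2] at k3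
    rw [h10] at k1 k2 k3
    rw [h01] at k1
    generalize t.side f (H.src f') = p at *
    generalize t.side f' (H.src f) = q at *
    generalize t.side f' (H.root D) = r at *
    generalize t.side f (H.root E) = s at *
    clear hk key k
    simp only [eq_iff_iff] at k1 k2 k3
    revert p q r s
    decide
  · simp only [k]
    by_cases h1 : e = f
    · subst h1
      have := t.side_src_eq hf' hf hne
      rw [← this]
      exact iff_of_false (fun h => h.2 rfl) fun h => h.2 rfl
    · rw [t.side_src_eq hf he h1]
      by_cases h2 : e = f'
      · subst h2
        rw [t.side_src_eq hf hf' hne.symm]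
        exact iff_of_false (fun h => h.1 rfl) fun h => h.1 rfl
      · rw [t.side_src_eq hf' he h2]

theorem isSplitting (t : c.IsTrimmed) : G.IsSplitting t.splitting := by
  constructor
  · rintro _ ⟨f, hf, rfl⟩
    exact t.isSplit hf
  · rintro _ ⟨f, hf, rfl⟩ _ ⟨f', hf', rfl⟩ h
    exact t.beyond_total hf hf' h

/-- Vertices with the same image are equal if they lie on the same sides. -/
theorem eq_of_side (t : c.IsTrimmed) {u w : H.V} (huw : c.onV u = c.onV w)
    (h : ∀ f ∈ c.F, c.onV (H.src f) = c.onV u → t.side f u = t.side f w) : u = w := by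
  obtain ⟨z, hz, hzb⟩ := BasedGraph.joinedIn_iff.1 (c.joinedIn_fibre (c.onV_eq_iff.1 huw))
  suffices z = 0 by
    rw [this, map_zero] at hzb
    exact pt_add_eq_zero hzb.symm
  funext f
  by_contra hf
  obtain ⟨hfF, hfv⟩ := hz f hf
  -- The chain `z` consists of collapsed edges, of which only `f` crosses the cut of `f`. So the
  -- coefficient of `f` is the difference of the two sides, which is zero.
  have hsum := (t.isCut hfF).sum_eq hzb
  rw [h f hfF hfv, CharTwo.add_self_eq_zero, Finset.sum_eq_single f (fun e _ hne => ?_)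
    (fun h => (h (Finset.mem_univ f)).elim), chain_of_mem (Or.inl rfl), mul_one] at hsum
  · exact hf hsum.symm
  · by_cases he : z e = 0
    · rw [he, zero_mul]
    · rw [chain_of_notMem (t.notMem_cutSet (hz e he).1 hne), mul_zero]

/-- The sides of the initial vertex of a half-edge. -/
theorem side_start (t : c.IsTrimmed) {f : H.E} (hf : f ∈ c.F) {x y} (hx : c.label x = some y)
    (hv : c.onV (H.src f) = G.start y) : t.side f (H.start x) = 1 ↔
      t.target.cactus.cyc y.1 ∈ t.beyond f ∨ t.target.Tail t.thin (G.start y) y := by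
  have hC := t.source.cactus.isCycle_cyc x.1
  have hxC := t.source.cactus.mem_cyc x.1
  have hmap : c.mapC (t.source.cactus.cyc x.1) = t.target.cactus.cyc y.1 :=
    t.target.cactus.eq_cyc (c.isCycle_mapC t.source hC) ((c.mem_mapC (b := x.2) hx).2 hxC)
  have hsx := c.label_start hx
  rcases t.target.root_eq_or t.thin (y := y) rfl with hr | ⟨hb, hp, hy⟩
  · rw [or_iff_left fun h : t.target.Tail t.thin (G.start y) y => h.root_ne hr, ← hmap, t.mapC_mem_beyond hC]
    rw [← hmap, c.root_mapC t.source hC] at hr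
    rw [and_iff_right (hr.trans hv.symm),
      t.eq_root hC (start_mem_verts hxC) (hsx.symm.trans hr.symm)]
  · have h1 : t.target.cactus.cyc y.1 ∉ t.beyond f := fun h => by
      have h2 := (t.beyond_subset f h).2
      rw [hp, hv] at h2
      exact (t.target.parent_spec hb).2.2 h2
    rw [or_iff_right h1]
    have hb' : c.onV (H.src f) ≠ G.base := hv ▸ hb
    have key : ∀ v (hv' : v ≠ G.base), G.start y = v →
        t.target.lo t.thin hb = t.target.lo t.thin hv' ∧
        t.target.hi t.thin hb = t.target.hi t.thin hv' := by
      rintro v hv' rfl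
      exact ⟨rfl, rfl⟩
    obtain ⟨k1, k2⟩ := key _ hb' hv.symm
    obtain ⟨s1, s2⟩ := t.side_parent hf hb' hx
    rcases hy with hy | hy
    · rw [s1 (hy.trans k1)]
      refine iff_of_false zero_ne_one fun h => ?_
      rw [hy] at h
      obtain ⟨hb2, h⟩ := h
      have h3 := (key _ hb2 (congrArg _ hy)).2
      exact (t.target.ends_spec t.thin hb).1 (congrArg Prod.fst (h.trans h3.symm))
    · exact iff_of_true (s2 (hy.trans k2)) ⟨hb, hy⟩

end IsTrimmed

/-- Agreement of the vertex maps propagates from the base vertex along all edges: the ends of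
surviving edges are determined by labels, and the two ends of a collapsed edge have the same image.
-/
theorem onV_congr {c d : Collapse H G} (hH : ∀ u v, H.joinedIn Set.univ u v)
    (h : c.label = d.label) : c.onV = d.onV := by
  have key : ∀ u v, H.joinedIn Set.univ u v → ((c.onV u = d.onV u) = (c.onV v = d.onV v)) :=
    fun u v hj => eq_of_joinedIn_const (f := fun v => c.onV v = d.onV v) (fun e _ => by
      by_cases he : e ∈ c.F
      · simp only [c.onV_edge he, d.onV_edge (F_congr h ▸ he)]
      · obtain ⟨y, hy⟩ := c.exists_label (x := (e, true)) he
        have h1 : ∀ x y, c.label x = some y → c.onV (H.start x) = d.onV (H.start x) :=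
          fun x y hx => (c.label_start hx).symm.trans (d.label_start (h ▸ hx))
        exact propext (iff_of_true (h1 _ _ hy) (h1 _ _ (c.label_not hy)))) hj
  funext v
  rw [key v H.base (hH _ _), c.onV_base, d.onV_base]

theorem mapC_congr {c d : Collapse H G} (h : c.label = d.label) : c.mapC = d.mapC := by
  funext C
  ext b
  obtain ⟨x, hx⟩ := c.label_surjective (b, true)
  exact (c.mem_mapC (b := x.2) hx).trans (d.mem_mapC (b := x.2) (h ▸ hx)).symm

theorem mapC_comp (d : Collapse H K) (e : Collapse K G) (C : Set H.E) :
    (d.comp e).mapC C = e.mapC (d.mapC C) := by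
  ext b
  obtain ⟨y, hy⟩ := e.label_surjective (b, true)
  obtain ⟨x, hx⟩ := d.label_surjective y
  have : (d.comp e).label x = some (b, true) := by
    rw [d.label_comp, hx, Option.bind_some, hy]
  exact ((d.comp e).mem_mapC (b := x.2) this).trans
    ((d.mem_mapC (b := x.2) hx).symm.trans (e.mem_mapC (b := y.2) hy).symm)

theorem exists_label_orient (c : Collapse H G) {e : H.E} {b' : Bool} {z : G.E × Bool}
    (h : c.label (e, b') = some z) (b : Bool) : ∃ b₀, c.label (e, b₀) = some (z.1, b) := by
  by_cases hb : b = z.2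
  · exact ⟨b', hb ▸ h⟩
  · exact ⟨!b', Bool.eq_not.2 hb ▸ c.label_not h⟩

namespace IsTrimmed

/-- The splittings of a partial collapse. -/
theorem splitting_comp (t : c.IsTrimmed) {d : Collapse H K} {e : Collapse K G} (t' : e.IsTrimmed)
    (hl : c.label = (d.comp e).label) :
    t'.splitting = (fun f => (c.onV (H.src f), t.beyond f)) '' (c.F \ d.F) := by
  have honV : ∀ w, c.onV w = e.onV (d.onV w) := fun w => congrFun (onV_congr t.source.conn hl) w
  have hmap : ∀ C, c.mapC C = e.mapC (d.mapC C) := fun C => by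
    rw [mapC_congr hl, mapC_comp]
  have hF : c.F = d.pull e.F := by rw [F_congr hl, F_comp]
  have key : ∀ f k, f ∈ c.F → d.label (f, true) = some k →
      (e.onV (K.src k.1), t'.beyond k.1) = (c.onV (H.src f), t.beyond f) := fun f k hf hk => by
    have hkF : k.1 ∈ e.F := (d.mem_pull hk).1 (hF ▸ hf)
    have hover : e.onV (K.src k.1) = c.onV (H.src f) := by
      rw [honV, ← e.onV_start hkF, d.label_start hk]
      rfl
    -- The potential of the image edge, pulled back along `d`, is a potential for the cut of `f`; by
    -- uniqueness the sides correspond.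
    have hcut : H.IsCut (t.cutSet f) fun w => t'.side k.1 (d.onV w) := by
      refine ⟨?_, fun a => ?_⟩
      · rw [d.onV_base]
        exact (t'.isCut hkF).base
      · by_cases ha : a ∈ d.F
        · rw [d.onV_edge ha, CharTwo.add_self_eq_zero, chain_of_notMem]
          rintro (rfl | ⟨b, y, hy, -⟩)
          · exact d.notMem_of_label hk ha
          · exact c.notMem_of_label hy (F_congr hl ▸ d.subset_F_comp e ha)
        · obtain ⟨z, hz⟩ := d.exists_label (x := (a, true)) ha
          have h1 := d.label_start hz
          have h2 := d.label_start (d.label_not hz)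
          change K.start z = d.onV (H.src a) at h1
          change K.start (z.1, !z.2) = d.onV (H.tgt a) at h2
          rw [← h1, ← h2, (t'.isCut hkF).start_add]
          have hmem : z.1 ∈ t'.cutSet k.1 ↔ a ∈ t.cutSet f := by
            refine or_congr ⟨fun h => d.label_fst_injective hz hk h, ?_⟩ ?_
            · rintro rfl
              rw [hz, Option.some_inj] at hk
              rw [hk]
            · rw [Set.mem_ofPred_eq, Set.mem_ofPred_eq, hover]
              constructor
              · rintro ⟨b, y, hy, h⟩
                obtain ⟨b₀, hb⟩ := d.exists_label_orient hz b
                exact ⟨b₀, y, by rw [hl, d.label_comp, hb, Option.bind_some, hy], h⟩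
              · rintro ⟨b, y, hy, h⟩
                rw [hl, d.label_comp] at hy
                obtain ⟨z', hz', hy⟩ := Option.bind_eq_some_iff.1 hy
                refine ⟨z'.2, y, ?_, h⟩
                rw [d.label_fst hz hz']
                exact hy
          by_cases h : a ∈ t.cutSet f
          · rw [chain_of_mem h, chain_of_mem (hmem.2 h)]
          · rw [chain_of_notMem h, chain_of_notMem (mt hmem.1 h)]
    have hside : ∀ w, t.side f w = t'.side k.1 (d.onV w) :=
      fun w => congrFun (hcut.cut_eq t.source.conn) w
    refine Prod.ext hover (Set.ext fun C => ⟨?_, ?_⟩)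
    · rintro ⟨D, ⟨hD, h1, h2⟩, rfl⟩
      obtain ⟨D, hD', rfl⟩ := (d.isCycle_iff t.source).1 hD
      rw [d.root_mapC t.source hD'] at h1 h2
      exact ⟨D, ⟨hD', (honV _).trans (h1.trans hover), (hside _).trans h2⟩, hmap D⟩
    · rintro ⟨D, ⟨hD, h1, h2⟩, rfl⟩
      refine ⟨d.mapC D, ⟨d.isCycle_mapC t.source hD, ?_, ?_⟩, (hmap D).symm⟩
      · rw [d.root_mapC t.source hD, ← honV, h1, hover]
      · rw [d.root_mapC t.source hD, ← hside, h2]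
  ext q
  constructor
  · rintro ⟨k, hk, rfl⟩
    obtain ⟨⟨f, b⟩, hx⟩ := d.label_surjective (k, true)
    have hf : f ∈ c.F := hF ▸ (d.mem_pull hx).2 hk
    have hfd : f ∉ d.F := d.notMem_of_label hx
    obtain ⟨z, hz⟩ := d.exists_label (x := (f, true)) hfd
    have := d.label_fst hx hz
    refine ⟨f, ⟨hf, hfd⟩, ?_⟩
    refine (key f z hf hz).symm.trans ?_
    rw [← this]
  · rintro ⟨f, ⟨hf, hfd⟩, rfl⟩
    obtain ⟨z, hz⟩ := d.exists_label (x := (f, true)) hfd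
    exact ⟨z.1, (d.mem_pull hz).1 (hF ▸ hf), key f z hf hz⟩

end IsTrimmed

end Collapse

end BasedGraph


/-! ### Cactus graphs from a collapse -/

namespace BasedGraph

variable {G H K : BasedGraph}

theorem exists_start_of_mem_verts {C : Set G.E} {v : G.V} (hv : v ∈ G.verts C) :
    ∃ y : G.E × Bool, y.1 ∈ C ∧ G.start y = v := by
  obtain ⟨e, he, h | h⟩ := hv
  exacts [⟨(e, true), he, h⟩, ⟨(e, false), he, h⟩]

theorem bdry_single_start [DecidableEq G.E] (y : G.E × Bool) :
    G.bdry (Pi.single y.1 1) = G.pt (G.start y) + G.pt (G.start (y.1, !y.2)) := by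
  rw [bdry_single]
  obtain ⟨e, b⟩ := y
  cases b
  exacts [add_comm _ _, rfl]

namespace Collapse

/-- A closed chain stays closed after the collapse, and there it is constant on every cycle. -/
theorem closed_const_label (c : Collapse H G) (hG : G.IsCactus) {x : H.E → ZMod 2}
    (hx : H.bdry x = 0) {a a' : H.E × Bool} {y y' : G.E × Bool} (h : c.label a = some y)
    (h' : c.label a' = some y') (hy : hG.cyc y.1 = hG.cyc y'.1) : x a.1 = x a'.1 := by
  have h0 : (H.collapse c.F).bdry (fun e => x e.1) = 0 := by rw [bdry_collapse, hx, map_zero]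
  obtain ⟨ha, h1, -⟩ := lab_eq_some c.iso h
  obtain ⟨ha', h1', -⟩ := lab_eq_some c.iso h'
  refine (c.iso.symm.isCactus hG).closed_const h0 (c.iso.symm.isCycle_image (hG.isCycle_cyc y.1))
    (e := surv a.1 ha) (e' := surv a'.1 ha') ⟨y.1, hG.mem_cyc _, ?_⟩
    ⟨y'.1, hy ▸ hG.mem_cyc _, ?_⟩
  · rw [← h1]
    exact c.iso.onE.symm_apply_apply _
  · rw [← h1']
    exact c.iso.onE.symm_apply_apply _

/-- A graph is a cactus graph if the cycles of its collapse lift to closed chains that partition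
its edges. -/
theorem isCactus_of_lift (c : Collapse H G) (hG : G.IsCactus) (κ : H.E → Set G.E)
    (hκ : ∀ x y, c.label x = some y → κ x.1 = hG.cyc y.1) (hκF : ∀ e, ∃ a, κ e = hG.cyc a)
    (h1 : ∀ a, H.bdry (H.chain {e | κ e = hG.cyc a}) = 0) :
    H.IsCactus ∧ ∀ e, H.IsCycle {e' | κ e' = κ e} := by
  classical
  have h1' : ∀ C, H.bdry (H.chain {e | κ e = C}) = 0 := fun C => by
    by_cases hC : ∃ a, C = hG.cyc a
    · obtain ⟨a, rfl⟩ := hC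
      exact h1 a
    · rw [show H.chain {e | κ e = C} = 0 from ?_, map_zero]
      funext e
      refine chain_of_notMem fun he => hC ?_
      obtain ⟨a, ha⟩ := hκF e
      exact ⟨a, he.symm.trans ha⟩
  refine isCactus_of_partition κ (fun e => h1' _) fun x hx => ?_
  suffices ∃ θ : Set G.E → ZMod 2, ∀ e, x e = θ (κ e) by
    obtain ⟨θ, hθ⟩ := this
    exact fun e e' h => by rw [hθ, hθ, h]
  -- The value of `x` on the surviving edges over a cycle. Adding to `x` the lifted cycles with
  -- these coefficients gives a closed chain supported in the collapsed forest, hence zero.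
  let θ : Set G.E → ZMod 2 := fun C =>
    if hC : ∃ a, C = hG.cyc a then x (c.unlabel (hC.choose, true)).1 else 0
  refine ⟨θ, fun e => ?_⟩
  have hsum : (∑ C : Set G.E, θ C • H.chain {e | κ e = C}) = fun e => θ (κ e) := by
    funext e
    rw [Finset.sum_apply, Finset.sum_eq_single (κ e)]
    · rw [Pi.smul_apply, chain_of_mem (show e ∈ {e' | κ e' = κ e} from rfl), smul_eq_mul, mul_one]
    · intro C _ hC
      rw [Pi.smul_apply, chain_of_notMem (show e ∉ {e' | κ e' = C} from fun h => hC h.symm),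
        smul_zero]
    · exact fun h => (h (Finset.mem_univ _)).elim
  have h0 : H.bdry (x + fun e => θ (κ e)) = 0 := by
    rw [map_add, hx, zero_add, ← hsum, map_sum]
    exact Finset.sum_eq_zero fun C _ => by rw [map_smul, h1', smul_zero]
  have := isForest_iff.1 c.forest _ h0 fun e he => by
    by_contra heF
    obtain ⟨y, hy⟩ := c.exists_label (x := (e, true)) heF
    have hC : ∃ a, κ e = hG.cyc a := ⟨_, hκ _ _ hy⟩
    have h2 : θ (κ e) = x (c.unlabel (hC.choose, true)).1 := dif_pos hC
    refine he ?_
    rw [Pi.add_apply, CharTwo.add_eq_zero, h2]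
    refine c.closed_const_label hG hx hy (c.label_unlabel _) ?_
    rw [← hκ _ _ hy]
    exact hC.choose_spec
  exact CharTwo.add_eq_zero.1 (congrFun this e)

end Collapse

/-! ### The blow-up of a set of splittings -/

section Splitting

variable (h : G.IsConnectedCactus) (ht : G.IsThin) {s : Set (G.V × Set (Set G.E))}

/-- The vertices of the blow-up. -/
def SplitVertex (G : BasedGraph) (s : Set (G.V × Set (Set G.E))) : Type :=
  {a : G.V × Set (G.V × Set (Set G.E)) // (∀ q ∈ a.2, q ∈ s ∧ q.1 = a.1) ∧
    ∀ q ∈ a.2, ∀ q' ∈ s, q'.1 = q.1 → q.2 ⊆ q'.2 → q' ∈ a.2}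

/-- The vertex of the blow-up at which a half-edge is attached. -/
def attach (s : Set (G.V × Set (Set G.E))) (y : G.E × Bool) : SplitVertex G s :=
  ⟨(G.start y, {q | q ∈ s ∧ q.1 = G.start y ∧ (h.cactus.cyc y.1 ∈ q.2 ∨ h.Tail ht (G.start y) y)}),
    fun _ hq => ⟨hq.1, hq.2.1⟩, fun _ hq _ hq' h1 h2 =>
      ⟨hq', h1.trans hq.2.1, hq.2.2.imp_left fun h => h2 h⟩⟩

/-- The graph in which the vertices are expanded to paths according to the splittings. -/
def splitGraph (s : Set (G.V × Set (Set G.E))) : BasedGraph where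
  V := SplitVertex G s
  E := G.E ⊕ s
  finite_V := Subtype.finite
  src := Sum.elim (fun e => attach h ht s (e, true)) fun q =>
    ⟨(q.1.1, {q' | q' ∈ s ∧ q'.1 = q.1.1 ∧ q.1.2 ⊂ q'.2}), fun _ hq => ⟨hq.1, hq.2.1⟩,
      fun _ hq _ hq' h1 h2 => ⟨hq', h1.trans hq.2.1, hq.2.2.trans_le h2⟩⟩
  tgt := Sum.elim (fun e => attach h ht s (e, false)) fun q =>
    ⟨(q.1.1, {q' | q' ∈ s ∧ q'.1 = q.1.1 ∧ q.1.2 ⊆ q'.2}), fun _ hq => ⟨hq.1, hq.2.1⟩,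
      fun _ hq _ hq' h1 h2 => ⟨hq', h1.trans hq.2.1, hq.2.2.trans h2⟩⟩
  base := ⟨(G.base, ∅), fun _ hq => hq.elim, fun _ hq => hq.elim⟩

/-- An edge of the original graph. -/
def oldEdge {h : G.IsConnectedCactus} {ht : G.IsThin} {s : Set (G.V × Set (Set G.E))} (e : G.E) :
    (splitGraph h ht s).E := Sum.inl e

/-- The edge of a splitting. -/
def newEdge {h : G.IsConnectedCactus} {ht : G.IsThin} {s : Set (G.V × Set (Set G.E))} (q : s) :
    (splitGraph h ht s).E := Sum.inr q

variable {h ht} in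
theorem oldEdge_injective : Function.Injective (oldEdge : G.E → (splitGraph h ht s).E) :=
  Sum.inl_injective

variable {h ht} in
theorem newEdge_injective : Function.Injective (newEdge : s → (splitGraph h ht s).E) :=
  Sum.inr_injective

variable {h ht} in
theorem newEdge_ne_oldEdge (q : s) (e : G.E) : (newEdge q : (splitGraph h ht s).E) ≠ oldEdge e :=
  Sum.inr_ne_inl

variable {h ht} in
theorem edge_cases (e : (splitGraph h ht s).E) : (∃ a, e = oldEdge a) ∨ ∃ q, e = newEdge q := by
  rcases e with e | q
  exacts [Or.inl ⟨e, rfl⟩, Or.inr ⟨q, rfl⟩]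

theorem start_oldEdge (y : G.E × Bool) :
    (splitGraph h ht s).start (oldEdge y.1, y.2) = attach h ht s y := by
  obtain ⟨e, b⟩ := y
  cases b <;> rfl

theorem splitVertex_ext {a b : SplitVertex G s} (h1 : a.1.1 = b.1.1)
    (h2 : ∀ q ∈ s, q.1 = a.1.1 → (q ∈ a.1.2 ↔ q ∈ b.1.2)) : a = b := by
  refine Subtype.ext (Prod.ext h1 (Set.ext fun q => ⟨fun hq => ?_, fun hq => ?_⟩))
  · exact (h2 q (a.2.1 q hq).1 (a.2.1 q hq).2).1 hq
  · exact (h2 q (b.2.1 q hq).1 ((b.2.1 q hq).2.trans h1.symm)).2 hq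

/-- A vertex with splittings is the end of the edge of the smallest one. -/
theorem exists_tgt_eq (hs : G.IsSplitting s) (a : SplitVertex G s) (ha : a.1.2.Nonempty) :
    ∃ q : s, q.1 ∈ a.1.2 ∧ (splitGraph h ht s).tgt (newEdge q) = a := by
  obtain ⟨q, hq, hmin⟩ := (Set.toFinite a.1.2).exists_minimalFor Prod.snd _ ha
  obtain ⟨hqs, hqa⟩ := a.2.1 q hq
  refine ⟨⟨q, hqs⟩, hq, splitVertex_ext hqa fun q' hq' h' => ⟨fun h1 => ?_, fun h1 => ?_⟩⟩
  · exact a.2.2 q hq q' hq' h1.2.1 h1.2.2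
  · refine ⟨hq', h', ?_⟩
    rcases hs.2 q hqs q' hq' h'.symm with h2 | h2
    exacts [h2, hmin h1 h2]

/-- Crossing the edge of the smallest splitting of a vertex removes that splitting. Repeating this
leads to the vertex over the same point that has no splittings. -/
theorem joinedIn_inr (hs : G.IsSplitting s) (a b : SplitVertex G s) (hab : a.1.1 = b.1.1) :
    (splitGraph h ht s).joinedIn (Set.range newEdge) a b := by
  suffices ∀ a : SplitVertex G s, (splitGraph h ht s).joinedIn (Set.range newEdge) a
      ⟨(a.1.1, ∅), fun _ hq => hq.elim, fun _ hq => hq.elim⟩ by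
    refine joinedIn_trans (this a) (joinedIn_symm ?_)
    have := this b
    simp only [← hab] at this
    exact this
  intro a
  induction hn : a.1.2.ncard using Nat.strong_induction_on generalizing a with
  | _ n ih =>
    rcases a.1.2.eq_empty_or_nonempty with ha | ha
    · rw [show a = ⟨(a.1.1, ∅), fun _ hq => hq.elim, fun _ hq => hq.elim⟩ from
        Subtype.ext (Prod.ext rfl ha)]
      exact joinedIn_refl _
    · obtain ⟨q, hqa, hq⟩ := exists_tgt_eq h ht hs a ha
      have hj := joinedIn_edge (G := splitGraph h ht s) (A := Set.range newEdge) ⟨q, rfl⟩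
      rw [hq] at hj
      refine joinedIn_trans (joinedIn_symm hj) ?_
      have h1 := ih _ ?_ ((splitGraph h ht s).src (newEdge q)) rfl
      · have h2 : ((splitGraph h ht s).src (newEdge q)).1.1 = a.1.1 := (a.2.1 _ hqa).2
        simp only [h2] at h1
        exact h1
      · rw [← hn]
        refine Set.ncard_lt_ncard ⟨?_, fun h' => (h' hqa).2.2.2 subset_rfl⟩ (Set.toFinite _)
        intro q' hq'
        exact a.2.2 _ hqa q' hq'.1 hq'.2.1 hq'.2.2.1

open Classical in
/-- Chains of new edges are determined by their boundaries. -/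
theorem apply_inr {z : (splitGraph h ht s).E → ZMod 2} (hz : ∀ e, z e ≠ 0 → e ∈ Set.range newEdge)
    {a b : SplitVertex G s}
    (hb : (splitGraph h ht s).bdry z = (splitGraph h ht s).pt a + (splitGraph h ht s).pt b)
    (q : s) : z (newEdge q) = (if q.1 ∈ a.1.2 then 1 else 0) + if q.1 ∈ b.1.2 then 1 else 0 := by
  -- Among the new edges, only the one of `q` changes whether `q` belongs to a vertex.
  have := add_eq_sum_of_bdry (G := splitGraph h ht s)
    (fun a : SplitVertex G s => if q.1 ∈ a.1.2 then 1 else 0) hb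
  rw [this, Finset.sum_eq_single (newEdge q) (fun e _ hne => ?_)
    fun h => (h (Finset.mem_univ _)).elim]
  · rw [if_neg (fun h => h.2.2.2 subset_rfl), if_pos ⟨q.2, rfl, subset_rfl⟩, zero_add, mul_one]
  · by_cases he : z e = 0
    · rw [he, zero_mul]
    · obtain ⟨q', rfl⟩ := hz e he
      have : q.1 ∈ ((splitGraph h ht s).src (newEdge q')).1.2 ↔
          q.1 ∈ ((splitGraph h ht s).tgt (newEdge q')).1.2 := by
        refine ⟨fun h => ⟨h.1, h.2.1, h.2.2.1⟩, fun h => ⟨h.1, h.2.1, h.2.2, fun h' => hne ?_⟩⟩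
        exact congrArg newEdge (Subtype.ext (Prod.ext h.2.1.symm (h.2.2.antisymm h')))
      simp only [this, CharTwo.add_self_eq_zero, mul_zero]

theorem isForest_inr : (splitGraph h ht s).IsForest (Set.range newEdge) := by
  refine isForest_iff.2 fun x hx hxF => funext fun e => ?_
  by_contra he
  obtain ⟨q, rfl⟩ := hxF e he
  refine he ?_
  rw [apply_inr h ht hxF (a := (splitGraph h ht s).base) (b := (splitGraph h ht s).base)
    (by rw [hx, add_self_fun]), CharTwo.add_self_eq_zero]
  rfl

def splitLabel (x : (splitGraph h ht s).E × Bool) : Option (G.E × Bool) :=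
  Sum.elim (fun e => some (e, x.2)) (fun _ => none) x.1

theorem splitLabel_eq_some {x : (splitGraph h ht s).E × Bool} {y : G.E × Bool} :
    splitLabel h ht x = some y ↔ x = (oldEdge y.1, y.2) := by
  obtain ⟨e, b⟩ := x
  obtain ⟨a, rfl⟩ | ⟨q, rfl⟩ := edge_cases e
  · change some (a, b) = some y ↔ _
    rw [Option.some_inj, Prod.ext_iff, Prod.ext_iff]
    exact and_congr_left' oldEdge_injective.eq_iff.symm
  · refine iff_of_false (fun h => by cases h) fun h => newEdge_ne_oldEdge q y.1 (congrArg Prod.fst h)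

theorem splitLabel_eq_none : {e | splitLabel h ht (e, true) = none} =
    (Set.range newEdge : Set (splitGraph h ht s).E) := by
  ext e
  obtain ⟨a, rfl⟩ | ⟨q, rfl⟩ := edge_cases e
  · exact iff_of_false (fun h => by cases h) (by rintro ⟨q, h⟩; exact newEdge_ne_oldEdge _ _ h)
  · exact iff_of_true rfl ⟨q, rfl⟩

/-- The collapse of the new edges. -/
noncomputable def splitCollapse (hs : G.IsSplitting s) : Collapse (splitGraph h ht s) G :=
  Collapse.ofLabel (splitLabel h ht)
    (fun x y hx => by
      rw [splitLabel_eq_some] at hx ⊢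
      rw [hx])
    (fun x x' y hx hx' => by
      rw [splitLabel_eq_some] at hx hx'
      rw [hx, hx'])
    (fun y => ⟨_, (splitLabel_eq_some h ht).2 rfl⟩)
    (fun a => a.1.1) (fun v => ⟨⟨(v, ∅), fun _ hq => hq.elim, fun _ hq => hq.elim⟩, rfl⟩) rfl
    (fun a b => by
      rw [splitLabel_eq_none]
      refine ⟨fun hab => joinedIn_inr h ht hs a b hab, fun hj => ?_⟩
      refine eq_of_joinedIn_const (f := fun a : SplitVertex G s => a.1.1) ?_ hj
      rintro _ ⟨q, rfl⟩
      rfl)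
    (fun x y hx => by
      rw [splitLabel_eq_some] at hx
      rw [hx]
      exact (congrArg (fun a : SplitVertex G s => a.1.1) (start_oldEdge h ht y)).symm)
    (by
      rw [splitLabel_eq_none]
      exact isForest_inr h ht)

variable (hs : G.IsSplitting s)

theorem label_splitCollapse {x : (splitGraph h ht s).E × Bool} {y : G.E × Bool} :
    (splitCollapse h ht hs).label x = some y ↔ x = (oldEdge y.1, y.2) :=
  (iff_of_eq (congrArg (· = some y) (Collapse.label_ofLabel x))).trans (splitLabel_eq_some h ht)

theorem F_splitCollapse : (splitCollapse h ht hs).F = Set.range newEdge :=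
  splitLabel_eq_none h ht

/-- The cycle of the original graph that contains or meets an edge. -/
noncomputable def splitCycle (e : (splitGraph h ht s).E) : Set G.E :=
  Sum.elim h.cactus.cyc (fun q : s => h.parent (hs.1 q.1 q.2).1) e

theorem mem_attach_of_root {y : G.E × Bool} (hy : G.root (h.cactus.cyc y.1) = G.start y)
    {q : G.V × Set (Set G.E)} : q ∈ (attach h ht s y).1.2 ↔
      q ∈ s ∧ q.1 = G.start y ∧ h.cactus.cyc y.1 ∈ q.2 :=
  and_congr_right fun _ => and_congr_right fun _ => or_iff_left fun h' => h'.root_ne hy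

theorem attach_eq_of_root {y y' : G.E × Bool} (hc : h.cactus.cyc y.1 = h.cactus.cyc y'.1)
    (hy : G.root (h.cactus.cyc y.1) = G.start y) (hy' : G.root (h.cactus.cyc y'.1) = G.start y') :
    attach h ht s y = attach h ht s y' := by
  have h1 : G.start y = G.start y' := by rw [← hy, hc, hy']
  refine splitVertex_ext h1 fun q _ _ => ?_
  rw [mem_attach_of_root h ht hy, mem_attach_of_root h ht hy', h1, hc]

/-- The parent cycle is not rooted at `v`, so no splitting at `v` contains it. Thus its first end is
attached where no splittings are present, while by `mem_attach_hi` its second end has all of them.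
-/
theorem notMem_attach_lo (hs : G.IsSplitting s) {v : G.V} (hv : v ≠ G.base)
    (q : G.V × Set (Set G.E)) : q ∉ (attach h ht s (h.lo ht hv)).1.2 := by
  rintro ⟨hq, hqv, h1⟩
  obtain ⟨-, -, h3, -⟩ := h.ends_spec ht hv
  rw [h3] at hqv h1
  rcases h1 with h1 | h1
  · rw [← h.cactus.eq_cyc (h.parent_spec hv).1 (h.lo_mem ht hv)] at h1
    refine (h.parent_spec hv).2.2 ?_
    rw [((hs.1 q hq).2.2.1 h1).2, hqv]
  · exact h.not_tail_lo ht hv h1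

theorem mem_attach_hi {v : G.V} (hv : v ≠ G.base) {q : G.V × Set (Set G.E)} :
    q ∈ (attach h ht s (h.hi ht hv)).1.2 ↔ q ∈ s ∧ q.1 = v := by
  obtain ⟨-, -, -, h4, -⟩ := h.ends_spec ht hv
  refine and_congr_right fun _ => ?_
  rw [h4]
  exact and_iff_left (Or.inr ⟨hv, rfl⟩)

/-- The parent cycle of `v` lifts to its two edges together with all new edges over `v`: these form
the path from the first end to the second, and at the root the two edges are attached to the same
vertex. Any other cycle of a thin graph has all half-edges at its root, so its edges become loops.
-/
theorem bdry_splitCycle (a : G.E) : (splitGraph h ht s).bdry ((splitGraph h ht s).chain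
    {e | splitCycle h ht hs e = h.cactus.cyc a}) = 0 := by
  classical
  by_cases hp : ∃ v, ∃ hv : v ≠ G.base, h.cactus.cyc a = h.parent hv
  · obtain ⟨v, hv, hp⟩ := hp
    rw [hp]
    obtain ⟨h1, h2, h3, h4, h5, h6⟩ := h.ends_spec ht hv
    have hcl := (h.cactus.eq_cyc (h.parent_spec hv).1 (h.lo_mem ht hv)).symm
    have hch := (h.cactus.eq_cyc (h.parent_spec hv).1 (h.hi_mem ht hv)).symm
    obtain ⟨z, hz, hzb⟩ := joinedIn_iff.1 (joinedIn_inr h ht hs (attach h ht s (h.lo ht hv))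
      (attach h ht s (h.hi ht hv)) (h3.trans h4.symm))
    have hzq := apply_inr h ht hz hzb
    have hx : (splitGraph h ht s).chain {e | splitCycle h ht hs e = h.parent hv} =
        z + (Pi.single (oldEdge (h.lo ht hv).1) 1 + Pi.single (oldEdge (h.hi ht hv).1) 1) := by
      funext e
      obtain ⟨e, rfl⟩ | ⟨q, rfl⟩ := edge_cases e
      · have hz0 : z (oldEdge e) = 0 := by
          by_contra h0
          obtain ⟨q, hq⟩ := hz _ h0
          exact newEdge_ne_oldEdge _ _ hq
        rw [Pi.add_apply, Pi.add_apply, hz0, zero_add]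
        have hmem : oldEdge e ∈ {e | splitCycle h ht hs e = h.parent hv} ↔
            e = (h.lo ht hv).1 ∨ e = (h.hi ht hv).1 := by
          change h.cactus.cyc e = h.parent hv ↔ e ∈ ({(h.lo ht hv).1, (h.hi ht hv).1} : Set G.E)
          rw [← h2]
          exact ⟨fun h' => h' ▸ h.cactus.mem_cyc e,
            fun h' => (h.cactus.eq_cyc (h.parent_spec hv).1 h').symm⟩
        by_cases hel : e = (h.lo ht hv).1
        · rw [chain_of_mem (hmem.2 (Or.inl hel)), hel, Pi.single_eq_same, Pi.single_eq_of_ne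
            (oldEdge_injective.ne h1), add_zero]
        · by_cases heh : e = (h.hi ht hv).1
          · rw [chain_of_mem (hmem.2 (Or.inr heh)), heh, Pi.single_eq_same, Pi.single_eq_of_ne
              (oldEdge_injective.ne h1.symm), zero_add]
          · rw [chain_of_notMem fun h' => (hmem.1 h').elim hel heh,
              Pi.single_eq_of_ne (oldEdge_injective.ne hel),
              Pi.single_eq_of_ne (oldEdge_injective.ne heh), add_zero]
      · rw [Pi.add_apply, Pi.add_apply, hzq, if_neg (notMem_attach_lo h ht hs hv _),
          Pi.single_eq_of_ne (newEdge_ne_oldEdge _ _), Pi.single_eq_of_ne (newEdge_ne_oldEdge _ _), add_zero, zero_add,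
          add_zero]
        have hmem : newEdge q ∈ {e | splitCycle h ht hs e = h.parent hv} ↔
            q.1 ∈ (attach h ht s (h.hi ht hv)).1.2 := by
          rw [mem_attach_hi, and_iff_right q.2]
          change h.parent (hs.1 q.1 q.2).1 = h.parent hv ↔ _
          refine ⟨fun h' => h.parent_injective ht _ _ h', fun h' => ?_⟩
          subst h'
          rfl
        by_cases hq : q.1 ∈ (attach h ht s (h.hi ht hv)).1.2
        · rw [if_pos hq, chain_of_mem (hmem.2 hq)]
        · rw [if_neg hq, chain_of_notMem (mt hmem.1 hq)]
    have hother : attach h ht s ((h.lo ht hv).1, !(h.lo ht hv).2) =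
        attach h ht s ((h.hi ht hv).1, !(h.hi ht hv).2) :=
      attach_eq_of_root h ht (hcl.trans hch.symm) ((congrArg _ hcl).trans h5.symm)
        ((congrArg _ hch).trans h6.symm)
    have hb : ∀ y : G.E × Bool, (splitGraph h ht s).bdry (Pi.single (oldEdge y.1) 1) =
        (splitGraph h ht s).pt (attach h ht s y) +
          (splitGraph h ht s).pt (attach h ht s (y.1, !y.2)) := fun y => by
      rw [← start_oldEdge, ← start_oldEdge]
      exact bdry_single_start (G := splitGraph h ht s) (oldEdge y.1, y.2)
    have hsum : ∀ a b c : (splitGraph h ht s).V → ZMod 2, a + b + ((a + c) + (b + c)) = 0 :=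
      fun a b c => by
        funext w
        change a w + b w + ((a w + c w) + (b w + c w)) = 0
        generalize a w = p, b w = q, c w = r
        revert p q r
        decide
    rw [hx, map_add, map_add, hzb, hb, hb, hother]
    exact hsum _ _ _
  · have hroot : ∀ y : G.E × Bool, h.cactus.cyc y.1 = h.cactus.cyc a →
        G.root (h.cactus.cyc y.1) = G.start y := fun y hy =>
      (h.root_eq_or ht (y := y) rfl).resolve_right fun ⟨hv, h', _⟩ => hp ⟨_, hv, hy ▸ h'⟩
    rw [bdry_apply]
    refine Finset.sum_eq_zero fun e _ => ?_
    obtain ⟨e, rfl⟩ | ⟨q, rfl⟩ := edge_cases e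
    · by_cases he : h.cactus.cyc e = h.cactus.cyc a
      · have h1 : (splitGraph h ht s).src (oldEdge e) = (splitGraph h ht s).tgt (oldEdge e) :=
          attach_eq_of_root h ht (y := (e, true)) (y' := (e, false)) rfl (hroot _ he) (hroot _ he)
        rw [h1, add_self_fun, smul_zero]
      · rw [chain_of_notMem, zero_smul]
        exact he
    · rw [chain_of_notMem, zero_smul]
      exact fun h' => hp ⟨_, (hs.1 q.1 q.2).1, h'.symm⟩

theorem isCactus_splitGraph (hs : G.IsSplitting s) : (splitGraph h ht s).IsCactus ∧
    ∀ e, (splitGraph h ht s).IsCycle {e' | splitCycle h ht hs e' = splitCycle h ht hs e} :=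
  (splitCollapse h ht hs).isCactus_of_lift h.cactus (splitCycle h ht hs)
    (fun x y hx => by
      rw [label_splitCollapse] at hx
      rw [hx]
      rfl)
    (fun e => by
      obtain ⟨e, rfl⟩ | ⟨q, rfl⟩ := edge_cases e
      · exact ⟨e, rfl⟩
      · exact ⟨_, h.cactus.eq_cyc (h.parent_spec _).1 (h.lo_mem ht (hs.1 q.1 q.2).1)⟩)
    (bdry_splitCycle h ht hs)

theorem isConnectedCactus_splitGraph (hs : G.IsSplitting s) : (splitGraph h ht s).IsConnectedCactus :=
  ⟨(isCactus_splitGraph h ht hs).1, fun _ _ => joinedIn_mono (Set.subset_univ _)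
    ((splitCollapse h ht hs).joinedIn_iff.1 (h.conn _ _))⟩

/-- Every vertex is attached to a cycle based at its image. -/
theorem IsConnectedCactus.exists_rootsAt (h : G.IsConnectedCactus) (hs : G.IsSplitting s) (hn : G.HasTwoCycles) (a : SplitVertex G s) : ∃ D ∈ G.rootsAt a.1.1,
    ∀ q ∈ s, q.1 = a.1.1 → (q ∈ a.1.2 ↔ D ∈ q.2) := by
  have hex : (G.rootsAt a.1.1).Nonempty := by
    by_cases hb : a.1.1 = G.base
    · obtain ⟨C, hC, hbC⟩ := hn.1
      exact ⟨C, hC, (h.gate_of_mem hC hbC).trans hb.symm⟩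
    · obtain ⟨C, D, hC, hD, hne, hwC, hwD⟩ := hn.2 _ hb
      by_contra! hn
      refine hne (h.parent_unique hC hD hwC hwD (fun h' => ?_) fun h' => ?_)
      · exact (Set.ext_iff.1 hn C).1 ⟨hC, h'⟩
      · exact (Set.ext_iff.1 hn D).1 ⟨hD, h'⟩
  -- `T` is the smallest splitting in `a`, or the set of all cycles rooted there if `a` has none.
  -- The largest splitting not in `a` does not contain `T`; since splittings are nested, a cycle in
  -- `T` outside it detects exactly the splittings in `a`.
  obtain ⟨T, hT, hTr, hTa, hTn⟩ : ∃ T : Set (Set G.E), T.Nonempty ∧ T ⊆ G.rootsAt a.1.1 ∧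
      (∀ q ∈ a.1.2, T ⊆ q.2) ∧ ∀ q ∈ s, q.1 = a.1.1 → q ∉ a.1.2 → ¬ T ⊆ q.2 := by
    rcases a.1.2.eq_empty_or_nonempty with ha | ha
    · refine ⟨_, hex, subset_rfl, fun q hq => (ha ▸ hq : q ∈ (∅ : Set _)).elim,
        fun q hq hqa _ hsub => ?_⟩
      rw [← hqa] at hsub
      exact (hs.1 q hq).2.2.2 hsub
    · obtain ⟨q, hq, hmin⟩ := (Set.toFinite a.1.2).exists_minimalFor Prod.snd _ ha
      obtain ⟨hqs, hqa⟩ := a.2.1 q hq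
      refine ⟨q.2, (hs.1 q hqs).2.1, hqa ▸ (hs.1 q hqs).2.2.1, fun q' hq' => ?_,
        fun q' hq' hqa' hn hsub => hn (a.2.2 q hq q' hq' (hqa'.trans hqa.symm) hsub)⟩
      rcases hs.2 q hqs q' (a.2.1 q' hq').1 (hqa.trans (a.2.1 q' hq').2.symm) with h2 | h2
      exacts [h2, hmin hq' h2]
  obtain ⟨D, hDT, hD⟩ : ∃ D ∈ T, ∀ q ∈ s, q.1 = a.1.1 → q ∉ a.1.2 → D ∉ q.2 := by
    rcases {q | q ∈ s ∧ q.1 = a.1.1 ∧ q ∉ a.1.2}.eq_empty_or_nonempty with h0 | h0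
    · obtain ⟨D, hD⟩ := hT
      exact ⟨D, hD, fun q h1 h2 h3 => ((Set.ext_iff.1 h0 q).1 ⟨h1, h2, h3⟩).elim⟩
    · obtain ⟨q, ⟨hqs, hqa, hqn⟩, hmax⟩ := (Set.toFinite _).exists_maximalFor Prod.snd _ h0
      obtain ⟨D, hD, hDq⟩ := Set.not_subset.1 (hTn q hqs hqa hqn)
      refine ⟨D, hD, fun q' h1 h2 h3 hDq' => hDq ?_⟩
      rcases hs.2 q hqs q' h1 (hqa.trans h2.symm) with h4 | h4
      exacts [hmax ⟨h1, h2, h3⟩ h4 hDq', h4 hDq']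
  refine ⟨D, hTr hDT, fun q hq hqa => ⟨fun h' => hTa q h' hDT, fun h' => ?_⟩⟩
  by_contra hn
  exact hD q hq hqa hn h'

theorem exists_attach_eq (hs : G.IsSplitting s) (hn : G.HasTwoCycles) (a : SplitVertex G s) :
    ∃ y : G.E × Bool, attach h ht s y = a ∧ G.root (h.cactus.cyc y.1) = G.start y := by
  obtain ⟨D, ⟨hD, hDa⟩, hDq⟩ := h.exists_rootsAt hs hn a
  obtain ⟨y, hy, hya⟩ := exists_start_of_mem_verts (h.root_mem hD)
  have hr : G.root (h.cactus.cyc y.1) = G.start y := by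
    rw [← h.cactus.eq_cyc hD hy, hya]
  refine ⟨y, splitVertex_ext (hya.trans hDa) fun q hq hqy => ?_, hr⟩
  have h1 : q.1 = a.1.1 := hqy.trans (hya.trans hDa)
  rw [mem_attach_of_root h ht hr, and_iff_right hq, hDq q hq h1, ← h.cactus.eq_cyc hD hy]
  exact and_iff_right hqy

/-- Some cycle rooted at the image is attached exactly at `a`. If `a` is not the base vertex, the
lifted parent cycle is a second one: it passes through all vertices over the image. -/
theorem hasTwoCycles_splitGraph (hs : G.IsSplitting s) (hn : G.HasTwoCycles) : (splitGraph h ht s).HasTwoCycles := by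
  have key : ∀ y : G.E × Bool, ∃ C, (splitGraph h ht s).IsCycle C ∧ oldEdge y.1 ∈ C ∧
      attach h ht s y ∈ (splitGraph h ht s).verts C ∧
      C = {e' | splitCycle h ht hs e' = h.cactus.cyc y.1} := fun y =>
    ⟨_, (isCactus_splitGraph h ht hs).2 (oldEdge y.1), rfl, start_oldEdge h ht y ▸
      start_mem_verts (G := splitGraph h ht s) (x := (oldEdge y.1, y.2)) rfl, rfl⟩
  refine ⟨?_, fun a ha => ?_⟩
  · obtain ⟨y, hy, -⟩ := exists_attach_eq h ht hs hn (splitGraph h ht s).base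
    obtain ⟨C, hC, -, hyC, -⟩ := key y
    exact ⟨C, hC, hy ▸ hyC⟩
  · obtain ⟨y, rfl, hyr⟩ := exists_attach_eq h ht hs hn a
    have hv : G.start y ≠ G.base := fun hb => ha (splitVertex_ext hb fun q hq hqb =>
      ((hs.1 q hq).1 (hqb.trans hb)).elim)
    obtain ⟨C, hC, hyC, haC, -⟩ := key y
    obtain ⟨h1, h2, h3, h4, h5, h6⟩ := h.ends_spec ht hv
    have hcl := (h.cactus.eq_cyc (h.parent_spec hv).1 (h.lo_mem ht hv)).symm
    obtain ⟨D, hD, -, hlD, hDe⟩ := key (h.lo ht hv)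
    refine ⟨C, D, hC, hD, ?_, haC, ?_⟩
    · rintro rfl
      rw [hDe, hcl] at hyC
      have h7 : h.cactus.cyc y.1 = h.parent hv := hyC
      rw [h7] at hyr
      exact (h.parent_spec hv).2.2 hyr
    · rcases (attach h ht s y).1.2.eq_empty_or_nonempty with h0 | h0
      · rw [show attach h ht s y = attach h ht s (h.lo ht hv) from
          splitVertex_ext h3.symm fun q _ _ => iff_of_false
            (fun h' => (h0 ▸ h' : q ∈ (∅ : Set _))) (notMem_attach_lo h ht hs hv q)]
        exact hlD
      · obtain ⟨q, hq, hqa⟩ := exists_tgt_eq h ht hs _ h0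
        refine ⟨newEdge q, ?_, Or.inr hqa⟩
        rw [hDe, hcl]
        change h.parent (hs.1 q.1 q.2).1 = h.parent hv
        have h8 : q.1.1 = G.start y := hq.2.1
        congr 1

/-- A new edge lies in the lift of the parent cycle of its vertex, and this vertex is not the root
of its parent cycle. -/
theorem isTrimmed_splitCollapse (hn : G.HasTwoCycles) : (splitCollapse h ht hs).IsTrimmed where
  source := isConnectedCactus_splitGraph h ht hs
  two := hasTwoCycles_splitGraph h ht hs hn
  thin := ht
  rootPart_eq := by
    refine Set.eq_empty_of_forall_notMem fun e he => ?_
    have hF := he.1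
    rw [F_splitCollapse] at hF
    obtain ⟨q, rfl⟩ := hF
    have hY := isConnectedCactus_splitGraph h ht hs
    have hC := hY.cactus.isCycle_cyc (newEdge q)
    have hv := (hs.1 q.1 q.2).1
    have hmap : (splitCollapse h ht hs).mapC (hY.cactus.cyc (newEdge q)) = h.parent hv := by
      refine h.cactus.cycle_eq (e := (h.lo ht hv).1)
        ((splitCollapse h ht hs).isCycle_mapC hY hC) (h.parent_spec hv).1
        (((splitCollapse h ht hs).mem_mapC (y := h.lo ht hv)
          ((label_splitCollapse h ht hs).2 rfl)).2 ?_) (h.lo_mem ht hv)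
      rw [← hY.cactus.eq_cyc ((isCactus_splitGraph h ht hs).2 (newEdge q)) rfl]
      exact (h.cactus.eq_cyc (h.parent_spec hv).1 (h.lo_mem ht hv)).symm
    have := (splitCollapse h ht hs).onV_eq_iff.2 he.2
    rw [← (splitCollapse h ht hs).root_mapC hY hC, hmap] at this
    exact (h.parent_spec hv).2.2 this

end Splitting

end BasedGraph


/-! ### Trimmed collapses and splittings -/

namespace BasedGraph

variable {G H K : BasedGraph} {s : Set (G.V × Set (Set G.E))}

open Classical in
-- Along new edges, both functions change exactly at the edge of `q`, and both vanish where the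
-- first end of the parent cycle is attached.
theorem side_newEdge (h : G.IsConnectedCactus) (ht : G.IsThin) (hs : G.IsSplitting s)
    (hn : G.HasTwoCycles) (q : s) (a : SplitVertex G s) (ha : a.1.1 = q.1.1) :
    (isTrimmed_splitCollapse h ht hs hn).side (newEdge q) a = if q.1 ∈ a.1.2 then 1 else 0 := by
  have hF : ∀ q : s, newEdge q ∈ (splitCollapse h ht hs).F := fun q => by
    rw [F_splitCollapse]
    exact ⟨q, rfl⟩
  have t := isTrimmed_splitCollapse h ht hs hn
  have hv := (hs.1 q.1 q.2).1
  obtain ⟨h1, h2, h3, h4, h5, h6⟩ := h.ends_spec ht hv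
  have hlo : (isTrimmed_splitCollapse h ht hs hn).side (newEdge q)
      (attach h ht s (h.lo ht hv)) = 0 := by
    have := ((isTrimmed_splitCollapse h ht hs hn).side_parent (hF q) (f := newEdge q) hv
      (x := (oldEdge (h.lo ht hv).1, (h.lo ht hv).2)) ((label_splitCollapse h ht hs).2 rfl)).1 rfl
    rwa [start_oldEdge] at this
  have hk := eq_of_joinedIn_const (G := splitGraph h ht s)
    (f := fun a : SplitVertex G s => (isTrimmed_splitCollapse h ht hs hn).side (newEdge q) a +
      if q.1 ∈ a.1.2 then 1 else 0) (A := Set.range newEdge) ?_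
    (joinedIn_inr h ht hs a (attach h ht s (h.lo ht hv)) (ha.trans h3.symm))
  · have hk' : (isTrimmed_splitCollapse h ht hs hn).side (newEdge q) a +
        (if q.1 ∈ a.1.2 then 1 else 0) = (isTrimmed_splitCollapse h ht hs hn).side (newEdge q)
          (attach h ht s (h.lo ht hv)) +
        if q.1 ∈ (attach h ht s (h.lo ht hv)).1.2 then 1 else 0 := hk
    rwa [hlo, if_neg (notMem_attach_lo h ht hs hv _), add_zero, CharTwo.add_eq_zero] at hk'
  · rintro _ ⟨q', rfl⟩
    by_cases hq : q' = q
    · subst hq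
      have h7 := (isTrimmed_splitCollapse h ht hs hn).side_src_ne (hF q')
      have h8 : q'.1 ∉ ((splitGraph h ht s).src (newEdge q')).1.2 := fun h => h.2.2.2 subset_rfl
      have h9 : q'.1 ∈ ((splitGraph h ht s).tgt (newEdge q')).1.2 := ⟨q'.2, rfl, subset_rfl⟩
      simp only [if_neg h8, if_pos h9]
      generalize (isTrimmed_splitCollapse h ht hs hn).side (newEdge q')
        ((splitGraph h ht s).src (newEdge q')) = a at *
      generalize (isTrimmed_splitCollapse h ht hs hn).side (newEdge q')
        ((splitGraph h ht s).tgt (newEdge q')) = b at *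
      clear * - h7
      revert a b
      decide
    · have h7 := (isTrimmed_splitCollapse h ht hs hn).side_src_eq (hF q) (hF q')
        (newEdge_injective.ne hq)
      have h8 : q.1 ∈ ((splitGraph h ht s).src (newEdge q')).1.2 ↔
          q.1 ∈ ((splitGraph h ht s).tgt (newEdge q')).1.2 := by
        refine ⟨fun h => ⟨h.1, h.2.1, h.2.2.1⟩, fun h => ⟨h.1, h.2.1, h.2.2, fun h' => hq ?_⟩⟩
        exact Subtype.ext (Prod.ext h.2.1.symm (h.2.2.antisymm h'))
      simp only [h7, h8]

/-- A cycle rooted at the vertex is attached beyond the edge of `q` exactly if it belongs to `q`; so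
the blow-up returns the splittings it was made from. -/
theorem splitting_newEdge (h : G.IsConnectedCactus) (ht : G.IsThin) (hs : G.IsSplitting s)
    (hn : G.HasTwoCycles) (q : s) :
    ((splitCollapse h ht hs).onV ((splitGraph h ht s).src (newEdge q)),
      (isTrimmed_splitCollapse h ht hs hn).beyond (newEdge q)) = q.1 := by
  have hF : newEdge q ∈ (splitCollapse h ht hs).F := by
    rw [F_splitCollapse]
    exact ⟨q, rfl⟩
  refine Prod.ext rfl (Set.ext fun D => ?_)
  by_cases hD : D ∈ G.rootsAt q.1.1
  · obtain ⟨y, hy, hya⟩ := exists_start_of_mem_verts (h.root_mem hD.1)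
    rw [hD.2] at hya
    have hr : G.root (h.cactus.cyc y.1) = G.start y := by
      rw [← h.cactus.eq_cyc hD.1 hy, hya, hD.2]
    have h1 := (isTrimmed_splitCollapse h ht hs hn).side_start hF
      (x := (oldEdge y.1, y.2)) ((label_splitCollapse h ht hs).2 rfl) hya.symm
    rw [or_iff_left fun h' => IsConnectedCactus.Tail.root_ne h' hr, start_oldEdge,
      side_newEdge h ht hs hn q _ hya, ← IsCactus.eq_cyc _ hD.1 hy] at h1
    rw [← h1]
    have h2 := mem_attach_of_root (s := s) h ht hr (q := q.1)
    rw [and_iff_right q.2, and_iff_right hya.symm, ← h.cactus.eq_cyc hD.1 hy] at h2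
    rw [← h2]
    by_cases h3 : q.1 ∈ (attach h ht s y).1.2 <;> simp [h3]
  · exact iff_of_false (fun h' => hD ((isTrimmed_splitCollapse h ht hs hn).beyond_subset _ h'))
      fun h' => hD ((hs.1 q.1 q.2).2.2.1 h')

theorem splitting_splitCollapse (h : G.IsConnectedCactus) (ht : G.IsThin) (hs : G.IsSplitting s)
    (hn : G.HasTwoCycles) : (isTrimmed_splitCollapse h ht hs hn).splitting = s := by
  rw [Collapse.IsTrimmed.splitting, F_splitCollapse, ← Set.range_comp]
  exact (congrArg Set.range (funext (splitting_newEdge h ht hs hn))).trans Subtype.range_coe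

namespace Collapse.IsTrimmed

variable {c : Collapse H G}

theorem mem_splitting (t : c.IsTrimmed) {f : H.E} (hf : f ∈ c.F) :
    (c.onV (H.src f), t.beyond f) ∈ t.splitting := ⟨f, hf, rfl⟩

/-- The splittings beyond which a vertex lies. -/
def position (t : c.IsTrimmed) (w : H.V) : SplitVertex G t.splitting :=
  ⟨(c.onV w, {q | ∃ f ∈ c.F, c.onV (H.src f) = c.onV w ∧ t.side f w = 1 ∧
      q = (c.onV (H.src f), t.beyond f)}), by
    rintro _ ⟨f, hf, hfw, -, rfl⟩
    exact ⟨t.mem_splitting hf, hfw⟩, by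
    rintro _ ⟨f, hf, hfw, h1, rfl⟩ _ ⟨f', hf', rfl⟩ h2 h3
    have hfw' := h2.trans hfw
    obtain ⟨D, -, hD⟩ := t.exists_mem_beyond (t.mapC_cyc hf).1 hfw.symm
    exact ⟨f', hf', hfw', (hD f' hf' h2).1 (h3 ((hD f hf rfl).2 h1)), rfl⟩⟩

theorem mem_position (t : c.IsTrimmed) {w : H.V} {f : H.E} (hf : f ∈ c.F) :
    (c.onV (H.src f), t.beyond f) ∈ (t.position w).1.2 ↔
      c.onV (H.src f) = c.onV w ∧ t.side f w = 1 := by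
  constructor
  · rintro ⟨f', hf', h1, h2, h3⟩
    obtain ⟨h4, h5⟩ := Prod.mk.inj h3
    rw [t.beyond_injective hf hf' h4 h5]
    exact ⟨h1, h2⟩
  · exact fun h => ⟨f, hf, h.1, h.2, rfl⟩

theorem position_eq (t : c.IsTrimmed) {w : H.V} {a : SplitVertex G t.splitting}
    (h1 : c.onV w = a.1.1) (h2 : ∀ f ∈ c.F, c.onV (H.src f) = c.onV w →
      (t.side f w = 1 ↔ (c.onV (H.src f), t.beyond f) ∈ a.1.2)) : t.position w = a := by
  refine splitVertex_ext h1 ?_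
  rintro _ ⟨f, hf, rfl⟩ hfw
  rw [← h2 f hf hfw, t.mem_position hf]
  exact and_iff_right hfw

theorem position_start (t : c.IsTrimmed) {x y} (hx : c.label x = some y) :
    t.position (H.start x) = attach t.target t.thin t.splitting y := by
  refine t.position_eq (c.label_start hx).symm fun f hf hfx => ?_
  rw [← c.label_start hx] at hfx
  rw [t.side_start hf hx hfx]
  exact ⟨fun h => ⟨t.mem_splitting hf, hfx, h⟩, fun h => h.2.2⟩

/-- The positions of the two ends of a collapsed edge differ by its own splitting only; nestedness
decides the others. The flag `b` records that a new edge starts on side 0, where its own splitting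
is still absent. -/
theorem position_edge (t : c.IsTrimmed) {x : H.E × Bool} (hx : x.1 ∈ c.F) {b : Bool}
    (hb : b = true ↔ t.side x.1 (H.start x) = 0) :
    t.position (H.start x) = (splitGraph t.target t.thin t.splitting).start
      (newEdge ⟨_, t.mem_splitting hx⟩, b) := by
  have h0 := c.onV_start hx
  have h0' : c.onV (H.start (x.1, !x.2)) = c.onV (H.src x.1) :=
    c.onV_start (x := (x.1, !x.2)) hx
  obtain ⟨hv, -⟩ := t.mapC_cyc hx
  obtain ⟨D, -, hD⟩ := t.exists_mem_beyond hv h0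
  obtain ⟨D', -, hD'⟩ := t.exists_mem_beyond hv h0'
  have hne : t.side x.1 (H.start x) ≠ t.side x.1 (H.start (x.1, !x.2)) :=
    (t.isCut hx).start_ne (Or.inl rfl)
  have heq : ∀ f ∈ c.F, f ≠ x.1 → t.side f (H.start x) = t.side f (H.start (x.1, !x.2)) :=
    fun f hf hfx => (t.isCut hf).start_eq (t.notMem_cutSet hx (Ne.symm hfx))
  cases b
  · have h1 : t.side x.1 (H.start x) = 1 := zmod_two_eq_one fun h => by cases hb.2 h
    have h1' : t.side x.1 (H.start (x.1, !x.2)) ≠ 1 := fun h => hne (h1.trans h.symm)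
    refine t.position_eq h0 fun f hf hfx => ?_
    rw [h0] at hfx
    have hiff : (c.onV (H.src f), t.beyond f) ∈ ((splitGraph t.target t.thin t.splitting).start
        (newEdge ⟨_, t.mem_splitting hx⟩, false)).1.2 ↔ t.beyond x.1 ⊆ t.beyond f :=
      ⟨fun h => h.2.2, fun h => ⟨t.mem_splitting hf, hfx, h⟩⟩
    rw [hiff]
    refine ⟨fun h2 => ?_, fun h2 => (hD f hf hfx).1 (h2 ((hD x.1 hx rfl).2 h1))⟩
    by_cases hfe : f = x.1
    · rw [hfe]
    · rw [heq f hf hfe] at h2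
      refine (t.beyond_total hx hf hfx.symm).resolve_right fun h3 => ?_
      exact h1' ((hD' x.1 hx rfl).1 (h3 ((hD' f hf hfx).2 h2)))
  · have h1 : t.side x.1 (H.start x) = 0 := hb.1 rfl
    have h1' : t.side x.1 (H.start (x.1, !x.2)) = 1 := zmod_two_eq_one fun h => hne (h1.trans h.symm)
    have h1n : t.side x.1 (H.start x) ≠ 1 := by
      rw [h1]
      exact zero_ne_one
    refine t.position_eq h0 fun f hf hfx => ?_
    rw [h0] at hfx
    have hiff : (c.onV (H.src f), t.beyond f) ∈ ((splitGraph t.target t.thin t.splitting).start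
        (newEdge ⟨_, t.mem_splitting hx⟩, true)).1.2 ↔ t.beyond x.1 ⊂ t.beyond f :=
      ⟨fun h => h.2.2, fun h => ⟨t.mem_splitting hf, hfx, h⟩⟩
    rw [hiff]
    constructor
    · intro h2
      have h3 : ¬ t.beyond f ⊆ t.beyond x.1 := fun h3 =>
        h1n ((hD x.1 hx rfl).1 (h3 ((hD f hf hfx).2 h2)))
      exact ⟨(t.beyond_total hx hf hfx.symm).resolve_right h3, h3⟩
    · intro h2
      have hfe : f ≠ x.1 := by
        rintro rfl
        exact h2.2 subset_rfl
      rw [heq f hf hfe]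
      exact (hD' f hf hfx).1 (h2.1 ((hD' x.1 hx rfl).2 h1'))

open Classical in
noncomputable def positionLabel (t : c.IsTrimmed) (x : H.E × Bool) :
    Option ((splitGraph t.target t.thin t.splitting).E × Bool) :=
  if hx : x.1 ∈ c.F then some (newEdge ⟨_, t.mem_splitting hx⟩, decide (t.side x.1 (H.start x) = 0))
  else (c.label x).map fun y => (oldEdge y.1, y.2)

theorem positionLabel_of_mem (t : c.IsTrimmed) {x : H.E × Bool} (hx : x.1 ∈ c.F) {b : Bool}
    (hb : b = true ↔ t.side x.1 (H.start x) = 0) :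
    t.positionLabel x = some (newEdge ⟨_, t.mem_splitting hx⟩, b) := by
  rw [positionLabel, dif_pos hx]
  congr 2
  by_cases h : t.side x.1 (H.start x) = 0
  · rw [hb.2 h, decide_eq_true h]
  · rw [decide_eq_false h, (Bool.eq_false_iff.2 (mt hb.1 h))]

theorem positionLabel_of_label (t : c.IsTrimmed) {x y} (hx : c.label x = some y) :
    t.positionLabel x = some (oldEdge y.1, y.2) := by
  rw [positionLabel, dif_neg (c.notMem_of_label hx), hx]
  rfl

theorem positionLabel_cases (t : c.IsTrimmed) (x : H.E × Bool) :
    (∃ y, c.label x = some y ∧ t.positionLabel x = some (oldEdge y.1, y.2)) ∨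
    ∃ hx : x.1 ∈ c.F, ∃ b, (b = true ↔ t.side x.1 (H.start x) = 0) ∧
      t.positionLabel x = some (newEdge ⟨_, t.mem_splitting hx⟩, b) := by
  classical
  by_cases hx : x.1 ∈ c.F
  · exact Or.inr ⟨hx, decide (t.side x.1 (H.start x) = 0), decide_eq_true_iff,
      t.positionLabel_of_mem hx decide_eq_true_iff⟩
  · obtain ⟨y, hy⟩ := c.exists_label hx
    exact Or.inl ⟨y, hy, t.positionLabel_of_label hy⟩

theorem positionLabel_ne_none (t : c.IsTrimmed) :
    {e | t.positionLabel (e, true) = none} = ∅ :=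
  Set.eq_empty_of_forall_notMem fun e he => by
    rw [Set.mem_ofPred_eq] at he
    obtain ⟨y, -, h⟩ | ⟨_, b, -, h⟩ := t.positionLabel_cases (e, true)
    · cases h.symm.trans he
    · cases h.symm.trans he

/-- The two ends of a collapsed edge lie on different sides of it, so the side determines the
orientation. -/
theorem eq_of_side_start (t : c.IsTrimmed) {x x' : H.E × Bool} (hx : x.1 ∈ c.F) (he : x.1 = x'.1)
    (h : t.side x.1 (H.start x) = 0 ↔ t.side x'.1 (H.start x') = 0) : x = x' := by
  obtain ⟨e, b⟩ := x
  obtain ⟨e', b'⟩ := x'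
  obtain rfl : e = e' := he
  by_contra hne
  have hb : b' = !b := Bool.eq_not.2 fun h' => hne (by rw [h'])
  subst hb
  have h1 := (t.isCut hx).start_ne (x := (e, b)) (Or.inl rfl)
  change t.side e _ ≠ t.side e _ at h1
  generalize t.side e (H.start (e, b)) = p at *
  generalize t.side e (H.start (e, !b)) = q at *
  clear * - h h1
  revert p q
  decide

/-- A trimmed collapse is isomorphic to the collapse given by its splittings. -/
noncomputable def toSplit (t : c.IsTrimmed) (hn : G.HasTwoCycles) :
    Collapse H (splitGraph t.target t.thin t.splitting) :=
  Collapse.ofLabel t.positionLabel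
    (fun x z hz => by
      obtain ⟨y, hy, h⟩ | ⟨hx, b, hb, h⟩ := t.positionLabel_cases x
      · rw [h, Option.some_inj] at hz
        subst hz
        exact t.positionLabel_of_label (c.label_not hy)
      · rw [h, Option.some_inj] at hz
        subst hz
        refine t.positionLabel_of_mem (x := (x.1, !x.2)) hx ?_
        have h1 := (t.isCut hx).start_ne (x := x) (Or.inl rfl)
        change t.side x.1 _ ≠ t.side x.1 _ at h1
        change (!b) = true ↔ t.side x.1 (H.start (x.1, !x.2)) = 0
        generalize t.side x.1 (H.start x) = p at *
        generalize t.side x.1 (H.start (x.1, !x.2)) = q at *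
        clear * - hb h1
        revert b p q
        decide)
    (fun x x' z hz hz' => by
      obtain ⟨y, hy, h⟩ | ⟨hx, b, hb, h⟩ := t.positionLabel_cases x <;>
      obtain ⟨y', hy', h'⟩ | ⟨hx', b', hb', h'⟩ := t.positionLabel_cases x' <;>
      rw [h, Option.some_inj] at hz <;> rw [h', Option.some_inj] at hz' <;>
      obtain ⟨h1, h2⟩ := Prod.mk.inj (hz.trans hz'.symm)
      · have := Prod.ext (oldEdge_injective h1) h2
        exact c.label_injective hy (this ▸ hy')
      · exact (newEdge_ne_oldEdge _ _ h1.symm).elim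
      · exact (newEdge_ne_oldEdge _ _ h1).elim
      · obtain ⟨h3, h4⟩ := Prod.mk.inj (congrArg Subtype.val (newEdge_injective h1))
        refine t.eq_of_side_start hx (t.beyond_injective hx hx' h3 h4) ?_
        rw [← hb, ← hb', h2])
    (fun z => by
      obtain ⟨e, b⟩ := z
      obtain ⟨a, rfl⟩ | ⟨q, rfl⟩ := edge_cases e
      · obtain ⟨x, hx⟩ := c.label_surjective (a, b)
        exact ⟨x, t.positionLabel_of_label hx⟩
      · obtain ⟨_, f, hf, rfl⟩ := q
        have h1 := t.side_src_ne hf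
        have h2 : ∃ b', b = true ↔ t.side f (H.start (f, b')) = 0 := by
          by_contra! hn
          have h3 := hn true
          have h4 := hn false
          change (b = true ∧ t.side f (H.src f) ≠ 0) ∨ (b ≠ true ∧ t.side f (H.src f) = 0) at h3
          change (b = true ∧ t.side f (H.tgt f) ≠ 0) ∨ (b ≠ true ∧ t.side f (H.tgt f) = 0) at h4
          generalize t.side f (H.src f) = p at *
          generalize t.side f (H.tgt f) = q at *
          clear * - h1 h3 h4
          revert b p q
          decide
        obtain ⟨b', hb'⟩ := h2
        exact ⟨(f, b'), t.positionLabel_of_mem (x := (f, b')) hf hb'⟩)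
    t.position
    (fun a => by
      obtain ⟨y, hy, -⟩ := exists_attach_eq t.target t.thin t.isSplitting hn a
      obtain ⟨x, hx⟩ := c.label_surjective y
      exact ⟨H.start x, (t.position_start hx).trans hy⟩)
    (t.position_eq c.onV_base fun f hf hfb =>
      ((t.mapC_cyc hf).1 (hfb.trans c.onV_base)).elim)
    (fun u w => by
      rw [t.positionLabel_ne_none, joinedIn_empty_iff]
      refine ⟨fun h => ?_, fun h => h ▸ rfl⟩
      have h1 : c.onV u = c.onV w := congrArg (fun a : SplitVertex G t.splitting => a.1.1) h
      refine t.eq_of_side h1 fun f hf hfu => ?_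
      have h2 := t.mem_position (w := u) hf
      rw [h, t.mem_position hf, and_iff_right (hfu.trans h1), and_iff_right hfu] at h2
      generalize t.side f u = p at *
      generalize t.side f w = q at *
      clear * - h2
      revert p q
      decide)
    (fun x z hz => by
      obtain ⟨y, hy, h⟩ | ⟨hx, b, hb, h⟩ := t.positionLabel_cases x
      · rw [h, Option.some_inj] at hz
        subst hz
        rw [t.position_start hy]
        exact start_oldEdge _ _ y
      · rw [h, Option.some_inj] at hz
        subst hz
        exact (t.position_edge hx hb).symm)
    (by
      rw [t.positionLabel_ne_none]
      exact isForest_empty)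

theorem F_toSplit (t : c.IsTrimmed) (hn : G.HasTwoCycles) : (t.toSplit hn).F = ∅ :=
  t.positionLabel_ne_none

theorem label_toSplit_comp (t : c.IsTrimmed) (hn : G.HasTwoCycles) : ((t.toSplit hn).comp
    (splitCollapse t.target t.thin t.isSplitting)).label = c.label := by
  funext x
  rw [label_comp]
  have h0 : (t.toSplit hn).label x = t.positionLabel x := Collapse.label_ofLabel x
  rw [h0]
  obtain ⟨y, hy, h⟩ | ⟨hx, b, hb, h⟩ := t.positionLabel_cases x
  · rw [h, hy, Option.bind_some, label_splitCollapse]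
  · rw [h, c.label_eq_none.2 hx, Option.bind_some, label_eq_none, F_splitCollapse]
    exact ⟨_, rfl⟩

end Collapse.IsTrimmed

end BasedGraph


/-! ### The up-link of a thin graph -/

namespace MarkedGraph

open BasedGraph AuterVertex

variable {n : ℕ} {X Y Z : MarkedGraph n}

/-- The collapse `e` induces an isomorphism of fundamental groups, which may be cancelled. -/
theorem Compatible.of_comp {c : Collapse Y.graph X.graph} {d : Collapse Y.graph Z.graph}
    {e : Collapse Z.graph X.graph} (hc : Y.Compatible X c) (he : Z.Compatible X e)
    (h : (d.comp e).label = c.label) : Y.Compatible Z d := fun g => by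
  have h1 : collapseEquiv e.iso e.forest (collapseEquiv d.iso d.forest (Y.marking g)) =
      collapseEquiv e.iso e.forest (Z.marking g) := Subtype.ext <| by
    refine Eq.trans ?_ (he g).symm
    rw [← hc g, ← Collapse.hom_congr h, d.hom_comp]
    rfl
  exact congrArg Subtype.val ((collapseEquiv e.iso e.forest).injective h1)

theorem hasTwoCycles (hX : X.graph.IsCactus) : X.graph.HasTwoCycles := X.reduced.hasTwoCycles hX

variable {s t : Set (X.graph.V × Set (Set X.graph.E))}

/-- The marked graph given by a set of splittings. -/
noncomputable def splitMarked (hX : X.graph.IsCactus) (ht : X.graph.IsThin)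
    (hs : X.graph.IsSplitting s) : MarkedGraph n :=
  X.blowUp ((isConnectedCactus_splitGraph (isConnectedCactus hX) ht hs).cactus.isReduced
    (isConnectedCactus_splitGraph (isConnectedCactus hX) ht hs).conn
    (hasTwoCycles_splitGraph (isConnectedCactus hX) ht hs (hasTwoCycles hX)))
    (splitCollapse (isConnectedCactus hX) ht hs)

theorem compatible_splitMarked (hX : X.graph.IsCactus) (ht : X.graph.IsThin)
    (hs : X.graph.IsSplitting s) : (splitMarked hX ht hs).Compatible X
      (splitCollapse (isConnectedCactus hX) ht hs) := compatible_blowUp _ _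

/-- The isomorphism `toSplit` commutes with the two collapses onto `X`, hence with the markings. -/
theorem mk_eq_splitMarked (hX : X.graph.IsCactus) {c : Collapse Y.graph X.graph}
    (hc : Y.Compatible X c) (tr : c.IsTrimmed) (hs : X.graph.IsSplitting s)
    (h : tr.splitting = s) : AuterVertex.mk Y = AuterVertex.mk (splitMarked hX tr.thin hs) := by
  subst h
  exact mk_eq_iff.2 ⟨tr.toSplit (hasTwoCycles hX), hc.of_comp (compatible_splitMarked hX tr.thin hs)
    (tr.label_toSplit_comp (hasTwoCycles hX)), tr.F_toSplit _⟩

/-- A partial collapse keeps just the splittings of the surviving edges (`splitting_comp`), which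
gives one direction. For the other, collapse the new edges of the splittings outside `s`: what
remains is trimmed and has splittings `s`, so it is the blow-up of `s`. -/
theorem splitMarked_le_iff (hX : X.graph.IsCactus) (ht : X.graph.IsThin)
    (hs : X.graph.IsSplitting s) (hs' : X.graph.IsSplitting t) :
    AuterVertex.mk (splitMarked hX ht hs) ≤ AuterVertex.mk (splitMarked hX ht hs') ↔ s ⊆ t := by
  have h := isConnectedCactus hX
  have hn := hasTwoCycles hX
  have tt := isTrimmed_splitCollapse h ht hs' hn
  constructor
  · intro hle
    obtain ⟨d, hd⟩ := AuterVertex.mk_le_mk.1 hle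
    have hl := (hd.comp (compatible_splitMarked hX ht hs)).label_eq
      (compatible_splitMarked hX ht hs')
    have h1 := Collapse.IsTrimmed.splitting_comp (isTrimmed_splitCollapse h ht hs' hn)
      (isTrimmed_splitCollapse h ht hs hn) (d := d) hl.symm
    exact ((splitting_splitCollapse h ht hs hn).ge.trans h1.le).trans
      ((Set.image_mono Set.sdiff_subset).trans (splitting_splitCollapse h ht hs' hn).le)
  · intro hst
    have hY : (splitMarked hX ht hs').graph.IsCactus := tt.source.cactus
    let c : Collapse (splitMarked hX ht hs').graph X.graph := splitCollapse h ht hs'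
    have hcF : c.F = Set.range newEdge := F_splitCollapse h ht hs'
    let B : Set (splitMarked hX ht hs').graph.E := newEdge '' {q : t | q.1 ∉ s}
    have hBc : B ⊆ c.F := hcF ▸ Set.image_subset_range _ _
    have hB : (splitMarked hX ht hs').graph.IsForest B := c.forest.mono hBc
    let d := Collapse.std _ hB
    have hd : (splitMarked hX ht hs').Compatible ((splitMarked hX ht hs').collapse hY hB) d :=
      compatible_collapse hY hB
    have he := hd.factor (compatible_splitMarked hX ht hs') (show d.F ⊆ c.F from hBc)
    have hZ : ((splitMarked hX ht hs').collapse hY hB).graph.IsConnectedCactus :=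
      d.isConnectedCactus (isConnectedCactus hY)
    have te : (d.factor c hBc).IsTrimmed := ⟨hZ, hasTwoCycles hZ.cactus, ht, by
      refine Set.eq_empty_of_forall_notMem fun y hy => ?_
      obtain ⟨x, hx⟩ := d.label_surjective (y, true)
      have := (d.mem_rootPart_factor (isConnectedCactus hY) hZ.cactus c hBc hx).1 hy
      exact (Set.ext_iff.1 tt.rootPart_eq x.1).1 this⟩
    have hsp : te.splitting = s := by
      rw [Collapse.IsTrimmed.splitting_comp (isTrimmed_splitCollapse h ht hs' hn) te (d := d)
        (d.label_comp_factor c hBc).symm]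
      ext q
      constructor
      · rintro ⟨f, ⟨hf, hfB⟩, rfl⟩
        obtain ⟨q, rfl⟩ : f ∈ Set.range newEdge := hcF ▸ hf
        have hq := splitting_newEdge h ht hs' hn q
        by_contra hqs
        have hmem : ∀ a b : X.graph.V × Set (Set X.graph.E), a = b → b ∈ s → a ∈ s :=
          fun a b h hb => h ▸ hb
        exact hfB ⟨q, fun h' : q.1 ∈ s => hqs (hmem _ _ hq h'), rfl⟩
      · intro hq
        refine ⟨newEdge ⟨q, hst hq⟩, ⟨hcF.ge ⟨_, rfl⟩, ?_⟩, splitting_newEdge h ht hs' hn _⟩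
        rintro ⟨q', hq', h'⟩
        exact hq' (by rw [newEdge_injective h']; exact hq)
    rw [← mk_eq_splitMarked hX he te hs hsp]
    exact AuterVertex.mk_le_mk.2 ⟨d, hd⟩

/-- Reduced blow-ups are those with a trimmed collapse onto `X`, and such a collapse is recovered
from its splittings. -/
theorem nonempty_splitting_orderIso_reducedUpSet (hX : X.IsMarkedCactus) (ht : X.graph.IsThin) :
    Nonempty (X.graph.Splitting ≃o X.reducedUpSet) := by
  have h := isConnectedCactus hX.1
  have hn := hasTwoCycles hX.1
  let f : X.graph.Splitting → X.reducedUpSet := fun s =>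
    ⟨AuterVertex.mk (splitMarked hX.1 ht s.2.2),
      mem_reducedUpSet hX (isConnectedCactus_splitGraph h ht s.2.2).cactus
        (compatible_splitMarked hX.1 ht s.2.2) (by
          rw [F_splitCollapse]
          obtain ⟨q, hq⟩ := s.2.1
          exact ⟨_, ⟨q, hq⟩, rfl⟩) (isTrimmed_splitCollapse h ht s.2.2 hn).rootPart_eq⟩
  refine ⟨RelIso.ofSurjective (OrderEmbedding.ofMapLEIff f fun s t =>
    splitMarked_le_iff hX.1 ht s.2.2 t.2.2) ?_⟩
  rintro ⟨b, hb⟩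
  obtain ⟨Y, rfl⟩ := Quotient.exists_rep b
  have hY := (mk_isMarkedCactus.1 hb.1.1).1
  obtain ⟨c, hc, hF⟩ := exists_compatible hb.1.2.1
  have tr : c.IsTrimmed := ⟨isConnectedCactus hY, hasTwoCycles hY, ht, hb.2 Y hY c rfl hc⟩
  exact ⟨⟨tr.splitting, hF.image _, tr.isSplitting⟩,
    Subtype.ext (mk_eq_splitMarked hX.1 hc tr tr.isSplitting rfl).symm⟩

end MarkedGraph


/-! ### The homotopy types of the links -/

theorem Fan.nonempty_homeoSphere {α E : Type*} [Fintype α] {K : PreAbstractSimplicialComplex α}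
    [NormedAddCommGroup E] [NormedSpace ℝ E] [FiniteDimensional ℝ E] (Φ : Fan K E) {k : ℕ}
    (hk : Module.finrank ℝ E = k) : Nonempty (K.Realization ≃ₜ UnitSphere k) :=
  ⟨Φ.homeoSphere (ContinuousLinearEquiv.ofFinrankEq (hk.trans finrank_euclideanSpace_fin.symm))⟩

namespace BasedGraph

variable {G : BasedGraph}

noncomputable instance {α : Type*} [Finite α] (d : α) : Fintype {a // a ≠ d} := Fintype.ofFinite _

noncomputable instance (C : Set G.E) : Fintype {e // e ∈ C} := Fintype.ofFinite _

noncomputable instance (v : G.V) : Fintype (G.rootsAt v) := Fintype.ofFinite _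

noncomputable instance {α : Type*} [Finite α] (K : PreAbstractSimplicialComplex α) :
    Fintype K.faces := Fintype.ofFinite _

theorem IsConnectedCactus.base_mem_verts_iff (h : G.IsConnectedCactus) {C : Set G.E}
    (hC : G.IsCycle C) : G.base ∈ G.verts C ↔ G.root C = G.base :=
  ⟨h.gate_of_mem hC, fun h' => h' ▸ h.root_mem hC⟩

/-- A cycle avoids the base vertex exactly if its root is another vertex; the cycles are counted by
their roots. -/
theorem coweight_eq (h : G.IsConnectedCactus) :
    G.coweight = ∑ v : {v : G.V // v ≠ G.base}, Fintype.card (G.rootsAt v.1) := by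
  rw [coweight, ← Nat.card_coe_set_eq, ← Fintype.card_sigma, ← Nat.card_eq_fintype_card]
  refine Nat.card_congr
    { toFun := fun C => ⟨⟨G.root C.1, mt (h.base_mem_verts_iff C.2.1).2 C.2.2⟩, C.1, C.2.1, rfl⟩
      invFun := fun a => ⟨a.2.1, a.2.2.1, fun hb =>
        a.1.2 (a.2.2.2.symm.trans ((h.base_mem_verts_iff a.2.2.1).1 hb))⟩
      left_inv := fun C => rfl
      right_inv := ?_ }
  rintro ⟨⟨v, hv⟩, C, hC, hCv⟩
  have hCv' : G.root C = v := hCv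
  subst hCv'
  rfl

theorem nonempty_rootsAt (h : G.IsConnectedCactus) (hn : G.HasTwoCycles) (v : G.V) : Nonempty (G.rootsAt v) := by
  obtain ⟨D, hD, -⟩ := h.exists_rootsAt (s := ∅) ⟨fun _ h => h.elim, fun _ h => h.elim⟩ hn
    ⟨(v, ∅), fun _ h => h.elim, fun _ h => h.elim⟩
  exact ⟨⟨D, hD⟩⟩

theorem finrank_boundary {κ : Type*} [Fintype κ] (d : κ) :
    Module.finrank ℝ ({a // a ≠ d} → ℝ) = Fintype.card κ - 1 := by
  classical
  rw [Module.finrank_fintype_fun_eq_card, Fintype.card_subtype_compl, Fintype.card_subtype_eq]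

/-- The fan of the join of the boundaries of the simplices on the parent cycles. -/
noncomputable def forestFan (h : G.IsConnectedCactus) (ht : G.IsThin) : Fan (forestComplex h) (∀ v : {v : G.V // v ≠ G.base},
    {a // a ≠ (⟨_, h.lo_mem ht v.2⟩ : {e // e ∈ h.parent v.2})} → ℝ) :=
  Fan.join fun _ => Fan.boundary _

/-- The fan of the join of the subdivided boundaries of the simplices on the cycles rooted at a
vertex. -/
noncomputable def splittingFan (d : ∀ v : {v : G.V // v ≠ G.base}, G.rootsAt v.1) :
    Fan G.splittingComplex (∀ v, {a // a ≠ d v} → ℝ) :=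
  Fan.join fun v => (Fan.boundary (d v)).sd

/-- Each vertex other than the base has a parent cycle with two edges, which contributes one
dimension. -/
theorem finrank_forestFan (h : G.IsConnectedCactus) (ht : G.IsThin) : Module.finrank ℝ (∀ v : {v : G.V // v ≠ G.base},
    {a // a ≠ (⟨_, h.lo_mem ht v.2⟩ : {e // e ∈ h.parent v.2})} → ℝ) = Nat.card G.V - 1 := by
  classical
  rw [Module.finrank_pi_fintype]
  have h1 : ∀ v : {v : G.V // v ≠ G.base}, Fintype.card {e // e ∈ h.parent v.2} = 2 := fun v => by
    obtain ⟨hne, h2, -⟩ := h.ends_spec ht v.2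
    rw [← Nat.card_eq_fintype_card]
    exact (congrArg Set.ncard h2).trans (Set.ncard_pair hne)
  simp only [finrank_boundary, h1]
  rw [Finset.sum_const, Finset.card_univ, smul_eq_mul, Nat.card_eq_fintype_card,
    Fintype.card_subtype_compl, Fintype.card_subtype_eq]
  exact mul_one _

/-- A vertex with k cycles rooted at it contributes k - 1, and k is at least 1. The additive form
avoids truncated subtraction and contains the bound on the number of vertices. -/
theorem finrank_splittingFan (h : G.IsConnectedCactus) (hn : G.HasTwoCycles)
    (d : ∀ v : {v : G.V // v ≠ G.base}, G.rootsAt v.1) :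
    Module.finrank ℝ (∀ v, {a // a ≠ d v} → ℝ) + (Nat.card G.V - 1) = G.coweight := by
  classical
  rw [Module.finrank_pi_fintype, coweight_eq h]
  have h1 : Nat.card G.V - 1 = ∑ v : {v : G.V // v ≠ G.base}, 1 := by
    rw [Finset.sum_const, Finset.card_univ, smul_eq_mul, mul_one,
      Nat.card_eq_fintype_card,
     
      Fintype.card_subtype_compl, Fintype.card_subtype_eq]
  rw [h1, ← Finset.sum_add_distrib]
  refine Finset.sum_congr rfl fun v _ => ?_
  rw [finrank_boundary]
  have := (Fintype.card_pos_iff (α := G.rootsAt v.1)).2 (nonempty_rootsAt h hn v.1)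
  omega

end BasedGraph

namespace MarkedGraph

open BasedGraph AuterVertex

variable {n : ℕ} {X : MarkedGraph n}

/-- The order complex of a face poset is the barycentric subdivision; the dual appears because
larger forests give smaller graphs. -/
theorem nonempty_downLink_equiv (hX : X.IsMarkedCactus) (ht : X.graph.IsThin) :
    Nonempty ((AuterVertex.mk X).downLink.Realization ≃ₕ
      UnitSphere (Nat.card X.graph.V - 1)) := by
  have h := isConnectedCactus hX.1
  obtain ⟨f⟩ := nonempty_downSet_orderIso hX
  obtain ⟨g⟩ := nonempty_descendingForest_orderIso h ht
  obtain ⟨k⟩ := (forestFan h ht).sd.dual.nonempty_homeoSphere (finrank_forestFan h ht)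
  exact ⟨(orderComplexHomeo fun s => mem_downLink).symm.toHomotopyEquiv.trans
    ((orderIsoEquiv (f.symm.trans g.symm.dual)).trans k.toHomotopyEquiv)⟩

theorem exists_retraction_upSet (hX : X.IsMarkedCactus) :
    ∃ r : (AuterVertex.mk X).upSet → (AuterVertex.mk X).upSet, Monotone r ∧ (∀ x, r x ≤ x) ∧
      (∀ x, (r x).1 ∈ X.reducedUpSet) ∧ ∀ x, x.1 ∈ X.reducedUpSet → r x = x :=
  exists_retraction (S := {x : (AuterVertex.mk X).upSet | x.1 ∈ X.reducedUpSet}) fun x => by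
    obtain ⟨y, hy, hyx, hmax⟩ := exists_reduction hX x.2
    exact ⟨⟨y, hy.1⟩, hy, hyx, fun z hz hzx => hmax z.1 hz hzx⟩

theorem nonempty_reducedUpSet_orderIso (hX : X.IsMarkedCactus) (ht : X.graph.IsThin) :
    Nonempty ({x : (AuterVertex.mk X).upSet | x.1 ∈ X.reducedUpSet} ≃o
      X.graph.splittingComplex.faces) := by
  obtain ⟨f⟩ := nonempty_splitting_orderIso_reducedUpSet hX ht
  obtain ⟨g⟩ := nonempty_splitting_orderIso X.graph
  let e : {x : (AuterVertex.mk X).upSet | x.1 ∈ X.reducedUpSet} ≃o X.reducedUpSet :=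
    { toFun := fun x => ⟨x.1.1, x.2⟩
      invFun := fun x => ⟨⟨x.1, x.2.1⟩, x.2⟩
      left_inv := fun _ => rfl
      right_inv := fun _ => rfl
      map_rel_iff' := Iff.rfl }
  exact ⟨e.trans (f.symm.trans g.symm)⟩

theorem nonempty_upLink_equiv (hX : X.IsMarkedCactus) (ht : X.graph.IsThin) :
    Nonempty ((AuterVertex.mk X).upLink.Realization ≃ₕ
      UnitSphere (X.graph.coweight + 1 - Nat.card X.graph.V)) := by
  have h := isConnectedCactus hX.1
  have hn := hasTwoCycles hX.1
  obtain ⟨r, hr, hle, hS, hfix⟩ := exists_retraction_upSet hX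
  obtain ⟨f⟩ := nonempty_reducedUpSet_orderIso hX ht
  have hd := fun v : {v : X.graph.V // v ≠ X.graph.base} => nonempty_rootsAt h hn v.1
  let d := fun v => (hd v).some
  have hk := finrank_splittingFan h hn d
  have hV : 0 < Nat.card X.graph.V := Nat.card_pos_iff.2 ⟨⟨X.graph.base⟩, inferInstance⟩
  obtain ⟨k⟩ := (splittingFan d).sd.nonempty_homeoSphere
    -- The subtraction is not truncated: `hk` and `hV` bound the number of vertices by the coweight
    -- plus one.
    (k := X.graph.coweight + 1 - Nat.card X.graph.V) (by omega)
  exact ⟨(orderComplexHomeo fun s => mem_upLink).symm.toHomotopyEquiv.trans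
    ((orderRetractEquiv _ r hr hle hS hfix).trans ((orderIsoEquiv f).trans k.toHomotopyEquiv))⟩

theorem nonempty_descendingLink_sphere (hX : X.IsMarkedCactus) (ht : X.graph.IsThin) :
    Nonempty ((AuterVertex.mk X).descendingLink.Realization ≃ₕ UnitSphere X.graph.coweight) := by
  have h := isConnectedCactus hX.1
  have hn := hasTwoCycles hX.1
  obtain ⟨a⟩ := nonempty_descendingLink_equiv hX
  obtain ⟨r, hr, hle, hS, hfix⟩ := exists_retraction_upSet hX
  obtain ⟨g⟩ := nonempty_descendingForest_orderIso h ht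
  obtain ⟨f⟩ := nonempty_reducedUpSet_orderIso hX ht
  have hd := fun v : {v : X.graph.V // v ≠ X.graph.base} => nonempty_rootsAt h hn v.1
  let d := fun v => (hd v).some
  have hk := finrank_splittingFan h hn d
  have : Fintype ((forestComplex h).facesᵒᵈ ⊕ₗ X.graph.splittingComplex.faces) :=
    Fintype.ofEquiv _ toLex
  -- The dimensions of the two fans add up to the coweight, whatever the number of vertices.
  obtain ⟨k⟩ := ((forestFan h ht).sd.dual.lexSum (splittingFan d).sd).nonempty_homeoSphere
    (k := X.graph.coweight) (by rw [Module.finrank_prod, finrank_forestFan, add_comm, hk])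
  exact ⟨a.trans ((lexRetractEquiv _ r hr hle hS hfix).trans
    ((orderIsoEquiv (g.symm.dual.sumLexCongr f)).trans k.toHomotopyEquiv))⟩

theorem card_le_coweight (hX : X.IsMarkedCactus) :
    Nat.card X.graph.V ≤ X.graph.coweight + 1 := by
  have h := isConnectedCactus hX.1
  have hn := hasTwoCycles hX.1
  have hd := fun v : {v : X.graph.V // v ≠ X.graph.base} => nonempty_rootsAt h hn v.1
  let d := fun v => (hd v).some
  have hk := finrank_splittingFan h hn d
  omega

theorem contractible_descendingLink (hX : X.IsMarkedCactus) (ht : ¬ X.graph.IsThin) :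
    ContractibleSpace (AuterVertex.mk X).descendingLink.Realization := by
  obtain ⟨a⟩ := nonempty_descendingLink_equiv hX
  have := contractible_of_not_isThin (isConnectedCactus hX.1) ht (Q := (AuterVertex.mk X).upSet)
  exact a.contractibleSpace

end MarkedGraph

theorem mainTheorem3 (n : ℕ) (Γ : MarkedGraph n) (hΓ : Γ.IsMarkedCactus)
    (c V : ℕ) (hc : c = Γ.graph.coweight) (hV : V = Nat.card Γ.graph.V) :
    (ContractibleSpace (AuterVertex.mk Γ).descendingLink.Realization ∨
      Nonempty ((AuterVertex.mk Γ).descendingLink.Realization ≃ₕ UnitSphere c)) ∧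
    (¬ Γ.graph.IsThin → ContractibleSpace (AuterVertex.mk Γ).descendingLink.Realization) ∧
    (Γ.graph.IsThin →
      (AuterVertex.mk Γ).descendingLink.IsJoin
        (AuterVertex.mk Γ).downLink (AuterVertex.mk Γ).upLink ∧
      1 ≤ V ∧ Nonempty ((AuterVertex.mk Γ).downLink.Realization ≃ₕ UnitSphere (V - 1)) ∧
      V ≤ c + 1 ∧ Nonempty ((AuterVertex.mk Γ).upLink.Realization ≃ₕ UnitSphere (c + 1 - V)) ∧
      Nonempty ((AuterVertex.mk Γ).descendingLink.Realization ≃ₕ UnitSphere c)) := by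
  subst hc hV
  refine ⟨?_, MarkedGraph.contractible_descendingLink hΓ, fun ht =>
    ⟨AuterVertex.isJoin_descendingLink (MarkedGraph.mk_isMarkedCactus.2 hΓ),
      Nat.card_pos_iff.2 ⟨⟨Γ.graph.base⟩, inferInstance⟩,
      MarkedGraph.nonempty_downLink_equiv hΓ ht, MarkedGraph.card_le_coweight hΓ,
      MarkedGraph.nonempty_upLink_equiv hΓ ht, MarkedGraph.nonempty_descendingLink_sphere hΓ ht⟩⟩
  by_cases ht : Γ.graph.IsThin
  · exact Or.inr (MarkedGraph.nonempty_descendingLink_sphere hΓ ht)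
  · exact Or.inl (MarkedGraph.contractible_descendingLink hΓ ht)
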